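/- **Setting.** Let $\tau\in i\mathbb R_{>0}$, $\Lambda=\mathbb Z+\tau\mathbb Z$, $\mathcal E_\tau=\mathbb C/\Lambda$, let $\gamma\subset\mathcal E_\tau$ be the oval $\operatorname{Im}p=\tfrac12\operatorname{Im}\tau$, oriented by increasing $\operatorname{Re}p$, let $\mathscr D\in(0,1)$, and let $w$ be a $1$-periodic function, analytic in a strip around $\gamma$ and real on $\gamma$. Let $\mathscr P_n$ be the space of elliptic functions whose only possible poles are a pole of order at most $n$ at $p=0$ and a simple pole at $\mathscr D$, and let $\pi_n\in\mathscr P_n$ ($n=0,1,2,\dots$) be the monic orthogonal sections: $\pi_n(p)=p^{-n}(1+\mathcal O(p))$ as $p\to0$ and $\int_\gamma\pi_n\pi_m\,e^{w}\,dp=0$ for $n\ne m$. A zero of $\pi_n$, as a section, is a point of the effective divisor $\mathrm{div}(\pi_n)+n(0)+(\mathscr D)$, with its multiplicity there. **Functions.** All functions are written in the coordinate $p\in\mathbb C$. $\theta_j(p;\tau)$ are the Jacobi theta functions normalized by $\theta_1(p+1;\tau)=-\theta_1(p;\tau)$. Put $$e^{\ell}=i\,\frac{\theta_1'(0;2\tau)}{\theta_1(\tau;2\tau)}e^{-i\pi\tau/2},\qquad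 e^{g(p)}=e^{\ell}\begin{cases}e^{i\pi(p-\frac\tau2)-\frac{i\pi}2}\dfrac{\theta_1(p;2\tau)}{\theta_1(p-\tau;2\tau)},&\tfrac12\operatorname{Im}\tau<\operatorname{Im}p<\operatorname{Im}\tau,\\[2mm] e^{-i\pi(p-\frac\tau2)+\frac{i\pi}2}\dfrac{\theta_1(p-\tau;2\tau)}{\theta_1(p;2\tau)},&0\le\operatorname{Im}p<\tfrac12\operatorname{Im}\tau,\end{cases}$$ $H=\frac{dg}{dp}$, and $$F_n(p)=e^{-i\pi p}\frac{\theta_1(\mathscr D;2\tau)\,\theta_1(p-\mathscr D-\tau;2\tau)\,\theta_1'(0;2\tau)\,\theta_j(p;2\tau)}{\theta_1(\mathscr D+\tau;2\tau)\,\theta_1(p-\mathscr D;2\tau)\,\theta_1(p;2\tau)\,\theta_j(0;2\tau)},$$ with $j=2$ for $n$ even and $j=3$ for $n$ odd. Let $M_{11}(p)=F_n(p)$ for $0\le\operatorname{Im}p<\frac12\operatorname{Im}\tau$ and $M_{11}(p)=-F_n(p+\tau)$ for $\frac12\operatorname{Im}\tau<\operatorname{Im}p<\operatorname{Im}\tau$.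 Both $e^g$ and $M_{11}$ are extended with period $\tau$. The Szegő function is $$S(p)=\int_\gamma C(p,q)\,w(q)\,\frac{H(q_+)\,dq}{2\pi i\,H(p)},\qquad C(p,q)=\frac{\theta_1'(0;\tau)\,\theta_1(q;\tau)\,\theta_1(p-\frac12;\tau)\,\theta_1(p-q+\frac12;\tau)}{\theta_1(\frac12;\tau)\,\theta_1(p;\tau)\,\theta_1(p-q;\tau)\,\theta_1(q-\frac12;\tau)},$$ continued to its removable singularities at $0$ and $\frac12$; $S_\infty=S(0)$. The subscript $+$ denotes the boundary value on $\gamma$ from above. **Theorem.** 0. $e^\ell>0$. Off $\gamma\cup\Lambda$, $e^g$ is holomorphic and $H=(e^g)'/e^g$ satisfies $H(p)^2=\wp(p)-\wp(\frac12)$, with $\wp$ the Weierstrass function of $\Lambda$; moreover $p\,e^{g(p)}\to1$ as $p\to0$. $S$ is analytic off $\gamma$. 1. For every compact $K$ in the complement of (the lift to $\mathbb C$ of) $\gamma$ there are $c_0>0$ and a constant such that, for all $n\ge 0$ and all $p\in K$ with $p\notin\Lambda\cup(\mathscr D+\Lambda)$, $$\pi_n(p)=e^{-S_\infty}\Big(M_{11}(p)+\frac{\mathcal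 O(e^{-nc_0})}{\operatorname{dist}(p,\mathscr D)}\Big)e^{(n-1)g(p)+S(p)},$$ uniformly in $p$, where $\operatorname{dist}$ is the flat distance on $\mathcal E_\tau$. 2. $M_{11}$ and $S$ have boundary values on $\gamma$ from above, and there is $c_0>0$ such that, uniformly in $s\in\mathbb R$, for $p=s+\frac\tau2$ and all $n\ge 0$, $$\pi_n(p)=2e^{(n-1)\ell-S_\infty}\Big[\operatorname{Re}\Big(M_{11}(p_+)\,e^{S(p_+)}u(s)^{n-1}\Big)+\mathcal O(e^{-nc_0})\Big],\qquad u(s)=e^{i\pi s-\frac{i\pi}2}\frac{\theta_1(s+\frac\tau2;2\tau)}{\theta_1(s-\frac\tau2;2\tau)}.$$ The leading term is a modulated cosine: $$\operatorname{Re}\big(M_{11}(p_+)e^{S(p_+)}u(s)^{n-1}\big)=|M_{11}(p_+)|\,e^{-\frac12w(p)}\cos\big((n-1)\arg u(s)+\arg M_{11}(p_+)+\operatorname{Im}S(p_+)\big).$$ 3. There are $c_0>0$ and $C$ such that for every even $n$ the section $\pi_n$ has exactly one zero off $\gamma$; it is simple, is represented by a point $z_n\in(0,1)$, and $|z_n-\frac12|\le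 Ce^{-nc_0}$. -/

import Mathlib

open Complex Filter Topology Asymptotics

namespace EllipticSections

noncomputable section

/-! ## Jacobi theta functions, as functions of the coordinate `p` of `ℂ / (ℤ + τ ℤ)`

They are normalized so that `θ₁ (p + 1) = - θ₁ p`; with the classical variable `z = π p` they are
the usual `θ_j (z | τ)`. Note that `jacobiTheta₂ p τ = ∑ exp (2 π i n p + π i n² τ)`. -/

/-- `θ₃ (p; τ) = ∑ exp (π i τ n² + 2 π i n p)`. -/
def theta3 (p τ : ℂ) : ℂ := jacobiTheta₂ p τ

/-- `θ₂ (p; τ) = ∑ exp (π i τ (n + 1/2)² + π i (2 n + 1) p)`. -/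
def theta2 (p τ : ℂ) : ℂ :=
  exp (Real.pi * I * (τ / 4 + p)) * jacobiTheta₂ (p + τ / 2) τ

/-- `θ₁ (p; τ) = - i ∑ (-1)ⁿ exp (π i τ (n + 1/2)² + π i (2 n + 1) p)`. -/
def theta1 (p τ : ℂ) : ℂ :=
  -I * exp (Real.pi * I * (τ / 4 + p)) * jacobiTheta₂ (p + 1 / 2 + τ / 2) τ

/-- `θ₁' (0; τ)`, the derivative with respect to `p`. -/
def theta1Deriv0 (τ : ℂ) : ℂ := deriv (fun p => theta1 p τ) 0

/-! ## The elliptic curve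

Functions on `ℂ / (ℤ + τ ℤ)` and its subsets are described by their lifts to `ℂ`. -/

/-- `p` belongs to the lattice `ℤ + τ ℤ`. -/
def InLattice (τ p : ℂ) : Prop := ∃ m k : ℤ, p = m + k * τ

/-- `p` lies on (the lift of) the oval `γ`, given by `Im p = Im τ / 2` modulo `Im τ`. -/
def OnGamma (τ p : ℂ) : Prop := ∃ k : ℤ, p.im = (k + 1 / 2) * τ.im

/-- The translate of `p` by a multiple of `τ` that lies in the strip `0 ≤ Im p < Im τ`. -/
def reduce (τ p : ℂ) : ℂ := p - (⌊p.im / τ.im⌋ : ℤ) * τ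

/-- The distance, in the flat metric of the torus, from `p` to the point `D`. -/
def torusDist (τ : ℂ) (D : ℝ) (p : ℂ) : ℝ :=
  Metric.infDist p {q : ℂ | InLattice τ (q - D)}

/-- The pair of periods `1, τ`, for use with Mathlib's Weierstrass function. -/
def periods (τ : ℂ) (him : 0 < τ.im) : PeriodPair where
  ω₁ := 1
  ω₂ := τ
  indep := by
    rw [LinearIndependent.pair_iff]
    intro s t h
    have h2 : t * τ.im = 0 := by simpa using congrArg Complex.im h
    have ht : t = 0 := (mul_eq_zero.mp h2).resolve_right him.ne'
    subst ht
    have h1 : s = 0 := by simpa using congrArg Complex.re h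
    exact ⟨h1, rfl⟩

/-! ## Orthogonal sections -/

/-- `f` belongs to `𝒪 (n ∞ + D)`, where `∞` is the point `p = 0`: it is an elliptic function whose
only singularities are a pole of order at most `n` at `0` and at most a simple pole at `D`. -/
structure IsSection (τ : ℂ) (D : ℝ) (n : ℕ) (f : ℂ → ℂ) : Prop where
  periodic_one : ∀ p, f (p + 1) = f p
  periodic_tau : ∀ p, f (p + τ) = f p
  analytic : ∀ p, ¬ InLattice τ p → ¬ InLattice τ (p - D) → AnalyticAt ℂ f p
  meromorphic_zero : MeromorphicAt f 0
  order_zero : ((-(n : ℤ) : ℤ) : WithTop ℤ) ≤ meromorphicOrderAt f 0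
  meromorphic_D : MeromorphicAt f (D : ℂ)
  order_D : ((-1 : ℤ) : WithTop ℤ) ≤ meromorphicOrderAt f (D : ℂ)

/-- `P 0, P 1, …` is the sequence of monic orthogonal sections for the measure `e^w dp` on `γ`. -/
structure IsMonicOrthogonal (τ : ℂ) (D : ℝ) (w : ℂ → ℂ) (P : ℕ → ℂ → ℂ) : Prop where
  isSection : ∀ n, IsSection τ D n (P n)
  monic : ∀ n, (fun p : ℂ => p ^ n * P n p - 1) =O[𝓝[≠] 0] (fun p : ℂ => p)
  orthogonal : ∀ n m, n ≠ m →
    ∫ s in (0 : ℝ)..1, P n (s + τ / 2) * P m (s + τ / 2) * exp (w (s + τ / 2)) = 0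

open Classical in
/-- The multiplicity at `p` of the divisor of zeros `div f + n (0) + (D)` of `f`, regarded as a
section of `𝒪 (n ∞ + D)`. -/
def sectionOrder (τ : ℂ) (D : ℝ) (n : ℕ) (f : ℂ → ℂ) (p : ℂ) : WithTop ℤ :=
  meromorphicOrderAt f p + ((if InLattice τ p then (n : ℤ) else 0 : ℤ) : WithTop ℤ)
    + ((if InLattice τ (p - D) then 1 else 0 : ℤ) : WithTop ℤ)

/-! ## The `g`-function -/

/-- The constant `e^ℓ = i θ₁'(0; 2τ) e^{- i π τ / 2} / θ₁(τ; 2τ)`. -/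
def expEll (τ : ℂ) : ℂ :=
  I * theta1Deriv0 (2 * τ) / theta1 τ (2 * τ) * exp (-(Real.pi * I * τ / 2))

/-- `e^{g - ℓ}` for `Im τ / 2 < Im p < Im τ`, as a meromorphic function on `ℂ`. -/
def gUpper (τ p : ℂ) : ℂ :=
  exp (Real.pi * I * (p - τ / 2) - Real.pi * I / 2) * (theta1 p (2 * τ) / theta1 (p - τ) (2 * τ))

/-- `e^{g - ℓ}` for `0 ≤ Im p < Im τ / 2`, as a meromorphic function on `ℂ`. -/
def gLower (τ p : ℂ) : ℂ :=
  exp (-(Real.pi * I * (p - τ / 2)) + Real.pi * I / 2) *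
    (theta1 (p - τ) (2 * τ) / theta1 p (2 * τ))

/-- The function `e^g` on the complement of `γ`; it is `τ`-periodic. -/
def expG (τ p : ℂ) : ℂ :=
  if (reduce τ p).im < τ.im / 2 then expEll τ * gLower τ (reduce τ p)
  else expEll τ * gUpper τ (reduce τ p)

/-- The logarithmic derivative of `e^g` in the upper half of the strip `0 ≤ Im p < Im τ`, continued
to `ℂ`; this is the branch of `√(℘(p) - ℘(1/2))` with `p * h p → 1` as `p → 0`. -/
def hfun (τ p : ℂ) : ℂ := logDeriv (gUpper τ) p

/-- `H = dg/dp`, on the complement of `γ`; it is `τ`-periodic and changes sign across `γ`. -/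
def H (τ p : ℂ) : ℂ :=
  if (reduce τ p).im < τ.im / 2 then - hfun τ (reduce τ p) else hfun τ (reduce τ p)

/-! ## The Szegő function -/

/-- The scalar Cauchy kernel with residue `1` at `p = q`. -/
def cauchyKernel (τ p q : ℂ) : ℂ :=
  theta1Deriv0 τ * theta1 q τ * theta1 (p - 1 / 2) τ * theta1 (p - q + 1 / 2) τ /
    (theta1 (1 / 2) τ * theta1 p τ * theta1 (p - q) τ * theta1 (q - 1 / 2) τ)

/-- The integral `∫_γ C(p,q) w(q) H(q₊) dq / (2 π i H(p))`. On `γ` the boundary value `H(q₊)` from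
above is `hfun τ q`. -/
def szegoIntegral (τ : ℂ) (w : ℂ → ℂ) (p : ℂ) : ℂ :=
  (∫ s in (0 : ℝ)..1, cauchyKernel τ p (s + τ / 2) * w (s + τ / 2) * hfun τ (s + τ / 2)) /
    (2 * Real.pi * I * H τ p)

/-- The Szegő function `S`. The limit only serves to fill the removable singularities
`p = 0` and `p = 1/2` of the integral formula. -/
def szego (τ : ℂ) (w : ℂ → ℂ) (p : ℂ) : ℂ := limUnder (𝓝[≠] p) (szegoIntegral τ w)

/-! ## The model solution -/

/-- `θ₂` for even `n` and `θ₃` for odd `n`. -/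
def theta23 (n : ℕ) (p τ : ℂ) : ℂ := if Even n then theta2 p τ else theta3 p τ

/-- The normalized function `C₁₁ f(p)` on the curve with periods `1, 2τ`. -/
def modelF (τ : ℂ) (D : ℝ) (n : ℕ) (p : ℂ) : ℂ :=
  exp (-(Real.pi * I * p)) *
    (theta1 D (2 * τ) * theta1 (p - D - τ) (2 * τ) * theta1Deriv0 (2 * τ) *
      theta23 n p (2 * τ)) /
    (theta1 (D + τ) (2 * τ) * theta1 (p - D) (2 * τ) * theta1 p (2 * τ) *
      theta23 n 0 (2 * τ))

/-- The entry `M₁₁` of the model solution, on the complement of `γ`; it is `τ`-periodic. -/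
def M11 (τ : ℂ) (D : ℝ) (n : ℕ) (p : ℂ) : ℂ :=
  if (reduce τ p).im < τ.im / 2 then modelF τ D n (reduce τ p)
  else - modelF τ D n (reduce τ p + τ)

end

end EllipticSections

open EllipticSections

/-!
The functions are lifted to the period annulus `|Im p| ≤ t/2` modulo `1`, where `τ = t i`. Its two
boundary circles are the two sides of the oval `γ`, glued by translation by `τ`, and `p = 0` and
`D` lie inside. On `γ` complex conjugation agrees with translation by `-τ`.

*The `g`-function.* On the annulus `e^{g - ℓ}` is `gLower`. It is unimodular on the boundary
circles, so by the maximum principle it is larger than `1` in modulus inside; continued across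
`γ`, it is smaller than `1`. The formula for `H²` follows from Liouville's theorem: an elliptic
function with at most one simple pole is constant (`const_of_simple_pole`, `hfun_sq`).

*The leading term.* The Szegő function is a Cauchy transform of `w` whose kernel changes sign under
translation by `τ`. It extends to a function `σ` holomorphic near the closed annulus with
`σ(p) + σ(p - τ) = -w(p)` near `γ` (`exists_szego`). With `N = n - 1`, the leading term is
`Φ = M₁₁ e^σ e^{N(g - ℓ)}`. The sum of its two boundary values on `γ` is orthogonal to all
sections of order at most `N`: by the boundary relation for `σ`, the weighted sum is the difference
of the boundary values of a function holomorphic in the annulus (`lineInt_leadTerm`).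

*The error.* `Φ` itself jumps across `γ`. A Cauchy integral with the kernel `θ₁'/θ₁` corrects it to
a genuine section of order `N + 1` (`exists_secNum_leadTerm_add_corr`). Each boundary value of `Φ`
continues past `γ` to where it decays geometrically, so a shift of the contours shows that
the correction is exponentially small inside and differs on `γ` from the second boundary value by an
exponentially small error (`corr_eq_on_gamma`, `exists_norm_corrErr_le`). The difference of the
normalized `π_n` and the corrected leading term is then a section of order `N`, and on `γ` its
conjugate is again the restriction of such a section. Both `π_n` and the sum of the boundary values
of `Φ` are orthogonal to that conjugate. Since `w` is real on `γ`, the weight is positive, so the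
weighted `L²` norm of the remainder is controlled by the error alone
(`exists_integral_remainder_le`). Cauchy's formula carries the bound into the annulus
(`exists_norm_remainder_le`), and this gives the asymptotics off and on `γ`. The case `n = 0`,
where the exponent `n - 1` is negative, is treated directly from `π_0 = 1`.

*The zeros.* Orthogonality to the difference of `π_n` and its conjugate section shows that `π_n` is
real on `γ` (`im_eq_zero`). If it had fewer than `n` zeros there, a theta quotient with the same
zeros on `γ` would be a section of lower order whose product with `π_n` has constant sign, which
contradicts orthogonality (`exists_ovalProd_factor_length_eq`). For even `n` the section `π_n` is
therefore a theta quotient with `n` zeros on `γ` and one further zero, which Abel's condition makes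
real (`exists_zero_factor`). The leading term vanishes on the real axis exactly at `1/2`, to first
order, so the asymptotics there force the zero to be exponentially close to `1/2`
(`exists_zero_bound`).
-/

namespace EllipticSections

noncomputable section


/-! ### Periodic holomorphic functions on horizontal strips -/

/-- The open horizontal strip `a < Im z < b`. -/
def strip (a b : ℝ) : Set ℂ := {z | a < z.im ∧ z.im < b}

/-- The local coordinate `e^{2πiz}` of the cylinder `ℂ / ℤ`. -/
def ex (z : ℂ) : ℂ := exp (2 * Real.pi * I * z)

/-- The integral of `f` over the horizontal segment from `c i` to `1 + c i`. -/
def lineInt (f : ℂ → ℂ) (c : ℝ) : ℂ := ∫ s in (0 : ℝ)..1, f (s + c * I)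

/-- `f` is holomorphic and `1`-periodic on the strip `a < Im z < b`. -/
structure PerHol (a b : ℝ) (f : ℂ → ℂ) : Prop where
  diff : DifferentiableOn ℂ f (strip a b)
  per : ∀ z ∈ strip a b, f (z + 1) = f z

theorem mem_strip {a b : ℝ} {z : ℂ} : z ∈ strip a b ↔ a < z.im ∧ z.im < b := Iff.rfl

theorem isOpen_strip (a b : ℝ) : IsOpen (strip a b) :=
  (isOpen_lt continuous_const continuous_im).inter (isOpen_lt continuous_im continuous_const)

theorem strip_mem_nhds {a b : ℝ} {z : ℂ} (hz : z ∈ strip a b) : strip a b ∈ 𝓝 z :=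
  (isOpen_strip a b).mem_nhds hz

theorem convex_strip (a b : ℝ) : Convex ℝ (strip a b) := by
  have h : strip a b = imCLM ⁻¹' (Set.Ioo a b) := by
    ext z; simp [strip]
  rw [h]
  exact (convex_Ioo a b).is_linear_preimage imCLM.toLinearMap.isLinear

theorem add_int_mem_strip {a b : ℝ} {z : ℂ} (n : ℤ) : z + n ∈ strip a b ↔ z ∈ strip a b := by
  simp [strip]

theorem add_one_mem_strip {a b : ℝ} {z : ℂ} : z + 1 ∈ strip a b ↔ z ∈ strip a b := by
  simp [strip]

theorem ex_add (z w : ℂ) : ex (z + w) = ex z * ex w := by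
  simp only [ex, mul_add, exp_add]

theorem ex_neg (z : ℂ) : ex (-z) = (ex z)⁻¹ := by
  simp only [ex, mul_neg, exp_neg]

theorem ex_sub (z w : ℂ) : ex (z - w) = ex z / ex w := by
  rw [sub_eq_add_neg, ex_add, ex_neg, div_eq_mul_inv]

theorem ex_ne_zero (z : ℂ) : ex z ≠ 0 := exp_ne_zero _

theorem ex_zero : ex 0 = 1 := by simp [ex]

theorem ex_eq_one_iff {z : ℂ} : ex z = 1 ↔ ∃ n : ℤ, z = n := by
  rw [ex, exp_eq_one_iff]
  have h := two_pi_I_ne_zero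
  refine exists_congr fun n => ⟨fun e => mul_left_cancel₀ h (by rw [e]; ring), fun e => ?_⟩
  rw [e]; ring

theorem ex_int (n : ℤ) : ex n = 1 := ex_eq_one_iff.2 ⟨n, rfl⟩

theorem ex_one : ex 1 = 1 := by simpa using ex_int 1

theorem ex_add_one (z : ℂ) : ex (z + 1) = ex z := by rw [ex_add, ex_one, mul_one]

theorem norm_ex (z : ℂ) : ‖ex z‖ = Real.exp (-(2 * Real.pi * z.im)) := by
  rw [ex, norm_exp]; congr 1; simp

theorem norm_ex_lt_one {z : ℂ} (h : 0 < z.im) : ‖ex z‖ < 1 := by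
  rw [norm_ex, Real.exp_lt_one_iff]
  have := mul_pos Real.pi_pos h
  linarith

theorem ex_ne_one_of_im_ne_zero {z : ℂ} (h : z.im ≠ 0) : ex z ≠ 1 := by
  rintro e
  obtain ⟨n, rfl⟩ := ex_eq_one_iff.1 e
  simp at h

theorem differentiable_ex : Differentiable ℂ ex := by unfold ex; fun_prop

theorem hasDerivAt_ex (z : ℂ) : HasDerivAt ex (2 * Real.pi * I * ex z) z := by
  have := ((hasDerivAt_id z).const_mul (2 * Real.pi * I)).cexp
  simp only [mul_one, id] at this
  exact this.congr_deriv (mul_comm _ _)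

namespace PerHol

variable {a b : ℝ} {f g : ℂ → ℂ}

theorem mono {a' b' : ℝ} (hf : PerHol a b f) (ha : a ≤ a') (hb : b' ≤ b) : PerHol a' b' f :=
  have h : strip a' b' ⊆ strip a b := fun _ hz => ⟨ha.trans_lt hz.1, hz.2.trans_le hb⟩
  ⟨hf.diff.mono h, fun z hz => hf.per z (h hz)⟩

theorem of_entire (hf : Differentiable ℂ f) (h : ∀ z, f (z + 1) = f z) : PerHol a b f :=
  ⟨hf.differentiableOn, fun z _ => h z⟩

theorem const (c : ℂ) : PerHol a b (fun _ => c) := of_entire (by fun_prop) fun _ => rfl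

theorem add (hf : PerHol a b f) (hg : PerHol a b g) : PerHol a b (fun z => f z + g z) :=
  ⟨hf.diff.add hg.diff, fun z hz => by simp only [hf.per z hz, hg.per z hz]⟩

theorem sub (hf : PerHol a b f) (hg : PerHol a b g) : PerHol a b (fun z => f z - g z) :=
  ⟨hf.diff.sub hg.diff, fun z hz => by simp only [hf.per z hz, hg.per z hz]⟩

theorem neg (hf : PerHol a b f) : PerHol a b (fun z => - f z) :=
  ⟨hf.diff.neg, fun z hz => by simp only [hf.per z hz]⟩

theorem mul (hf : PerHol a b f) (hg : PerHol a b g) : PerHol a b (fun z => f z * g z) :=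
  ⟨hf.diff.mul hg.diff, fun z hz => by simp only [hf.per z hz, hg.per z hz]⟩

theorem const_mul (c : ℂ) (hf : PerHol a b f) : PerHol a b (fun z => c * f z) :=
  (const c).mul hf

theorem pow (hf : PerHol a b f) (n : ℕ) : PerHol a b (fun z => f z ^ n) :=
  ⟨hf.diff.pow n, fun z hz => by simp only [hf.per z hz]⟩

theorem exp_comp (hf : PerHol a b f) : PerHol a b (fun z => exp (f z)) :=
  ⟨hf.diff.cexp, fun z hz => by simp only [hf.per z hz]⟩

theorem inv (hf : PerHol a b f) (h0 : ∀ z ∈ strip a b, f z ≠ 0) :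
    PerHol a b (fun z => (f z)⁻¹) :=
  ⟨hf.diff.inv h0, fun z hz => by simp only [hf.per z hz]⟩

theorem div (hf : PerHol a b f) (hg : PerHol a b g) (h0 : ∀ z ∈ strip a b, g z ≠ 0) :
    PerHol a b (fun z => f z / g z) :=
  ⟨hf.diff.div hg.diff h0, fun z hz => by simp only [hf.per z hz, hg.per z hz]⟩

theorem congr (hf : PerHol a b f) (h : ∀ z ∈ strip a b, g z = f z) : PerHol a b g :=
  ⟨hf.diff.congr h, fun z hz => by
    rw [h z hz, h _ (add_one_mem_strip.2 hz), hf.per z hz]⟩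

theorem comp_add (hf : PerHol a b f) (w : ℂ) :
    PerHol (a - w.im) (b - w.im) (fun z => f (z + w)) := by
  have h : ∀ z ∈ strip (a - w.im) (b - w.im), z + w ∈ strip a b := fun z hz => by
    simp only [mem_strip, add_im] at hz ⊢; constructor <;> linarith [hz.1, hz.2]
  refine ⟨hf.diff.comp (by fun_prop) h, fun z hz => ?_⟩
  rw [show z + 1 + w = z + w + 1 by ring, hf.per _ (h z hz)]

theorem comp_sub (hf : PerHol a b f) (w : ℂ) :
    PerHol (a + w.im) (b + w.im) (fun z => f (z - w)) := by
  simpa [sub_eq_add_neg] using hf.comp_add (-w)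

theorem comp_const_sub (hf : PerHol a b f) (w : ℂ) :
    PerHol (w.im - b) (w.im - a) (fun z => f (w - z)) := by
  have h : ∀ z ∈ strip (w.im - b) (w.im - a), w - z ∈ strip a b := fun z hz => by
    simp only [mem_strip, sub_im] at hz ⊢; constructor <;> linarith [hz.1, hz.2]
  refine ⟨hf.diff.comp (by fun_prop) h, fun z hz => ?_⟩
  have h1 : w - (z + 1) ∈ strip a b := by
    have := h (z + 1) (add_one_mem_strip.2 hz)
    exact this
  rw [← hf.per _ h1]; congr 1; ring

theorem per_int (hf : PerHol a b f) (n : ℤ) {z : ℂ} (hz : z ∈ strip a b) : f (z + n) = f z := by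
  induction n using Int.induction_on with
  | zero => simp
  | succ n ih =>
    rw [← ih]
    have := hf.per (z + (n : ℤ)) ((add_int_mem_strip _).2 hz)
    rw [← this]; push_cast; congr 1; ring
  | pred n ih =>
    rw [← ih]
    have h1 := (add_int_mem_strip (a := a) (b := b) (z := z) (-(n : ℤ) - 1)).2 hz
    rw [← hf.per _ h1]; push_cast; congr 1; ring

theorem continuousAt (hf : PerHol a b f) {z : ℂ} (hz : z ∈ strip a b) : ContinuousAt f z :=
  (hf.diff.differentiableAt (strip_mem_nhds hz)).continuousAt

theorem differentiableAt (hf : PerHol a b f) {z : ℂ} (hz : z ∈ strip a b) :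
    DifferentiableAt ℂ f z := hf.diff.differentiableAt (strip_mem_nhds hz)

theorem analyticAt (hf : PerHol a b f) {z : ℂ} (hz : z ∈ strip a b) : AnalyticAt ℂ f z :=
  hf.diff.analyticAt (strip_mem_nhds hz)

theorem deriv (hf : PerHol a b f) : PerHol a b (deriv f) := by
  refine ⟨hf.diff.deriv (isOpen_strip a b), fun z hz => ?_⟩
  rw [← deriv_comp_add_const]
  exact Filter.EventuallyEq.deriv_eq (eventually_of_mem (strip_mem_nhds hz) hf.per)

/-- A horizontal segment inside the strip gives a continuous integrand. -/
theorem continuous_line (hf : PerHol a b f) {c : ℝ} (hac : a < c) (hcb : c < b) :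
    Continuous (fun s : ℝ => f (s + c * I)) := by
  have : ∀ s : ℝ, (s + c * I : ℂ) ∈ strip a b := fun s => by simp [mem_strip, hac, hcb]
  exact hf.diff.continuousOn.comp_continuous (by fun_prop) this

/-- By periodicity, boundedness on a closed substrip is boundedness on a rectangle. -/
theorem exists_bound (hf : PerHol a b f) {a' b' : ℝ} (ha : a < a') (hb : b' < b) :
    ∃ C : ℝ, 0 ≤ C ∧ ∀ z : ℂ, a' ≤ z.im → z.im ≤ b' → ‖f z‖ ≤ C := by
  have hK : IsCompact (Set.Icc (0 : ℝ) 1 ×ℂ Set.Icc a' b') := isCompact_Icc.reProdIm isCompact_Icc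
  have hsub : (Set.Icc (0 : ℝ) 1 ×ℂ Set.Icc a' b') ⊆ strip a b := fun z hz => by
    rw [mem_reProdIm] at hz
    exact ⟨ha.trans_le hz.2.1, hz.2.2.trans_lt hb⟩
  obtain ⟨C, hC⟩ := hK.exists_bound_of_continuousOn (hf.diff.continuousOn.mono hsub)
  refine ⟨max C 0, le_max_right _ _, fun z h1 h2 => le_max_of_le_left ?_⟩
  have hz : z ∈ strip a b := ⟨ha.trans_le h1, h2.trans_lt hb⟩
  rw [← hf.per_int (-⌊z.re⌋) hz]
  refine hC _ ?_
  rw [mem_reProdIm]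
  simp only [Int.cast_neg, add_re, neg_re, intCast_re, add_im, neg_im, intCast_im, neg_zero,
    add_zero]
  exact ⟨⟨by linarith [Int.floor_le z.re], by linarith [Int.lt_floor_add_one z.re]⟩, h1, h2⟩

/-- Cauchy's theorem on the cylinder: the integral over a horizontal circle does not depend on its
height. -/
theorem lineInt_eq (hf : PerHol a b f) {c d : ℝ} (hc : a < c ∧ c < b) (hd : a < d ∧ d < b) :
    lineInt f c = lineInt f d := by
  have h := integral_boundary_rect_eq_zero_of_differentiableOn f (c * I) (1 + d * I) (by
    refine hf.diff.mono fun z hz => ?_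
    rw [mem_reProdIm] at hz
    have h2 : z.im ∈ Set.uIcc c d := by simpa using hz.2
    rw [Set.mem_uIcc] at h2
    rcases h2 with h2 | h2
    · exact ⟨hc.1.trans_le h2.1, h2.2.trans_lt hd.2⟩
    · exact ⟨hd.1.trans_le h2.1, h2.2.trans_lt hc.2⟩)
  simp only [mul_re, ofReal_re, I_re, mul_zero, ofReal_im, I_im, mul_one, sub_self, add_re, one_re,
    add_zero, mul_im, zero_add, add_im, one_im, smul_eq_mul, ofReal_one, ofReal_zero] at h
  have hv : (∫ y : ℝ in c..d, f (1 + y * I)) = ∫ y : ℝ in c..d, f (y * I) := by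
    refine intervalIntegral.integral_congr fun y hy => ?_
    rw [Set.mem_uIcc] at hy
    have : (y * I : ℂ) ∈ strip a b := by
      simp only [mem_strip, mul_im, ofReal_re, I_im, mul_one, ofReal_im, I_re, mul_zero, add_zero]
      rcases hy with h2 | h2
      · exact ⟨hc.1.trans_le h2.1, h2.2.trans_lt hd.2⟩
      · exact ⟨hd.1.trans_le h2.1, h2.2.trans_lt hc.2⟩
    rw [add_comm, hf.per _ this]
  rw [hv] at h
  simp only [lineInt]
  linear_combination h

end PerHol

theorem perHol_ex {a b : ℝ} : PerHol a b ex := .of_entire differentiable_ex ex_add_one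

theorem perHol_one_sub_ex {a b : ℝ} (p : ℂ) : PerHol a b (fun z => 1 - ex (z - p)) :=
  .of_entire (by unfold ex; fun_prop) fun z => by
    rw [show z + 1 - p = z - p + 1 by ring, ex_add_one]

/-- On the cylinder, a zero can be divided out: the quotient by `1 - e^{2πi(z-p)}` is again
holomorphic and periodic. -/
theorem PerHol.exists_div {a b : ℝ} {g : ℂ → ℂ} (hg : PerHol a b g) {p : ℂ} (hp : p ∈ strip a b)
    (h0 : g p = 0) :
    ∃ g₁, PerHol a b g₁ ∧ ∀ z ∈ strip a b, g z = (1 - ex (z - p)) * g₁ z := by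
  classical
  set E : ℂ → ℂ := fun z => 1 - ex (z - p) with hE
  have hEd : Differentiable ℂ E := by simp only [hE]; unfold ex; fun_prop
  have hEderiv : ∀ z, E z = 0 → HasDerivAt E (-(2 * Real.pi * I)) z := fun z hz => by
    have h1 : ex (z - p) = 1 := by simp only [hE] at hz; exact (sub_eq_zero.1 hz).symm
    have h2 := ((hasDerivAt_ex (z - p)).comp z ((hasDerivAt_id z).sub_const p)).const_sub 1
    simpa [h1] using h2
  have hzero : ∀ z ∈ strip a b, E z = 0 → g z = 0 ∧ _root_.deriv g z = _root_.deriv g p := by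
    intro z hz h
    have h1 : ex (z - p) = 1 := by simp only [hE] at h; exact (sub_eq_zero.1 h).symm
    obtain ⟨n, hn⟩ := ex_eq_one_iff.1 h1
    have : z = p + n := by rw [← hn]; ring
    rw [this, hg.per_int n hp, hg.deriv.per_int n hp]
    exact ⟨h0, rfl⟩
  set g₁ : ℂ → ℂ := fun z =>
    if E z = 0 then -(_root_.deriv g p / (2 * Real.pi * I)) else g z / E z with hg₁
  refine ⟨g₁, ⟨fun z hz => DifferentiableAt.differentiableWithinAt ?_, fun z hz => ?_⟩,
    fun z hz => ?_⟩
  · by_cases h : E z = 0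
    · have hgz := hzero z hz h
      have hs := strip_mem_nhds hz
      have e1 : DifferentiableAt ℂ (dslope g z) z :=
        ((Complex.differentiableOn_dslope hs).2 hg.diff).differentiableAt hs
      have e2 : DifferentiableAt ℂ (dslope E z) z :=
        ((Complex.differentiableOn_dslope univ_mem).2 hEd.differentiableOn).differentiableAt
          univ_mem
      have h3 : dslope E z z = -(2 * Real.pi * I) := by
        rw [dslope_same, (hEderiv z h).deriv]
      have h3' : dslope E z z ≠ 0 := by rw [h3]; exact neg_ne_zero.2 two_pi_I_ne_zero
      refine (e1.div e2 h3').congr_of_eventuallyEq ?_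
      have hne : ∀ᶠ y in 𝓝 z, dslope E z y ≠ 0 := e2.continuousAt.eventually_ne h3'
      filter_upwards [hne] with y hy
      by_cases hyz : y = z
      · subst hyz
        simp only [hg₁, if_pos h, Pi.div_apply, h3, dslope_same, hgz.2]
        rw [div_neg]
      · have hE1 : E y = (y - z) * dslope E z y := by
          have := sub_smul_dslope E z y
          rw [smul_eq_mul, h, sub_zero] at this; exact this.symm
        have hg1 : g y = (y - z) * dslope g z y := by
          have := sub_smul_dslope g z y
          rw [smul_eq_mul, hgz.1, sub_zero] at this; exact this.symm
        have hE2 : E y ≠ 0 := by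
          rw [hE1]; exact mul_ne_zero (sub_ne_zero.2 hyz) hy
        simp only [hg₁, if_neg hE2, Pi.div_apply]
        rw [hE1, hg1, mul_div_mul_left _ _ (sub_ne_zero.2 hyz)]
    · have : ∀ᶠ y in 𝓝 z, E y ≠ 0 := (hEd z).continuousAt.eventually_ne h
      refine ((hg.differentiableAt hz).div (hEd z) h).congr_of_eventuallyEq ?_
      filter_upwards [this] with y hy
      simp only [hg₁, if_neg hy, Pi.div_apply]
  · have : E (z + 1) = E z := (perHol_one_sub_ex (a := a) (b := b) p).per z hz
    simp only [hg₁, this, hg.per z hz]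
  · by_cases h : E z = 0
    · have h' : (1 - ex (z - p)) = 0 := h
      rw [(hzero z hz h).1, h', zero_mul]
    · simp only [hg₁, if_neg h]
      have h' : (1 - ex (z - p)) ≠ 0 := h
      rw [mul_div_cancel₀ _ h']

theorem perHol_inv_one_sub_ex {a b : ℝ} {p : ℂ} (hp : p.im ≤ a ∨ b ≤ p.im) :
    PerHol a b (fun z => (1 - ex (z - p))⁻¹) := by
  refine (perHol_one_sub_ex p).inv fun z hz h => ?_
  have := ex_ne_one_of_im_ne_zero (z := z - p) (by
    simp only [sub_im]
    rcases hp with hp | hp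
    · linarith [hz.1]
    · linarith [hz.2])
  exact this (sub_eq_zero.1 h).symm

theorem lineInt_norm_le {f : ℂ → ℂ} {c C : ℝ} (h : ∀ s : ℝ, ‖f (s + c * I)‖ ≤ C) :
    ‖lineInt f c‖ ≤ C := by
  have := intervalIntegral.norm_integral_le_of_norm_le_const (a := (0 : ℝ)) (b := 1)
    (f := fun s : ℝ => f (s + c * I)) (C := C) (fun s _ => h s)
  simpa [lineInt] using this

theorem lineInt_sub {f g : ℂ → ℂ} {c : ℝ} (hf : Continuous fun s : ℝ => f (s + c * I))
    (hg : Continuous fun s : ℝ => g (s + c * I)) :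
    lineInt (fun z => f z - g z) c = lineInt f c - lineInt g c :=
  intervalIntegral.integral_sub (hf.intervalIntegrable _ _) (hg.intervalIntegrable _ _)

theorem lineInt_add {f g : ℂ → ℂ} {c : ℝ} (hf : Continuous fun s : ℝ => f (s + c * I))
    (hg : Continuous fun s : ℝ => g (s + c * I)) :
    lineInt (fun z => f z + g z) c = lineInt f c + lineInt g c :=
  intervalIntegral.integral_add (hf.intervalIntegrable _ _) (hg.intervalIntegrable _ _)

theorem lineInt_const_mul (k : ℂ) (f : ℂ → ℂ) (c : ℝ) :
    lineInt (fun z => k * f z) c = k * lineInt f c :=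
  intervalIntegral.integral_const_mul _ _

theorem lineInt_congr {f g : ℂ → ℂ} {c : ℝ} (h : ∀ s : ℝ, f (s + c * I) = g (s + c * I)) :
    lineInt f c = lineInt g c :=
  intervalIntegral.integral_congr fun s _ => h s

/-- Moving the line to `+i∞` evaluates the integral of the Cauchy kernel of the cylinder. -/
theorem lineInt_inv_one_sub_ex_above {p : ℂ} {c : ℝ} (hc : p.im < c) :
    lineInt (fun z => (1 - ex (z - p))⁻¹) c = 1 := by
  have key : ∀ d : ℝ, p.im + 1 < d →
      ‖lineInt (fun z => (1 - ex (z - p))⁻¹) c - 1‖ ≤ 2 * Real.exp (-(2 * Real.pi * (d - p.im))) := by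
    intro d hd
    rw [(perHol_inv_one_sub_ex (a := p.im) (b := max c d + 1) (.inl le_rfl)).lineInt_eq
      (d := d) ⟨hc, by linarith [le_max_left c d]⟩ ⟨by linarith, by linarith [le_max_right c d]⟩]
    have h1 : lineInt (fun _ => (1 : ℂ)) d = 1 := by simp [lineInt]
    have hcont := (perHol_inv_one_sub_ex (a := p.im) (b := d + 1) (p := p) (.inl le_rfl)).continuous_line
      (c := d) (by linarith) (by linarith)
    rw [show lineInt (fun z => (1 - ex (z - p))⁻¹) d - 1
      = lineInt (fun z => (1 - ex (z - p))⁻¹ - 1) d by rw [lineInt_sub hcont continuous_const, h1]]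
    refine lineInt_norm_le fun s => ?_
    have hn : ‖ex (s + d * I - p)‖ = Real.exp (-(2 * Real.pi * (d - p.im))) := by
      rw [norm_ex]; simp
    have hsmall : ‖ex (s + d * I - p)‖ ≤ 1 / 2 := by
      rw [hn]
      have h2 : Real.exp (-(2 * Real.pi * (d - p.im))) ≤ Real.exp (-1) := by
        apply Real.exp_le_exp.2
        nlinarith [Real.pi_gt_three]
      have h3 := Real.exp_neg_one_lt_d9
      linarith
    have hden : 1 / 2 ≤ ‖1 - ex (s + d * I - p)‖ := by
      have := norm_sub_norm_le (1 : ℂ) (ex (s + d * I - p))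
      rw [norm_one] at this; linarith
    have hne : 1 - ex (s + d * I - p) ≠ 0 := by
      intro h; rw [h, norm_zero] at hden; norm_num at hden
    rw [show (1 - ex (s + d * I - p))⁻¹ - 1 = ex (s + d * I - p) / (1 - ex (s + d * I - p)) by
      field_simp; ring, norm_div, hn, div_le_iff₀ (by linarith)]
    nlinarith [Real.exp_pos (-(2 * Real.pi * (d - p.im)))]
  have hlim : Tendsto (fun d : ℝ => 2 * Real.exp (-(2 * Real.pi * (d - p.im)))) atTop (𝓝 (2 * 0)) := by
    refine Tendsto.const_mul _ (Real.tendsto_exp_neg_atTop_nhds_zero.comp ?_)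
    exact (tendsto_atTop_add_const_right _ (-p.im) tendsto_id).const_mul_atTop (by positivity)
  have h0 : ‖lineInt (fun z => (1 - ex (z - p))⁻¹) c - 1‖ ≤ 2 * 0 :=
    ge_of_tendsto hlim (by filter_upwards [eventually_gt_atTop (p.im + 1)] with d hd using key d hd)
  rw [mul_zero, norm_le_zero_iff, sub_eq_zero] at h0
  exact h0

theorem lineInt_neg_line (f : ℂ → ℂ) (c : ℝ) (hf : ∀ s : ℝ, f (s + c * I + 1) = f (s + c * I)) :
    lineInt (fun z => f (-z)) (-c) = lineInt f c := by
  simp only [lineInt]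
  have h := intervalIntegral.integral_comp_sub_left (fun s : ℝ => f (s + c * I)) (a := 0) (b := 1) 1
  rw [sub_self, sub_zero] at h
  rw [← h]
  refine intervalIntegral.integral_congr fun s _ => ?_
  have h2 := hf (-s)
  rw [show -(s + (-c : ℝ) * I : ℂ) = (-s : ℝ) + c * I by push_cast; ring, ← h2]
  congr 1; push_cast; ring

theorem lineInt_inv_one_sub_ex_below {p : ℂ} {c : ℝ} (hc : c < p.im) :
    lineInt (fun z => (1 - ex (z - p))⁻¹) c = 0 := by
  have hcont := (perHol_inv_one_sub_ex (a := -p.im) (b := -c + 1) (p := -p)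
    (.inl (by simp))).continuous_line (c := -c) (by linarith) (by linarith)
  have h1 := lineInt_inv_one_sub_ex_above (p := -p) (c := -c) (by simpa using hc)
  have h2 := lineInt_neg_line (fun z => (1 - ex (z - -p))⁻¹) (-c) (fun s => by
    rw [show (s + (-c : ℝ) * I + 1 - -p : ℂ) = s + (-c : ℝ) * I - -p + 1 by ring, ex_add_one])
  rw [neg_neg, h1] at h2
  have h3 : lineInt (fun z => (1 - ex (z - p))⁻¹) c
      = lineInt (fun z => 1 - (1 - ex (-z - -p))⁻¹) c := by
    refine lineInt_congr fun s => ?_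
    have hz : ex (s + c * I - p) ≠ 1 := ex_ne_one_of_im_ne_zero (by simp; linarith)
    have h0 := ex_ne_zero (s + c * I - p)
    rw [show -(s + c * I) - -p = -(s + c * I - p) by ring, ex_neg]
    generalize ex (s + c * I - p) = y at *
    have hy1 : 1 - y ≠ 0 := sub_ne_zero.2 hz.symm
    have hy2 : y - 1 ≠ 0 := sub_ne_zero.2 hz
    field_simp
    ring
  rw [h3, lineInt_sub continuous_const, h2]
  · simp [lineInt]
  · have := hcont.comp continuous_neg
    refine this.congr fun s => ?_
    simp only [Function.comp]
    congr 3; push_cast; ring_nf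

theorem ne_of_line {p : ℂ} {c : ℝ} (hc : c ≠ p.im) (s : ℝ) : 1 - ex (s + c * I - p) ≠ 0 := fun h =>
  ex_ne_one_of_im_ne_zero (z := s + c * I - p) (by simpa [sub_eq_zero] using hc)
    (sub_eq_zero.1 h).symm

theorem PerHol.continuous_cauchy {a b : ℝ} {f : ℂ → ℂ} (hf : PerHol a b f) {p : ℂ} {c : ℝ}
    (hac : a < c) (hcb : c < b) (hc : c ≠ p.im) :
    Continuous fun s : ℝ => f (s + c * I) * (1 - ex (s + c * I - p))⁻¹ :=
  (hf.continuous_line hac hcb).mul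
    ((((perHol_one_sub_ex (a := a) (b := b) p).continuous_line hac hcb)).inv₀ (ne_of_line hc))

/-- Cauchy's integral formula on the cylinder. -/
theorem PerHol.cauchy {a b : ℝ} {f : ℂ → ℂ} (hf : PerHol a b f) {p : ℂ} {c d : ℝ}
    (hac : a < c) (hcp : c < p.im) (hpd : p.im < d) (hdb : d < b) :
    lineInt (fun z => f z * (1 - ex (z - p))⁻¹) d - lineInt (fun z => f z * (1 - ex (z - p))⁻¹) c
      = f p := by
  obtain ⟨g, hg, hfg⟩ := (hf.sub (.const (f p))).exists_div (p := p)
    ⟨hac.trans hcp, hpd.trans hdb⟩ (sub_self _)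
  have key : ∀ e : ℝ, a < e → e < b → e ≠ p.im →
      lineInt (fun z => f z * (1 - ex (z - p))⁻¹) e
        = lineInt g e + f p * lineInt (fun z => (1 - ex (z - p))⁻¹) e := by
    intro e h1 h2 h3
    rw [← lineInt_const_mul, ← lineInt_add (hg.continuous_line h1 h2)
      ((PerHol.const (f p)).continuous_cauchy h1 h2 h3)]
    refine lineInt_congr fun s => ?_
    have h4 := hfg (s + e * I) (by simp [mem_strip, h1, h2])
    have h5 := ne_of_line h3 s
    have h6 : g (s + e * I) = (f (s + e * I) - f p) * (1 - ex (s + e * I - p))⁻¹ := by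
      rw [h4]; field_simp
    rw [h6]; ring
  rw [key d (by linarith) hdb hpd.ne', key c hac (by linarith) hcp.ne,
    lineInt_inv_one_sub_ex_above hpd, lineInt_inv_one_sub_ex_below hcp,
    hg.lineInt_eq (c := d) (d := c) ⟨by linarith, hdb⟩ ⟨hac, by linarith⟩]
  ring

/-- Interior values are bounded by `L¹` norms on two horizontal circles. -/
theorem PerHol.norm_le_of_integral_le {a b : ℝ} {f : ℂ → ℂ} (hf : PerHol a b f) {p : ℂ}
    {c d η M : ℝ} (hη : 0 < η)
    (hac : a < c) (hcp : c + η ≤ p.im) (hpd : p.im + η ≤ d) (hdb : d < b)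
    (hc : ∫ s in (0 : ℝ)..1, ‖f (s + c * I)‖ ≤ M) (hd : ∫ s in (0 : ℝ)..1, ‖f (s + d * I)‖ ≤ M) :
    ‖f p‖ ≤ 2 * (1 - Real.exp (-(2 * Real.pi * η)))⁻¹ * M := by
  set k := (1 - Real.exp (-(2 * Real.pi * η)))⁻¹ with hk
  have hpos : 0 < 1 - Real.exp (-(2 * Real.pi * η)) := by
    have : Real.exp (-(2 * Real.pi * η)) < 1 := Real.exp_lt_one_iff.2 (by
      have := mul_pos Real.pi_pos hη; linarith)
    linarith
  have hkernel : ∀ e : ℝ, (e + η ≤ p.im ∨ p.im + η ≤ e) → ∀ s : ℝ,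
      ‖(1 - ex (s + e * I - p))⁻¹‖ ≤ k := by
    intro e he s
    rw [norm_inv, hk]
    refine inv_anti₀ hpos ?_
    have hn : ‖ex (s + e * I - p)‖ = Real.exp (-(2 * Real.pi * (e - p.im))) := by
      rw [norm_ex]; simp
    rcases he with he | he
    · have h1 := norm_sub_norm_le (ex (s + e * I - p)) (1 : ℂ)
      rw [norm_one, norm_sub_rev, hn] at h1
      have h2 : 1 + 2 * Real.pi * η ≤ Real.exp (-(2 * Real.pi * (e - p.im))) := by
        refine le_trans ?_ (Real.add_one_le_exp _)
        nlinarith [Real.pi_pos]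
      have h3 : 1 - 2 * Real.pi * η ≤ Real.exp (-(2 * Real.pi * η)) := by
        have := Real.add_one_le_exp (-(2 * Real.pi * η)); linarith
      linarith
    · have h1 := norm_sub_norm_le (1 : ℂ) (ex (s + e * I - p))
      rw [norm_one, hn] at h1
      have : Real.exp (-(2 * Real.pi * (e - p.im))) ≤ Real.exp (-(2 * Real.pi * η)) := by
        apply Real.exp_le_exp.2; nlinarith [Real.pi_pos]
      linarith
  have hint : ∀ e : ℝ, a < e → e < b → (e + η ≤ p.im ∨ p.im + η ≤ e) →
      (∫ s in (0 : ℝ)..1, ‖f (s + e * I)‖ ≤ M) →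
      ‖lineInt (fun z => f z * (1 - ex (z - p))⁻¹) e‖ ≤ k * M := by
    intro e h1 h2 h3 h4
    have hne : e ≠ p.im := by rcases h3 with h | h <;> intro h' <;> linarith
    have h5 := (hf.continuous_cauchy h1 h2 hne)
    have h6 := hf.continuous_line h1 h2
    calc ‖lineInt (fun z => f z * (1 - ex (z - p))⁻¹) e‖
        ≤ ∫ s in (0 : ℝ)..1, ‖f (s + e * I) * (1 - ex (s + e * I - p))⁻¹‖ :=
          intervalIntegral.norm_integral_le_integral_norm zero_le_one
      _ ≤ ∫ s in (0 : ℝ)..1, k * ‖f (s + e * I)‖ := by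
          refine intervalIntegral.integral_mono_on zero_le_one (h5.norm.intervalIntegrable _ _)
            ((continuous_const.mul h6.norm).intervalIntegrable _ _) fun s _ => ?_
          rw [norm_mul, mul_comm]
          exact mul_le_mul_of_nonneg_right (hkernel e h3 s) (norm_nonneg _)
      _ = k * ∫ s in (0 : ℝ)..1, ‖f (s + e * I)‖ := intervalIntegral.integral_const_mul _ _
      _ ≤ k * M := mul_le_mul_of_nonneg_left h4 (inv_nonneg.2 hpos.le)
  rw [← hf.cauchy hac (by linarith : c < p.im) (by linarith : p.im < d) hdb]
  refine (norm_sub_le _ _).trans ?_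
  have h1 := hint d (by linarith) hdb (.inr hpd) hd
  have h2 := hint c hac (by linarith) (.inl hcp) hc
  linarith

/-- A holomorphic function on a closed annulus whose two boundary circles are glued by `p ↦ p - τ`
is constant: its modulus is attained at an interior point of a slightly larger annulus. -/
theorem PerHol.eq_const_of_glue {t ε : ℝ} (ht : 0 < t) (hε : 0 < ε) {h : ℂ → ℂ}
    (hh : PerHol (-(t / 2) - ε) (t / 2 + ε) h)
    (hglue : ∀ p : ℂ, t / 2 - ε < p.im → p.im < t / 2 + ε → h (p - t * I) = h p) :
    ∃ c, ∀ p ∈ strip (-(t / 2) - ε) (t / 2 + ε), h p = c := by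
  -- The modulus on the compact fundamental domain has a maximum.
  have hK : IsCompact (Set.Icc (0 : ℝ) 1 ×ℂ Set.Icc (-(t / 2)) (t / 2)) :=
    isCompact_Icc.reProdIm isCompact_Icc
  have hsub : (Set.Icc (0 : ℝ) 1 ×ℂ Set.Icc (-(t / 2)) (t / 2)) ⊆
      strip (-(t / 2) - ε) (t / 2 + ε) := fun z hz => by
    rw [mem_reProdIm] at hz
    exact ⟨by linarith [hz.2.1], by linarith [hz.2.2]⟩
  obtain ⟨p₀, hp₀, hmax⟩ := hK.exists_isMaxOn (f := fun z => ‖h z‖)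
    ⟨0, by rw [mem_reProdIm]; simp; linarith⟩ (hh.diff.continuousOn.mono hsub).norm
  have hmax1 : ∀ z : ℂ, -(t / 2) ≤ z.im → z.im ≤ t / 2 → ‖h z‖ ≤ ‖h p₀‖ := by
    intro z h1 h2
    rw [← hh.per_int (-⌊z.re⌋) (z := z) ⟨by linarith, by linarith⟩]
    refine hmax ?_
    rw [mem_reProdIm]
    simp only [Int.cast_neg, add_re, neg_re, intCast_re, add_im, neg_im, intCast_im, neg_zero,
      add_zero]
    exact ⟨⟨by linarith [Int.floor_le z.re], by linarith [Int.lt_floor_add_one z.re]⟩, h1, h2⟩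
  set ε' := min ε (t / 2) with hε'
  have hε'0 : 0 < ε' := lt_min hε (by linarith)
  have h1 : ε' ≤ ε := min_le_left _ _
  have h2 : ε' ≤ t / 2 := min_le_right _ _
  have hmax2 : IsMaxOn (norm ∘ h) (strip (-(t / 2) - ε') (t / 2 + ε')) p₀ := by
    intro z hz
    have hz1 := hz.1
    have hz2 := hz.2
    simp only [Set.mem_ofPred_eq, Function.comp]
    rcases le_or_gt z.im (t / 2) with h3 | h3
    · rcases le_or_gt (-(t / 2)) z.im with h4 | h4
      · exact hmax1 z h4 h3
      · have := hglue (z + t * I) (by simp; linarith) (by simp; linarith)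
        rw [add_sub_cancel_right] at this
        rw [this]
        exact hmax1 _ (by simp; linarith) (by simp; linarith)
    · have := hglue z (by linarith) (by linarith)
      rw [← this]
      exact hmax1 _ (by simp; linarith) (by simp; linarith)
  have hp₀' : p₀ ∈ strip (-(t / 2) - ε') (t / 2 + ε') := by
    rw [mem_reProdIm] at hp₀
    exact ⟨by linarith [hp₀.2.1], by linarith [hp₀.2.2]⟩
  have heq := Complex.eqOn_of_isPreconnected_of_isMaxOn_norm
    (convex_strip _ _).isPreconnected (isOpen_strip _ _)
    (hh.mono (by linarith) (by linarith)).diff hp₀' hmax2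
  have hcst : Set.EqOn h (fun _ => h p₀) (strip (-(t / 2) - ε) (t / 2 + ε)) := by
    refine (hh.diff.analyticOnNhd (isOpen_strip _ _)).eqOn_of_preconnected_of_eventuallyEq
      analyticOnNhd_const (convex_strip _ _).isPreconnected (z₀ := p₀)
      ⟨by linarith [hp₀'.1], by linarith [hp₀'.2]⟩ ?_
    filter_upwards [strip_mem_nhds hp₀'] with z hz using heq hz
  exact ⟨h p₀, hcst⟩

/-! ### Theta functions: functional equations and zeros -/

theorem differentiable_theta1 {τ : ℂ} (hτ : 0 < τ.im) : Differentiable ℂ (fun z => theta1 z τ) := by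
  intro z
  unfold theta1
  refine DifferentiableAt.mul (by fun_prop) ?_
  exact DifferentiableAt.comp (f := fun z : ℂ => z + 1 / 2 + τ / 2) z
    (differentiableAt_jacobiTheta₂_fst (z + 1 / 2 + τ / 2) hτ) (by fun_prop)

theorem theta1_add_one (z τ : ℂ) : theta1 (z + 1) τ = -theta1 z τ := by
  unfold theta1
  rw [show z + 1 + 1 / 2 + τ / 2 = z + 1 / 2 + τ / 2 + 1 by ring, jacobiTheta₂_add_left,
    show Real.pi * I * (τ / 4 + (z + 1)) = Real.pi * I * (τ / 4 + z) + Real.pi * I by ring,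
    exp_add, exp_pi_mul_I]
  ring

theorem theta1_add_tau (z τ : ℂ) :
    theta1 (z + τ) τ = -exp (-(Real.pi * I * τ) - 2 * Real.pi * I * z) * theta1 z τ := by
  unfold theta1
  rw [show z + τ + 1 / 2 + τ / 2 = z + 1 / 2 + τ / 2 + τ by ring, jacobiTheta₂_add_left',
    show Real.pi * I * (τ / 4 + (z + τ)) = Real.pi * I * (τ / 4 + z) + Real.pi * I * τ by ring,
    show -Real.pi * I * (τ + 2 * (z + 1 / 2 + τ / 2))
      = (-(Real.pi * I * τ) - 2 * Real.pi * I * z) + (-(Real.pi * I * τ)) + -(Real.pi * I) by ring,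
    exp_add, exp_add _ (-(Real.pi * I)), exp_add _ (-(Real.pi * I * τ)),
    exp_neg (Real.pi * I), exp_pi_mul_I, exp_neg (Real.pi * I * τ)]
  have := exp_ne_zero (Real.pi * I * τ)
  field_simp

theorem theta1_neg (z τ : ℂ) : theta1 (-z) τ = -theta1 z τ := by
  unfold theta1
  rw [show -z + 1 / 2 + τ / 2 = -(z - 1 / 2 - τ / 2) by ring, jacobiTheta₂_neg_left,
    show z + 1 / 2 + τ / 2 = z - 1 / 2 - τ / 2 + 1 + τ by ring, jacobiTheta₂_add_left',
    jacobiTheta₂_add_left,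
    show -Real.pi * I * (τ + 2 * (z - 1 / 2 - τ / 2 + 1))
      = -(2 * (Real.pi * I * z)) + -(Real.pi * I) by ring, exp_add _ (-(Real.pi * I)),
    exp_neg (Real.pi * I), exp_pi_mul_I,
    show Real.pi * I * (τ / 4 + -z) = Real.pi * I * (τ / 4 + z) + -(2 * (Real.pi * I * z)) by ring,
    exp_add]
  ring

theorem theta1_zero (τ : ℂ) : theta1 0 τ = 0 := by
  have := theta1_neg 0 τ
  rw [neg_zero] at this
  exact self_eq_neg.1 this

theorem theta2_eq (z τ : ℂ) : theta2 z τ = theta1 (z + 1 / 2) τ := by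
  unfold theta1 theta2
  rw [show z + 1 / 2 + 1 / 2 + τ / 2 = z + τ / 2 + 1 by ring, jacobiTheta₂_add_left,
    show Real.pi * I * (τ / 4 + (z + 1 / 2)) = Real.pi * I * (τ / 4 + z) + Real.pi / 2 * I by ring,
    exp_add, exp_pi_div_two_mul_I]
  ring_nf
  rw [I_sq]; ring

theorem theta3_eq (z τ : ℂ) :
    theta3 z τ = exp (Real.pi * I * (τ / 4 + z)) * theta1 (z + 1 / 2 + τ / 2) τ := by
  unfold theta1 theta3
  rw [show z + 1 / 2 + τ / 2 + 1 / 2 + τ / 2 = z + 1 + τ by ring, jacobiTheta₂_add_left',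
    jacobiTheta₂_add_left,
    show Real.pi * I * (τ / 4 + (z + 1 / 2 + τ / 2))
      = Real.pi * I * (τ / 4 + z) + Real.pi * I * (τ / 2) + Real.pi / 2 * I by ring,
    exp_add, exp_pi_div_two_mul_I,
    show -Real.pi * I * (τ + 2 * (z + 1))
      = -(Real.pi * I * (τ / 4 + z)) + -(Real.pi * I * (τ / 4 + z)) + -(Real.pi * I * (τ / 2))
        + -(2 * Real.pi * I) by ring,
    exp_add _ (-(2 * Real.pi * I)), exp_neg (2 * Real.pi * I), exp_two_pi_mul_I,
    exp_add _ (-(Real.pi * I * (τ / 2))), exp_add (-(Real.pi * I * (τ / 4 + z))),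
    exp_add (Real.pi * I * (τ / 4 + z)),
    exp_neg, exp_neg]
  have h1 := exp_ne_zero (Real.pi * I * (τ / 4 + z))
  have h2 := exp_ne_zero (Real.pi * I * (τ / 2))
  field_simp
  rw [I_sq]; ring

theorem theta1_conj (t : ℝ) (z : ℂ) :
    (starRingEnd ℂ) (theta1 z (t * I)) = theta1 ((starRingEnd ℂ) z) (t * I) := by
  unfold theta1
  set x := (starRingEnd ℂ) z
  simp only [map_mul, map_neg, conj_I, jacobiTheta₂_conj, map_add, map_div₀, map_one, map_ofNat,
    conj_ofReal, ← exp_conj]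
  rw [show x + 1 / 2 + t * I / 2 = x + 1 / 2 + t * -I / 2 + t * I by ring,
    show -(↑t * -I) = (t : ℂ) * I by ring, jacobiTheta₂_add_left',
    show -Real.pi * I * (t * I + 2 * (x + 1 / 2 + t * -I / 2))
      = -(2 * (Real.pi * I * x)) + -(Real.pi * I) by ring, exp_add _ (-(Real.pi * I)),
    exp_neg (Real.pi * I), exp_pi_mul_I,
    show Real.pi * -I * (t * -I / 4 + x)
      = Real.pi * I * (t * I / 4 + x) + -(2 * (Real.pi * I * x)) by ring, exp_add]
  ring

/-- The Euler product `∏ (1 - q^n x)`. -/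
def eulerProd (q x : ℂ) : ℂ := ∏' n : ℕ, (1 + -(q ^ n * x))

theorem summable_eulerProd {q : ℂ} (hq : ‖q‖ < 1) (x : ℂ) :
    Summable fun n : ℕ => ‖-(q ^ n * x)‖ := by
  simp only [norm_neg, norm_mul, norm_pow]
  exact (summable_geometric_of_lt_one (norm_nonneg _) hq).mul_right _

theorem eulerProd_eq {q : ℂ} (hq : ‖q‖ < 1) (x : ℂ) :
    eulerProd q x = (1 - x) * eulerProd q (q * x) := by
  unfold eulerProd
  have h : ∀ n : ℕ, 1 + -(q ^ n * (q * x)) = 1 + -(q ^ (n + 1) * x) := fun n => by ring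
  simp only [h]
  rw [tprod_eq_zero_mul' (f := fun n : ℕ => 1 + -(q ^ n * x))]
  · simp [sub_eq_add_neg]
  · exact multipliable_one_add_of_summable (f := fun n : ℕ => -(q ^ (n + 1) * x))
      ((summable_nat_add_iff 1).2 (summable_eulerProd hq x))

theorem eulerProd_ne_zero {q : ℂ} (hq : ‖q‖ < 1) {x : ℂ} (hx : ‖x‖ < 1) : eulerProd q x ≠ 0 := by
  refine tprod_one_add_ne_zero_of_summable (fun n h => ?_) (summable_eulerProd hq x)
  have h1 : q ^ n * x = 1 := by linear_combination -h
  have h2 : ‖q ^ n * x‖ < 1 := by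
    rw [norm_mul, norm_pow]
    exact mul_lt_one_of_nonneg_of_lt_one_right (pow_le_one₀ (norm_nonneg _) hq.le)
      (norm_nonneg _) hx
  rw [h1, norm_one] at h2
  exact lt_irrefl _ h2

theorem differentiable_eulerProd {q : ℂ} (hq : ‖q‖ < 1) : Differentiable ℂ (eulerProd q) := by
  intro x
  have hO : IsOpen (Metric.ball (0 : ℂ) (‖x‖ + 1)) := Metric.isOpen_ball
  have h := Summable.hasProdLocallyUniformlyOn_nat_one_add (f := fun (n : ℕ) (x : ℂ) => -(q ^ n * x))
    (u := fun n : ℕ => ‖q‖ ^ n * (‖x‖ + 1)) hO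
    ((summable_geometric_of_lt_one (norm_nonneg _) hq).mul_right _)
    (.of_forall fun n y hy => by
      rw [norm_neg, norm_mul, norm_pow]
      have : ‖y‖ < ‖x‖ + 1 := by simpa using hy
      gcongr)
    (fun n => by fun_prop)
  have h2 : DifferentiableOn ℂ (fun y => ∏' n : ℕ, (1 + -(q ^ n * y))) (Metric.ball 0 (‖x‖ + 1)) :=
    h.differentiableOn
      (.of_forall fun _ => by simpa [Finset.prod_fn] using
        DifferentiableOn.finsetProd (fun _ _ => by fun_prop)) hO
  exact h2.differentiableAt (hO.mem_nhds (by simp))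

theorem tau_im {t : ℝ} : ((t : ℂ) * I).im = t := by simp

theorem norm_ex_tau {t : ℝ} (ht : 0 < t) : ‖ex (t * I)‖ < 1 :=
  norm_ex_lt_one (by simpa using ht)

/-- On the imaginary axis all terms of the theta series are positive. -/
theorem jacobiTheta₂_im_pos {t : ℝ} (ht : 0 < t) (y : ℝ) :
    0 < (jacobiTheta₂ (y * I) (t * I)).re := by
  have h := (hasSum_jacobiTheta₂_term (y * I) (τ := t * I) (by simpa using ht))
  have hre := hasSum_re h
  have hterm : ∀ n : ℤ, (jacobiTheta₂_term n (y * I) (t * I)).re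
      = Real.exp (-(2 * Real.pi * n * y + Real.pi * t * n ^ 2)) := by
    intro n
    rw [jacobiTheta₂_term, show 2 * Real.pi * I * n * (y * I) + Real.pi * I * n ^ 2 * (t * I)
      = ((-(2 * Real.pi * n * y + Real.pi * t * n ^ 2) : ℝ) : ℂ) by
        push_cast
        linear_combination (2 * Real.pi * n * y + Real.pi * n ^ 2 * t : ℂ) * I_sq, exp_ofReal_re]
  simp only [hterm] at hre
  have := hre.tsum_eq
  rw [← this]
  exact hre.summable.tsum_pos (fun n => (Real.exp_pos _).le) 0 (Real.exp_pos _)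

theorem jacobiTheta₂_zero_pos {t : ℝ} (ht : 0 < t) : 0 < (jacobiTheta₂ 0 (t * I)).re := by
  simpa using jacobiTheta₂_im_pos ht 0

/-- One point at which `θ₁` does not vanish: it shows that the constant in the product formula is
not zero. -/
theorem theta1_ne_zero_aux {t : ℝ} (ht : 0 < t) : theta1 (-(1 / 2) - t * I / 2) (t * I) ≠ 0 := by
  unfold theta1
  rw [show -(1 / 2) - t * I / 2 + 1 / 2 + t * I / 2 = (0 : ℂ) by ring]
  have h := jacobiTheta₂_zero_pos ht
  refine mul_ne_zero (mul_ne_zero (neg_ne_zero.2 I_ne_zero) (exp_ne_zero _)) fun h0 => ?_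
  rw [h0] at h; simp at h

/-- The normalized function `e^{πiz} θ₁(z)` descends to the cylinder `ℂ / ℤ`. Its quotient by the
product `(1 - x) ∏ (1 - q^n x) (1 - q^n / x)` is elliptic without poles, hence constant: this gives
the product formula, and with it the zeros of `θ₁`. -/
theorem exists_theta1_factor {t : ℝ} (ht : 0 < t) :
    ∃ U : ℂ → ℂ, Differentiable ℂ U ∧ (∀ z, U (z + 1) = U z) ∧
      (∀ z : ℂ, |z.im| < t → U z ≠ 0) ∧
      ∀ z, theta1 z (t * I) = exp (-(Real.pi * I * z)) * ((1 - ex z) * U z) := by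
  set q := ex (t * I) with hq
  have hq1 : ‖q‖ < 1 := norm_ex_tau ht
  have hd := differentiable_theta1 (τ := t * I) (by simpa using ht)
  have hP := differentiable_eulerProd hq1
  set U₀ : ℂ → ℂ := fun z => eulerProd q (q * ex z) * eulerProd q (q * ex (-z)) with hU₀
  set A : ℂ → ℂ := fun z => theta1 z (t * I) * exp (Real.pi * I * z) with hA
  have hAd : Differentiable ℂ A := hd.mul (by fun_prop)
  have hU₀d : Differentiable ℂ U₀ := by
    refine (hP.comp ?_).mul (hP.comp ?_)
    · exact (differentiable_const _).mul differentiable_ex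
    · exact (differentiable_const _).mul (differentiable_ex.comp differentiable_neg)
  have hU₀per : ∀ z, U₀ (z + 1) = U₀ z := fun z => by
    simp only [hU₀, ex_add_one, ex_neg]
  have hAper : ∀ z, A (z + 1) = A z := fun z => by
    simp only [hA]
    rw [theta1_add_one, mul_add, mul_one, exp_add, exp_pi_mul_I]; ring
  have hU₀ne : ∀ z : ℂ, |z.im| < t → U₀ z ≠ 0 := fun z hz => by
    rw [abs_lt] at hz
    have h1 : ‖q * ex z‖ < 1 := by
      rw [hq, ← ex_add]; exact norm_ex_lt_one (by simp; linarith)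
    have h2 : ‖q * ex (-z)‖ < 1 := by
      rw [hq, ← ex_add]; exact norm_ex_lt_one (by simp; linarith)
    exact mul_ne_zero (eulerProd_ne_zero hq1 h1) (eulerProd_ne_zero hq1 h2)
  have hper : -(t / 2) - t / 2 = -t := by ring
  have hper' : t / 2 + t / 2 = t := by ring
  obtain ⟨A₁, hA₁, hA₁eq⟩ := (PerHol.of_entire (a := -(t / 2) - t / 2) (b := t / 2 + t / 2)
    hAd hAper).exists_div (p := 0) (by rw [hper, hper']; simp [mem_strip, ht])
      (by simp [hA, theta1_zero])
  have hU₀ne' : ∀ z ∈ strip (-(t / 2) - t / 2) (t / 2 + t / 2), U₀ z ≠ 0 := fun z hz => by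
    rw [hper, hper'] at hz; exact hU₀ne z (abs_lt.2 hz)
  -- Both numerator and denominator are multiplied by `- e^{2πiτ} / e^{2πip}` under `p ↦ p - τ`.
  have hglue : ∀ p : ℂ, t / 2 - t / 2 < p.im → p.im < t / 2 + t / 2 →
      A₁ (p - t * I) / U₀ (p - t * I) = A₁ p / U₀ p := by
    intro p h1 h2
    have hp : p ∈ strip (-(t / 2) - t / 2) (t / 2 + t / 2) := ⟨by linarith, by linarith⟩
    have hp' : p - t * I ∈ strip (-(t / 2) - t / 2) (t / 2 + t / 2) := by
      simp only [mem_strip, sub_im, tau_im]; exact ⟨by linarith, by linarith⟩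
    have e1 := hA₁eq p hp
    have e2 := hA₁eq _ hp'
    rw [sub_zero] at e1 e2
    have n1 : 1 - ex p ≠ 0 := fun h =>
      ex_ne_one_of_im_ne_zero (z := p) (by linarith) (sub_eq_zero.1 h).symm
    have n2 : 1 - ex (p - t * I) ≠ 0 := fun h =>
      ex_ne_one_of_im_ne_zero (z := p - t * I) (by simp; linarith) (sub_eq_zero.1 h).symm
    have hq0 : q ≠ 0 := ex_ne_zero _
    have hx0 := ex_ne_zero p
    have hAA : A p = -(q / ex p) * A (p - t * I) := by
      simp only [hA]
      have := theta1_add_tau (p - t * I) (t * I)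
      rw [sub_add_cancel] at this
      rw [this, show Real.pi * I * p = Real.pi * I * (p - t * I) + Real.pi * I * (t * I) by ring,
        exp_add, show -(Real.pi * I * (t * I)) - 2 * Real.pi * I * (p - t * I)
          = 2 * Real.pi * I * (t * I) - 2 * Real.pi * I * p - Real.pi * I * (t * I) by ring,
        exp_sub, exp_sub, hq, ex, ex]
      have := exp_ne_zero (Real.pi * I * (t * I))
      field_simp
    have hTT : (1 - ex p) * U₀ p = -(q / ex p) * ((1 - ex (p - t * I)) * U₀ (p - t * I)) := by
      simp only [hU₀]
      rw [ex_neg, ex_neg, ex_sub]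
      have e3 := eulerProd_eq hq1 (ex p)
      have e4 := eulerProd_eq hq1 (ex p / q)
      rw [show q * (ex p / q) = ex p by field_simp] at e4
      have e5 := eulerProd_eq hq1 (q * (ex p)⁻¹)
      rw [← hq, inv_div, show q * (ex p / q) = ex p by field_simp, e3,
        show q * (q / ex p) = q * (q * (ex p)⁻¹) by ring, e5]
      field_simp
      ring
    have f1 : A₁ p = A p / (1 - ex p) := by rw [e1]; field_simp
    have f2 : A₁ (p - t * I) = A (p - t * I) / (1 - ex (p - t * I)) := by rw [e2]; field_simp
    have u1 := hU₀ne' p hp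
    have u2 := hU₀ne' _ hp'
    rw [f1, f2, div_div, div_div, hTT, hAA]
    have : -(q / ex p) ≠ 0 := neg_ne_zero.2 (div_ne_zero hq0 hx0)
    rw [mul_div_mul_left _ _ this]
  obtain ⟨c, hc⟩ := PerHol.eq_const_of_glue ht (by linarith)
    (hA₁.div (.of_entire hU₀d hU₀per) hU₀ne') hglue
  rw [hper, hper'] at hc hA₁eq hU₀ne'
  have hstrip : ∀ z ∈ strip (-t) t, A z = (1 - ex z) * (c * U₀ z) := fun z hz => by
    have h1 := hc z hz
    have h2 := hA₁eq z hz
    rw [sub_zero] at h2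
    rw [h2, ← h1]
    have := hU₀ne' z hz
    field_simp
  have hall : ∀ z, A z = (1 - ex z) * (c * U₀ z) := by
    have h1 : AnalyticOnNhd ℂ A Set.univ := hAd.differentiableOn.analyticOnNhd isOpen_univ
    have h2 : AnalyticOnNhd ℂ (fun z => (1 - ex z) * (c * U₀ z)) Set.univ :=
      Differentiable.differentiableOn (((differentiable_const _).sub differentiable_ex).mul
        ((differentiable_const _).mul hU₀d)) |>.analyticOnNhd isOpen_univ
    have := h1.eq_of_eventuallyEq h2 (z₀ := 0)
      (eventually_of_mem (strip_mem_nhds (a := -t) (b := t) (by simp [mem_strip, ht])) hstrip)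
    exact fun z => congrFun this z
  have hc0 : c ≠ 0 := by
    rintro rfl
    have h1 := hall (-(1 / 2) - t * I / 2)
    simp only [hA, zero_mul, mul_zero] at h1
    exact mul_ne_zero (theta1_ne_zero_aux ht) (exp_ne_zero _) h1
  refine ⟨fun z => c * U₀ z, (differentiable_const _).mul hU₀d, fun z => by simp only [hU₀per],
    fun z hz => mul_ne_zero hc0 (hU₀ne z hz), fun z => ?_⟩
  rw [← hall z]
  simp only [hA]
  rw [mul_comm (theta1 _ _), ← mul_assoc, ← exp_add]
  simp

theorem inLattice_sub_tau {τ z : ℂ} (k : ℤ) : InLattice τ (z - k * τ) ↔ InLattice τ z := by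
  constructor
  · rintro ⟨m, l, h⟩
    exact ⟨m, l + k, by push_cast; linear_combination h⟩
  · rintro ⟨m, l, h⟩
    exact ⟨m, l - k, by push_cast; linear_combination h⟩

theorem theta1_sub_tau_eq_zero {τ z : ℂ} (k : ℤ) : theta1 (z - k * τ) τ = 0 ↔ theta1 z τ = 0 := by
  have h1 : ∀ z : ℂ, theta1 (z + τ) τ = 0 ↔ theta1 z τ = 0 := fun z => by
    rw [theta1_add_tau]; simp [exp_ne_zero]
  induction k using Int.induction_on with
  | zero => simp
  | succ n ih =>
    refine Iff.trans ?_ ih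
    rw [← h1]; push_cast
    rw [show z - (n + 1) * τ + τ = z - n * τ by ring]
  | pred n ih =>
    refine Iff.trans ?_ ih
    push_cast
    rw [show z - (-n - 1) * τ = z - (-n) * τ + τ by ring, h1]

/-- The translate by a multiple of `τ = t i` that lies in the strip `|Im p| ≤ t / 2`. -/
def fold (t : ℝ) (p : ℂ) : ℂ := p - (round (p.im / t) : ℤ) * (t * I)

theorem fold_im (t : ℝ) (p : ℂ) : (fold t p).im = p.im - round (p.im / t) * t := by
  simp [fold]

theorem abs_fold_im_le {t : ℝ} (ht : 0 < t) (p : ℂ) : |(fold t p).im| ≤ t / 2 := by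
  have h := abs_sub_round (p.im / t)
  rw [fold_im, show p.im - round (p.im / t) * t = (p.im / t - round (p.im / t)) * t by
    field_simp, abs_mul, abs_of_pos ht]
  nlinarith

theorem inLattice_of_im {t : ℝ} (ht : 0 < t) {z : ℂ} (hz : |z.im| < t) :
    InLattice (t * I) z ↔ ex z = 1 := by
  rw [ex_eq_one_iff]
  constructor
  · rintro ⟨m, k, h⟩
    have him : z.im = k * t := by rw [h]; simp
    have hk : k = 0 := by
      rw [him, abs_mul, abs_of_pos ht] at hz
      have : |(k : ℝ)| < 1 := by
        by_contra h'; push Not at h'; nlinarith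
      exact Int.abs_lt_one_iff.1 (by exact_mod_cast this)
    exact ⟨m, by rw [h, hk]; simp⟩
  · rintro ⟨m, h⟩
    exact ⟨m, 0, by rw [h]; simp⟩

theorem theta1_eq_zero_iff {t : ℝ} (ht : 0 < t) {z : ℂ} :
    theta1 z (t * I) = 0 ↔ InLattice (t * I) z := by
  rw [← theta1_sub_tau_eq_zero (round (z.im / t)), ← inLattice_sub_tau (round (z.im / t))]
  have him : |(fold t z).im| < t := (abs_fold_im_le ht z).trans_lt (by linarith)
  change theta1 (fold t z) _ = 0 ↔ InLattice _ (fold t z)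
  obtain ⟨U, -, -, h2, h3⟩ := exists_theta1_factor ht
  rw [h3, inLattice_of_im ht him]
  simp only [mul_eq_zero, exp_ne_zero, h2 _ him, or_false, false_or, sub_eq_zero]
  exact eq_comm

theorem hasDerivAt_theta1_zero {t : ℝ} (ht : 0 < t) :
    HasDerivAt (fun z => theta1 z (t * I)) (theta1Deriv0 (t * I)) 0 :=
  (differentiable_theta1 (by simpa using ht) 0).hasDerivAt

theorem theta1Deriv0_ne_zero {t : ℝ} (ht : 0 < t) : theta1Deriv0 (t * I) ≠ 0 := by
  obtain ⟨U, h0, -, h2, h3⟩ := exists_theta1_factor ht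
  have hd := hasDerivAt_theta1_zero ht
  have h4 : HasDerivAt (fun z => exp (-(Real.pi * I * z)) * ((1 - ex z) * U z))
      (-(2 * Real.pi * I) * U 0) 0 := by
    have e1 : DifferentiableAt ℂ (fun z : ℂ => exp (-(Real.pi * I * z))) 0 := by fun_prop
    have e2 := ((hasDerivAt_ex 0).const_sub 1).mul (h0 0).hasDerivAt
    have e3 := e1.hasDerivAt.mul e2
    refine e3.congr_deriv ?_
    simp [ex_zero]
  rw [hd.unique (h4.congr_of_eventuallyEq (.of_forall fun z => h3 z))]
  exact mul_ne_zero (neg_ne_zero.2 two_pi_I_ne_zero) (h2 0 (by simpa using ht))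

/-! ### Reality and positivity of theta constants -/

theorem theta1_ofReal_im (t s : ℝ) : (theta1 s (t * I)).im = 0 := by
  rw [← conj_eq_iff_im, theta1_conj, conj_ofReal]

theorem theta1_half_pos {t : ℝ} (ht : 0 < t) : 0 < (theta1 ((1 / 2 : ℝ) : ℂ) (t * I)).re := by
  have h := theta2_eq 0 (t * I)
  rw [zero_add] at h
  rw [ofReal_div, ofReal_one, ofReal_ofNat, ← h, theta2, zero_add, add_zero,
    show (t * I / 2 : ℂ) = (t / 2 : ℝ) * I by push_cast; ring,
    show (Real.pi * I * (t * I / 4) : ℂ) = ((-(Real.pi * t / 4) : ℝ) : ℂ) by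
      push_cast; linear_combination (Real.pi * t / 4 : ℂ) * I_sq, ← ofReal_exp, re_ofReal_mul]
  exact mul_pos (Real.exp_pos _) (jacobiTheta₂_im_pos ht _)

theorem not_inLattice_of_mem_Ioo {τ : ℂ} (hτ : τ.im ≠ 0) {s : ℝ} (hs : s ∈ Set.Ioo (0 : ℝ) 1) :
    ¬ InLattice τ s := by
  rintro ⟨m, k, h⟩
  have h1 : (k : ℝ) * τ.im = 0 := by simpa using (congrArg im h).symm
  have hk : k = 0 := by
    have := (mul_eq_zero.1 h1).resolve_right hτ
    exact_mod_cast this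
  rw [hk] at h
  have h2 : s = m := by simpa using congrArg re h
  rw [h2] at hs
  have h3 : 0 < m := by exact_mod_cast hs.1
  have h4 : m < 1 := by exact_mod_cast hs.2
  lia

theorem theta1_pos {t : ℝ} (ht : 0 < t) {s : ℝ} (hs : s ∈ Set.Ioo (0 : ℝ) 1) :
    0 < (theta1 s (t * I)).re := by
  have hne : ∀ x ∈ Set.Ioo (0 : ℝ) 1, (theta1 x (t * I)).re ≠ 0 := fun x hx h => by
    have : theta1 x (t * I) = 0 := Complex.ext h (theta1_ofReal_im t x)
    exact not_inLattice_of_mem_Ioo (by simpa using ht.ne') hx ((theta1_eq_zero_iff ht).1 this)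
  have hc : Continuous fun x : ℝ => (theta1 x (t * I)).re :=
    continuous_re.comp ((differentiable_theta1 (by simpa using ht)).continuous.comp
      continuous_ofReal)
  by_contra hneg
  push Not at hneg
  obtain ⟨x, hx, hx0⟩ := (isPreconnected_Ioo (a := (0 : ℝ)) (b := 1)).intermediate_value hs
    (b := 1 / 2) (by norm_num) hc.continuousOn ⟨hneg, (theta1_half_pos ht).le⟩
  exact hne x hx hx0

theorem theta1Deriv0_pos {t : ℝ} (ht : 0 < t) :
    (theta1Deriv0 (t * I)).im = 0 ∧ 0 < (theta1Deriv0 (t * I)).re := by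
  have h := (hasDerivAt_theta1_zero ht).comp_ofReal (z := 0)
  have him : (theta1Deriv0 (t * I)).im = 0 := by
    have h1 : HasDerivAt (fun s : ℝ => (theta1 s (t * I)).im) (theta1Deriv0 (t * I)).im 0 :=
      imCLM.hasFDerivAt.comp_hasDerivAt _ h
    simp only [theta1_ofReal_im] at h1
    exact h1.unique (hasDerivAt_const _ _)
  have h1 : HasDerivAt (fun s : ℝ => (theta1 s (t * I)).re) (theta1Deriv0 (t * I)).re 0 :=
    reCLM.hasFDerivAt.comp_hasDerivAt _ h
  have h2 : 0 ≤ (theta1Deriv0 (t * I)).re := by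
    have h3 := h1.tendsto_slope_zero_right
    refine ge_of_tendsto h3 ?_
    filter_upwards [Ioo_mem_nhdsGT (zero_lt_one' ℝ)] with s hs
    simp only [zero_add, ofReal_zero, theta1_zero, zero_re, sub_zero, smul_eq_mul]
    exact mul_nonneg (inv_nonneg.2 hs.1.le) (theta1_pos ht hs).le
  refine ⟨him, h2.lt_of_ne fun h0 => theta1Deriv0_ne_zero ht (Complex.ext h0.symm him)⟩

theorem jacobiTheta₂_ofReal_im (t s : ℝ) : (jacobiTheta₂ s (t * I)).im = 0 := by
  rw [← conj_eq_iff_im, jacobiTheta₂_conj]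
  simp

theorem jacobiTheta₂_ofReal_pos {t : ℝ} (ht : 0 < t) (s : ℝ) :
    0 < (jacobiTheta₂ s (t * I)).re := by
  have hne : ∀ x : ℝ, (jacobiTheta₂ x (t * I)).re ≠ 0 := fun x h => by
    have h0 : theta3 x (t * I) = 0 := Complex.ext h (jacobiTheta₂_ofReal_im t x)
    rw [theta3_eq, mul_eq_zero, or_iff_right (exp_ne_zero _), theta1_eq_zero_iff ht] at h0
    obtain ⟨m, k, h1⟩ := h0
    have h2 : t / 2 = k * t := by simpa using congrArg im h1
    have h3 : (2 * k : ℝ) = 1 := by field_simp at h2; linarith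
    have h4 : 2 * k = 1 := by exact_mod_cast h3
    lia
  have hc : Continuous fun x : ℝ => (jacobiTheta₂ x (t * I)).re := by
    refine continuous_re.comp (Continuous.comp (g := fun z : ℂ => jacobiTheta₂ z (t * I)) ?_
      continuous_ofReal)
    exact (show Differentiable ℂ (fun z : ℂ => jacobiTheta₂ z (t * I)) from fun z =>
      differentiableAt_jacobiTheta₂_fst z (by simpa using ht)).continuous
  by_contra hneg
  push Not at hneg
  obtain ⟨x, hx0⟩ := mem_range_of_exists_le_of_exists_ge hc ⟨s, hneg⟩
    ⟨0, by simpa using (jacobiTheta₂_zero_pos ht).le⟩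
  exact hne x hx0

theorem theta1_add_half_tau (s τ : ℂ) :
    theta1 (s + τ / 2) τ
      = I * exp (-(Real.pi * I * τ / 4)) * exp (-(Real.pi * I * s)) * jacobiTheta₂ (s + 1 / 2) τ := by
  unfold theta1
  rw [show s + τ / 2 + 1 / 2 + τ / 2 = s + 1 / 2 + τ by ring, jacobiTheta₂_add_left',
    show -Real.pi * I * (τ + 2 * (s + 1 / 2)) = -(Real.pi * I * τ) + -(2 * (Real.pi * I * s))
      + -(Real.pi * I) by ring, exp_add _ (-(Real.pi * I)), exp_neg (Real.pi * I), exp_pi_mul_I,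
    exp_add, show Real.pi * I * (τ / 4 + (s + τ / 2)) = Real.pi * I * τ + Real.pi * I * s
      + -(Real.pi * I * τ / 4) by ring, exp_add, exp_add, exp_neg (Real.pi * I * τ),
    exp_neg (2 * (Real.pi * I * s)), exp_neg (Real.pi * I * s),
    show 2 * (Real.pi * I * s) = Real.pi * I * s + Real.pi * I * s by ring, exp_add]
  have h1 := exp_ne_zero (Real.pi * I * τ)
  have h2 := exp_ne_zero (Real.pi * I * s)
  field_simp

/-- The exponential factor in the definition of `e^ℓ` is the one relating `θ₁(τ; 2τ)` to the value
of a real theta series. -/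
theorem expEll_eq (τ : ℂ) :
    expEll τ = theta1Deriv0 (2 * τ) / jacobiTheta₂ (1 / 2) (2 * τ) := by
  unfold expEll
  have h := theta1_add_half_tau 0 (2 * τ)
  rw [show 0 + 2 * τ / 2 = τ by ring, zero_add, mul_zero, neg_zero, exp_zero, mul_one] at h
  rw [h, show -(Real.pi * I * (2 * τ) / 4) = -(Real.pi * I * τ / 2) by ring]
  have h1 := exp_ne_zero (-(Real.pi * I * τ / 2))
  by_cases h0 : jacobiTheta₂ (1 / 2) (2 * τ) = 0
  · rw [h0]; simp
  field_simp

theorem two_mul_tau (t : ℝ) : 2 * ((t : ℂ) * I) = ((2 * t : ℝ) : ℂ) * I := by push_cast; ring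

theorem expEll_pos {t : ℝ} (ht : 0 < t) :
    (expEll (t * I)).im = 0 ∧ 0 < (expEll (t * I)).re := by
  have ht2 : 0 < 2 * t := by linarith
  rw [expEll_eq, two_mul_tau]
  obtain ⟨h1, h2⟩ := theta1Deriv0_pos ht2
  have h3 := jacobiTheta₂_ofReal_pos ht2 (1 / 2)
  have h4 := jacobiTheta₂_ofReal_im (2 * t) (1 / 2)
  rw [show ((1 / 2 : ℝ) : ℂ) = 1 / 2 by push_cast; ring] at h3 h4
  set x := theta1Deriv0 ((2 * t : ℝ) * I)
  set y := jacobiTheta₂ (1 / 2) ((2 * t : ℝ) * I)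
  have hx : x = (x.re : ℂ) := Complex.ext (by simp) (by simp [h1])
  have hy : y = (y.re : ℂ) := Complex.ext (by simp) (by simp [h4])
  rw [hx, hy, ← ofReal_div]
  exact ⟨ofReal_im _, by rw [ofReal_re]; exact div_pos h2 h3⟩

/-! ### Removable singularities and elliptic functions of degree at most one -/

/-- A periodic meromorphic function without poles in the strip agrees, after its removable
singularities are filled in, with a holomorphic one. At points where it is analytic already, no
value changes. -/
theorem exists_perHol_of_meromorphic {a b : ℝ} {f : ℂ → ℂ}
    (hmer : ∀ z ∈ strip a b, MeromorphicAt f z)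
    (hord : ∀ z ∈ strip a b, 0 ≤ meromorphicOrderAt f z)
    (hper : ∀ z ∈ strip a b, f (z + 1) = f z) :
    ∃ g, PerHol a b g ∧ (∀ z ∈ strip a b, g =ᶠ[𝓝[≠] z] f) ∧
      ∀ z ∈ strip a b, AnalyticAt ℂ f z → g z = f z := by
  have hm : MeromorphicOn f (strip a b) := hmer
  set g := toMeromorphicNFOn f (strip a b) with hg
  have heq : ∀ z ∈ strip a b, g =ᶠ[𝓝[≠] z] f := fun z hz => hm.toMeromorphicNFOn_eq_self_on_nhdsNE hz
  have han : ∀ z ∈ strip a b, AnalyticAt ℂ g z := fun z hz => by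
    have h1 : MeromorphicNFAt g z := meromorphicNFOn_toMeromorphicNFOn f (strip a b) hz
    refine h1.meromorphicOrderAt_nonneg_iff_analyticAt.1 ?_
    rw [hg, meromorphicOrderAt_toMeromorphicNFOn hm hz]
    exact hord z hz
  refine ⟨g, ⟨fun z hz => (han z hz).differentiableAt.differentiableWithinAt, fun z hz => ?_⟩, heq,
    fun z hz hf => ?_⟩
  · have hz1 := add_one_mem_strip.2 hz
    have h1 : ContinuousAt (fun y => g (y + 1)) z :=
      ContinuousAt.comp (f := fun y : ℂ => y + 1) (g := g) (han _ hz1).continuousAt (by fun_prop)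
    have h2 : Tendsto (fun y : ℂ => y + 1) (𝓝[≠] z) (𝓝[≠] (z + 1)) := by
      refine tendsto_nhdsWithin_iff.2 ⟨?_, ?_⟩
      · exact (continuous_id.add continuous_const).continuousAt.tendsto.mono_left nhdsWithin_le_nhds
      · filter_upwards [self_mem_nhdsWithin] with y hy
        simpa using hy
    have h3 : (fun y => g (y + 1)) =ᶠ[𝓝[≠] z] g := by
      filter_upwards [h2.eventually (heq _ hz1), heq z hz,
        nhdsWithin_le_nhds (strip_mem_nhds hz)] with y e1 e2 e3
      rw [e1, e2, hper y e3]
    exact ((h1.eventuallyEq_nhds_iff_eventuallyEq_nhdsNE (han z hz).continuousAt).1 h3).eq_of_nhds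
  · exact (((han z hz).continuousAt.eventuallyEq_nhds_iff_eventuallyEq_nhdsNE hf.continuousAt).1
      (heq z hz)).eq_of_nhds

/-- An elliptic function with at most one simple pole is constant: Cauchy's formula on the period
annulus shows that the residue vanishes. -/
theorem const_of_simple_pole {t ε : ℝ} (ht : 0 < t) (hε : 0 < ε) {x : ℝ} {g : ℂ → ℂ}
    (hg : PerHol (-(t / 2) - ε) (t / 2 + ε) g)
    (hglue : ∀ p : ℂ, t / 2 - ε < p.im → p.im < t / 2 + ε → p.im ≠ 0 → p.im ≠ t →
      g (p - t * I) / (1 - ex (p - t * I - x)) = g p / (1 - ex (p - x))) :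
    ∃ c, ∀ p ∈ strip (-(t / 2) - ε) (t / 2 + ε), g p = c * (1 - ex (p - x)) := by
  have hx0 : (x : ℂ).im = 0 := ofReal_im x
  have hne : ∀ p : ℂ, p.im ≠ 0 → 1 - ex (p - x) ≠ 0 := fun p hp h =>
    ex_ne_one_of_im_ne_zero (z := p - x) (by simpa using hp) (sub_eq_zero.1 h).symm
  have h0 : g x = 0 := by
    rw [← hg.cauchy (p := x) (c := -(t / 2)) (d := t / 2) (by linarith) (by rw [hx0]; linarith)
      (by rw [hx0]; linarith) (by linarith), sub_eq_zero]
    refine intervalIntegral.integral_congr fun s _ => ?_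
    have := hglue (s + (t / 2 : ℝ) * I) (by simp; linarith) (by simp; linarith)
      (by simp; linarith) (by simp; linarith)
    rw [div_eq_mul_inv (g _), div_eq_mul_inv (g _)] at this
    rw [show (s + (t / 2 : ℝ) * I - t * I : ℂ) = s + (-(t / 2) : ℝ) * I by push_cast; ring] at this
    exact this.symm
  have hx : (x : ℂ) ∈ strip (-(t / 2) - ε) (t / 2 + ε) := by
    simp only [mem_strip, hx0]; constructor <;> linarith
  obtain ⟨g₁, hg₁, h1⟩ := hg.exists_div hx h0
  have hε' : 0 < min ε (t / 2) := lt_min hε (by linarith)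
  have he1 : min ε (t / 2) ≤ ε := min_le_left _ _
  have he2 : min ε (t / 2) ≤ t / 2 := min_le_right _ _
  obtain ⟨c, hc⟩ := (hg₁.mono (a' := -(t / 2) - min ε (t / 2)) (b' := t / 2 + min ε (t / 2))
    (by linarith) (by linarith)).eq_const_of_glue ht hε'
    (fun p hp1 hp2 => by
      have e1 := h1 p ⟨by linarith, by linarith⟩
      have e2 := h1 (p - t * I) (by
        simp only [mem_strip, sub_im, tau_im]; constructor <;> linarith)
      have e3 := hglue p (by linarith) (by linarith) (by linarith) (by linarith)
      rwa [e1, e2, mul_div_cancel_left₀ _ (hne p (by linarith)),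
        mul_div_cancel_left₀ _ (hne _ (by simp; linarith))] at e3)
  have hall : Set.EqOn g₁ (fun _ => c) (strip (-(t / 2) - ε) (t / 2 + ε)) := by
    refine (hg₁.diff.analyticOnNhd (isOpen_strip _ _)).eqOn_of_preconnected_of_eventuallyEq
      analyticOnNhd_const (convex_strip _ _).isPreconnected (z₀ := x) hx ?_
    filter_upwards [strip_mem_nhds (a := -(t / 2) - min ε (t / 2)) (b := t / 2 + min ε (t / 2))
      (z := x) (by simp only [mem_strip, hx0]; constructor <;> linarith)] with z hz using hc z hz
  exact ⟨c, fun p hp => by rw [h1 p hp, hall hp]; ring⟩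

/-- A function with boundary values of modulus one on both sides of a strip and with a zero inside
has modulus less than one inside. -/
theorem PerHol.norm_lt_one {a b c d : ℝ} {f : ℂ → ℂ} (hf : PerHol a b f) (hac : a < c) (hdb : d < b)
    (hc : ∀ z : ℂ, z.im = c → ‖f z‖ = 1) (hd : ∀ z : ℂ, z.im = d → ‖f z‖ = 1)
    {z₀ : ℂ} (hz₀ : c < z₀.im ∧ z₀.im < d) (h0 : f z₀ = 0) {z : ℂ} (hz : c < z.im ∧ z.im < d) :
    ‖f z‖ < 1 := by
  -- An interior maximum makes `f` vanish identically, against its modulus on the boundary.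
  have hno : ∀ p ∈ strip c d, ¬ IsMaxOn (norm ∘ f) (strip c d) p := by
    intro p hp hmax
    have heq := Complex.eqOn_of_isPreconnected_of_isMaxOn_norm
      (convex_strip _ _).isPreconnected (isOpen_strip _ _)
      (hf.mono hac.le hdb.le).diff hp hmax
    have hp0 : f p = 0 := by
      have := heq (show z₀ ∈ strip c d from hz₀)
      simp only [Function.const] at this
      rw [← this, h0]
    have hbd : f (d * I) = 0 := by
      have hcont : ContinuousAt f (d * I) := hf.continuousAt (by
        simp only [mem_strip, tau_im]; constructor <;> linarith [hz₀.1, hz₀.2])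
      have hlim : Tendsto (fun y : ℝ => f (y * I)) (𝓝[<] d) (𝓝 (f (d * I))) :=
        (hcont.tendsto.comp ((continuous_ofReal.mul continuous_const).tendsto d)).mono_left
          nhdsWithin_le_nhds
      refine tendsto_nhds_unique hlim (tendsto_const_nhds.congr' ?_)
      filter_upwards [Ioo_mem_nhdsLT (hz₀.1.trans hz₀.2)] with y hy
      have := heq (show (y * I : ℂ) ∈ strip c d by simp only [mem_strip, tau_im]; exact hy)
      simp only [Function.const] at this
      rw [this, hp0]
    have := hd (d * I) (by simp)
    rw [hbd, norm_zero] at this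
    exact zero_ne_one this
  have hK : IsCompact (Set.Icc (0 : ℝ) 1 ×ℂ Set.Icc c d) := isCompact_Icc.reProdIm isCompact_Icc
  have hsub : (Set.Icc (0 : ℝ) 1 ×ℂ Set.Icc c d) ⊆ strip a b := fun y hy => by
    rw [mem_reProdIm] at hy
    exact ⟨by linarith [hy.2.1], by linarith [hy.2.2]⟩
  obtain ⟨p₀, hp₀, hmax⟩ := hK.exists_isMaxOn (f := fun z => ‖f z‖)
    ⟨d * I, by rw [mem_reProdIm]; simp; linarith [hz₀.1, hz₀.2]⟩ (hf.diff.continuousOn.mono hsub).norm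
  have hmax1 : ∀ y : ℂ, c ≤ y.im → y.im ≤ d → ‖f y‖ ≤ ‖f p₀‖ := by
    intro y h1 h2
    rw [← hf.per_int (-⌊y.re⌋) (z := y) ⟨by linarith, by linarith⟩]
    refine hmax ?_
    rw [mem_reProdIm]
    simp only [Int.cast_neg, add_re, neg_re, intCast_re, add_im, neg_im, intCast_im, neg_zero,
      add_zero]
    exact ⟨⟨by linarith [Int.floor_le y.re], by linarith [Int.lt_floor_add_one y.re]⟩, h1, h2⟩
  rw [mem_reProdIm] at hp₀
  have hp1 : ‖f p₀‖ = 1 := by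
    rcases eq_or_lt_of_le hp₀.2.1 with h | h
    · exact hc _ h.symm
    · rcases eq_or_lt_of_le hp₀.2.2 with h' | h'
      · exact hd _ h'
      · exact absurd (fun y hy => hmax1 y hy.1.le hy.2.le) (hno p₀ ⟨h, h'⟩)
  refine lt_of_le_of_ne (hp1 ▸ hmax1 z hz.1.le hz.2.le) fun h => hno z hz fun y hy => ?_
  change ‖f y‖ ≤ ‖f z‖
  rw [h, ← hp1]
  exact hmax1 y hy.1.le hy.2.le

/-! ### The fundamental annulus -/

theorem round_eq_of_abs_lt {x : ℝ} {k : ℤ} (h : |x - k| < 1 / 2) : round x = k := by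
  rw [abs_lt] at h
  rw [round_eq, Int.floor_eq_iff]
  constructor <;> linarith

theorem fold_eq_of_abs_lt {t : ℝ} (ht : 0 < t) {p : ℂ} {k : ℤ} (h : |p.im - k * t| < t / 2) :
    fold t p = p - k * (t * I) := by
  have : round (p.im / t) = k := by
    apply round_eq_of_abs_lt
    rw [show p.im / t - k = (p.im - k * t) / t by field_simp, abs_div, abs_of_pos ht,
      div_lt_iff₀ ht]
    linarith
  rw [fold, this]

theorem fold_of_abs_lt {t : ℝ} (ht : 0 < t) {p : ℂ} (h : |p.im| < t / 2) : fold t p = p := by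
  rw [fold_eq_of_abs_lt ht (k := 0) (by simpa using h)]
  simp

theorem abs_fold_im_lt {t : ℝ} (ht : 0 < t) {p : ℂ} (hp : ¬ OnGamma (t * I) p) :
    |(fold t p).im| < t / 2 := by
  refine lt_of_le_of_ne (abs_fold_im_le ht p) fun h => hp ?_
  rw [fold_im] at h
  simp only [OnGamma, tau_im]
  rcases (abs_eq (by linarith)).1 h with h | h
  · exact ⟨round (p.im / t), by linarith⟩
  · exact ⟨round (p.im / t) - 1, by push_cast; linarith⟩

theorem eventually_fold_eq {t : ℝ} (ht : 0 < t) {p : ℂ} (hp : ¬ OnGamma (t * I) p) :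
    ∀ᶠ p' in 𝓝 p, fold t p' = p' - (round (p.im / t) : ℤ) * (t * I) := by
  have h := abs_fold_im_lt ht hp
  rw [fold_im] at h
  have hc : Continuous fun p' : ℂ => |p'.im - round (p.im / t) * t| := by fun_prop
  filter_upwards [hc.continuousAt.eventually_lt continuousAt_const h] with p' hp'
  exact fold_eq_of_abs_lt ht hp'

theorem eventually_not_onGamma {t : ℝ} (ht : 0 < t) {p : ℂ} (hp : ¬ OnGamma (t * I) p) :
    ∀ᶠ p' in 𝓝 p, ¬ OnGamma (t * I) p' := by
  have hc : Continuous fun p' : ℂ => |p'.im - round (p.im / t) * t| := by fun_prop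
  have h := abs_fold_im_lt ht hp
  rw [fold_im] at h
  filter_upwards [hc.continuousAt.eventually_lt continuousAt_const h] with p' hp'
  rintro ⟨k, hk⟩
  rw [tau_im] at hk
  rw [hk, show (k + 1 / 2) * t - round (p.im / t) * t = (k - round (p.im / t) + 1 / 2) * t by ring,
    abs_mul, abs_of_pos ht] at hp'
  have h6 : |(k - round (p.im / t) + 1 / 2 : ℝ)| < 1 / 2 := by
    by_contra h7; push Not at h7; nlinarith
  rw [abs_lt] at h6
  have h7 : ((k - round (p.im / t) : ℤ) : ℝ) < 0 := by push_cast; linarith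
  have h8 : (-1 : ℝ) < ((k - round (p.im / t) : ℤ) : ℝ) := by push_cast; linarith
  have h9 : k - round (p.im / t) < 0 := by exact_mod_cast h7
  have h10 : -1 < k - round (p.im / t) := by exact_mod_cast h8
  lia

theorem reduce_eq (t : ℝ) (p : ℂ) : reduce (t * I) p = p - (⌊p.im / t⌋ : ℤ) * (t * I) := by
  simp [reduce]

theorem fold_eq_reduce {t : ℝ} (ht : 0 < t) {p : ℂ} (h : (reduce (t * I) p).im < t / 2) :
    fold t p = reduce (t * I) p := by
  rw [reduce_eq] at h ⊢
  refine fold_eq_of_abs_lt ht ?_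
  have h1 := Int.floor_le (p.im / t)
  have h2 : ⌊p.im / t⌋ * t ≤ p.im := by rwa [le_div_iff₀ ht] at h1
  rw [abs_lt]
  constructor
  · linarith
  · simpa using h

theorem reduce_eq_fold_add {t : ℝ} (ht : 0 < t) {p : ℂ} (hp : ¬ OnGamma (t * I) p)
    (h : ¬ (reduce (t * I) p).im < t / 2) : reduce (t * I) p = fold t p + t * I := by
  have hne : (reduce (t * I) p).im ≠ t / 2 := fun h' => hp ⟨⌊p.im / t⌋, by
    rw [reduce_eq] at h'
    simp at h' ⊢
    linarith⟩
  have hlt : t / 2 < (reduce (t * I) p).im := lt_of_le_of_ne (not_lt.1 h) hne.symm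
  rw [reduce_eq] at hlt ⊢
  have h1 := Int.lt_floor_add_one (p.im / t)
  rw [div_lt_iff₀ ht] at h1
  rw [fold_eq_of_abs_lt ht (k := ⌊p.im / t⌋ + 1)]
  · push_cast; ring
  · simp only [sub_im, mul_im, intCast_re, intCast_im, mul_re, ofReal_re, I_re, mul_zero,
      ofReal_im, I_im, mul_one, sub_self, add_zero] at hlt
    rw [abs_lt]; push_cast; constructor <;> linarith

/-- A `τ`-periodic function assembled from the two formulas on the halves of the period strip is the
composition of the first formula with `fold`. -/
theorem ite_reduce_eq {t : ℝ} (ht : 0 < t) {p : ℂ} (hp : ¬ OnGamma (t * I) p) {f g : ℂ → ℂ}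
    (hfg : ∀ q, g (q + t * I) = f q) :
    (if (reduce (t * I) p).im < ((t : ℂ) * I).im / 2 then f (reduce (t * I) p)
      else g (reduce (t * I) p)) = f (fold t p) := by
  rw [tau_im]
  split_ifs with h
  · rw [fold_eq_reduce ht h]
  · rw [reduce_eq_fold_add ht hp h, hfg]

theorem inLattice_fold {t : ℝ} {p : ℂ} : InLattice (t * I) (fold t p) ↔ InLattice (t * I) p :=
  inLattice_sub_tau _

/-! ### The `g`-function -/

theorem gUpper_eq_inv (τ p : ℂ) : gUpper τ p = (gLower τ p)⁻¹ := by
  unfold gUpper gLower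
  rw [mul_inv, inv_div, ← exp_neg]
  congr 2; ring

theorem theta1_add_tau_two (p τ : ℂ) :
    theta1 (p + τ) (2 * τ) = -exp (-(2 * Real.pi * I * p)) * theta1 (p - τ) (2 * τ) := by
  have := theta1_add_tau (p - τ) (2 * τ)
  rw [show p - τ + 2 * τ = p + τ by ring] at this
  rw [this]; congr 3; ring

theorem gUpper_add_tau (τ p : ℂ) : gUpper τ (p + τ) = gLower τ p := by
  unfold gUpper gLower
  rw [add_sub_cancel_right, theta1_add_tau_two,
    show Real.pi * I * (p + τ - τ / 2) - Real.pi * I / 2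
      = -(Real.pi * I * (p - τ / 2)) + Real.pi * I / 2 + 2 * Real.pi * I * p + -(Real.pi * I) by ring,
    exp_add _ (-(Real.pi * I)), exp_add _ (2 * Real.pi * I * p), exp_neg (Real.pi * I),
    exp_pi_mul_I, exp_neg (2 * Real.pi * I * p)]
  have := exp_ne_zero (2 * Real.pi * I * p)
  by_cases h : theta1 p (2 * τ) = 0
  · rw [h]; simp
  field_simp

theorem gLower_sub_tau (τ p : ℂ) : gLower τ (p - τ) = (gLower τ p)⁻¹ := by
  have := gUpper_add_tau τ (p - τ)
  rw [sub_add_cancel] at this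
  rw [← this, gUpper_eq_inv]

theorem gLower_add_one (τ p : ℂ) : gLower τ (p + 1) = -gLower τ p := by
  unfold gLower
  rw [show p + 1 - τ = p - τ + 1 by ring, theta1_add_one, theta1_add_one, neg_div_neg_eq,
    show -(Real.pi * I * (p + 1 - τ / 2)) + Real.pi * I / 2
      = -(Real.pi * I * (p - τ / 2)) + Real.pi * I / 2 + -(Real.pi * I) by ring,
    exp_add _ (-(Real.pi * I)), exp_neg (Real.pi * I), exp_pi_mul_I]
  ring

theorem two_mul_tau_conj (t : ℝ) (z : ℂ) :
    (starRingEnd ℂ) (theta1 z (2 * (t * I))) = theta1 ((starRingEnd ℂ) z) (2 * (t * I)) := by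
  rw [two_mul_tau]; exact theta1_conj _ _

theorem gLower_conj (t : ℝ) (p : ℂ) :
    (starRingEnd ℂ) (gLower (t * I) p) = gLower (t * I) ((starRingEnd ℂ) p) := by
  unfold gLower
  rw [map_mul, map_div₀, two_mul_tau_conj, two_mul_tau_conj, ← exp_conj]
  set x := (starRingEnd ℂ) p
  simp only [map_add, map_neg, map_mul, map_sub, conj_ofReal, conj_I, map_div₀, map_ofNat]
  change _ * (theta1 (x - t * -I) _ / theta1 x _) = _
  rw [show x - t * -I = x + t * I by ring, theta1_add_tau_two,
    show -(Real.pi * -I * (x - t * -I / 2)) + Real.pi * -I / 2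
      = -(Real.pi * I * (x - t * I / 2)) + Real.pi * I / 2 + 2 * Real.pi * I * x
        + -(Real.pi * I) by ring,
    exp_add _ (-(Real.pi * I)), exp_add _ (2 * Real.pi * I * x), exp_neg (Real.pi * I),
    exp_pi_mul_I, exp_neg (2 * Real.pi * I * x)]
  have := exp_ne_zero (2 * Real.pi * I * x)
  by_cases h : theta1 x (2 * (t * I)) = 0
  · rw [h]; simp
  field_simp

theorem theta1_two_ne_zero {t : ℝ} (ht : 0 < t) {p : ℂ} (h1 : 0 < |p.im|) (h2 : |p.im| < 2 * t) :
    theta1 p (2 * (t * I)) ≠ 0 := by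
  rw [two_mul_tau]
  intro h
  rw [theta1_eq_zero_iff (by linarith), inLattice_of_im (by linarith) h2] at h
  exact ex_ne_one_of_im_ne_zero (abs_pos.1 h1) h

/-- On the annulus `|Im p| < t` the function `e^{ℓ-g}` is `1 - e^{2πip}` times a unit. -/
theorem exists_gUpper_factor {t : ℝ} (ht : 0 < t) :
    ∃ V : ℂ → ℂ, PerHol (-t) t V ∧ (∀ z ∈ strip (-t) t, V z ≠ 0) ∧
      ∀ z ∈ strip (-t) t, gUpper (t * I) z = exp (Real.pi * I * z) * ((1 - ex z) * V z) := by
  have ht2 : 0 < 2 * t := by linarith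
  obtain ⟨U, hU, hUper, hU0, hUeq⟩ := exists_theta1_factor ht2
  set τ : ℂ := t * I with hτ
  set C := exp (-(Real.pi * I * τ / 2) - Real.pi * I / 2 - Real.pi * I * τ) with hC
  have hden : ∀ z ∈ strip (-t) t, (1 - ex (z - τ)) * U (z - τ) ≠ 0 := fun z hz => by
    refine mul_ne_zero (fun h => ?_) (hU0 _ ?_)
    · exact ex_ne_one_of_im_ne_zero (z := z - τ) (by simp [hτ]; linarith [hz.2])
        (sub_eq_zero.1 h).symm
    · simp only [hτ, sub_im, tau_im, abs_lt]; constructor <;> linarith [hz.1, hz.2]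
  have hUp : ∀ {a b : ℝ}, PerHol a b U := .of_entire hU hUper
  have hUpτ : PerHol (-t) t (fun z => U (z - τ)) :=
    .of_entire (hU.comp (by fun_prop)) fun z => by
      rw [show z + 1 - τ = z - τ + 1 by ring, hUper]
  refine ⟨fun z => C * (U z / ((1 - ex (z - τ)) * U (z - τ))),
    (hUp.div ((perHol_one_sub_ex τ).mul hUpτ) hden).const_mul C, fun z hz => ?_, fun z hz => ?_⟩
  · refine mul_ne_zero (exp_ne_zero _) (div_ne_zero (hU0 z ?_) (hden z hz))
    rw [abs_lt]; constructor <;> linarith [hz.1, hz.2]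
  · unfold gUpper
    have key : exp (Real.pi * I * (z - τ / 2) - Real.pi * I / 2) * exp (-(Real.pi * I * z))
        = exp (Real.pi * I * z) * C * exp (-(Real.pi * I * (z - τ))) := by
      rw [hC, ← exp_add, ← exp_add, ← exp_add]; congr 1; ring
    have hd := hden z hz
    have he := exp_ne_zero (-(Real.pi * I * (z - τ)))
    rw [two_mul_tau, hUeq, hUeq, ← mul_div_assoc, ← mul_assoc, key]
    field_simp

theorem gUpper_ne_zero {t : ℝ} (ht : 0 < t) {p : ℂ} (h : |p.im| < t) (h1 : ex p ≠ 1) :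
    gUpper (t * I) p ≠ 0 := by
  obtain ⟨V, -, hV0, hVeq⟩ := exists_gUpper_factor ht
  have hp : p ∈ strip (-t) t := abs_lt.1 h
  rw [hVeq p hp]
  exact mul_ne_zero (exp_ne_zero _) (mul_ne_zero (sub_ne_zero.2 h1.symm) (hV0 p hp))

theorem differentiableAt_gUpper {t : ℝ} (ht : 0 < t) {p : ℂ} (h : |p.im| < t) :
    DifferentiableAt ℂ (gUpper (t * I)) p := by
  obtain ⟨V, hV, -, hVeq⟩ := exists_gUpper_factor ht
  have hp : p ∈ strip (-t) t := abs_lt.1 h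
  have h1 : DifferentiableAt ℂ (fun z => exp (Real.pi * I * z) * ((1 - ex z) * V z)) p :=
    DifferentiableAt.mul (by fun_prop)
      (((differentiableAt_const _).sub (differentiable_ex p)).mul (hV.differentiableAt hp))
  exact h1.congr_of_eventuallyEq (eventually_of_mem (strip_mem_nhds hp) hVeq)

/-- On `γ` complex conjugation is translation by `-τ`, which inverts `e^{g - ℓ}`, while conjugation
preserves its modulus. -/
theorem norm_gLower_of_im {t : ℝ} (ht : 0 < t) {p : ℂ} (hp : p.im = t / 2) :
    ‖gLower (t * I) p‖ = 1 := by
  have h1 := gLower_sub_tau (t * I) p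
  have hc : (starRingEnd ℂ) p = p - t * I := by
    apply Complex.ext <;> simp [hp]; ring
  rw [← hc, ← gLower_conj] at h1
  have h2 := congrArg norm h1
  rw [norm_conj, norm_inv] at h2
  have h0 : ‖gLower (t * I) p‖ ≠ 0 := by
    have h3 : gUpper (t * I) p ≠ 0 → ‖gLower (t * I) p‖ ≠ 0 := by
      rw [gUpper_eq_inv]; intro h; simpa using h
    refine h3 (gUpper_ne_zero ht ?_ <| ex_ne_one_of_im_ne_zero (by rw [hp]; linarith))
    rw [hp, abs_of_pos] <;> linarith
  have h3 : ‖gLower (t * I) p‖ * ‖gLower (t * I) p‖ = 1 := by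
    nth_rw 1 [h2]; exact inv_mul_cancel₀ h0
  nlinarith [norm_nonneg (gLower (t * I) p)]

theorem norm_gLower_of_im_neg {t : ℝ} (ht : 0 < t) {p : ℂ} (hp : p.im = -(t / 2)) :
    ‖gLower (t * I) p‖ = 1 := by
  have h1 := gLower_sub_tau (t * I) (p + t * I)
  rw [add_sub_cancel_right] at h1
  rw [h1, norm_inv, norm_gLower_of_im ht (by simp [hp]; ring), inv_one]

/-- The maximum principle: `e^{ℓ - g}` is unimodular on the boundary of the period annulus and
vanishes at `0`. Its square is used because the function itself is only antiperiodic. -/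
theorem norm_gUpper_lt_one {t : ℝ} (ht : 0 < t) {p : ℂ} (hp : |p.im| < t / 2) :
    ‖gUpper (t * I) p‖ < 1 := by
  have hper : ∀ z, gUpper (t * I) (z + 1) = -gUpper (t * I) z := fun z => by
    rw [gUpper_eq_inv, gUpper_eq_inv, gLower_add_one, inv_neg]
  have hf : PerHol (-t) t (fun z => gUpper (t * I) z ^ 2) :=
    ⟨fun z hz => ((differentiableAt_gUpper ht (abs_lt.2 hz)).pow 2).differentiableWithinAt,
      fun z _ => by rw [hper]; ring⟩
  have h0 : gUpper (t * I) 0 = 0 := by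
    obtain ⟨V, -, -, hVeq⟩ := exists_gUpper_factor ht
    rw [hVeq 0 (by simp [mem_strip, ht]), ex_zero]; simp
  have := hf.norm_lt_one (c := -(t / 2)) (d := t / 2) (z₀ := 0) (z := p) (by linarith) (by linarith)
    (fun z hz => by rw [norm_pow, gUpper_eq_inv, norm_inv, norm_gLower_of_im_neg ht hz]; norm_num)
    (fun z hz => by rw [norm_pow, gUpper_eq_inv, norm_inv, norm_gLower_of_im ht hz]; norm_num)
    (by simp [ht]) (by simp [h0]) (abs_lt.1 hp)
  rw [norm_pow] at this
  nlinarith [norm_nonneg (gUpper (t * I) p)]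

/-- Across `γ`, on the second sheet, `e^{g - ℓ}` becomes `e^{ℓ - g}` of the translated point, so it
is small there. -/
theorem norm_gLower_lt_one {t : ℝ} (ht : 0 < t) {p : ℂ} (h1 : t / 2 < |p.im|)
    (h2 : |p.im| < 3 * t / 2) : ‖gLower (t * I) p‖ < 1 := by
  rcases le_or_gt 0 p.im with h | h
  · rw [abs_of_nonneg h] at h1 h2
    have e := gLower_sub_tau (t * I) p
    rw [show gLower (t * I) p = gUpper (t * I) (p - t * I) by rw [gUpper_eq_inv, e, inv_inv]]
    refine norm_gUpper_lt_one ht ?_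
    simp only [sub_im, tau_im, abs_lt]; constructor <;> linarith
  · rw [abs_of_neg h] at h1 h2
    rw [← gUpper_add_tau]
    refine norm_gUpper_lt_one ht ?_
    simp only [add_im, tau_im, abs_lt]; constructor <;> linarith

theorem expG_eq {t : ℝ} (ht : 0 < t) {p : ℂ} (hp : ¬ OnGamma (t * I) p) :
    expG (t * I) p = expEll (t * I) * gLower (t * I) (fold t p) := by
  unfold expG
  exact ite_reduce_eq ht hp (f := fun q => expEll (t * I) * gLower (t * I) q)
    (g := fun q => expEll (t * I) * gUpper (t * I) q) fun q => by rw [gUpper_add_tau]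

theorem hfun_add_tau (τ p : ℂ) : hfun τ (p + τ) = -hfun τ p := by
  unfold hfun
  rw [logDeriv_apply, logDeriv_apply, ← deriv_comp_add_const, gUpper_add_tau]
  have h1 : (fun x => gUpper τ (x + τ)) = fun x => (gUpper τ x)⁻¹ := by
    funext x; rw [gUpper_add_tau, gUpper_eq_inv, inv_inv]
  have h2 : gLower τ p = (gUpper τ p)⁻¹ := by rw [gUpper_eq_inv, inv_inv]
  rw [h1, h2]
  by_cases hd : DifferentiableAt ℂ (gUpper τ) p
  · by_cases h0 : gUpper τ p = 0
    · simp [h0]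
    · rw [(hd.hasDerivAt.fun_inv h0).deriv]; field_simp
  · have h3 : ¬ DifferentiableAt ℂ (fun x => (gUpper τ x)⁻¹) p ∨ gUpper τ p = 0 := by
      by_contra hcon
      push Not at hcon
      have h4 := hcon.1.fun_inv (inv_ne_zero hcon.2)
      simp only [inv_inv] at h4
      exact hd h4
    rcases h3 with h3 | h3
    · rw [deriv_zero_of_not_differentiableAt h3, deriv_zero_of_not_differentiableAt hd]; simp
    · simp [h3]

theorem H_eq {t : ℝ} (ht : 0 < t) {p : ℂ} (hp : ¬ OnGamma (t * I) p) :
    H (t * I) p = -hfun (t * I) (fold t p) := by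
  unfold H
  exact ite_reduce_eq ht hp (f := fun q => -hfun (t * I) q) (g := hfun (t * I)) fun q =>
    hfun_add_tau _ _

theorem hasDerivAt_expG {t : ℝ} (ht : 0 < t) {p : ℂ} (hp : ¬ OnGamma (t * I) p)
    (hL : ¬ InLattice (t * I) p) : HasDerivAt (expG (t * I)) (H (t * I) p * expG (t * I) p) p := by
  set q := fold t p with hq
  have hqim : |q.im| < t / 2 := abs_fold_im_lt ht hp
  have hq1 : ex q ≠ 1 := fun h =>
    hL (inLattice_fold.1 ((inLattice_of_im ht (by linarith : |q.im| < t)).2 h))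
  have h0 := gUpper_ne_zero ht (by linarith : |q.im| < t) hq1
  have hd := (differentiableAt_gUpper ht (by linarith : |q.im| < t)).hasDerivAt
  have h1 : HasDerivAt (gLower (t * I)) (-hfun (t * I) q * gLower (t * I) q) q := by
    have h2 := hd.fun_inv h0
    have h3 : (fun x => (gUpper (t * I) x)⁻¹) = gLower (t * I) := by
      funext x; rw [gUpper_eq_inv, inv_inv]
    rw [h3] at h2
    refine h2.congr_deriv ?_
    rw [hfun, logDeriv_apply, show gLower (t * I) q = (gUpper (t * I) q)⁻¹ by
      rw [gUpper_eq_inv, inv_inv]]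
    field_simp
  rw [H_eq ht hp, expG_eq ht hp]
  have h4 : HasDerivAt (fun p' => expEll (t * I) *
      gLower (t * I) (p' - (round (p.im / t) : ℤ) * (t * I)))
      (expEll (t * I) * (-hfun (t * I) q * gLower (t * I) q)) p :=
    (HasDerivAt.comp_sub_const p _ h1).const_mul _
  refine (h4.congr_of_eventuallyEq ?_).congr_deriv (by ring)
  filter_upwards [eventually_not_onGamma ht hp, eventually_fold_eq ht hp] with p' h5 h6
  rw [expG_eq ht h5, h6]

/-! ### The differential of `g` and the Weierstrass function -/

/-- The differential of `-g` has a simple pole with residue `1` at the origin and no other pole,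
modulo `1`, on the annulus `|Im p| < t`. -/
theorem exists_hfun_eq_div {t : ℝ} (ht : 0 < t) :
    ∃ N, PerHol (-t) t N ∧ N 0 = -(2 * Real.pi * I) ∧
      ∀ p ∈ strip (-t) t, ex p ≠ 1 → hfun (t * I) p = N p / (1 - ex p) := by
  obtain ⟨V, hV, hV0, hVeq⟩ := exists_gUpper_factor ht
  refine ⟨fun z => Real.pi * I * (1 - ex z) - 2 * Real.pi * I * ex z
    + (1 - ex z) * (deriv V z / V z), ?_, by simp [ex_zero], fun p hp h1 => ?_⟩
  · have h : PerHol (-t) t (fun z => 1 - ex z) := by simpa using perHol_one_sub_ex (a := -t) (b := t) 0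
    exact ((h.const_mul _).sub (perHol_ex.const_mul _)).add (h.mul (hV.deriv.div hV hV0))
  · have hne : 1 - ex p ≠ 0 := sub_ne_zero.2 h1.symm
    have hd1 : HasDerivAt (fun z : ℂ => exp (Real.pi * I * z))
        (exp (Real.pi * I * p) * (Real.pi * I)) p := by
      have := ((hasDerivAt_id p).const_mul (Real.pi * I : ℂ)).cexp
      simpa using this
    have hd2 := ((hasDerivAt_ex p).const_sub 1).mul (hV.differentiableAt hp).hasDerivAt
    have hd := (hd1.mul hd2).congr_of_eventuallyEq (eventually_of_mem (strip_mem_nhds hp) hVeq)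
    rw [hfun, logDeriv_apply, hd.deriv, hVeq p hp]
    have h2 := hV0 p hp
    have h3 := exp_ne_zero (Real.pi * I * p)
    simp only [Pi.mul_apply]
    field_simp
    ring

theorem theta1_half_shift (p τ : ℂ) :
    theta1 (p + τ - 1 / 2) τ = exp (-(Real.pi * I * τ) - 2 * Real.pi * I * p) * theta1 (p - 1 / 2) τ := by
  rw [show p + τ - 1 / 2 = p - 1 / 2 + τ by ring, theta1_add_tau,
    show -(Real.pi * I * τ) - 2 * Real.pi * I * (p - 1 / 2)
      = -(Real.pi * I * τ) - 2 * Real.pi * I * p + Real.pi * I by ring, exp_add _ (Real.pi * I),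
    exp_pi_mul_I]
  ring

/-- `√(℘ - ℘(1/2))` up to a constant. -/
def thetaQuot (τ p : ℂ) : ℂ := theta1 (p - 1 / 2) τ / theta1 p τ

theorem thetaQuot_add_tau (τ p : ℂ) : thetaQuot τ (p + τ) = -thetaQuot τ p := by
  unfold thetaQuot
  rw [theta1_half_shift, theta1_add_tau, neg_mul, div_neg, mul_div_mul_left _ _ (exp_ne_zero _)]

/-- Both functions change sign under translation by `τ`, so their quotient is elliptic. Its only
possible pole is a simple one at the zero `1/2` of the theta quotient, so it is constant. -/
theorem exists_hfun_eq_thetaQuot {t : ℝ} (ht : 0 < t) :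
    ∃ c : ℂ, c ≠ 0 ∧ ∀ p ∈ strip (-t) t, ex p ≠ 1 → hfun (t * I) p = c * thetaQuot (t * I) p := by
  obtain ⟨N, hN, hN0, hNeq⟩ := exists_hfun_eq_div ht
  obtain ⟨U, hU, hUper, hU0, hUeq⟩ := exists_theta1_factor ht
  have e1 : -(t / 2) - t / 2 = -t := by ring
  have e2 : t / 2 + t / 2 = t := by ring
  have hsh : ∀ z : ℂ, z - ((1 / 2 : ℝ) : ℂ) = z - 1 / 2 := fun z => by push_cast; ring
  have him : ∀ z ∈ strip (-t) t, U (z - 1 / 2) ≠ 0 := fun z hz => by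
    refine hU0 _ ?_
    rw [← hsh, sub_im, ofReal_im, sub_zero]; exact abs_lt.2 hz
  have hg : PerHol (-t) t (fun z => N z * (U z / U (z - 1 / 2))) := by
    refine hN.mul (PerHol.div (.of_entire hU hUper) (.of_entire (hU.comp (by fun_prop)) fun z => ?_)
      him)
    rw [show z + 1 - 1 / 2 = z - 1 / 2 + 1 by ring, hUper]
  have key : ∀ p ∈ strip (-t) t, p.im ≠ 0 → N p * (U p / U (p - 1 / 2)) / (1 - ex (p - (1 / 2 : ℝ)))
      = exp (Real.pi * I / 2) * (hfun (t * I) p / thetaQuot (t * I) p) := by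
    intro p hp h0
    have h1 := ex_ne_one_of_im_ne_zero h0
    have h1' : 1 - ex p ≠ 0 := sub_ne_zero.2 h1.symm
    have h2 : 1 - ex (p - 1 / 2) ≠ 0 := fun h => ex_ne_one_of_im_ne_zero (z := p - 1 / 2)
      (by simpa using h0) (sub_eq_zero.1 h).symm
    have h3 := hU0 p (abs_lt.2 hp)
    have h4 := him p hp
    rw [hNeq p hp h1, thetaQuot, hUeq, hUeq, hsh,
      show -(Real.pi * I * (p - 1 / 2)) = -(Real.pi * I * p) + Real.pi * I / 2 by ring, exp_add]
    have h5 := exp_ne_zero (-(Real.pi * I * p))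
    have h6 := exp_ne_zero (Real.pi * I / 2)
    field_simp
  obtain ⟨c, hc⟩ := const_of_simple_pole (x := 1 / 2) ht (show (0 : ℝ) < t / 2 by linarith)
    (g := fun z => N z * (U z / U (z - 1 / 2))) (by rwa [e1, e2])
    (fun p h1 h2 h3 h4 => by
      have hp : p ∈ strip (-t) t := ⟨by linarith, by linarith⟩
      have hp' : p - t * I ∈ strip (-t) t := by
        simp only [mem_strip, sub_im, tau_im]; constructor <;> linarith
      rw [key p hp h3, key _ hp' (by simp; exact sub_ne_zero.2 h4)]
      have e3 := hfun_add_tau (t * I) (p - t * I)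
      have e4 := thetaQuot_add_tau (t * I) (p - t * I)
      rw [sub_add_cancel] at e3 e4
      rw [e3, e4, neg_div_neg_eq])
  rw [e1, e2] at hc
  refine ⟨c * exp (-(Real.pi * I / 2)), mul_ne_zero (fun h0 => ?_) (exp_ne_zero _),
    fun p hp h1 => ?_⟩
  · have h0' : (0 : ℂ) ∈ strip (-t) t := by simp [mem_strip, ht]
    have := hc 0 h0'
    simp only [h0, zero_mul] at this
    refine mul_ne_zero ?_ (div_ne_zero (hU0 0 (by simpa using ht)) (him 0 h0')) this
    rw [hN0]; exact neg_ne_zero.2 two_pi_I_ne_zero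
  · have h2 := hc p hp
    have h1' : 1 - ex p ≠ 0 := sub_ne_zero.2 h1.symm
    have h3 := hU0 p (abs_lt.2 hp)
    have h4 := him p hp
    simp only [hsh] at h2
    have h7 : N p = c * (1 - ex (p - 1 / 2)) * U (p - 1 / 2) / U p := by
      rw [← h2, eq_div_iff h3, mul_assoc, div_mul_cancel₀ _ h4]
    rw [hNeq p hp h1, thetaQuot, hUeq, hUeq, h7,
      show -(Real.pi * I * (p - 1 / 2)) = -(Real.pi * I * p) + Real.pi * I / 2 by ring, exp_add,
      exp_neg (Real.pi * I / 2)]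
    have h5 := exp_ne_zero (-(Real.pi * I * p))
    have h6 := exp_ne_zero (Real.pi * I / 2)
    field_simp

theorem mem_lattice_periods {τ : ℂ} (him : 0 < τ.im) {p : ℂ} :
    p ∈ (periods τ him).lattice ↔ InLattice τ p := by
  rw [PeriodPair.mem_lattice]
  simp only [periods, mul_one, InLattice]
  exact exists₂_congr fun _ _ => eq_comm

theorem ex_half_ne_one : ex (1 / 2) ≠ 1 := by
  intro h
  obtain ⟨n, hn⟩ := ex_eq_one_iff.1 h
  have h1 : (1 / 2 : ℝ) = n := by
    have := congrArg re hn; simpa using this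
  have h2 : (2 * n : ℝ) = 1 := by linarith
  have h3 : 2 * n = 1 := by exact_mod_cast h2
  lia

/-- The difference of `h²` and `℘` is elliptic with at most a simple pole at `0`, hence constant.
The constant is found at `1/2`, where `h` vanishes. -/
theorem hfun_sq {t : ℝ} (ht : 0 < t) (him : 0 < ((t : ℂ) * I).im) {p : ℂ} (hp : p ∈ strip (-t) t)
    (h1 : ex p ≠ 1) :
    hfun (t * I) p ^ 2 = (periods (t * I) him).weierstrassP p
      - (periods (t * I) him).weierstrassP (1 / 2) := by
  set L := periods (t * I) him with hL
  obtain ⟨N, hN, hN0, hNeq⟩ := exists_hfun_eq_div ht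
  have hlat : ∀ z ∈ strip (-t) t, (z ∈ L.lattice ↔ ex z = 1) := fun z hz => by
    rw [hL, mem_lattice_periods, inLattice_of_im ht (abs_lt.2 hz)]
  have hLper : ∀ z (m : ℤ), L.weierstrassP (z + m) = L.weierstrassP z := fun z m =>
    L.weierstrassP_add_coe z ⟨m, (mem_lattice_periods him).2 ⟨m, 0, by simp⟩⟩
  have hLτ : ∀ z, L.weierstrassP (z - t * I) = L.weierstrassP z := fun z =>
    L.weierstrassP_sub_coe z ⟨t * I, (mem_lattice_periods him).2 ⟨0, 1, by simp⟩⟩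
  set f : ℂ → ℂ := fun z => (hfun (t * I) z ^ 2 - L.weierstrassP z) * (1 - ex z) with hf
  have hfan : ∀ z ∈ strip (-t) t, ex z ≠ 1 → AnalyticAt ℂ f z := by
    intro z hz hz1
    have hW : AnalyticAt ℂ L.weierstrassP z :=
      L.analyticOnNhd_weierstrassP z fun h => hz1 ((hlat z hz).1 h)
    have hH : AnalyticAt ℂ (hfun (t * I)) z := by
      have hq : AnalyticAt ℂ (fun z => N z / (1 - ex z)) z :=
        (hN.analyticAt hz).div (analyticAt_const.sub (differentiable_ex.analyticAt z))
          (sub_ne_zero.2 hz1.symm)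
      refine hq.congr ?_
      filter_upwards [strip_mem_nhds hz, (differentiable_ex z).continuousAt.eventually_ne hz1]
        with y hy hy1 using (hNeq y hy hy1).symm
    exact ((hH.pow 2).sub hW).mul (analyticAt_const.sub (differentiable_ex.analyticAt z))
  -- The double poles cancel at the origin.
  have h0 : ∃ F, AnalyticAt ℂ F 0 ∧ f =ᶠ[𝓝[≠] 0] F := by
    have h0s : (0 : ℂ) ∈ strip (-t) t := by simp [mem_strip, ht]
    set E : ℂ → ℂ := dslope (fun z => 1 - ex z) 0 with hE
    have hdE : Differentiable ℂ (fun z => 1 - ex z) := (differentiable_const _).sub differentiable_ex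
    have hEan : AnalyticAt ℂ E 0 :=
      ((Complex.differentiableOn_dslope univ_mem).2 hdE.differentiableOn).analyticAt univ_mem
    have hE0 : E 0 = -(2 * Real.pi * I) := by
      rw [hE, dslope_same, ((hasDerivAt_ex 0).const_sub 1).deriv, ex_zero, mul_one]
    have hEeq : ∀ z, 1 - ex z = z * E z := fun z => by
      have := sub_smul_dslope (fun z => 1 - ex z) 0 z
      simpa [ex_zero] using this.symm
    have hEne : E 0 ≠ 0 := by rw [hE0]; exact neg_ne_zero.2 two_pi_I_ne_zero
    set r : ℂ → ℂ := fun z => N z ^ 2 / E z ^ 2 - 1 with hr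
    have hran : AnalyticAt ℂ r 0 :=
      (((hN.analyticAt h0s).pow 2).div (hEan.pow 2) (pow_ne_zero 2 hEne)).sub analyticAt_const
    have hr0 : r 0 = 0 := by
      simp only [hr]; rw [hN0, hE0, div_self, sub_self]
      exact pow_ne_zero 2 (neg_ne_zero.2 two_pi_I_ne_zero)
    have hdr : AnalyticAt ℂ (dslope r 0) 0 := by
      obtain ⟨s, hs, hrs⟩ := hran.exists_mem_nhds_analyticOnNhd
      exact ((Complex.differentiableOn_dslope hs).2 hrs.differentiableOn).analyticAt hs
    have hreq : ∀ z, r z = z * dslope r 0 z := fun z => by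
      have := sub_smul_dslope r 0 z
      simpa [hr0] using this.symm
    refine ⟨fun z => dslope r 0 z * E z - z * E z * L.weierstrassPExcept 0 z,
      (hdr.mul hEan).sub ((analyticAt_id.mul hEan).mul (L.analyticAt_weierstrassPExcept 0)), ?_⟩
    filter_upwards [nhdsWithin_le_nhds (strip_mem_nhds h0s), self_mem_nhdsWithin,
      nhdsWithin_le_nhds (hEan.continuousAt.eventually_ne hEne)] with z hz hz0 hEz
    have hz0' : z ≠ 0 := hz0
    have hexz : ex z ≠ 1 := fun h => mul_ne_zero hz0' hEz (by rw [← hEeq, h, sub_self])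
    have hPe := L.weierstrassPExcept_add ⟨0, L.lattice.zero_mem⟩ z
    simp only [sub_zero] at hPe
    have h3 := hreq z
    simp only [hr] at h3
    simp only [hf]
    rw [hNeq z hz hexz, hEeq, ← hPe]
    have h4 : N z ^ 2 = E z ^ 2 * (1 + z * dslope r 0 z) := by
      rw [← h3]; field_simp; ring
    rw [div_pow, h4]
    field_simp
    ring
  have hfper : ∀ z ∈ strip (-t) t, ∀ m : ℤ, f (z + m) = f z := by
    intro z hz m
    have hexm : ex (z + m) = ex z := by rw [ex_add, ex_int, mul_one]
    by_cases hz1 : ex z = 1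
    · simp only [hf]; rw [hexm, hz1]; simp
    · simp only [hf]
      rw [hNeq z hz hz1, hNeq _ ((add_int_mem_strip m).2 hz) (by rwa [hexm]), hexm, hLper,
        hN.per_int m hz]
  obtain ⟨F, hF, hFeq⟩ := h0
  have hpole : ∀ n : ℤ, f =ᶠ[𝓝[≠] (n : ℂ)] fun z => F (z - n) := by
    intro n
    have hns : (n : ℂ) ∈ strip (-t) t := by simp [mem_strip, ht]
    have h2 : Tendsto (fun y : ℂ => y - n) (𝓝[≠] (n : ℂ)) (𝓝[≠] 0) := by
      refine tendsto_nhdsWithin_iff.2 ⟨?_, ?_⟩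
      · have : Tendsto (fun y : ℂ => y - n) (𝓝 (n : ℂ)) (𝓝 0) := by
          have h := (by fun_prop : Continuous fun y : ℂ => y - (n : ℂ)).tendsto (n : ℂ)
          rwa [sub_self] at h
        exact this.mono_left nhdsWithin_le_nhds
      · filter_upwards [self_mem_nhdsWithin] with y hy
        simpa [sub_eq_zero] using hy
    filter_upwards [h2.eventually hFeq, nhdsWithin_le_nhds (strip_mem_nhds hns)] with y hy hys
    have := hfper (y - n) (by
      rw [sub_eq_add_neg, ← Int.cast_neg]; exact (add_int_mem_strip _).2 hys) n
    rw [sub_add_cancel] at this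
    rw [this, hy]
  have hFan : ∀ n : ℤ, AnalyticAt ℂ (fun z => F (z - n)) n := fun n =>
    AnalyticAt.comp (g := F) (f := fun z : ℂ => z - n) (by simpa using hF)
      (analyticAt_id.sub analyticAt_const)
  have e1 : -(t / 2) - t / 2 = -t := by ring
  have e2 : t / 2 + t / 2 = t := by ring
  obtain ⟨g, hg, -, hgf⟩ := exists_perHol_of_meromorphic (a := -t) (b := t) (f := f)
    (fun z hz => by
      by_cases hz1 : ex z = 1
      · obtain ⟨n, rfl⟩ := ex_eq_one_iff.1 hz1
        exact (hFan n).meromorphicAt.congr (hpole n).symm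
      · exact (hfan z hz hz1).meromorphicAt)
    (fun z hz => by
      by_cases hz1 : ex z = 1
      · obtain ⟨n, rfl⟩ := ex_eq_one_iff.1 hz1
        rw [meromorphicOrderAt_congr (hpole n)]
        exact (hFan n).meromorphicOrderAt_nonneg
      · exact (hfan z hz hz1).meromorphicOrderAt_nonneg)
    (fun z hz => by simpa using hfper z hz 1)
  have hgv : ∀ z ∈ strip (-t) t, ex z ≠ 1 →
      g z / (1 - ex z) = hfun (t * I) z ^ 2 - L.weierstrassP z := fun z hz hz1 => by
    rw [hgf z hz (hfan z hz hz1)]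
    simp only [hf]
    rw [mul_div_cancel_right₀ _ (sub_ne_zero.2 hz1.symm)]
  obtain ⟨c, hc⟩ := const_of_simple_pole (x := 0) ht (show (0 : ℝ) < t / 2 by linarith)
    (g := g) (by rwa [e1, e2])
    (fun p h1 h2 h3 h4 => by
      have hp : p ∈ strip (-t) t := ⟨by linarith, by linarith⟩
      have hp' : p - t * I ∈ strip (-t) t := by
        simp only [mem_strip, sub_im, tau_im]; constructor <;> linarith
      rw [ofReal_zero, sub_zero, sub_zero, hgv p hp (ex_ne_one_of_im_ne_zero h3),
        hgv _ hp' (ex_ne_one_of_im_ne_zero (by simp; exact sub_ne_zero.2 h4)), hLτ]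
      have e3 := hfun_add_tau (t * I) (p - t * I)
      rw [sub_add_cancel] at e3
      rw [e3, neg_sq])
  rw [e1, e2] at hc
  have hconst : ∀ z ∈ strip (-t) t, ex z ≠ 1 → hfun (t * I) z ^ 2 - L.weierstrassP z = c := by
    intro z hz hz1
    rw [← hgv z hz hz1, hc z hz, ofReal_zero, sub_zero, mul_div_cancel_right₀ _
      (sub_ne_zero.2 hz1.symm)]
  have hhalf := hconst (1 / 2) (by simp [mem_strip, ht]) ex_half_ne_one
  obtain ⟨k, -, hk⟩ := exists_hfun_eq_thetaQuot ht
  rw [hk (1 / 2) (by simp [mem_strip, ht]) ex_half_ne_one, thetaQuot, sub_self, theta1_zero] at hhalf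
  have := hconst p hp h1
  rw [← hhalf] at this
  linear_combination this

theorem H_sq {t : ℝ} (ht : 0 < t) (him : 0 < ((t : ℂ) * I).im) {p : ℂ}
    (hp : ¬ OnGamma (t * I) p) (hL : ¬ InLattice (t * I) p) :
    H (t * I) p ^ 2 = (periods (t * I) him).weierstrassP p
      - (periods (t * I) him).weierstrassP (1 / 2) := by
  have hqim : |(fold t p).im| < t := (abs_fold_im_lt ht hp).trans (by linarith)
  rw [H_eq ht hp, neg_sq, hfun_sq ht him (abs_lt.1 hqim) fun h =>
    hL (inLattice_fold.1 ((inLattice_of_im ht hqim).2 h))]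
  congr 1
  exact (periods (t * I) him).weierstrassP_sub_coe p
    ⟨(round (p.im / t) : ℤ) * (t * I), (mem_lattice_periods him).2 ⟨0, round (p.im / t), by simp⟩⟩

theorem not_onGamma_of_abs_lt {t : ℝ} (ht : 0 < t) {p : ℂ} (h : |p.im| < t / 2) :
    ¬ OnGamma (t * I) p := by
  rintro ⟨k, hk⟩
  rw [tau_im] at hk
  rw [hk, abs_mul, abs_of_pos ht] at h
  have h6 : |(k + 1 / 2 : ℝ)| < 1 / 2 := by
    by_contra h7; push Not at h7; nlinarith
  rw [abs_lt] at h6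
  have h9 : k < 0 := by exact_mod_cast (by linarith : (k : ℝ) < 0)
  have h10 : -1 < k := by exact_mod_cast (by linarith : (-1 : ℝ) < k)
  lia

theorem eventually_abs_im_lt {p : ℂ} {c : ℝ} (h : |p.im| < c) : ∀ᶠ q : ℂ in 𝓝 p, |q.im| < c :=
  (continuous_abs.comp continuous_im).continuousAt.eventually_lt continuousAt_const h

theorem tendsto_mul_expG {t : ℝ} (ht : 0 < t) :
    Tendsto (fun p : ℂ => p * expG (t * I) p) (𝓝[≠] 0) (𝓝 1) := by
  have ht2 : 0 < 2 * t := by linarith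
  have hd := hasDerivAt_theta1_zero ht2
  have hd0 := theta1Deriv0_ne_zero ht2
  rw [← two_mul_tau] at hd hd0
  set τ : ℂ := t * I with hτ
  have hθτ : theta1 τ (2 * τ) ≠ 0 := by
    refine theta1_two_ne_zero ht ?_ ?_
    · rw [hτ, tau_im]; exact abs_pos.2 ht.ne'
    · rw [hτ, tau_im, abs_of_pos ht]; linarith
  have h1 : Tendsto (fun p : ℂ => p⁻¹ * theta1 p (2 * τ)) (𝓝[≠] 0) (𝓝 (theta1Deriv0 (2 * τ))) := by
    have := hd.tendsto_slope_zero
    simpa [theta1_zero] using this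
  have h2 : Tendsto (fun p : ℂ => expEll τ * (exp (-(Real.pi * I * (p - τ / 2)) + Real.pi * I / 2)
      * theta1 (p - τ) (2 * τ))) (𝓝[≠] 0) (𝓝 (expEll τ *
        (exp (-(Real.pi * I * (0 - τ / 2)) + Real.pi * I / 2) * theta1 (0 - τ) (2 * τ)))) := by
    refine (Continuous.tendsto ?_ 0).mono_left nhdsWithin_le_nhds
    have hc := (differentiable_theta1 (τ := 2 * τ) (by simpa [hτ] using ht)).continuous
    exact continuous_const.mul ((by fun_prop : Continuous _).mul
      (hc.comp (continuous_id.sub continuous_const)))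
  have h3 := h2.div h1 hd0
  have hval : expEll τ * (exp (-(Real.pi * I * (0 - τ / 2)) + Real.pi * I / 2) *
      theta1 (0 - τ) (2 * τ)) / theta1Deriv0 (2 * τ) = 1 := by
    rw [zero_sub, zero_sub, theta1_neg, expEll,
      show -(Real.pi * I * -(τ / 2)) + Real.pi * I / 2 = Real.pi * I * τ / 2 + Real.pi / 2 * I by ring,
      exp_add, exp_pi_div_two_mul_I, exp_neg]
    have := exp_ne_zero (Real.pi * I * τ / 2)
    field_simp
    rw [I_sq]; ring
  rw [hval] at h3
  refine h3.congr' ?_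
  filter_upwards [nhdsWithin_le_nhds (eventually_abs_im_lt (p := 0) (c := t / 2)
    (by simpa using ht)), self_mem_nhdsWithin] with p hp hp0
  have hp0' : p ≠ 0 := hp0
  rw [expG_eq ht (not_onGamma_of_abs_lt ht hp), fold_of_abs_lt ht hp, gLower, Pi.div_apply,
    ← hτ]
  by_cases h : theta1 p (2 * τ) = 0
  · simp [h]
  field_simp

/-! ### Cauchy transforms on the annulus -/

/-- `κ` is a `1`-periodic kernel on `|Im z| < t` whose only singularity modulo `1` is a simple pole
at `0` with residue `1`. -/
def IsCauchyKernel (t : ℝ) (κ : ℂ → ℂ) : Prop :=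
  ∃ l, PerHol (-t) t l ∧
    ∀ z ∈ strip (-t) t, ex z ≠ 1 → κ z = 2 * Real.pi * I * (1 - ex (-z))⁻¹ + l z

/-- The Cauchy transform of `f` with kernel `κ` along the line `Im q = c`. -/
def ctr (κ f : ℂ → ℂ) (c : ℝ) (p : ℂ) : ℂ :=
  (2 * Real.pi * I)⁻¹ * lineInt (fun q => κ (p - q) * f q) c

theorem IsCauchyKernel.perHol_left {t : ℝ} {κ : ℂ → ℂ} (hκ : IsCauchyKernel t κ) :
    PerHol (-t) 0 κ := by
  obtain ⟨l, hl, h⟩ := hκ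
  by_cases ht : 0 ≤ t
  · have h1 : PerHol (-t) 0 (fun z => (1 - ex (-z))⁻¹) := by
      have := (perHol_inv_one_sub_ex (a := 0) (b := t) (p := 0) (by simp)).comp_const_sub 0
      simpa using this
    refine ((h1.const_mul (2 * Real.pi * I)).add (hl.mono le_rfl ht)).congr fun z hz => ?_
    exact h z ⟨hz.1, hz.2.trans_le ht⟩ (ex_ne_one_of_im_ne_zero hz.2.ne)
  · have : ∀ z, z ∉ strip (-t) 0 := fun z hz => by have := hz.1.trans hz.2; linarith
    exact ⟨fun z hz => (this z hz).elim, fun z hz => (this z hz).elim⟩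

theorem IsCauchyKernel.perHol_right {t : ℝ} {κ : ℂ → ℂ} (hκ : IsCauchyKernel t κ) :
    PerHol 0 t κ := by
  obtain ⟨l, hl, h⟩ := hκ
  by_cases ht : 0 ≤ t
  · have h1 : PerHol 0 t (fun z => (1 - ex (-z))⁻¹) := by
      have := (perHol_inv_one_sub_ex (a := -t) (b := 0) (p := 0) (by simp)).comp_const_sub 0
      simpa using this
    refine ((h1.const_mul (2 * Real.pi * I)).add (hl.mono (by linarith) le_rfl)).congr fun z hz => ?_
    exact h z ⟨by linarith [hz.1], hz.2⟩ (ex_ne_one_of_im_ne_zero hz.1.ne')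
  · have : ∀ z, z ∉ strip 0 t := fun z hz => by have := hz.1.trans hz.2; linarith
    exact ⟨fun z hz => (this z hz).elim, fun z hz => (this z hz).elim⟩

/-- Differentiation under the integral sign: the convolution of a holomorphic kernel with a
continuous function on a line is holomorphic. -/
theorem PerHol.lineInt_conv {a b c : ℝ} {κ f : ℂ → ℂ} (hκ : PerHol a b κ)
    (hf : Continuous fun s : ℝ => f (s + c * I)) :
    PerHol (c + a) (c + b) (fun p => lineInt (fun q => κ (p - q) * f q) c) := by
  have hmem : ∀ p ∈ strip (c + a) (c + b), ∀ s : ℝ, p - (s + c * I) ∈ strip a b := by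
    intro p hp s
    have h1 := hp.1
    have h2 := hp.2
    simp only [mem_strip, sub_im, add_im, ofReal_im, mul_im, ofReal_re, I_im, I_re]
    constructor <;> linarith
  have hcont : ∀ g, PerHol a b g → ∀ p ∈ strip (c + a) (c + b),
      Continuous fun s : ℝ => g (p - (s + c * I)) * f (s + c * I) := by
    intro g hg p hp
    refine Continuous.mul ?_ hf
    refine continuous_iff_continuousAt.2 fun s => ?_
    exact ContinuousAt.comp (g := g) (f := fun s : ℝ => p - (s + c * I))
      (hg.continuousAt (hmem p hp s)) (by fun_prop)
  refine ⟨fun p hp => DifferentiableAt.differentiableWithinAt ?_, fun p hp => ?_⟩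
  · obtain ⟨a', ha1, ha2⟩ := exists_between hp.1
    obtain ⟨b', hb1, hb2⟩ := exists_between hp.2
    obtain ⟨M, hM0, hM⟩ := hκ.deriv.exists_bound (a' := a' - c) (b' := b' - c) (by linarith)
      (by linarith)
    have hsub : ∀ x ∈ strip a' b', x ∈ strip (c + a) (c + b) := fun x hx =>
      ⟨ha1.trans hx.1, hx.2.trans hb2⟩
    have := intervalIntegral.hasDerivAt_integral_of_dominated_loc_of_deriv_le
      (μ := MeasureTheory.volume) (a := 0) (b := 1)
      (F := fun (p : ℂ) (s : ℝ) => κ (p - (s + c * I)) * f (s + c * I))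
      (F' := fun (p : ℂ) (s : ℝ) => _root_.deriv κ (p - (s + c * I)) * f (s + c * I))
      (bound := fun s => M * ‖f (s + c * I)‖) (x₀ := p) (s := strip a' b')
      (strip_mem_nhds ⟨ha2, hb1⟩)
      (eventually_of_mem (strip_mem_nhds ⟨ha2, hb1⟩) fun x hx =>
        (hcont κ hκ x (hsub x hx)).aestronglyMeasurable)
      ((hcont κ hκ p hp).intervalIntegrable _ _)
      (hcont _ hκ.deriv p hp).aestronglyMeasurable
      (.of_forall fun s _ x hx => by
        rw [norm_mul]
        refine mul_le_mul_of_nonneg_right (hM _ ?_ ?_) (norm_nonneg _)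
        · have := hx.1; simp; linarith
        · have := hx.2; simp; linarith)
      ((continuous_const.mul hf.norm).intervalIntegrable _ _)
      (.of_forall fun s _ x hx => by
        have h1 := (hκ.differentiableAt (hmem x (hsub x hx) s)).hasDerivAt
        have h2 := h1.comp x ((hasDerivAt_id x).sub_const ((s : ℂ) + c * I))
        simp only [mul_one] at h2
        exact h2.mul_const _)
    exact this.2.differentiableAt
  · refine lineInt_congr fun s => ?_
    rw [show p + 1 - (s + c * I) = p - (s + c * I) + 1 by ring, hκ.per _ (hmem p hp s)]

theorem perHol_ctr_below {t c : ℝ} {κ f : ℂ → ℂ} (hκ : IsCauchyKernel t κ)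
    (hf : Continuous fun s : ℝ => f (s + c * I)) : PerHol (c - t) c (ctr κ f c) := by
  have := (hκ.perHol_left.lineInt_conv hf).const_mul (2 * Real.pi * I)⁻¹
  rw [← sub_eq_add_neg, add_zero] at this
  exact this

/-- The Cauchy transform at a point below the line of integration does not depend on that line. -/
theorem ctr_eq_of_lt {t a b c d : ℝ} {κ f : ℂ → ℂ} (hκ : IsCauchyKernel t κ) (hf : PerHol a b f)
    {p : ℂ} (hc : a < c ∧ c < b) (hd : a < d ∧ d < b) (hpc : c - t < p.im ∧ p.im < c)
    (hpd : d - t < p.im ∧ p.im < d) : ctr κ f c p = ctr κ f d p := by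
  unfold ctr
  congr 1
  have h1 := hκ.perHol_left.comp_const_sub p
  have h2 : PerHol (max a p.im) (min b (p.im + t)) (fun q => κ (p - q) * f q) :=
    (h1.mono (by simp) (by simp)).mul (hf.mono (le_max_left _ _) (min_le_left _ _))
  exact h2.lineInt_eq ⟨max_lt hc.1 hpc.2, lt_min hc.2 (by linarith [hpc.1])⟩
    ⟨max_lt hd.1 hpd.2, lt_min hd.2 (by linarith [hpd.1])⟩

/-- The Plemelj jump relation. -/
theorem ctr_jump {t a b c d : ℝ} {κ f : ℂ → ℂ} (hκ : IsCauchyKernel t κ) (hf : PerHol a b f)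
    {p : ℂ} (hc : a < c ∧ c < p.im) (hd : p.im < d ∧ d < b) (hpc : p.im - c < t)
    (hpd : d - p.im < t) : ctr κ f d p = f p + ctr κ f c p := by
  obtain ⟨l, hl, hκl⟩ := hκ
  have hl' : PerHol (max a (p.im - t)) (min b (p.im + t)) (fun q => l (p - q) * f q) :=
    ((hl.comp_const_sub p).mono (le_max_right _ _) (by simp)).mul
      (hf.mono (le_max_left _ _) (min_le_left _ _))
  have hcd : c < d := hc.2.trans hd.1
  have hc' : max a (p.im - t) < c ∧ c < min b (p.im + t) :=
    ⟨max_lt hc.1 (by linarith), lt_min (hcd.trans hd.2) (by linarith [hc.2])⟩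
  have hd' : max a (p.im - t) < d ∧ d < min b (p.im + t) :=
    ⟨max_lt (hc.1.trans hcd) (by linarith [hd.1]), lt_min hd.2 (by linarith)⟩
  have key : ∀ y : ℝ, a < y → y < b → y ≠ p.im → -t < p.im - y → p.im - y < t →
      (max a (p.im - t) < y ∧ y < min b (p.im + t)) →
      lineInt (fun q => κ (p - q) * f q) y
        = 2 * Real.pi * I * lineInt (fun q => f q * (1 - ex (q - p))⁻¹) y
          + lineInt (fun q => l (p - q) * f q) y := by
    intro y h1 h2 h3 h4 h5 h6
    rw [← lineInt_const_mul, ← lineInt_add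
      (f := fun q => 2 * Real.pi * I * (f q * (1 - ex (q - p))⁻¹))
      (g := fun q => l (p - q) * f q) (continuous_const.mul (hf.continuous_cauchy h1 h2 h3)) (hl'.continuous_line h6.1 h6.2)]
    refine lineInt_congr fun s => ?_
    rw [hκl _ (by simp [mem_strip]; constructor <;> linarith)
      (ex_ne_one_of_im_ne_zero (by simp; exact sub_ne_zero.2 h3.symm)), neg_sub]
    ring
  have hC := hf.cauchy hc.1 hc.2 hd.1 hd.2
  unfold ctr
  rw [key c hc.1 (hcd.trans hd.2) hc.2.ne (by linarith [hc.2]) hpc hc',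
    key d (hc.1.trans hcd) hd.2 hd.1.ne' (by linarith) (by linarith [hd.1]) hd',
    hl'.lineInt_eq hd' hc', ← hC]
  field_simp [two_pi_I_ne_zero]
  ring

/-- The function on the closed annulus `|Im p| ≤ t/2` given by the Cauchy transform of `f` along its
upper boundary circle, continued analytically across both boundary circles. -/
def csol (t δ : ℝ) (κ f : ℂ → ℂ) (p : ℂ) : ℂ :=
  if 0 ≤ p.im then ctr κ f (t / 2 + δ / 2) p else ctr κ f (t / 2 - δ / 2) p

/-- The value of `csol` is the Cauchy transform along any admissible line above the point. -/
theorem csol_eq {t δ : ℝ} (hδ : 0 < δ) (hδt : δ < t) {κ f : ℂ → ℂ} (hκ : IsCauchyKernel t κ)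
    (hf : PerHol (t / 2 - δ) (t / 2 + δ) f) {p : ℂ}
    (hp : p ∈ strip (-(t / 2) - δ / 2) (t / 2 + δ / 2)) {c : ℝ}
    (hc : t / 2 - δ < c ∧ c < t / 2 + δ) (hpc : c - t < p.im ∧ p.im < c) :
    csol t δ κ f p = ctr κ f c p := by
  have h1 := hp.1
  have h2 := hp.2
  unfold csol
  split_ifs with h
  · exact ctr_eq_of_lt hκ hf ⟨by linarith, by linarith⟩ hc ⟨by linarith, by linarith⟩ hpc
  · push Not at h
    exact ctr_eq_of_lt hκ hf ⟨by linarith, by linarith⟩ hc ⟨by linarith, by linarith⟩ hpc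

theorem perHol_csol {t δ : ℝ} (hδ : 0 < δ) (hδt : δ < t) {κ f : ℂ → ℂ} (hκ : IsCauchyKernel t κ)
    (hf : PerHol (t / 2 - δ) (t / 2 + δ) f) :
    PerHol (-(t / 2) - δ / 2) (t / 2 + δ / 2) (csol t δ κ f) := by
  have key : ∀ p ∈ strip (-(t / 2) - δ / 2) (t / 2 + δ / 2), ∃ c : ℝ,
      (t / 2 - δ < c ∧ c < t / 2 + δ) ∧ (c - t < p.im ∧ p.im < c) := by
    intro p hp
    have h1 := hp.1
    have h2 := hp.2
    rcases le_or_gt 0 p.im with h | h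
    · exact ⟨t / 2 + δ / 2, by constructor <;> linarith, by constructor <;> linarith⟩
    · exact ⟨t / 2 - δ / 2, by constructor <;> linarith, by constructor <;> linarith⟩
  refine ⟨fun p hp => DifferentiableAt.differentiableWithinAt ?_, fun p hp => ?_⟩ <;>
    obtain ⟨c, hc, hpc⟩ := key p hp <;>
    have hP := perHol_ctr_below hκ (hf.continuous_line hc.1 hc.2)
  · refine (hP.differentiableAt hpc).congr_of_eventuallyEq ?_
    filter_upwards [strip_mem_nhds hp, strip_mem_nhds (z := p) hpc] with y hy hy'
    exact csol_eq hδ hδt hκ hf hy hc hy'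
  · rw [csol_eq hδ hδt hκ hf hp hc hpc, csol_eq hδ hδt hκ hf (add_one_mem_strip.2 hp) hc
      (by simpa using hpc), hP.per p hpc]

/-- The additive boundary relation of the Cauchy transform. For a kernel with multiplier `e` and
additive period `2πib`, it is the jump relation together with the quasiperiodicity of the kernel.
-/
theorem csol_sub_tau {t δ : ℝ} (hδ : 0 < δ) (hδt : δ < t) {κ f : ℂ → ℂ} (hκ : IsCauchyKernel t κ)
    (hf : PerHol (t / 2 - δ) (t / 2 + δ) f) {e b : ℂ}
    (hqp : ∀ z : ℂ, 0 < z.im → z.im < t → κ (z - t * I) = e * κ z + 2 * Real.pi * I * b) {p : ℂ}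
    (hp : t / 2 - δ / 2 < p.im ∧ p.im < t / 2 + δ / 2) :
    csol t δ κ f (p - t * I)
      = e * (csol t δ κ f p - f p) + b * lineInt f (t / 2 - δ / 2) := by
  have him : (p - t * I).im = p.im - t := by rw [sub_im, tau_im]
  rw [csol_eq hδ hδt hκ hf (p := p - t * I) (c := t / 2 - δ / 2)
    ⟨by rw [him]; linarith, by rw [him]; linarith⟩ ⟨by linarith, by linarith⟩
    ⟨by rw [him]; linarith, by rw [him]; linarith⟩,
    csol_eq hδ hδt hκ hf (p := p) (c := t / 2 + δ / 2) ⟨by linarith, by linarith⟩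
    ⟨by linarith, by linarith⟩ ⟨by linarith, by linarith⟩,
    ctr_jump hκ hf (c := t / 2 - δ / 2) (d := t / 2 + δ / 2) (p := p) ⟨by linarith, hp.1⟩
      ⟨hp.2, by linarith⟩ (by linarith) (by linarith), add_sub_cancel_left]
  unfold ctr
  have hcont : Continuous fun s : ℝ => κ (p - (s + (t / 2 - δ / 2 : ℝ) * I))
      * f (s + (t / 2 - δ / 2 : ℝ) * I) := by
    have h1 := hκ.perHol_right.comp_const_sub p
    refine Continuous.mul ?_ (hf.continuous_line (by linarith) (by linarith))
    exact h1.continuous_line (by linarith) (by linarith)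
  have h1 : lineInt (fun q => κ (p - t * I - q) * f q) (t / 2 - δ / 2)
      = e * lineInt (fun q => κ (p - q) * f q) (t / 2 - δ / 2)
        + 2 * Real.pi * I * b * lineInt f (t / 2 - δ / 2) := by
    rw [← lineInt_const_mul, ← lineInt_const_mul, ← lineInt_add
      (f := fun q => e * (κ (p - q) * f q)) (g := fun q => 2 * Real.pi * I * b * f q) (continuous_const.mul hcont)
      (continuous_const.mul (hf.continuous_line (by linarith) (by linarith)))]
    refine lineInt_congr fun s => ?_
    rw [sub_right_comm, hqp _ (by simp; linarith) (by simp; linarith)]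
    ring
  rw [h1]
  field_simp [two_pi_I_ne_zero]

/-! ### The two Cauchy kernels and the Szegő function -/

theorem inv_one_sub_ex_neg {z : ℂ} (hz1 : ex z ≠ 1) : (1 - ex (-z))⁻¹ = -ex z / (1 - ex z) := by
  have h3 : 1 - ex z ≠ 0 := sub_ne_zero.2 hz1.symm
  have h4 : ex z - 1 ≠ 0 := sub_ne_zero.2 hz1
  have h5 := ex_ne_zero z
  rw [ex_neg]
  field_simp
  rw [← neg_sub (ex z) 1]

theorem IsCauchyKernel.of_eq_div {t : ℝ} (ht : 0 < t) {κ N : ℂ → ℂ} (hN : PerHol (-t) t N)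
    (hN0 : N 0 = -(2 * Real.pi * I))
    (h : ∀ z ∈ strip (-t) t, ex z ≠ 1 → κ z = N z / (1 - ex z)) : IsCauchyKernel t κ := by
  have h1 : PerHol (-t) t (fun z => N z + 2 * Real.pi * I * ex z) :=
    hN.add (perHol_ex.const_mul _)
  obtain ⟨l, hl, hl'⟩ := h1.exists_div (p := 0) (by simp [mem_strip, ht]) (by
    rw [hN0, ex_zero]; ring)
  refine ⟨l, hl, fun z hz hz1 => ?_⟩
  have h2 := hl' z hz
  rw [sub_zero] at h2
  have h3 : 1 - ex z ≠ 0 := sub_ne_zero.2 hz1.symm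
  rw [h z hz hz1, inv_one_sub_ex_neg hz1, div_eq_iff h3, add_mul, mul_assoc, div_mul_cancel₀ _ h3]
  linear_combination h2

/-- The Cauchy kernel that changes sign under translation by `τ`. -/
def antiKernel (τ z : ℂ) : ℂ :=
  theta1Deriv0 τ * theta1 (z + 1 / 2) τ / (theta1 (1 / 2) τ * theta1 z τ)

theorem theta1_half_ne_zero {t : ℝ} (ht : 0 < t) : theta1 (1 / 2) (t * I) ≠ 0 := by
  intro h
  have := theta1_half_pos ht
  push_cast at this
  rw [h] at this
  simp at this

theorem theta1Deriv0_eq_of_factor {τ : ℂ} {U : ℂ → ℂ} (hU : Differentiable ℂ U)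
    (hUeq : ∀ z, theta1 z τ = exp (-(Real.pi * I * z)) * ((1 - ex z) * U z)) :
    theta1Deriv0 τ = -(2 * Real.pi * I) * U 0 := by
  have h1 : HasDerivAt (fun z : ℂ => exp (-(Real.pi * I * z))) (-(Real.pi * I)) 0 := by
    have := ((hasDerivAt_id (0 : ℂ)).const_mul (Real.pi * I : ℂ)).neg.cexp
    simpa using this
  have h2 := h1.mul (((hasDerivAt_ex 0).const_sub 1).mul (hU 0).hasDerivAt)
  have h3 : (fun z => theta1 z τ) = (fun z : ℂ => exp (-(Real.pi * I * z))) *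
    ((fun z => 1 - ex z) * U) := funext hUeq
  rw [theta1Deriv0, h3, h2.deriv]
  simp [ex_zero]

theorem isCauchyKernel_antiKernel {t : ℝ} (ht : 0 < t) : IsCauchyKernel t (antiKernel (t * I)) := by
  obtain ⟨U, hU, hUper, hU0, hUeq⟩ := exists_theta1_factor ht
  have hU00 : U 0 ≠ 0 := hU0 0 (by simpa using ht)
  have hd := theta1Deriv0_eq_of_factor hU hUeq
  refine IsCauchyKernel.of_eq_div ht (N := fun z => theta1Deriv0 (t * I) / theta1 (1 / 2) (t * I) *
    (exp (Real.pi * I * z) * theta1 (z + 1 / 2) (t * I) / U z)) ?_ ?_ ?_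
  · refine (PerHol.div (.of_entire ?_ fun z => ?_) (.of_entire hU hUper)
      fun z hz => hU0 z (abs_lt.2 hz)).const_mul _
    · have h1 : Differentiable ℂ fun z => theta1 (z + 1 / 2) (t * I) :=
        (differentiable_theta1 (by rwa [tau_im])).comp (differentiable_id.add_const (1 / 2))
      exact Differentiable.mul (by fun_prop) h1
    · rw [show z + 1 + 1 / 2 = z + 1 / 2 + 1 by ring, theta1_add_one,
        show Real.pi * I * (z + 1) = Real.pi * I * z + Real.pi * I by ring, exp_add, exp_pi_mul_I]
      ring
  · have := theta1_half_ne_zero ht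
    simp only [mul_zero, exp_zero, zero_add, one_mul]
    rw [hd]
    generalize theta1 (1 / 2) (t * I) = y at *
    field_simp
  · intro z hz hz1
    have h1 := theta1_half_ne_zero ht
    have h2 := hU0 z (abs_lt.2 hz)
    have h3 : 1 - ex z ≠ 0 := sub_ne_zero.2 hz1.symm
    rw [antiKernel, hUeq z, exp_neg]
    have h4 := exp_ne_zero (Real.pi * I * z)
    field_simp

theorem antiKernel_add_tau (τ z : ℂ) : antiKernel τ (z + τ) = -antiKernel τ z := by
  unfold antiKernel
  have h1 : theta1 (z + τ + 1 / 2) τ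
      = exp (-(Real.pi * I * τ) - 2 * Real.pi * I * z) * theta1 (z + 1 / 2) τ := by
    have := theta1_half_shift (z + 1) τ
    rw [show z + 1 + τ - 1 / 2 = z + τ + 1 / 2 by ring, show z + 1 - 1 / 2 = z + 1 / 2 by ring,
      show -(Real.pi * I * τ) - 2 * Real.pi * I * (z + 1)
        = -(Real.pi * I * τ) - 2 * Real.pi * I * z - 2 * Real.pi * I by ring, exp_sub,
      exp_two_pi_mul_I, div_one] at this
    exact this
  rw [h1, theta1_add_tau]
  have h2 := exp_ne_zero (-(Real.pi * I * τ) - 2 * Real.pi * I * z)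
  rw [show theta1 (1 / 2) τ * (-exp (-(Real.pi * I * τ) - 2 * Real.pi * I * z) * theta1 z τ)
    = -exp (-(Real.pi * I * τ) - 2 * Real.pi * I * z) * (theta1 (1 / 2) τ * theta1 z τ) by ring,
    show theta1Deriv0 τ * (exp (-(Real.pi * I * τ) - 2 * Real.pi * I * z) * theta1 (z + 1 / 2) τ)
    = -exp (-(Real.pi * I * τ) - 2 * Real.pi * I * z) * (-(theta1Deriv0 τ * theta1 (z + 1 / 2) τ))
    by ring, mul_div_mul_left _ _ (neg_ne_zero.2 h2), neg_div]

theorem antiKernel_conj {t : ℝ} (ht : 0 < t) (z : ℂ) : (starRingEnd ℂ) (antiKernel (t * I) z)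
    = antiKernel (t * I) ((starRingEnd ℂ) z) := by
  have h1 : (starRingEnd ℂ) (theta1Deriv0 (t * I)) = theta1Deriv0 (t * I) :=
    conj_eq_iff_im.2 (theta1Deriv0_pos ht).1
  have h2 : (starRingEnd ℂ) (1 / 2 : ℂ) = 1 / 2 := by
    rw [map_div₀, map_one, map_ofNat]
  simp only [antiKernel, map_div₀, map_mul, theta1_conj, h1, map_add, h2]

/-- The logarithmic derivative of `θ₁`: the Cauchy kernel with an additive period. -/
def zetaKernel (τ z : ℂ) : ℂ := logDeriv (fun z => theta1 z τ) z

theorem isCauchyKernel_zetaKernel {t : ℝ} (ht : 0 < t) : IsCauchyKernel t (zetaKernel (t * I)) := by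
  obtain ⟨U, hU, hUper, hU0, hUeq⟩ := exists_theta1_factor ht
  have hUp : PerHol (-t) t U := .of_entire hU hUper
  refine ⟨fun z => deriv U z / U z - Real.pi * I,
    (hUp.deriv.div hUp fun z hz => hU0 z (abs_lt.2 hz)).sub (.const _), fun z hz hz1 => ?_⟩
  have h1 : HasDerivAt (fun z : ℂ => exp (-(Real.pi * I * z)))
      (exp (-(Real.pi * I * z)) * (-(Real.pi * I))) z := by
    have := ((hasDerivAt_id z).const_mul (Real.pi * I : ℂ)).neg.cexp
    simpa using this
  have h2 := h1.mul (((hasDerivAt_ex z).const_sub 1).mul (hU z).hasDerivAt)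
  have h3 : (fun z => theta1 z (t * I)) = (fun z : ℂ => exp (-(Real.pi * I * z))) *
    ((fun z => 1 - ex z) * U) := funext hUeq
  have h4 := hU0 z (abs_lt.2 hz)
  have h5 : 1 - ex z ≠ 0 := sub_ne_zero.2 hz1.symm
  have h6 := exp_ne_zero (-(Real.pi * I * z))
  rw [zetaKernel, logDeriv_apply, h3, h2.deriv, inv_one_sub_ex_neg hz1]
  simp only [Pi.mul_apply, hUeq z]
  field_simp
  ring

theorem zetaKernel_sub_tau {t : ℝ} (ht : 0 < t) {z : ℂ} (hz : theta1 z (t * I) ≠ 0) :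
    zetaKernel (t * I) (z - t * I) = zetaKernel (t * I) z + 2 * Real.pi * I := by
  set τ : ℂ := t * I with hτ
  have hd := differentiable_theta1 (τ := τ) (by rwa [hτ, tau_im])
  have h0 : theta1 (z - τ) τ ≠ 0 := by
    have := theta1_sub_tau_eq_zero (τ := τ) (z := z) 1
    rw [Int.cast_one, one_mul] at this
    exact fun h => hz (this.1 h)
  have h1 : logDeriv (fun y => theta1 (y + τ) τ) (z - τ) = zetaKernel τ z := by
    rw [logDeriv_apply, zetaKernel, logDeriv_apply]
    have := deriv_comp_add_const (fun y => theta1 y τ) τ (z - τ)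
    rw [this, sub_add_cancel]
  have h2 : HasDerivAt (fun y : ℂ => -exp (-(Real.pi * I * τ) - 2 * Real.pi * I * y))
      (-(exp (-(Real.pi * I * τ) - 2 * Real.pi * I * (z - τ)) * (-(2 * Real.pi * I)))) (z - τ) := by
    have := ((((hasDerivAt_id (z - τ)).const_mul (2 * Real.pi * I : ℂ)).const_sub
      (-(Real.pi * I * τ))).cexp).fun_neg
    simpa using this
  have h3 : (fun y => theta1 (y + τ) τ) = fun y =>
      -exp (-(Real.pi * I * τ) - 2 * Real.pi * I * y) * theta1 y τ :=
    funext fun y => theta1_add_tau y τ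
  rw [h3, logDeriv_mul (f := fun y => -exp (-(Real.pi * I * τ) - 2 * Real.pi * I * y))
    (g := fun y => theta1 y τ) _ (neg_ne_zero.2 (exp_ne_zero _)) h0 h2.differentiableAt (hd _),
    logDeriv_apply, h2.deriv] at h1
  have h4 := exp_ne_zero (-(Real.pi * I * τ) - 2 * Real.pi * I * (z - τ))
  rw [← h1, zetaKernel, neg_div_neg_eq, mul_div_cancel_left₀ _ h4]
  ring

/-- Since `H` is a constant multiple of a theta quotient, the Cauchy kernel times `H(q)` is `H(p)`
times a difference kernel. -/
theorem cauchyKernel_mul_hfun {τ p q c : ℂ} (hq : theta1 q τ ≠ 0) (hq' : theta1 (q - 1 / 2) τ ≠ 0)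
    (hc : hfun τ q = c * thetaQuot τ q) :
    cauchyKernel τ p q * hfun τ q = c * thetaQuot τ p * antiKernel τ (p - q) := by
  rw [hc]
  unfold cauchyKernel thetaQuot antiKernel
  generalize theta1 (q - 1 / 2) τ = y at *
  field_simp

theorem cauchyKernel_add_tau (τ p q : ℂ) : cauchyKernel τ (p + τ) q = cauchyKernel τ p q := by
  have h : ∀ p, cauchyKernel τ p q = (theta1 q τ / theta1 (q - 1 / 2) τ) *
      (thetaQuot τ p * antiKernel τ (p - q)) := fun p => by
    unfold cauchyKernel thetaQuot antiKernel
    simp only [div_eq_mul_inv, mul_inv]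
    ring
  rw [h, h, thetaQuot_add_tau, add_sub_right_comm, antiKernel_add_tau, neg_mul_neg]

theorem onGamma_fold {t : ℝ} (ht : 0 < t) {p : ℂ} (hp : ¬ OnGamma (t * I) p) :
    ¬ OnGamma (t * I) (fold t p) := not_onGamma_of_abs_lt ht (abs_fold_im_lt ht hp)

theorem szegoIntegral_fold {t : ℝ} (ht : 0 < t) (w : ℂ → ℂ) {p : ℂ} (hp : ¬ OnGamma (t * I) p) :
    szegoIntegral (t * I) w p = szegoIntegral (t * I) w (fold t p) := by
  have h1 : ∀ q, cauchyKernel (t * I) (fold t p) q = cauchyKernel (t * I) p q := fun q => by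
    have h : Function.Periodic (fun p => cauchyKernel (t * I) p q) (t * I) :=
      fun p => cauchyKernel_add_tau _ p q
    exact h.sub_int_mul_eq (round (p.im / t))
  have h2 : H (t * I) (fold t p) = H (t * I) p := by
    rw [H_eq ht hp, H_eq ht (onGamma_fold ht hp), fold_of_abs_lt ht (abs_fold_im_lt ht hp)]
  simp only [szegoIntegral, h1, h2]

theorem line_half (s t : ℝ) : (s : ℂ) + ((t / 2 : ℝ) : ℂ) * I = s + t * I / 2 := by
  push_cast; ring

/-- The Szegő integral is a Cauchy transform with the sign-changing difference kernel. The sign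
comes from `H = -h` on the period annulus. -/
theorem szegoIntegral_eq_ctr {t : ℝ} (ht : 0 < t) (w : ℂ → ℂ) {p : ℂ} (hp : |p.im| < t / 2)
    (h1 : ex p ≠ 1) (h2 : ex (p - 1 / 2) ≠ 1) :
    szegoIntegral (t * I) w p = -ctr (antiKernel (t * I)) w (t / 2) p := by
  obtain ⟨c, hc0, hc⟩ := exists_hfun_eq_thetaQuot ht
  have hpt : |p.im| < t := hp.trans (by linarith)
  have hne : ∀ z : ℂ, |z.im| < t → ex z ≠ 1 → theta1 z (t * I) ≠ 0 := fun z hz hz1 h =>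
    hz1 ((inLattice_of_im ht hz).1 ((theta1_eq_zero_iff ht).1 h))
  have hq0 : thetaQuot (t * I) p ≠ 0 :=
    div_ne_zero (hne _ (by simpa using hpt) h2) (hne _ hpt h1)
  have hint : (∫ s in (0 : ℝ)..1, cauchyKernel (t * I) p (s + t * I / 2) * w (s + t * I / 2) *
      hfun (t * I) (s + t * I / 2)) = c * thetaQuot (t * I) p *
        lineInt (fun q => antiKernel (t * I) (p - q) * w q) (t / 2) := by
    rw [← lineInt_const_mul]
    refine intervalIntegral.integral_congr fun s _ => ?_
    simp only
    rw [line_half]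
    set q : ℂ := s + t * I / 2 with hq
    have hqim : q.im = t / 2 := by
      rw [hq, ← line_half]; simp
    have hqim' : (q - 1 / 2).im = t / 2 := by rw [sub_im, hqim]; simp
    have hlt : ∀ z : ℂ, z.im = t / 2 → theta1 z (t * I) ≠ 0 := fun z hz =>
      hne z (by rw [hz, abs_of_pos] <;> linarith) (ex_ne_one_of_im_ne_zero (by rw [hz]; positivity))
    rw [mul_right_comm, cauchyKernel_mul_hfun (hlt q hqim) (hlt _ hqim')
      (hc q ⟨by linarith, by linarith⟩ (ex_ne_one_of_im_ne_zero (by rw [hqim]; positivity)))]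
    ring
  rw [szegoIntegral, hint, H_eq ht (not_onGamma_of_abs_lt ht hp), fold_of_abs_lt ht hp,
    hc p (abs_lt.1 hpt) h1, ctr]
  have h3 := two_pi_I_ne_zero
  field_simp

theorem eventually_ex_sub_ne_one (p a : ℂ) : ∀ᶠ z in 𝓝[≠] p, ex (z - a) ≠ 1 := by
  have h : HasDerivAt (fun z => ex (z - a)) (2 * Real.pi * I * ex (p - a)) p := by
    have := (hasDerivAt_ex (p - a)).comp p ((hasDerivAt_id p).sub_const a)
    simpa [Function.comp_def] using this
  exact h.eventually_ne (mul_ne_zero two_pi_I_ne_zero (ex_ne_zero _))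

theorem integral_zero_one_conj (g : ℝ → ℂ) : (starRingEnd ℂ) (∫ s in (0 : ℝ)..1, g s)
    = ∫ s in (0 : ℝ)..1, (starRingEnd ℂ) (g s) := by
  rw [intervalIntegral.integral_of_le zero_le_one, intervalIntegral.integral_of_le zero_le_one,
    integral_conj]

/-- The Szegő function on the closed annulus `|Im p| ≤ t/2` extends analytically to a neighbourhood
`σ`, which solves the scalar boundary value problem `σ(p) + σ(p - τ) = -w(p)` near `γ`. -/
theorem exists_szego {t δ : ℝ} (ht : 0 < t) (hδ : 0 < δ) (hδt : δ < t) {w : ℂ → ℂ}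
    (hw : PerHol (t / 2 - δ) (t / 2 + δ) w) (hwr : ∀ p : ℂ, p.im = t / 2 → (w p).im = 0) :
    ∃ σ, PerHol (-(t / 2) - δ / 2) (t / 2 + δ / 2) σ ∧
      (∀ p : ℂ, t / 2 - δ / 2 < p.im ∧ p.im < t / 2 + δ / 2 → σ p + σ (p - t * I) = -w p) ∧
      (∀ p : ℂ, ¬ OnGamma (t * I) p → szego (t * I) w p = σ (fold t p)) ∧
      ∀ p : ℂ, |p.im| ≤ t / 2 → σ ((starRingEnd ℂ) p) = (starRingEnd ℂ) (σ p) := by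
  have hκ := isCauchyKernel_antiKernel ht
  have hP := perHol_csol hδ hδt hκ hw
  have hin : ∀ q : ℂ, |q.im| < t / 2 → csol t δ (antiKernel (t * I)) w q
      = ctr (antiKernel (t * I)) w (t / 2) q := fun q hq => by
    rw [abs_lt] at hq
    exact csol_eq hδ hδt hκ hw ⟨by linarith, by linarith⟩ ⟨by linarith, by linarith⟩
      ⟨by linarith, by linarith⟩
  refine ⟨fun p => -csol t δ (antiKernel (t * I)) w p, hP.neg, fun p hp => ?_, fun p hp => ?_, ?_⟩
  -- The kernel changes sign under translation by `τ`, which turns the jump relation into a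
  -- relation for the sum of the boundary values.
  · have := csol_sub_tau hδ hδt hκ hw (e := -1) (b := 0) (fun z _ _ => by
      have := antiKernel_add_tau (t * I) (z - t * I)
      rw [sub_add_cancel] at this
      rw [this]; ring) hp
    beta_reduce
    rw [this]; ring
  · have hfp := abs_fold_im_lt ht hp
    refine Tendsto.limUnder_eq ?_
    set k : ℤ := round (p.im / t)
    have hfe := eventually_fold_eq ht hp
    have hfp' : fold t p = p - k * (t * I) := hfe.self_of_nhds
    have hcont : ContinuousAt (fun y : ℂ => -csol t δ (antiKernel (t * I)) w (y - k * (t * I))) p := by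
      refine ContinuousAt.comp (g := fun y => -csol t δ (antiKernel (t * I)) w y)
        (f := fun y : ℂ => y - k * (t * I)) (hP.neg.continuousAt ?_) (by fun_prop)
      rw [← hfp']
      rw [abs_lt] at hfp
      exact ⟨by linarith, by linarith⟩
    rw [hfp']
    refine (hcont.tendsto.mono_left nhdsWithin_le_nhds).congr' ?_
    have hopen : ∀ᶠ y : ℂ in 𝓝 p, |(y - k * (t * I)).im| < t / 2 := by
      have h : ContinuousAt (fun y : ℂ => |(y - k * (t * I)).im|) p := by fun_prop
      exact h.eventually_lt continuousAt_const (by simpa [← hfp'] using hfp)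
    filter_upwards [nhdsWithin_le_nhds hfe, nhdsWithin_le_nhds hopen,
      eventually_ex_sub_ne_one p (k * (t * I)), eventually_ex_sub_ne_one p (k * (t * I) + 1 / 2)]
      with y hy1 hy2 hy3 hy4
    have hyk : |y.im - k * t| < t / 2 := by simpa using hy2
    have hyg : ¬ OnGamma (t * I) y := by
      intro hg
      have h1 := not_onGamma_of_abs_lt ht hy2
      obtain ⟨j, hj⟩ := hg
      exact h1 ⟨j - k, by rw [sub_im, hj]; simp; ring⟩
    rw [szegoIntegral_fold ht w hyg, hy1, szegoIntegral_eq_ctr ht w hy2 hy3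
      (by rwa [sub_sub]), hin _ hy2]
  -- Reality in the open annulus; the boundary circles are then reached by continuity.
  · have hcj : ∀ p : ℂ, |p.im| < t / 2 → -csol t δ (antiKernel (t * I)) w ((starRingEnd ℂ) p)
        = (starRingEnd ℂ) (-csol t δ (antiKernel (t * I)) w p) := by
      intro p hp
      rw [hin p hp, hin _ (by simpa using hp)]
      have h1 : (starRingEnd ℂ) (lineInt (fun q => antiKernel (t * I) (p - q) * w q) (t / 2))
          = -lineInt (fun q => antiKernel (t * I) ((starRingEnd ℂ) p - q) * w q) (t / 2) := by
        rw [← neg_one_mul, ← lineInt_const_mul]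
        unfold lineInt
        rw [integral_zero_one_conj]
        refine intervalIntegral.integral_congr fun s _ => ?_
        simp only
        rw [line_half, map_mul, antiKernel_conj ht, conj_eq_iff_im.2 (hwr _ (by
          rw [← line_half]; simp))]
        have h2 : (starRingEnd ℂ) (p - (s + t * I / 2))
            = (starRingEnd ℂ) p - (s + t * I / 2) + t * I := by
          simp only [map_sub, map_add, map_mul, map_div₀, conj_ofReal, conj_I, map_ofNat]
          ring
        rw [h2, antiKernel_add_tau]
        ring
      simp only [ctr, map_neg, map_mul, h1, map_inv₀, conj_ofReal, conj_I, map_ofNat]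
      ring
    intro p hp
    have hlim : Tendsto (fun r : ℝ => (r : ℂ) * p.im * I + p.re) (𝓝[<] 1) (𝓝 p) := by
      have h : Tendsto (fun r : ℝ => (r : ℂ) * p.im * I + p.re) (𝓝 1)
          (𝓝 (((1 : ℝ) : ℂ) * p.im * I + p.re)) := by
        refine Continuous.tendsto ?_ 1
        fun_prop
      have h2 : ((1 : ℝ) : ℂ) * p.im * I + p.re = p := by
        rw [ofReal_one, one_mul, add_comm]; exact re_add_im p
      rw [h2] at h
      exact h.mono_left nhdsWithin_le_nhds
    have hmem : ∀ q : ℂ, |q.im| ≤ t / 2 → q ∈ strip (-(t / 2) - δ / 2) (t / 2 + δ / 2) := fun q hq => by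
      rw [abs_le] at hq
      exact ⟨by linarith, by linarith⟩
    have h1 := ((hP.neg.continuousAt (hmem _ (by simpa using hp))).tendsto).comp
      ((Complex.continuous_conj.tendsto p).comp hlim)
    have h2 := (Complex.continuous_conj.tendsto _).comp
      (((hP.neg.continuousAt (hmem p hp)).tendsto).comp hlim)
    refine tendsto_nhds_unique_of_eventuallyEq h1 h2 ?_
    filter_upwards [Ioo_mem_nhdsLT (show (0 : ℝ) < 1 by norm_num)] with r hr
    refine hcj _ ?_
    have h3 : ((r : ℂ) * p.im * I + p.re).im = r * p.im := by simp
    rw [h3, abs_mul, abs_of_pos hr.1]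
    nlinarith [hr.2, hr.1, abs_nonneg p.im]

/-! ### The model solution -/

theorem exp_pi_mul_nat_add_one (k : ℕ) (p : ℂ) :
    exp (Real.pi * I * k * (p + 1)) = (-1) ^ k * exp (Real.pi * I * k * p) := by
  rw [show Real.pi * I * k * (p + 1) = k * (Real.pi * I) + Real.pi * I * k * p by ring, exp_add,
    exp_nat_mul, exp_pi_mul_I]

theorem theta23_add_one (n : ℕ) (p τ : ℂ) :
    theta23 n (p + 1) τ = (-1) ^ (n + 1) * theta23 n p τ := by
  unfold theta23
  split_ifs with h
  · rw [theta2_eq, theta2_eq, add_right_comm, theta1_add_one, h.add_one.neg_one_pow]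
    ring
  · rw [theta3, theta3, jacobiTheta₂_add_left, (Nat.not_even_iff_odd.1 h).add_one.neg_one_pow,
      one_mul]

theorem theta23_add_tau (n : ℕ) (p τ : ℂ) :
    theta23 n (p + τ) τ = exp (-(Real.pi * I * τ) - 2 * Real.pi * I * p) * theta23 n p τ := by
  unfold theta23
  split_ifs with h
  · rw [theta2_eq, theta2_eq, add_right_comm, theta1_add_tau,
      show -(Real.pi * I * τ) - 2 * Real.pi * I * (p + 1 / 2)
        = -(Real.pi * I * τ) - 2 * Real.pi * I * p - Real.pi * I by ring, exp_sub _ (Real.pi * I),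
      exp_pi_mul_I]
    ring
  · rw [theta3, theta3, jacobiTheta₂_add_left']
    congr 2
    ring

theorem theta23_conj {t : ℝ} (n : ℕ) (p : ℂ) :
    (starRingEnd ℂ) (theta23 n p (t * I)) = theta23 n ((starRingEnd ℂ) p) (t * I) := by
  unfold theta23
  split_ifs with h
  · rw [theta2_eq, theta2_eq, theta1_conj]
    congr 1
    rw [map_add, map_div₀, map_one, map_ofNat]
  · rw [theta3, theta3, jacobiTheta₂_conj]
    congr 1
    simp

theorem theta23_zero_ne_zero {t : ℝ} (ht : 0 < t) (n : ℕ) : theta23 n 0 (t * I) ≠ 0 := by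
  unfold theta23
  split_ifs with h
  · rw [theta2_eq, zero_add]; exact theta1_half_ne_zero ht
  · intro h0
    have := jacobiTheta₂_zero_pos ht
    rw [theta3] at h0
    rw [h0] at this
    simp at this

theorem differentiable_theta23 {τ : ℂ} (hτ : 0 < τ.im) (n : ℕ) :
    Differentiable ℂ fun p => theta23 n p τ := by
  unfold theta23
  split_ifs with h
  · simp only [theta2_eq]
    exact (differentiable_theta1 hτ).comp (differentiable_id.add_const _)
  · exact fun p => differentiableAt_jacobiTheta₂_fst p hτ

theorem theta23_congr {n m : ℕ} (h : Even n ↔ Even m) : theta23 n = theta23 m := by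
  funext p τ
  simp only [theta23, h]

theorem modelF_congr {n m : ℕ} (h : Even n ↔ Even m) (τ : ℂ) (D : ℝ) :
    modelF τ D n = modelF τ D m := by
  funext p
  simp only [modelF, theta23_congr h]

theorem modelF_add_one (τ : ℂ) (D : ℝ) (n : ℕ) (p : ℂ) :
    modelF τ D n (p + 1) = (-1) ^ (n + 1) * modelF τ D n p := by
  have h1 : exp (-(Real.pi * I * (p + 1))) = -exp (-(Real.pi * I * p)) := by
    rw [show -(Real.pi * I * (p + 1)) = -(Real.pi * I * p) - Real.pi * I by ring, exp_sub,
      exp_pi_mul_I, div_neg, div_one]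
  unfold modelF
  rw [show p + 1 - D - τ = p - D - τ + 1 by ring, show p + 1 - (D : ℂ) = p - D + 1 by ring,
    theta1_add_one, theta1_add_one, theta1_add_one, theta23_add_one, h1]
  simp only [div_eq_mul_inv, mul_inv, inv_neg]
  ring

theorem modelF_add_two_tau (τ : ℂ) (D : ℝ) (n : ℕ) (p : ℂ) :
    modelF τ D n (p + 2 * τ) = -modelF τ D n p := by
  unfold modelF
  rw [show p + 2 * τ - D - τ = p - D - τ + 2 * τ by ring,
    show p + 2 * τ - (D : ℂ) = p - D + 2 * τ by ring, theta1_add_tau, theta1_add_tau,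
    theta1_add_tau, theta23_add_tau,
    show -(Real.pi * I * (2 * τ)) - 2 * Real.pi * I * (p - D - τ)
      = (-(Real.pi * I * (2 * τ)) - 2 * Real.pi * I * (p - D)) + Real.pi * I * (2 * τ) by ring,
    show -(Real.pi * I * (p + 2 * τ)) = -(Real.pi * I * p) - Real.pi * I * (2 * τ) by ring,
    exp_add _ (Real.pi * I * (2 * τ)), exp_sub _ (Real.pi * I * (2 * τ))]
  have h1 := exp_ne_zero (-(Real.pi * I * (2 * τ)) - 2 * Real.pi * I * (p - D))
  have h2 := exp_ne_zero (-(Real.pi * I * (2 * τ)) - 2 * Real.pi * I * p)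
  have h3 := exp_ne_zero (Real.pi * I * (2 * τ))
  generalize exp (-(Real.pi * I * (2 * τ)) - 2 * Real.pi * I * (p - D)) = a at *
  generalize exp (-(Real.pi * I * (2 * τ)) - 2 * Real.pi * I * p) = b at *
  generalize exp (Real.pi * I * (2 * τ)) = c at *
  simp only [div_eq_mul_inv, mul_inv, inv_neg]
  field_simp

theorem modelF_conj {t : ℝ} (ht : 0 < t) (D : ℝ) (n : ℕ) (p : ℂ) :
    (starRingEnd ℂ) (modelF (t * I) D n p) = modelF (t * I) D n ((starRingEnd ℂ) p) := by
  set q := (starRingEnd ℂ) p with hq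
  have hτ : (starRingEnd ℂ) (t * I : ℂ) = -(t * I) := by simp
  have hθ : ∀ z, (starRingEnd ℂ) (theta1 z (2 * (t * I))) = theta1 ((starRingEnd ℂ) z) (2 * (t * I)) :=
    two_mul_tau_conj t
  have h23 : ∀ z, (starRingEnd ℂ) (theta23 n z (2 * (t * I)))
      = theta23 n ((starRingEnd ℂ) z) (2 * (t * I)) := fun z => by
    rw [two_mul_tau]; exact theta23_conj n z
  have hd : (starRingEnd ℂ) (theta1Deriv0 (2 * (t * I))) = theta1Deriv0 (2 * (t * I)) := by
    rw [two_mul_tau]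
    exact conj_eq_iff_im.2 (theta1Deriv0_pos (by linarith)).1
  unfold modelF
  simp only [map_div₀, map_mul, hθ, h23, hd, map_sub, map_add, map_zero, conj_ofReal, hτ, ← hq]
  rw [sub_neg_eq_add, theta1_add_tau_two, ← sub_eq_add_neg]
  have h2 := theta1_add_tau_two D (t * I)
  have h3 : theta1 (D - t * I) (2 * (t * I)) = -exp (2 * Real.pi * I * D) *
      theta1 (D + t * I) (2 * (t * I)) := by
    rw [h2, exp_neg]
    field_simp
  have h4 : (starRingEnd ℂ) (exp (-(Real.pi * I * p))) = exp (Real.pi * I * q) := by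
    rw [← exp_conj]; simp [hq]
  rw [h3, h4, show -(2 * Real.pi * I * (q - D)) = -(Real.pi * I * q) - Real.pi * I * q +
    2 * Real.pi * I * D by ring, exp_add, exp_sub]
  have h5 := exp_ne_zero (Real.pi * I * q)
  have h6 := exp_ne_zero (2 * Real.pi * I * D)
  generalize exp (Real.pi * I * q) = a at *
  generalize exp (2 * Real.pi * I * D) = b at *
  simp only [div_eq_mul_inv, mul_inv, inv_neg]
  field_simp

theorem M11_eq {t : ℝ} (ht : 0 < t) (D : ℝ) (n : ℕ) {p : ℂ} (hp : ¬ OnGamma (t * I) p) :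
    M11 (t * I) D n p = modelF (t * I) D n (fold t p) := by
  refine ite_reduce_eq ht hp (f := modelF (t * I) D n)
    (g := fun q => -modelF (t * I) D n (q + t * I)) fun q => ?_
  rw [add_assoc, ← two_mul, modelF_add_two_tau, neg_neg]

/-- `1` for even `n` and `0` for odd `n`: the exponent of the factor `e^{πip}` that makes
`modelF τ D n` periodic. -/
def parity (n : ℕ) : ℕ := if Even n then 1 else 0

theorem neg_one_pow_parity (n : ℕ) : (-1 : ℂ) ^ parity n = (-1) ^ (n + 1) := by
  unfold parity
  split_ifs with h
  · rw [h.add_one.neg_one_pow, pow_one]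
  · rw [(Nat.not_even_iff_odd.1 h).add_one.neg_one_pow, pow_zero]

theorem parity_congr {n m : ℕ} (h : Even n ↔ Even m) : parity n = parity m := by
  simp only [parity, h]

theorem sq_neg_one_pow (k : ℕ) : ((-1 : ℂ) ^ k) * (-1) ^ k = 1 := by
  rw [← mul_pow]; simp

/-- The model function has at most simple poles, at `0` and `D`. The factor `A n` depends on `n`
only through its parity, which makes all later bounds uniform in `n`. -/
theorem exists_modelF_factor {t : ℝ} (ht : 0 < t) (D : ℝ) :
    ∃ A : ℕ → ℂ → ℂ, (∀ n, PerHol (-(2 * t)) (2 * t) (A n)) ∧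
      (∀ n m, (Even n ↔ Even m) → A n = A m) ∧
      (∀ n, A n 0 = -(2 * Real.pi * I) * (1 - ex (-D))) ∧
      (∀ n p, p ∈ strip (-(2 * t)) (2 * t) → modelF (t * I) D n p
        = exp (-(Real.pi * I * parity n * p)) * A n p / ((1 - ex p) * (1 - ex (p - D)))) := by
  have ht2 : 0 < 2 * t := by linarith
  have htim : 0 < (2 * (t * I) : ℂ).im := by rw [two_mul_tau, tau_im]; exact ht2
  obtain ⟨U, hU, hUper, hU0, hUeq⟩ := exists_theta1_factor ht2
  rw [← two_mul_tau] at hUeq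
  have hd := theta1Deriv0_eq_of_factor hU hUeq
  have h23 : ∀ n, theta23 n 0 (2 * (t * I)) ≠ 0 := fun n => by
    rw [two_mul_tau]; exact theta23_zero_ne_zero ht2 n
  have hDτ : theta1 (D + t * I) (2 * (t * I)) ≠ 0 :=
    theta1_two_ne_zero ht (by simpa using ht.ne') (by simp [abs_of_pos ht]; linarith)
  have hUD : ∀ z ∈ strip (-(2 * t)) (2 * t), U (z - D) ≠ 0 := fun z hz => by
    refine hU0 _ ?_
    rw [sub_im, ofReal_im, sub_zero]; exact abs_lt.2 hz
  refine ⟨fun n p => theta1 D (2 * (t * I)) * theta1Deriv0 (2 * (t * I)) /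
    (theta1 (D + t * I) (2 * (t * I)) * theta23 n 0 (2 * (t * I))) * exp (-(Real.pi * I * D)) *
    (exp (Real.pi * I * parity n * p) * exp (Real.pi * I * p) *
      theta1 (p - D - t * I) (2 * (t * I)) * theta23 n p (2 * (t * I)) / (U p * U (p - D))),
    fun n => ?_, fun n m h => ?_, fun n => ?_, fun n p hp => ?_⟩
  · refine (PerHol.div (.of_entire ?_ fun z => ?_) (.mul (.of_entire hU hUper)
      (.of_entire (hU.comp (differentiable_id.sub_const (D : ℂ))) fun z => ?_))
      fun z hz => mul_ne_zero (hU0 z (abs_lt.2 hz)) (hUD z hz)).const_mul _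
    · have h1 : Differentiable ℂ fun z => theta1 (z - D - t * I) (2 * (t * I)) :=
        (differentiable_theta1 htim).comp ((differentiable_id.sub_const (D : ℂ)).sub_const (t * I))
      exact (Differentiable.mul (by fun_prop) h1).mul (differentiable_theta23 htim n)
    · have h1 := exp_pi_mul_nat_add_one 1 z
      simp only [Nat.cast_one, mul_one, pow_one] at h1
      rw [exp_pi_mul_nat_add_one, h1, show z + 1 - D - t * I = z - D - t * I + 1 by ring,
        theta1_add_one, theta23_add_one, neg_one_pow_parity]
      linear_combination (exp (Real.pi * I * parity n * z) * exp (Real.pi * I * z) *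
        theta1 (z - D - t * I) (2 * (t * I)) * theta23 n z (2 * (t * I))) * sq_neg_one_pow (n + 1)
    · simp only [Function.comp, id]
      rw [show z + 1 - (D : ℂ) = z - D + 1 by ring, hUper]
  · simp only [theta23_congr h, parity_congr h]
  · have h1 := hUeq (-D)
    have h2 := hU0 0 (by simpa using ht)
    have h3 := hUD 0 (by simp [mem_strip, ht])
    have h4 := h23 n
    rw [zero_sub] at h3
    have h5 : exp (-(Real.pi * I * -D)) * exp (-(Real.pi * I * D)) = 1 := by
      rw [← exp_add, ← exp_zero]; congr 1; ring
    rw [theta1_neg, neg_eq_iff_eq_neg] at h1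
    simp only [mul_zero, exp_zero, one_mul, zero_sub]
    rw [show -(D : ℂ) - t * I = -(D + t * I) by ring, theta1_neg, h1, hd]
    generalize theta1 (D + t * I) (2 * (t * I)) = v at *
    generalize theta23 n 0 (2 * (t * I)) = y at *
    generalize exp (-(Real.pi * I * -D)) = a at *
    generalize exp (-(Real.pi * I * D)) = b at *
    rw [← mul_one (-(2 * Real.pi * I) * (1 - ex (-D))), ← h5]
    field_simp
  · have h1 := hU0 p (abs_lt.2 hp)
    have h2 := hUD p hp
    rw [modelF, hUeq p, hUeq (p - D),
      show -(Real.pi * I * (p - D)) = -(Real.pi * I * p) + Real.pi * I * D by ring, exp_add]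
    simp only [exp_neg]
    have h3 := exp_ne_zero (Real.pi * I * p)
    have h4 := exp_ne_zero (Real.pi * I * D)
    have h5 := exp_ne_zero (Real.pi * I * parity n * p)
    have h6 := h23 n
    generalize exp (Real.pi * I * p) = a at *
    generalize exp (Real.pi * I * D) = b at *
    generalize exp (Real.pi * I * parity n * p) = c at *
    generalize U (p - D) = u at *
    generalize ex (p - D) = e at *
    generalize theta1 (p - D - t * I) (2 * (t * I)) = y at *
    generalize theta1 (D + t * I) (2 * (t * I)) = v at *
    simp only [div_eq_mul_inv, mul_inv, inv_inv]
    field_simp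

/-- On the second sheet the model function has no poles and vanishes at `D`. -/
theorem exists_modelF_add_tau_factor {t : ℝ} (ht : 0 < t) (D : ℝ) (n : ℕ) :
    ∃ B : ℂ → ℂ, PerHol (-t) t B ∧ ∀ p ∈ strip (-t) t,
      modelF (t * I) D n (p + t * I) = exp (-(Real.pi * I * parity n * p)) *
        ((1 - ex (p - D)) * B p) := by
  have ht2 : 0 < 2 * t := by linarith
  have htim : 0 < (2 * (t * I) : ℂ).im := by rw [two_mul_tau, tau_im]; exact ht2
  obtain ⟨U, hU, hUper, hU0, hUeq⟩ := exists_theta1_factor ht2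
  rw [← two_mul_tau] at hUeq
  have hne : ∀ z ∈ strip (-t) t, ∀ a : ℝ, theta1 (z + t * I - a) (2 * (t * I)) ≠ 0 := by
    intro z hz a
    have h1 := hz.1
    have h2 := hz.2
    have h3 : (z + t * I - a).im = z.im + t := by simp
    refine theta1_two_ne_zero ht ?_ ?_ <;> rw [h3, abs_of_pos (by linarith)] <;> linarith
  have hcomp : ∀ a : ℂ, Differentiable ℂ fun z => theta1 (z + t * I - a) (2 * (t * I)) := fun a =>
    (differentiable_theta1 htim).comp ((differentiable_id.add_const (t * I : ℂ)).sub_const a)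
  have h1 : ∀ z, exp (Real.pi * I * (z + 1)) = -exp (Real.pi * I * z) := fun z => by
    rw [show Real.pi * I * (z + 1) = Real.pi * I * z + Real.pi * I by ring, exp_add, exp_pi_mul_I]
    ring
  refine ⟨fun p => theta1 D (2 * (t * I)) * theta1Deriv0 (2 * (t * I)) /
    (theta1 (D + t * I) (2 * (t * I)) * theta23 n 0 (2 * (t * I))) *
    (exp (Real.pi * I * parity n * p) * exp (-(Real.pi * I * (p + t * I))) *
      exp (-(Real.pi * I * (p - D))) * U (p - D) * theta23 n (p + t * I) (2 * (t * I)) /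
      (theta1 (p + t * I - D) (2 * (t * I)) * theta1 (p + t * I - (0 : ℝ)) (2 * (t * I)))),
    ⟨?_, fun z hz => ?_⟩, fun p hp => ?_⟩
  · refine DifferentiableOn.const_mul (DifferentiableOn.div (Differentiable.differentiableOn ?_)
      ((hcomp _).mul (hcomp _)).differentiableOn
      fun z hz => mul_ne_zero (hne z hz D) (hne z hz 0)) _
    have h2 : Differentiable ℂ fun z => theta23 n (z + t * I) (2 * (t * I)) :=
      (differentiable_theta23 htim n).comp (differentiable_id.add_const (t * I : ℂ))
    have h3 : Differentiable ℂ fun z => U (z - D) := hU.comp (differentiable_id.sub_const (D : ℂ))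
    exact Differentiable.mul (Differentiable.mul (by fun_prop) h3) h2
  · rw [exp_pi_mul_nat_add_one, neg_one_pow_parity,
      show -(Real.pi * I * (z + 1 + t * I)) = -(Real.pi * I * (z + t * I)) - Real.pi * I by ring,
      show -(Real.pi * I * (z + 1 - D)) = -(Real.pi * I * (z - D)) - Real.pi * I by ring,
      exp_sub _ (Real.pi * I), exp_sub _ (Real.pi * I), exp_pi_mul_I,
      show z + 1 - (D : ℂ) = z - D + 1 by ring, hUper,
      show z + 1 + t * I - D = z + t * I - D + 1 by ring,
      show z + 1 + t * I - (0 : ℝ) = z + t * I - (0 : ℝ) + 1 by ring,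
      show z + 1 + t * I = z + t * I + 1 by ring, theta1_add_one, theta1_add_one, theta23_add_one,
      neg_mul_neg]
    congr 2
    linear_combination (exp (Real.pi * I * parity n * z) * exp (-(Real.pi * I * (z + t * I))) *
      exp (-(Real.pi * I * (z - D))) * U (z - D) * theta23 n (z + t * I) (2 * (t * I))) *
      sq_neg_one_pow (n + 1)
  · have h6 := exp_ne_zero (Real.pi * I * parity n * p)
    rw [modelF, show p + t * I - D - t * I = p - D by ring, hUeq (p - D), exp_neg (Real.pi * I *
      parity n * p), ofReal_zero]
    beta_reduce
    rw [sub_zero]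
    generalize exp (Real.pi * I * parity n * p) = c at *
    simp only [div_eq_mul_inv, mul_inv]
    field_simp

/-! ### Sections on the period annulus -/

/-- `f` is a section of `𝒪 (n ∞ + D)` with numerator `g`: on the `ε`-neighbourhood of the period
annulus `|Im p| ≤ t/2` it is the quotient of the periodic holomorphic function `g` by
`(1 - e^{2πip})ⁿ (1 - e^{2πi(p - D)})`, and its values near the two boundary circles match. -/
structure SecNum (t D ε : ℝ) (n : ℕ) (f g : ℂ → ℂ) : Prop where
  num : PerHol (-(t / 2) - ε) (t / 2 + ε) g
  eq_div : ∀ p ∈ strip (-(t / 2) - ε) (t / 2 + ε), ex p ≠ 1 → ex (p - D) ≠ 1 →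
    f p = g p / ((1 - ex p) ^ n * (1 - ex (p - D)))
  glue : ∀ p : ℂ, t / 2 - ε < p.im → p.im < t / 2 + ε → f (p - t * I) = f p

theorem ex_sub_ofReal_ne_one {p : ℂ} (D : ℝ) (h : p.im ≠ 0) : ex (p - D) ≠ 1 :=
  ex_ne_one_of_im_ne_zero (by simpa using h)

namespace SecNum

variable {t D ε : ℝ} {n : ℕ} {f g f' g' : ℂ → ℂ}

theorem sub (h : SecNum t D ε n f g) (h' : SecNum t D ε n f' g') :
    SecNum t D ε n (fun p => f p - f' p) (fun p => g p - g' p) where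
  num := h.num.sub h'.num
  eq_div p hp h1 h2 := by rw [h.eq_div p hp h1 h2, h'.eq_div p hp h1 h2, sub_div]
  glue p h1 h2 := by rw [h.glue p h1 h2, h'.glue p h1 h2]

theorem const_mul (h : SecNum t D ε n f g) (c : ℂ) :
    SecNum t D ε n (fun p => c * f p) (fun p => c * g p) where
  num := h.num.const_mul c
  eq_div p hp h1 h2 := by rw [h.eq_div p hp h1 h2, mul_div_assoc]
  glue p h1 h2 := by rw [h.glue p h1 h2]

/-- The order of a section drops by one if its numerator vanishes at the origin. -/
theorem lower (ht : 0 < t) (hε : 0 < ε) (h : SecNum t D ε (n + 1) f g) (h0 : g 0 = 0) :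
    ∃ g', SecNum t D ε n f g' := by
  obtain ⟨g', hg', hgg⟩ := h.num.exists_div (p := 0)
    ⟨by simp; linarith, by simp; linarith⟩ h0
  refine ⟨g', hg', fun p hp h1 h2 => ?_, h.glue⟩
  have h3 : 1 - ex p ≠ 0 := sub_ne_zero.2 h1.symm
  rw [h.eq_div p hp h1 h2, hgg p hp, sub_zero, pow_succ', mul_assoc, mul_div_mul_left _ _ h3]

/-- The only sections of order `0` are the constants, since a single simple pole, at `D`, is
impossible. -/
theorem eq_const (ht : 0 < t) (hε : 0 < ε) (hεt : ε < t / 2) (h : SecNum t D ε 0 f g) :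
    ∃ c, ∀ p ∈ strip (-(t / 2) - ε) (t / 2 + ε), ex p ≠ 1 → ex (p - D) ≠ 1 → f p = c := by
  obtain ⟨c, hc⟩ := const_of_simple_pole ht hε (x := D) h.num fun p h1 h2 h3 h4 => by
    have e1 : (p - t * I).im = p.im - t := by rw [sub_im, tau_im]
    have h5 : (p - t * I).im ≠ 0 := by rw [e1]; exact sub_ne_zero.2 h4
    have h6 := h.eq_div p ⟨by linarith, h2⟩ (ex_ne_one_of_im_ne_zero h3) (ex_sub_ofReal_ne_one D h3)
    have h7 := h.eq_div (p - t * I) ⟨by rw [e1]; linarith, by rw [e1]; linarith⟩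
      (ex_ne_one_of_im_ne_zero h5) (ex_sub_ofReal_ne_one D h5)
    rw [pow_zero, one_mul] at h6 h7
    rw [← h6, ← h7, h.glue p h1 h2]
  refine ⟨c, fun p hp h1 h2 => ?_⟩
  rw [h.eq_div p hp h1 h2, hc p hp, pow_zero, one_mul,
    mul_div_cancel_right₀ _ (sub_ne_zero.2 h2.symm)]

theorem perHol (h : SecNum t D ε n f g) {a b : ℝ} (ha : -(t / 2) - ε ≤ a) (hb : b ≤ t / 2 + ε)
    (h0 : ∀ y, a < y → y < b → y ≠ 0) : PerHol a b f := by
  have hne : ∀ z ∈ strip a b, z.im ≠ 0 := fun z hz => h0 _ hz.1 hz.2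
  have h1 := perHol_one_sub_ex (a := a) (b := b) 0
  simp only [sub_zero] at h1
  refine ((h.num.mono ha hb).div ((h1.pow n).mul (perHol_one_sub_ex (D : ℂ)))
    fun z hz => mul_ne_zero (pow_ne_zero _ (sub_ne_zero.2 (ex_ne_one_of_im_ne_zero (hne z hz)).symm))
      (sub_ne_zero.2 (ex_sub_ofReal_ne_one D (hne z hz)).symm)).congr fun z hz => ?_
  exact h.eq_div z ⟨ha.trans_lt hz.1, hz.2.trans_le hb⟩ (ex_ne_one_of_im_ne_zero (hne z hz))
    (ex_sub_ofReal_ne_one D (hne z hz))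

theorem continuous_gamma (ht : 0 < t) (hε : 0 < ε) (h : SecNum t D ε n f g) :
    Continuous fun s : ℝ => f (s + (t / 2 : ℝ) * I) :=
  (h.perHol (a := 0) (b := t / 2 + ε) (by linarith) le_rfl fun _ h1 _ => h1.ne').continuous_line
    (by linarith) (by linarith)

/-- The conjugate section `p ↦ conj (f (conj p))`; the point `D` is real, so the poles stay in
place. -/
theorem conj (h : SecNum t D ε n f g) :
    ∃ g', SecNum t D ε n (fun p => (starRingEnd ℂ) (f ((starRingEnd ℂ) p))) g' := by
  have hs : ∀ p, p ∈ strip (-(t / 2) - ε) (t / 2 + ε) →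
      (starRingEnd ℂ) p ∈ strip (-(t / 2) - ε) (t / 2 + ε) := fun p hp => by
    have h1 := hp.1
    have h2 := hp.2
    exact ⟨by rw [conj_im]; linarith, by rw [conj_im]; linarith⟩
  have hex : ∀ p, (starRingEnd ℂ) (ex ((starRingEnd ℂ) p)) = (ex p)⁻¹ := fun p => by
    rw [← ex_neg, ex, ex, ← exp_conj]
    congr 1
    simp only [map_mul, map_ofNat, conj_ofReal, conj_I, Complex.conj_conj]
    ring
  have h1 : PerHol (-(t / 2) - ε) (t / 2 + ε)
      (fun p => (starRingEnd ℂ) (g ((starRingEnd ℂ) p))) :=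
    ⟨fun p hp => (differentiableAt_conj_conj_iff.2
      (h.num.differentiableAt (hs p hp))).differentiableWithinAt,
      fun p hp => by rw [map_add, map_one, h.num.per _ (hs p hp)]⟩
  have h2 : ∀ x : ℂ, x ≠ 0 → 1 - x⁻¹ = (-x)⁻¹ * (1 - x) := fun x hx => by
    field_simp; ring
  refine ⟨fun p => (starRingEnd ℂ) (g ((starRingEnd ℂ) p)) * ((-ex p) ^ n * (-ex (p - D))),
    h1.mul ((perHol_ex.neg.pow n).mul ?_), fun p hp h3 h4 => ?_, fun p h3 h4 => ?_⟩
  · have := (perHol_one_sub_ex (a := -(t / 2) - ε) (b := t / 2 + ε) (D : ℂ)).sub (.const 1)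
    simpa using this
  · have h5 : ex ((starRingEnd ℂ) p) ≠ 1 := fun h6 => h3 (by
      have := hex p
      rw [h6, map_one] at this
      exact (inv_eq_one.1 this.symm))
    have h7 : (starRingEnd ℂ) p - D = (starRingEnd ℂ) (p - D) := by simp
    have h6 : ex ((starRingEnd ℂ) p - D) ≠ 1 := fun h6 => h4 (by
      have := hex (p - D)
      rw [← h7, h6, map_one] at this
      exact (inv_eq_one.1 this.symm))
    rw [h.eq_div _ (hs p hp) h5 h6, map_div₀, map_mul, map_pow, map_sub, map_sub, map_one, h7, hex,
      hex, h2 _ (ex_ne_zero _), h2 _ (ex_ne_zero _), mul_pow]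
    simp only [div_eq_mul_inv, mul_inv, inv_pow, inv_inv]
    ring
  · have := h.glue ((starRingEnd ℂ) p + t * I) (by simp; linarith) (by simp; linarith)
    rw [add_sub_cancel_right] at this
    rw [this]
    congr 2
    simp

end SecNum

/-! ### Orders of sections -/

theorem meromorphicOrderAt_one_sub_ex (a z : ℂ) [Decidable (ex (z - a) = 1)] :
    meromorphicOrderAt (fun y => 1 - ex (y - a)) z = if ex (z - a) = 1 then 1 else 0 := by
  have han : AnalyticAt ℂ (fun y => 1 - ex (y - a)) z :=
    (analyticAt_const.sub ((differentiable_ex.comp (differentiable_id.sub_const a)).analyticAt z))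
  split_ifs with h
  · have hd : HasDerivAt (fun y => 1 - ex (y - a)) (-(2 * Real.pi * I * ex (z - a))) z := by
      have := ((hasDerivAt_ex (z - a)).comp z ((hasDerivAt_id z).sub_const a)).const_sub 1
      simpa [Function.comp_def] using this
    rw [han.meromorphicOrderAt_eq, han.analyticOrderAt_eq_one_of_zero_deriv_ne_zero (by simp [h])
      (by rw [hd.deriv]; exact neg_ne_zero.2 (mul_ne_zero two_pi_I_ne_zero (ex_ne_zero _)))]
    rfl
  · rw [han.meromorphicOrderAt_eq, han.analyticOrderAt_eq_zero.2 (sub_ne_zero.2 (Ne.symm h))]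
    rfl

theorem analyticAt_one_sub_ex (a z : ℂ) : AnalyticAt ℂ (fun y => 1 - ex (y - a)) z :=
  analyticAt_const.sub ((differentiable_ex.comp (differentiable_id.sub_const a)).analyticAt z)

theorem IsSection.add_lattice {τ : ℂ} {D : ℝ} {n : ℕ} {f : ℂ → ℂ} (h : IsSection τ D n f)
    (p : ℂ) (m k : ℤ) : f (p + (m + k * τ)) = f p := by
  have h1 : Function.Periodic f 1 := h.periodic_one
  have h2 : Function.Periodic f τ := h.periodic_tau
  have h3 := (h2.int_mul k) (p + m)
  rw [add_assoc] at h3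
  rw [h3]
  simpa using (h1.int_mul m) p

theorem IsSection.order_add_lattice {τ : ℂ} {D : ℝ} {n : ℕ} {f : ℂ → ℂ} (h : IsSection τ D n f)
    (p : ℂ) (m k : ℤ) : meromorphicOrderAt f (p + (m + k * τ)) = meromorphicOrderAt f p := by
  rw [← meromorphicOrderAt_comp_add_const_eq_meromorphicOrderAt]
  congr 1
  exact funext fun z => h.add_lattice z m k

theorem IsSection.meromorphicAt_add_lattice {τ : ℂ} {D : ℝ} {n : ℕ} {f : ℂ → ℂ}
    (h : IsSection τ D n f) {p : ℂ} (hp : MeromorphicAt f p) (m k : ℤ) :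
    MeromorphicAt f (p + (m + k * τ)) := by
  rw [← meromorphicAt_comp_add_const_iff_meromorphicAt]
  convert hp using 1
  exact funext fun z => h.add_lattice z m k

theorem IsSection.meromorphicAt {τ : ℂ} {D : ℝ} {n : ℕ} {f : ℂ → ℂ} (h : IsSection τ D n f)
    (p : ℂ) : MeromorphicAt f p := by
  by_cases h0 : InLattice τ p
  · obtain ⟨m, k, hp⟩ := h0
    have := h.meromorphicAt_add_lattice h.meromorphic_zero m k
    rwa [zero_add, ← hp] at this
  by_cases h1 : InLattice τ (p - D)
  · obtain ⟨m, k, hp⟩ := h1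
    have := h.meromorphicAt_add_lattice h.meromorphic_D m k
    rwa [← hp, add_sub_cancel] at this
  exact (h.analytic p h0 h1).meromorphicAt

theorem one_sub_ex_eq : (fun y => 1 - ex y) = fun y => 1 - ex (y - 0) := by
  simp

/-- In the fundamental annulus the zero divisor of a section is the divisor of its numerator. -/
theorem IsSection.sectionOrder_eq {t : ℝ} (ht : 0 < t) {D : ℝ} {n : ℕ} {f : ℂ → ℂ}
    (h : IsSection (t * I) D n f) {p : ℂ} (hp : |p.im| < t) :
    sectionOrder (t * I) D n f p
      = meromorphicOrderAt (fun y => f y * ((1 - ex y) ^ n * (1 - ex (y - D)))) p := by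
  classical
  have h1 : MeromorphicAt (fun y => 1 - ex y) p := by
    rw [one_sub_ex_eq]; exact (analyticAt_one_sub_ex 0 p).meromorphicAt
  have h2 := (analyticAt_one_sub_ex D p).meromorphicAt
  have e1 := meromorphicOrderAt_one_sub_ex 0 p
  rw [← one_sub_ex_eq] at e1
  have hf := h.meromorphicAt p
  rw [sub_zero] at e1
  rw [fun_meromorphicOrderAt_mul hf ((h1.fun_pow n).fun_mul h2),
    fun_meromorphicOrderAt_mul (h1.fun_pow n) h2, fun_meromorphicOrderAt_pow h1, e1,
    meromorphicOrderAt_one_sub_ex, sectionOrder]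
  simp only [inLattice_of_im ht hp, inLattice_of_im (z := p - D) ht (by simpa using hp)]
  rw [add_assoc]
  congr 2
  · split_ifs <;> simp
  · split_ifs <;> simp

theorem IsSection.sectionOrder_fold {t : ℝ} {D : ℝ} {n : ℕ} {f : ℂ → ℂ}
    (h : IsSection (t * I) D n f) (p : ℂ) :
    sectionOrder (t * I) D n f p = sectionOrder (t * I) D n f (fold t p) := by
  have h1 : meromorphicOrderAt f (fold t p) = meromorphicOrderAt f p := by
    have := h.order_add_lattice (fold t p) 0 (round (p.im / t))
    rw [← this]
    congr 1
    simp [fold]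
  have h2 : InLattice (t * I) (fold t p - D) ↔ InLattice (t * I) (p - D) := by
    rw [fold, sub_right_comm]; exact inLattice_sub_tau _
  classical
  unfold sectionOrder
  rw [h1]
  exact congrArg₂ (· + ·) (congrArg₂ (· + ·) rfl (congrArg _ (if_congr inLattice_fold.symm rfl rfl)))
    (congrArg _ (if_congr h2.symm rfl rfl))

theorem IsSection.sectionOrder_nonneg {t : ℝ} (ht : 0 < t) {D : ℝ} (hD : D ∈ Set.Ioo (0 : ℝ) 1)
    {n : ℕ} {f : ℂ → ℂ} (h : IsSection (t * I) D n f) (p : ℂ) :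
    0 ≤ sectionOrder (t * I) D n f p := by
  have hDl : ¬ InLattice (t * I) D := not_inLattice_of_mem_Ioo (by simpa using ht.ne') hD
  have hsub : ∀ a b : ℂ, InLattice (t * I) a → InLattice (t * I) b → InLattice (t * I) (a - b) := by
    rintro a b ⟨m, k, rfl⟩ ⟨m', k', rfl⟩
    exact ⟨m - m', k - k', by push_cast; ring⟩
  unfold sectionOrder
  by_cases h0 : InLattice (t * I) p
  · have h1 : ¬ InLattice (t * I) (p - D) := fun h1 => hDl (by
      have := hsub _ _ h0 h1
      rwa [sub_sub_cancel] at this)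
    obtain ⟨m, k, hp⟩ := id h0
    have h2 := h.order_add_lattice 0 m k
    rw [zero_add, ← hp] at h2
    rw [if_pos h0, if_neg h1, h2]
    have h3 := add_le_add_left h.order_zero ((n : ℤ) : WithTop ℤ)
    have h4 : ((-(n : ℤ) : ℤ) : WithTop ℤ) + ((n : ℤ) : WithTop ℤ) = 0 := by
      rw [← WithTop.coe_add, neg_add_cancel, WithTop.coe_zero]
    rw [h4] at h3
    simpa using h3
  by_cases h1 : InLattice (t * I) (p - D)
  · obtain ⟨m, k, hp⟩ := id h1
    have h2 := h.order_add_lattice D m k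
    rw [← hp, add_sub_cancel] at h2
    rw [if_neg h0, if_pos h1, h2]
    have h3 := add_le_add_left h.order_D ((1 : ℤ) : WithTop ℤ)
    have h4 : ((-1 : ℤ) : WithTop ℤ) + ((1 : ℤ) : WithTop ℤ) = 0 := by
      rw [← WithTop.coe_add, neg_add_cancel, WithTop.coe_zero]
    rw [h4] at h3
    simpa using h3
  · rw [if_neg h0, if_neg h1]
    simpa using (h.analytic p h0 h1).meromorphicOrderAt_nonneg

/-- Every section has a numerator, and the zero divisor of the section is the divisor of its
numerator. -/
theorem IsSection.exists_secNum {t : ℝ} (ht : 0 < t) {D : ℝ} (hD : D ∈ Set.Ioo (0 : ℝ) 1)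
    {n : ℕ} {f : ℂ → ℂ} (h : IsSection (t * I) D n f) {ε : ℝ} (hε : ε ≤ t / 2) :
    ∃ g, SecNum t D ε n f g ∧ ∀ p ∈ strip (-(t / 2) - ε) (t / 2 + ε),
      meromorphicOrderAt g p = sectionOrder (t * I) D n f p := by
  have him : ∀ p ∈ strip (-(t / 2) - ε) (t / 2 + ε), |p.im| < t := fun p hp =>
    abs_lt.2 ⟨by linarith [hp.1], by linarith [hp.2]⟩
  have h1 : ∀ p, MeromorphicAt (fun y => (1 - ex y) ^ n * (1 - ex (y - D))) p := fun p => by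
    have e1 : MeromorphicAt (fun y => 1 - ex y) p := by
      rw [one_sub_ex_eq]; exact (analyticAt_one_sub_ex 0 p).meromorphicAt
    exact (e1.fun_pow n).fun_mul (analyticAt_one_sub_ex D p).meromorphicAt
  obtain ⟨g, hg, hgf, hga⟩ := exists_perHol_of_meromorphic (a := -(t / 2) - ε) (b := t / 2 + ε)
    (f := fun y => f y * ((1 - ex y) ^ n * (1 - ex (y - D))))
    (fun p _ => (h.meromorphicAt p).fun_mul (h1 p))
    (fun p hp => by rw [← h.sectionOrder_eq ht (him p hp)]; exact h.sectionOrder_nonneg ht hD p)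
    (fun p _ => by
      rw [h.periodic_one, ex_add_one, show p + 1 - (D : ℂ) = p - D + 1 by ring, ex_add_one])
  refine ⟨g, ⟨hg, fun p hp h2 h3 => ?_, fun p _ _ => ?_⟩, fun p hp => ?_⟩
  · have h4 : AnalyticAt ℂ f p := h.analytic p (fun h5 => h2 ((inLattice_of_im ht (him p hp)).1 h5))
      fun h5 => h3 ((inLattice_of_im ht (by simpa using him p hp)).1 h5)
    have h6 : AnalyticAt ℂ (fun y => 1 - ex y) p := by
      rw [one_sub_ex_eq]; exact analyticAt_one_sub_ex 0 p
    rw [hga p hp (h4.fun_mul ((h6.fun_pow n).fun_mul (analyticAt_one_sub_ex D p))),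
      mul_div_cancel_right₀]
    exact mul_ne_zero (pow_ne_zero _ (sub_ne_zero.2 h2.symm)) (sub_ne_zero.2 h3.symm)
  · have := h.periodic_tau (p - t * I)
    rw [sub_add_cancel] at this
    exact this.symm
  · rw [meromorphicOrderAt_congr (hgf p hp), h.sectionOrder_eq ht (him p hp)]

/-! ### Orthogonality -/

theorem ex_neg_ofReal_ne_one {D : ℝ} (hD : D ∈ Set.Ioo (0 : ℝ) 1) : ex (-D) ≠ 1 := by
  intro h
  have hl := not_inLattice_of_mem_Ioo (τ := I) (by simp) hD
  obtain ⟨m, hm⟩ := ex_eq_one_iff.1 h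
  exact hl ⟨-m, 0, by push_cast; rw [← hm]; ring⟩

theorem tendsto_one_sub_ex_div : Tendsto (fun p : ℂ => (1 - ex p) / p) (𝓝[≠] 0)
    (𝓝 (-(2 * Real.pi * I))) := by
  have h := ((hasDerivAt_ex 0).const_sub 1).tendsto_slope_zero
  simp only [ex_zero, mul_one, sub_self, zero_add, sub_zero, smul_eq_mul] at h
  refine h.congr fun p => ?_
  rw [div_eq_inv_mul]

/-- The value of the numerator at the origin is determined by the leading coefficient of the
section, here `1`. -/
theorem SecNum.num_zero {t D ε : ℝ} (ht : 0 < t) (hε : 0 < ε) {n : ℕ}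
    {f g : ℂ → ℂ} (h : SecNum t D ε n f g)
    (hm : (fun p : ℂ => p ^ n * f p - 1) =O[𝓝[≠] 0] (fun p : ℂ => p)) :
    g 0 = (-(2 * Real.pi * I)) ^ n * (1 - ex (-D)) := by
  have h0 : (0 : ℂ) ∈ strip (-(t / 2) - ε) (t / 2 + ε) := ⟨by simp; linarith, by simp; linarith⟩
  have h1 : Tendsto (fun p : ℂ => p ^ n * f p) (𝓝[≠] 0) (𝓝 1) := by
    have h2 : Tendsto (fun p : ℂ => p) (𝓝[≠] 0) (𝓝 0) := nhdsWithin_le_nhds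
    have h3 := (hm.trans_tendsto h2).add_const 1
    simpa using h3
  have h2 : Tendsto (fun p : ℂ => 1 - ex (p - D)) (𝓝[≠] 0) (𝓝 (1 - ex (-D))) := by
    have := ((analyticAt_one_sub_ex D 0).continuousAt.tendsto).mono_left
      (nhdsWithin_le_nhds (s := {0}ᶜ))
    simpa using this
  have h3 := (h1.mul (tendsto_one_sub_ex_div.pow n)).mul h2
  rw [one_mul] at h3
  have h4 := ((h.num.continuousAt h0).tendsto).mono_left (nhdsWithin_le_nhds (s := {0}ᶜ))
  refine tendsto_nhds_unique_of_eventuallyEq h4 h3 ?_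
  filter_upwards [nhdsWithin_le_nhds (strip_mem_nhds h0), eventually_ex_sub_ne_one 0 0,
    eventually_ex_sub_ne_one 0 D, self_mem_nhdsWithin] with p hp h5 h6 h7
  rw [sub_zero] at h5
  have h8 : p ≠ 0 := h7
  have h9 : 1 - ex p ≠ 0 := sub_ne_zero.2 h5.symm
  have h10 : 1 - ex (p - D) ≠ 0 := sub_ne_zero.2 h6.symm
  rw [h.eq_div p hp h5 h6, div_pow]
  field_simp

theorem SecNum.eq_zero {t D ε : ℝ} (ht : 0 < t) (hε : 0 < ε) (hεt : ε < t / 2)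
    (hD : D ∈ Set.Ioo (0 : ℝ) 1) {f g : ℂ → ℂ} (h : SecNum t D ε 0 f g) (h0 : g 0 = 0) :
    ∀ p ∈ strip (-(t / 2) - ε) (t / 2 + ε), ex p ≠ 1 → ex (p - D) ≠ 1 → f p = 0 := by
  obtain ⟨c, hc⟩ := h.eq_const ht hε hεt
  have h1 : Tendsto g (𝓝[≠] 0) (𝓝 (c * (1 - ex (-D)))) := by
    have h00 : (0 : ℂ) ∈ strip (-(t / 2) - ε) (t / 2 + ε) := ⟨by simp; linarith, by simp; linarith⟩
    have h2 : Tendsto (fun p : ℂ => c * (1 - ex (p - D))) (𝓝[≠] 0) (𝓝 (c * (1 - ex (-D)))) := by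
      have := (((analyticAt_one_sub_ex D 0).continuousAt.tendsto).mono_left
        (nhdsWithin_le_nhds (s := {0}ᶜ))).const_mul c
      simpa using this
    refine h2.congr' ?_
    filter_upwards [nhdsWithin_le_nhds (strip_mem_nhds h00), eventually_ex_sub_ne_one 0 0,
      eventually_ex_sub_ne_one 0 D] with p hp h5 h6
    rw [sub_zero] at h5
    have h7 := h.eq_div p hp h5 h6
    rw [pow_zero, one_mul, eq_div_iff (sub_ne_zero.2 h6.symm), hc p hp h5 h6] at h7
    exact h7
  have h2 : Tendsto g (𝓝[≠] 0) (𝓝 (g 0)) :=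
    ((h.num.continuousAt ⟨by simp; linarith, by simp; linarith⟩).tendsto).mono_left
      nhdsWithin_le_nhds
  have h3 := tendsto_nhds_unique h1 h2
  rw [h0, mul_eq_zero] at h3
  have hc0 := h3.resolve_right (sub_ne_zero.2 (ex_neg_ofReal_ne_one hD).symm)
  intro p hp h5 h6
  rw [hc p hp h5 h6, hc0]

/-- A monic orthogonal section is orthogonal to every section of lower order. -/
theorem IsMonicOrthogonal.lineInt_eq_zero {t : ℝ} (ht : 0 < t) {D : ℝ} (hD : D ∈ Set.Ioo (0 : ℝ) 1)
    {w : ℂ → ℂ} {P : ℕ → ℂ → ℂ} (hP : IsMonicOrthogonal (t * I) D w P)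
    (hw : Continuous fun s : ℝ => w (s + (t / 2 : ℝ) * I)) {ε : ℝ} (hε : 0 < ε) (hεt : ε < t / 2)
    {n m : ℕ} (hmn : m < n) {f g : ℂ → ℂ} (hf : SecNum t D ε m f g) :
    lineInt (fun q => P n q * f q * exp (w q)) (t / 2) = 0 := by
  obtain ⟨gn, hgn, -⟩ := (hP.isSection n).exists_secNum ht hD hεt.le
  have hcn := hgn.continuous_gamma ht hε
  induction m generalizing f g with
  | zero =>
    obtain ⟨gm, hgm, -⟩ := (hP.isSection 0).exists_secNum ht hD hεt.le
    have hm0 := hgm.num_zero ht hε (hP.monic 0)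
    set a := g 0 / gm 0 with ha
    have h1 : gm 0 ≠ 0 := by
      rw [hm0]
      exact mul_ne_zero (pow_ne_zero _ (neg_ne_zero.2 two_pi_I_ne_zero))
        (sub_ne_zero.2 (ex_neg_ofReal_ne_one hD).symm)
    have h2 := (hf.sub (hgm.const_mul a)).eq_zero ht hε hεt hD (by
      rw [ha, div_mul_cancel₀ _ h1, sub_self])
    have h3 := hP.orthogonal n 0 hmn.ne'
    have h4 : lineInt (fun q => P n q * f q * exp (w q)) (t / 2)
        = a * ∫ s in (0 : ℝ)..1, P n (s + t * I / 2) * P 0 (s + t * I / 2) *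
          exp (w (s + t * I / 2)) := by
      rw [← intervalIntegral.integral_const_mul]
      refine intervalIntegral.integral_congr fun s _ => ?_
      have him : ((s : ℂ) + (t / 2 : ℝ) * I).im ≠ 0 := by simp; linarith
      have h5 := h2 (s + (t / 2 : ℝ) * I) ⟨by simp; linarith, by simp; linarith⟩
        (ex_ne_one_of_im_ne_zero him) (ex_sub_ofReal_ne_one D him)
      simp only
      rw [sub_eq_zero.1 h5, line_half]
      ring
    rw [h4, h3, mul_zero]
  | succ m ih =>
    obtain ⟨gm, hgm, -⟩ := (hP.isSection (m + 1)).exists_secNum ht hD hεt.le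
    have hm0 := hgm.num_zero ht hε (hP.monic (m + 1))
    set a := g 0 / gm 0 with ha
    have h1 : gm 0 ≠ 0 := by
      rw [hm0]
      exact mul_ne_zero (pow_ne_zero _ (neg_ne_zero.2 two_pi_I_ne_zero))
        (sub_ne_zero.2 (ex_neg_ofReal_ne_one hD).symm)
    have hsub := hf.sub (hgm.const_mul a)
    obtain ⟨g', hg'⟩ := hsub.lower ht hε (by
      rw [ha, div_mul_cancel₀ _ h1, sub_self])
    have h2 := ih (by lia) hg'
    have h3 := hP.orthogonal n (m + 1) hmn.ne'
    have h4 : lineInt (fun q => P n q * P (m + 1) q * exp (w q)) (t / 2) = 0 := by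
      rw [← h3]
      refine intervalIntegral.integral_congr fun s _ => ?_
      simp only
      rw [line_half]
    have h5 : lineInt (fun q => P n q * f q * exp (w q)) (t / 2)
        = lineInt (fun q => P n q * (f q - a * P (m + 1) q) * exp (w q)) (t / 2)
          + a * lineInt (fun q => P n q * P (m + 1) q * exp (w q)) (t / 2) := by
      rw [← lineInt_const_mul, ← lineInt_add
        (f := fun q => P n q * (f q - a * P (m + 1) q) * exp (w q))
        (g := fun q => a * (P n q * P (m + 1) q * exp (w q)))
        ((hcn.mul (hsub.continuous_gamma ht hε)).mul hw.cexp)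
        (continuous_const.mul ((hcn.mul (hgm.continuous_gamma ht hε)).mul hw.cexp))]
      refine lineInt_congr fun s => ?_
      ring
    rw [h5, h2, h4, mul_zero, add_zero]

/-! ### The leading term -/

/-- As `exists_gUpper_factor`, together with the value of the unit at the origin, which `p e^{g(p)}
→ 1` determines. -/
theorem exists_gUpper_factor_zero {t : ℝ} (ht : 0 < t) :
    ∃ V : ℂ → ℂ, PerHol (-t) t V ∧ (∀ z ∈ strip (-t) t, V z ≠ 0) ∧
      (∀ z ∈ strip (-t) t, gUpper (t * I) z = exp (Real.pi * I * z) * ((1 - ex z) * V z)) ∧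
      -(2 * Real.pi * I) * V 0 = expEll (t * I) := by
  obtain ⟨V, hV, hV0, hVeq⟩ := exists_gUpper_factor ht
  refine ⟨V, hV, hV0, hVeq, ?_⟩
  have h0 : (0 : ℂ) ∈ strip (-t) t := by simp [mem_strip, ht]
  have h1 : Tendsto (fun p : ℂ => gUpper (t * I) p / p) (𝓝[≠] 0) (𝓝 (-(2 * Real.pi * I) * V 0)) := by
    have h2 : Tendsto (fun p : ℂ => exp (Real.pi * I * p)) (𝓝[≠] 0) (𝓝 1) := by
      have : Tendsto (fun p : ℂ => exp (Real.pi * I * p)) (𝓝 0) (𝓝 (exp (Real.pi * I * 0))) :=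
        Continuous.tendsto (by fun_prop) 0
      rw [mul_zero, exp_zero] at this
      exact this.mono_left nhdsWithin_le_nhds
    have h3 := ((hV.continuousAt h0).tendsto).mono_left (nhdsWithin_le_nhds (s := {0}ᶜ))
    have h4 := h2.mul (tendsto_one_sub_ex_div.mul h3)
    rw [one_mul] at h4
    refine h4.congr' ?_
    filter_upwards [nhdsWithin_le_nhds (strip_mem_nhds h0)] with p hp
    rw [hVeq p hp]; ring
  have h5 := (tendsto_mul_expG ht).mul h1
  rw [one_mul] at h5
  refine (tendsto_nhds_unique_of_eventuallyEq h5 (tendsto_const_nhds (x := expEll (t * I))) ?_)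
  filter_upwards [nhdsWithin_le_nhds (eventually_abs_im_lt (p := 0) (c := t / 2)
    (by simpa using ht)), self_mem_nhdsWithin, eventually_ex_sub_ne_one 0 0] with p hp hp0 h6
  have hp0' : p ≠ 0 := hp0
  rw [sub_zero] at h6
  have h7 : gUpper (t * I) p ≠ 0 := gUpper_ne_zero ht (hp.trans (by linarith)) h6
  have h8 : gLower (t * I) p = (gUpper (t * I) p)⁻¹ := by rw [gUpper_eq_inv, inv_inv]
  rw [expG_eq ht (not_onGamma_of_abs_lt ht hp), fold_of_abs_lt ht hp, h8]
  field_simp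

/-- The leading term, up to a constant factor, of the orthogonal section of order `N + 1`. -/
def leadTerm (t D : ℝ) (σ : ℂ → ℂ) (N : ℕ) (p : ℂ) : ℂ :=
  modelF (t * I) D (N + 1) p * exp (σ p) * gLower (t * I) p ^ N

theorem neg_one_pow_parity_add (N : ℕ) : (-1 : ℂ) ^ (parity (N + 1) + N) = 1 := by
  rw [pow_add, neg_one_pow_parity, pow_add, pow_add]
  linear_combination sq_neg_one_pow N

/-- The numerator of the leading term and its value at the origin. The half-integer exponents of
the model function and of `e^{g - ℓ}` combine to an even multiple of `πip`, so that the numerator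
is periodic. -/
theorem exists_leadTerm_num {t ε : ℝ} (ht : 0 < t) (hε : 0 < ε) (hεt : ε < t / 2) (D : ℝ) {σ : ℂ → ℂ}
    (hσ : PerHol (-(t / 2) - ε) (t / 2 + ε) σ) (N : ℕ) :
    ∃ g, PerHol (-(t / 2) - ε) (t / 2 + ε) g ∧
      (∀ p ∈ strip (-(t / 2) - ε) (t / 2 + ε), leadTerm t D σ N p
        = g p / ((1 - ex p) ^ (N + 1) * (1 - ex (p - D)))) ∧
      g 0 = exp (σ 0) * (expEll (t * I) ^ N)⁻¹ *
        ((-(2 * Real.pi * I)) ^ (N + 1) * (1 - ex (-D))) := by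
  obtain ⟨A, hA, -, hA0, hAeq⟩ := exists_modelF_factor ht D
  obtain ⟨V, hV, hV0, hVeq, hVz⟩ := exists_gUpper_factor_zero ht
  have hs : ∀ p ∈ strip (-(t / 2) - ε) (t / 2 + ε), p ∈ strip (-t) t := fun p hp =>
    ⟨by linarith [hp.1], by linarith [hp.2]⟩
  refine ⟨fun p => exp (-(Real.pi * I * (parity (N + 1) + N : ℕ) * p)) *
    (A (N + 1) p * exp (σ p) * (V p ^ N)⁻¹), ?_, fun p hp => ?_, ?_⟩
  · refine PerHol.mul (.of_entire (by fun_prop) fun p => ?_)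
      ((((hA _).mono (by linarith) (by linarith)).mul hσ.exp_comp).mul
      (((hV.mono (by linarith) (by linarith)).pow N).inv fun z hz => pow_ne_zero _ (hV0 z (hs z hz))))
    rw [exp_neg, exp_pi_mul_nat_add_one, neg_one_pow_parity_add, one_mul, exp_neg]
  · have h1 : gLower (t * I) p = (gUpper (t * I) p)⁻¹ := by rw [gUpper_eq_inv, inv_inv]
    have h2 : exp (-(Real.pi * I * (parity (N + 1) + N : ℕ) * p))
        = exp (-(Real.pi * I * parity (N + 1) * p)) * (exp (Real.pi * I * p) ^ N)⁻¹ := by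
      rw [← exp_nat_mul, ← exp_neg, ← exp_add]
      congr 1
      push_cast; ring
    beta_reduce
    rw [leadTerm, hAeq _ _ ⟨by linarith [hp.1], by linarith [hp.2]⟩, h1, hVeq p (hs p hp), h2]
    simp only [div_eq_mul_inv, mul_inv, mul_pow, inv_pow, pow_succ]
    ring
  · have h1 : expEll (t * I) ^ N = (-(2 * Real.pi * I)) ^ N * V 0 ^ N := by rw [← hVz, mul_pow]
    have h2 : V 0 ^ N ≠ 0 := pow_ne_zero _ (hV0 0 (by simp [mem_strip, ht]))
    have h3 : (-(2 * Real.pi * I) : ℂ) ^ N ≠ 0 := pow_ne_zero _ (neg_ne_zero.2 two_pi_I_ne_zero)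
    simp only [mul_zero, neg_zero, exp_zero, one_mul]
    rw [h1, hA0, mul_inv, pow_succ]
    field_simp

/-- The sum of the two boundary values of the leading term is orthogonal to all sections of order at
most `N`: on the second sheet, the weighted integrand extends holomorphically to the annulus. -/
theorem lineInt_leadTerm {t ε : ℝ} (ht : 0 < t) (hε : 0 < ε) (hεt : ε < t / 2) {D : ℝ}
    {w σ : ℂ → ℂ} (hσ : PerHol (-(t / 2) - ε) (t / 2 + ε) σ)
    (hjump : ∀ p : ℂ, p.im = t / 2 → σ p + σ (p - t * I) = -w p) {N : ℕ} {f g : ℂ → ℂ}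
    (hf : SecNum t D ε N f g) :
    lineInt (fun q => (leadTerm t D σ N q + leadTerm t D σ N (q - t * I)) * f q * exp (w q)) (t / 2)
      = 0 := by
  obtain ⟨B, hB, hBeq⟩ := exists_modelF_add_tau_factor ht D (N + 1)
  obtain ⟨V, hV, hV0, hVeq, -⟩ := exists_gUpper_factor_zero ht
  have hs : ∀ p ∈ strip (-(t / 2) - ε) (t / 2 + ε), p ∈ strip (-t) t := fun p hp =>
    ⟨by linarith [hp.1], by linarith [hp.2]⟩
  set m := parity (N + 1) with hm
  set G : ℂ → ℂ := fun p => exp (Real.pi * I * (m + N : ℕ) * p) * (ex p ^ m)⁻¹ *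
    (B p * exp (-σ p) * V p ^ N * g p) with hG
  have hGp : PerHol (-(t / 2) - ε) (t / 2 + ε) G := by
    refine PerHol.mul (.of_entire ?_ fun p => ?_)
      ((((hB.mono (by linarith) (by linarith)).mul hσ.neg.exp_comp).mul
      ((hV.mono (by linarith) (by linarith)).pow N)).mul hf.num)
    · have h1 := differentiable_ex
      exact Differentiable.mul (by fun_prop)
        ((h1.pow m).inv fun z => pow_ne_zero _ (ex_ne_zero z))
    · rw [exp_pi_mul_nat_add_one, neg_one_pow_parity_add, one_mul, ex_add_one]
  have hGval : ∀ p ∈ strip (-(t / 2) - ε) (t / 2 + ε), p.im ≠ 0 →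
      G p = modelF (t * I) D (N + 1) (p + t * I) * exp (-σ p) * gUpper (t * I) p ^ N * f p := by
    intro p hp h0
    have h1 := ex_ne_one_of_im_ne_zero h0
    have h2 := ex_sub_ofReal_ne_one D h0
    have h3 : 1 - ex p ≠ 0 := sub_ne_zero.2 h1.symm
    have h4 : 1 - ex (p - D) ≠ 0 := sub_ne_zero.2 h2.symm
    have h5 : exp (Real.pi * I * (m + N : ℕ) * p) * (ex p ^ m)⁻¹
        = exp (-(Real.pi * I * m * p)) * exp (Real.pi * I * p) ^ N := by
      rw [← exp_nat_mul, ex, ← exp_nat_mul, ← exp_neg, ← exp_add, ← exp_add]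
      congr 1
      push_cast; ring
    rw [hBeq p (hs p hp), hVeq p (hs p hp), hf.eq_div p hp h1 h2, hG]
    beta_reduce
    rw [h5, mul_pow, mul_pow]
    field_simp
  have hline := hGp.lineInt_eq (c := -(t / 2)) (d := t / 2) ⟨by linarith, by linarith⟩
    ⟨by linarith, by linarith⟩
  have h1 : ∀ s : ℝ, (s : ℂ) + (-(t / 2) : ℝ) * I = s + (t / 2 : ℝ) * I - t * I := fun s => by
    push_cast; ring
  have hmem : ∀ s : ℝ, (s : ℂ) + (t / 2 : ℝ) * I ∈ strip (-(t / 2) - ε) (t / 2 + ε) := fun s =>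
    ⟨by simp; linarith, by simp; linarith⟩
  have hmem' : ∀ s : ℝ, (s : ℂ) + (t / 2 : ℝ) * I - t * I ∈ strip (-(t / 2) - ε) (t / 2 + ε) :=
    fun s => ⟨by simp; linarith, by simp; linarith⟩
  have him : ∀ s : ℝ, ((s : ℂ) + (t / 2 : ℝ) * I).im = t / 2 := fun s => by simp
  have hcont : Continuous fun s : ℝ => G (s + (t / 2 : ℝ) * I) :=
    hGp.continuous_line (by linarith) (by linarith)
  have hcont' : Continuous fun s : ℝ => G (s + (t / 2 : ℝ) * I - t * I) := by
    simp only [← h1]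
    exact hGp.continuous_line (by linarith) (by linarith)
  have hsplit : lineInt (fun q => (leadTerm t D σ N q + leadTerm t D σ N (q - t * I)) * f q *
      exp (w q)) (t / 2) = lineInt (fun q => G (q - t * I) - G q) (t / 2) := by
    refine lineInt_congr fun s => ?_
    set q : ℂ := s + (t / 2 : ℝ) * I with hq
    have hqim : q.im = t / 2 := him s
    have e1 := hjump q hqim
    rw [hGval q (hmem s) (by rw [hqim]; positivity), hGval (q - t * I) (hmem' s) (by
        rw [sub_im, tau_im, hqim]; linarith), sub_add_cancel,
      hf.glue q (by linarith) (by linarith)]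
    have e2 : modelF (t * I) D (N + 1) (q + t * I) = -modelF (t * I) D (N + 1) (q - t * I) := by
      rw [← modelF_add_two_tau]
      congr 1; ring
    have e3 : gUpper (t * I) q = gLower (t * I) (q - t * I) := by
      rw [gUpper_eq_inv, gLower_sub_tau]
    have e4 : gUpper (t * I) (q - t * I) = gLower (t * I) q := by
      rw [gUpper_eq_inv, gLower_sub_tau, inv_inv]
    have e5 : exp (-σ q) = exp (σ (q - t * I)) * exp (w q) := by
      rw [← exp_add]; congr 1; linear_combination -e1
    have e6 : exp (-σ (q - t * I)) = exp (σ q) * exp (w q) := by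
      rw [← exp_add]; congr 1; linear_combination -e1
    rw [e2, e3, e4, e5, e6, leadTerm, leadTerm]
    ring
  rw [hsplit, lineInt_sub (f := fun q => G (q - t * I)) hcont' hcont, ← hline, sub_eq_zero]
  exact intervalIntegral.integral_congr fun s _ => by simp only [h1]

/-! ### Correcting the leading term to a section -/

theorem ctr_sub {t c : ℝ} {κ f g : ℂ → ℂ} (hκ : IsCauchyKernel t κ) {p : ℂ}
    (hpc : c - t < p.im ∧ p.im < c) (hf : Continuous fun s : ℝ => f (s + c * I))
    (hg : Continuous fun s : ℝ => g (s + c * I)) :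
    ctr κ (fun q => f q - g q) c p = ctr κ f c p - ctr κ g c p := by
  have hk : Continuous fun s : ℝ => κ (p - (s + c * I)) :=
    (hκ.perHol_left.comp_const_sub p).continuous_line (by linarith) (by linarith)
  unfold ctr
  rw [← mul_sub, ← lineInt_sub (f := fun q => κ (p - q) * f q) (g := fun q => κ (p - q) * g q)
    (hk.mul hf) (hk.mul hg)]
  congr 1
  exact lineInt_congr fun s => mul_sub _ _ _

theorem IsCauchyKernel.exists_pole_factor {t : ℝ} {κ : ℂ → ℂ} (hκ : IsCauchyKernel t κ) (D : ℝ) :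
    ∃ K, PerHol (-t) t K ∧
      ∀ p ∈ strip (-t) t, ex (p - D) ≠ 1 → κ (p - D) = K p / (1 - ex (p - D)) := by
  obtain ⟨l, hl, hκl⟩ := hκ
  have h1 := (hl.comp_sub (D : ℂ))
  simp only [ofReal_im, add_zero] at h1
  have h2 : PerHol (-t) t fun p => ex (p - D) := by
    simpa using (perHol_ex (a := -t) (b := t)).comp_sub (D : ℂ)
  refine ⟨fun p => (-(2 * Real.pi * I)) * ex (p - D) + l (p - D) * (1 - ex (p - D)),
    (h2.const_mul _).add (h1.mul (perHol_one_sub_ex (D : ℂ))), fun p hp h3 => ?_⟩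
  rw [hκl (p - D) (by simpa [mem_strip] using hp) h3, inv_one_sub_ex_neg h3]
  have h4 : 1 - ex (p - D) ≠ 0 := sub_ne_zero.2 h3.symm
  field_simp

/-- The jump of the leading term across `γ`. -/
def leadJump (t D : ℝ) (σ : ℂ → ℂ) (N : ℕ) (q : ℂ) : ℂ :=
  leadTerm t D σ N (q - t * I) - leadTerm t D σ N q

/-- The Cauchy integral that corrects the leading term to a section: it has the opposite jump
across `γ`, and its only pole is a simple one at `D`. -/
def corr (t D ε : ℝ) (σ : ℂ → ℂ) (N : ℕ) (p : ℂ) : ℂ :=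
  csol t ε (zetaKernel (t * I)) (leadJump t D σ N) p
    - (2 * Real.pi * I)⁻¹ * zetaKernel (t * I) (p - D) * lineInt (leadJump t D σ N) (t / 2 - ε / 2)

/-- The Cauchy integral `corr` after its two parts have been moved to the lines
`Im q = t/2 - a` and `Im q = t/2 + a`, where they decay geometrically. -/
def corrErr (t D a : ℝ) (σ : ℂ → ℂ) (N : ℕ) (p : ℂ) : ℂ :=
  ctr (zetaKernel (t * I)) (fun q => leadTerm t D σ N (q - t * I)) (t / 2 - a) p
    - ctr (zetaKernel (t * I)) (leadTerm t D σ N) (t / 2 + a) p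
    - (2 * Real.pi * I)⁻¹ * zetaKernel (t * I) (p - D) *
      (lineInt (fun q => leadTerm t D σ N (q - t * I)) (t / 2 - a)
        - lineInt (leadTerm t D σ N) (t / 2 + a))

section

variable {t ε D : ℝ} {σ : ℂ → ℂ}

theorem perHol_leadTerm (ht : 0 < t) (hε : 0 < ε) (hεt : ε < t / 2)
    (hσ : PerHol (-(t / 2) - ε) (t / 2 + ε) σ) (N : ℕ) {a b : ℝ} (ha : -(t / 2) - ε ≤ a)
    (hb : b ≤ t / 2 + ε) (h0 : ∀ y, a < y → y < b → y ≠ 0) :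
    PerHol a b (leadTerm t D σ N) := by
  obtain ⟨g, hg, hgeq, -⟩ := exists_leadTerm_num ht hε hεt D hσ N
  have hne : ∀ z ∈ strip a b, z.im ≠ 0 := fun z hz => h0 _ hz.1 hz.2
  have h1 := perHol_one_sub_ex (a := a) (b := b) 0
  simp only [sub_zero] at h1
  refine ((hg.mono ha hb).div ((h1.pow (N + 1)).mul (perHol_one_sub_ex (D : ℂ)))
    fun z hz => mul_ne_zero (pow_ne_zero _ (sub_ne_zero.2 (ex_ne_one_of_im_ne_zero (hne z hz)).symm))
      (sub_ne_zero.2 (ex_sub_ofReal_ne_one D (hne z hz)).symm)).congr fun z hz => ?_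
  exact hgeq z ⟨ha.trans_lt hz.1, hz.2.trans_le hb⟩

theorem perHol_leadTerm_upper (ht : 0 < t) (hε : 0 < ε) (hεt : ε < t / 2)
    (hσ : PerHol (-(t / 2) - ε) (t / 2 + ε) σ) (N : ℕ) :
    PerHol (t / 2 - ε) (t / 2 + ε) (leadTerm t D σ N) :=
  perHol_leadTerm ht hε hεt hσ N (by linarith) le_rfl fun y h1 _ => by linarith

theorem perHol_leadTerm_lower (ht : 0 < t) (hε : 0 < ε) (hεt : ε < t / 2)
    (hσ : PerHol (-(t / 2) - ε) (t / 2 + ε) σ) (N : ℕ) :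
    PerHol (t / 2 - ε) (t / 2 + ε) (fun q => leadTerm t D σ N (q - t * I)) := by
  have h := (perHol_leadTerm (D := D) ht hε hεt hσ N (a := -(t / 2) - ε) (b := -(t / 2) + ε) le_rfl
    (by linarith) fun y _ h1 => by linarith).comp_sub (t * I : ℂ)
  rw [tau_im, show -(t / 2) - ε + t = t / 2 - ε by ring,
    show -(t / 2) + ε + t = t / 2 + ε by ring] at h
  exact h

theorem perHol_leadJump (ht : 0 < t) (hε : 0 < ε) (hεt : ε < t / 2)
    (hσ : PerHol (-(t / 2) - ε) (t / 2 + ε) σ) (N : ℕ) :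
    PerHol (t / 2 - ε) (t / 2 + ε) (leadJump t D σ N) :=
  (perHol_leadTerm_lower ht hε hεt hσ N).sub (perHol_leadTerm_upper ht hε hεt hσ N)

/-- The corrected leading term is a section of order `N + 1` with an explicit leading coefficient:
the correction cancels the jump across `γ` and is regular at the origin. The residue at `D` absorbs
the additive period of the zeta kernel. -/
theorem exists_secNum_leadTerm_add_corr (ht : 0 < t) (hε : 0 < ε) (hεt : ε < t / 2)
    (hσ : PerHol (-(t / 2) - ε) (t / 2 + ε) σ) (N : ℕ) :
    ∃ g, SecNum t D (ε / 2) (N + 1) (fun p => leadTerm t D σ N p + corr t D ε σ N p) g ∧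
      g 0 = exp (σ 0) * (expEll (t * I) ^ N)⁻¹ *
        ((-(2 * Real.pi * I)) ^ (N + 1) * (1 - ex (-D))) := by
  have hκ := isCauchyKernel_zetaKernel ht
  have hJ := perHol_leadJump (D := D) ht hε hεt hσ N
  obtain ⟨g, hg, hgeq, hg0⟩ := exists_leadTerm_num ht hε hεt D hσ N
  obtain ⟨K, hK, hKeq⟩ := hκ.exists_pole_factor D
  have hcs := perHol_csol hε (by linarith) hκ hJ
  have h1 := perHol_one_sub_ex (a := -(t / 2) - ε / 2) (b := t / 2 + ε / 2) 0
  simp only [sub_zero] at h1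
  set c := (2 * Real.pi * I : ℂ)⁻¹ * lineInt (leadJump t D σ N) (t / 2 - ε / 2) with hc
  refine ⟨fun p => g p + (1 - ex p) ^ (N + 1) *
    ((1 - ex (p - D)) * csol t ε (zetaKernel (t * I)) (leadJump t D σ N) p - c * K p),
    ⟨?_, fun p hp h2 h3 => ?_, fun p h2 h3 => ?_⟩, ?_⟩
  · exact (hg.mono (by linarith) (by linarith)).add ((h1.pow _).mul
      (((perHol_one_sub_ex (D : ℂ)).mul hcs).sub
        ((hK.mono (by linarith) (by linarith)).const_mul c)))
  · have h4 : (1 - ex p) ^ (N + 1) ≠ 0 := pow_ne_zero _ (sub_ne_zero.2 h2.symm)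
    have h5 : 1 - ex (p - D) ≠ 0 := sub_ne_zero.2 h3.symm
    rw [hgeq p ⟨by linarith [hp.1], by linarith [hp.2]⟩, corr,
      hKeq p ⟨by linarith [hp.1], by linarith [hp.2]⟩ h3, mul_right_comm, ← hc]
    field_simp
  · have h4 := csol_sub_tau hε (by linarith) hκ hJ (e := 1) (b := 1) (fun z hz1 hz2 => by
      rw [zetaKernel_sub_tau ht]
      · ring
      · intro h
        have habs : |z.im| < t := by rw [abs_of_pos hz1]; exact hz2
        exact ex_ne_one_of_im_ne_zero hz1.ne'
          ((inLattice_of_im ht habs).1 ((theta1_eq_zero_iff ht).1 h))) ⟨h2, h3⟩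
    have h5 : zetaKernel (t * I) (p - t * I - D) = zetaKernel (t * I) (p - D) + 2 * Real.pi * I := by
      rw [sub_right_comm]
      refine zetaKernel_sub_tau ht fun h => ?_
      have e1 : (p - D).im = p.im := by simp
      have habs : |(p - D).im| < t := by rw [e1, abs_of_pos (by linarith)]; linarith
      exact ex_ne_one_of_im_ne_zero (by rw [e1]; linarith)
        ((inLattice_of_im ht habs).1 ((theta1_eq_zero_iff ht).1 h))
    simp only [corr]
    rw [h4, h5]
    have h6 : leadJump t D σ N p = leadTerm t D σ N (p - t * I) - leadTerm t D σ N p := rfl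
    rw [h6]
    have h7 := two_pi_I_ne_zero
    field_simp
    ring
  · simp only [ex_zero, sub_self]
    rw [zero_pow (Nat.succ_ne_zero N), zero_mul, add_zero, hg0]

theorem lineInt_leadJump (ht : 0 < t) (hε : 0 < ε) (hεt : ε < t / 2)
    (hσ : PerHol (-(t / 2) - ε) (t / 2 + ε) σ) (N : ℕ) {a : ℝ} (ha : 0 < a) (haε : a < ε) :
    lineInt (leadJump t D σ N) (t / 2 - ε / 2)
      = lineInt (fun q => leadTerm t D σ N (q - t * I)) (t / 2 - a)
        - lineInt (leadTerm t D σ N) (t / 2 + a) := by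
  have h1 := perHol_leadTerm_upper (D := D) ht hε hεt hσ N
  have h2 := perHol_leadTerm_lower (D := D) ht hε hεt hσ N
  unfold leadJump
  rw [lineInt_sub (f := fun q => leadTerm t D σ N (q - t * I))
    (h2.continuous_line (by linarith) (by linarith))
    (h1.continuous_line (by linarith) (by linarith)),
    h2.lineInt_eq (d := t / 2 - a) ⟨by linarith, by linarith⟩ ⟨by linarith, by linarith⟩,
    h1.lineInt_eq (d := t / 2 + a) ⟨by linarith, by linarith⟩ ⟨by linarith, by linarith⟩]

/-- Away from `γ` the correction equals its contour-shifted form. -/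
theorem corr_eq_corrErr (ht : 0 < t) (hε : 0 < ε) (hεt : ε < t / 2)
    (hσ : PerHol (-(t / 2) - ε) (t / 2 + ε) σ) (N : ℕ) {a : ℝ} (ha : 0 < a) (haε : a < ε) {p : ℂ}
    (hp : |p.im| < t / 2 - a) : corr t D ε σ N p = corrErr t D a σ N p := by
  have hκ := isCauchyKernel_zetaKernel ht
  have hJ := perHol_leadJump (D := D) ht hε hεt hσ N
  have h1 := perHol_leadTerm_upper (D := D) ht hε hεt hσ N
  have h2 := perHol_leadTerm_lower (D := D) ht hε hεt hσ N
  rw [abs_lt] at hp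
  rw [corr, corrErr, lineInt_leadJump ht hε hεt hσ N ha haε,
    csol_eq hε (by linarith) hκ hJ (c := t / 2) ⟨by linarith, by linarith⟩
      ⟨by linarith, by linarith⟩ ⟨by linarith, by linarith⟩]
  congr 1
  unfold leadJump
  rw [ctr_sub (f := fun q => leadTerm t D σ N (q - t * I)) hκ ⟨by linarith, by linarith⟩
    (h2.continuous_line (by linarith) (by linarith))
    (h1.continuous_line (by linarith) (by linarith)),
    ctr_eq_of_lt hκ h2 (d := t / 2 - a) ⟨by linarith, by linarith⟩ ⟨by linarith, by linarith⟩
      ⟨by linarith, by linarith⟩ ⟨by linarith, by linarith⟩,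
    ctr_eq_of_lt hκ h1 (d := t / 2 + a) ⟨by linarith, by linarith⟩ ⟨by linarith, by linarith⟩
      ⟨by linarith, by linarith⟩ ⟨by linarith, by linarith⟩]

/-- On `γ`, moving the line for the translated leading term across the point contributes a residue:
the second boundary value of the leading term. -/
theorem corr_eq_on_gamma (ht : 0 < t) (hε : 0 < ε) (hεt : ε < t / 2)
    (hσ : PerHol (-(t / 2) - ε) (t / 2 + ε) σ) (N : ℕ) {a : ℝ} (ha : 0 < a) (haε : a < ε) {p : ℂ}
    (hp : p.im = t / 2) :
    corr t D ε σ N p = leadTerm t D σ N (p - t * I) + corrErr t D a σ N p := by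
  have hκ := isCauchyKernel_zetaKernel ht
  have hJ := perHol_leadJump (D := D) ht hε hεt hσ N
  have h1 := perHol_leadTerm_upper (D := D) ht hε hεt hσ N
  have h2 := perHol_leadTerm_lower (D := D) ht hε hεt hσ N
  rw [corr, corrErr, lineInt_leadJump ht hε hεt hσ N ha haε,
    csol_eq hε (by linarith) hκ hJ (c := t / 2 + a) ⟨by linarith, by linarith⟩
      ⟨by linarith, by linarith⟩ ⟨by linarith, by linarith⟩, ← add_sub_assoc]
  congr 1
  unfold leadJump
  rw [ctr_sub (f := fun q => leadTerm t D σ N (q - t * I)) hκ ⟨by linarith, by linarith⟩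
    (h2.continuous_line (by linarith) (by linarith))
    (h1.continuous_line (by linarith) (by linarith)),
    ctr_jump hκ h2 (c := t / 2 - a) (d := t / 2 + a) ⟨by linarith, by linarith⟩
      ⟨by linarith, by linarith⟩ (by linarith) (by linarith), add_sub_assoc]

end

/-! ### Geometric decay of the correction -/

theorem exists_forall_le_of_periodic {h : ℝ → ℝ} (hc : Continuous h) (hp : Function.Periodic h 1) :
    ∃ s₀, ∀ s, h s ≤ h s₀ := by
  obtain ⟨s₀, -, hs⟩ := (isCompact_Icc (a := (0 : ℝ)) (b := 1)).exists_isMaxOn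
    (Set.nonempty_Icc.2 zero_le_one) hc.continuousOn
  refine ⟨s₀, fun s => ?_⟩
  obtain ⟨y, hy, hsy⟩ := hp.exists_mem_Ico₀ one_pos s
  rw [hsy]
  exact hs ⟨hy.1, hy.2.le⟩

theorem continuous_gLower_line {t c : ℝ} (ht : 0 < t) (hc : |c| < t) (hc0 : c ≠ 0) :
    Continuous fun s : ℝ => gLower (t * I) (s + c * I) := by
  have him : ∀ s : ℝ, ((s : ℂ) + c * I).im = c := fun s => by simp
  refine continuous_iff_continuousAt.2 fun s => ?_
  have h1 : ContinuousAt (gUpper (t * I)) (s + c * I) :=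
    (differentiableAt_gUpper ht (by rwa [him])).continuousAt
  have h2 : gLower (t * I) = fun p => (gUpper (t * I) p)⁻¹ := funext fun p => by
    rw [gUpper_eq_inv, inv_inv]
  have h3 : ContinuousAt (gLower (t * I)) (s + c * I) := by
    rw [h2]
    exact h1.inv₀ (gUpper_ne_zero ht (by rwa [him]) (ex_ne_one_of_im_ne_zero (by rwa [him])))
  exact ContinuousAt.comp (f := fun s : ℝ => (s : ℂ) + c * I) h3 (by fun_prop)

/-- Compactness on the two lines makes the bound `|e^{g - ℓ}| < 1` beyond `γ` uniform. -/
theorem exists_norm_gLower_le {t a : ℝ} (ht : 0 < t) (ha : 0 < a) (hat : a < t / 2) :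
    ∃ ρ : ℝ, 0 < ρ ∧ ρ < 1 ∧ ∀ p : ℂ, (p.im = t / 2 + a ∨ p.im = -(t / 2) - a) →
      ‖gLower (t * I) p‖ ≤ ρ := by
  have key : ∀ c : ℝ, t / 2 < |c| → |c| < t → ∃ ρ : ℝ, ρ < 1 ∧ ∀ p : ℂ, p.im = c →
      ‖gLower (t * I) p‖ ≤ ρ := by
    intro c h1 h2
    obtain ⟨s₀, hs⟩ := exists_forall_le_of_periodic
      (continuous_gLower_line ht h2 (by rintro rfl; simp at h1; linarith)).norm fun s => by
        rw [ofReal_add, ofReal_one, add_right_comm, gLower_add_one, norm_neg]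
    refine ⟨_, norm_gLower_lt_one ht (p := s₀ + c * I) (by simpa using h1)
      (by simp; linarith), fun p hp => ?_⟩
    have := hs p.re
    rwa [← hp, re_add_im, hp] at this
  obtain ⟨ρ₁, h1, h1'⟩ := key (t / 2 + a) (by rw [abs_of_pos] <;> linarith)
    (by rw [abs_of_pos] <;> linarith)
  obtain ⟨ρ₂, h2, h2'⟩ := key (-(t / 2) - a) (by rw [abs_of_neg] <;> linarith)
    (by rw [abs_of_neg] <;> linarith)
  refine ⟨max (1 / 2) (max ρ₁ ρ₂), lt_max_of_lt_left (by norm_num),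
    max_lt (by norm_num) (max_lt h1 h2), ?_⟩
  rintro p (hp | hp)
  · exact (h1' p hp).trans ((le_max_left _ _).trans (le_max_right _ _))
  · exact (h2' p hp).trans ((le_max_right _ _).trans (le_max_right _ _))

theorem exists_norm_modelF_le {t D c : ℝ} (ht : 0 < t) (hc : |c| < 2 * t) (hc0 : c ≠ 0) :
    ∃ C : ℝ, 0 ≤ C ∧ ∀ (n : ℕ) (p : ℂ), p.im = c → ‖modelF (t * I) D n p‖ ≤ C := by
  obtain ⟨A, hA, -, -, hAeq⟩ := exists_modelF_factor ht D
  rw [abs_lt] at hc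
  have him : ∀ s : ℝ, ((s : ℂ) + c * I).im = c := fun s => by simp
  have key : ∀ n, ∃ C : ℝ, 0 ≤ C ∧ ∀ p : ℂ, p.im = c → ‖modelF (t * I) D n p‖ ≤ C := by
    intro n
    have hcont : Continuous fun s : ℝ => modelF (t * I) D n (s + c * I) := by
      have h1 : ∀ s : ℝ, modelF (t * I) D n (s + c * I)
          = exp (-(Real.pi * I * parity n * (s + c * I))) * A n (s + c * I) /
            ((1 - ex (s + c * I - (0 : ℝ))) * (1 - ex (s + c * I - D))) := fun s => by
        rw [hAeq n _ ⟨by rw [him]; linarith, by rw [him]; linarith⟩, ofReal_zero, sub_zero]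
      simp only [h1]
      have h2 : ∀ x : ℝ, Continuous fun s : ℝ => 1 - ex (s + c * I - x) := fun x => by
        have := differentiable_ex.continuous
        exact continuous_const.sub (this.comp (by fun_prop))
      have hne : ∀ (x : ℝ) (s : ℝ), 1 - ex (s + c * I - x) ≠ 0 := fun x s =>
        sub_ne_zero.2 (ex_sub_ofReal_ne_one x (by rwa [him])).symm
      exact ((by fun_prop : Continuous _).mul ((hA n).continuous_line (by linarith)
        (by linarith))).div ((h2 0).mul (h2 D)) fun s => mul_ne_zero (hne 0 s) (hne D s)
    obtain ⟨s₀, hs⟩ := exists_forall_le_of_periodic hcont.norm fun s => by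
      rw [ofReal_add, ofReal_one, add_right_comm, modelF_add_one, norm_mul, norm_pow, norm_neg,
        norm_one, one_pow, one_mul]
    refine ⟨‖modelF (t * I) D n (s₀ + c * I)‖, norm_nonneg _, fun p hp => ?_⟩
    have := hs p.re
    rwa [← hp, re_add_im, hp] at this
  obtain ⟨C₀, h0, h0'⟩ := key 0
  obtain ⟨C₁, h1, h1'⟩ := key 1
  refine ⟨max C₀ C₁, le_max_of_le_left h0, fun n p hp => ?_⟩
  rcases Nat.even_or_odd n with hn | hn
  · rw [modelF_congr (m := 0) (by simpa using hn)]
    exact (h0' p hp).trans (le_max_left _ _)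
  · rw [modelF_congr (m := 1) (by simpa using hn)]
    exact (h1' p hp).trans (le_max_right _ _)

section

variable {t ε D : ℝ} {σ : ℂ → ℂ}

theorem exists_norm_leadTerm_le (ht : 0 < t) (hεt : ε < t / 2)
    (hσ : PerHol (-(t / 2) - ε) (t / 2 + ε) σ) {a : ℝ} (ha : 0 < a) (haε : a < ε) :
    ∃ C ρ : ℝ, 0 ≤ C ∧ 0 < ρ ∧ ρ < 1 ∧ ∀ (N : ℕ) (p : ℂ),
      (p.im = t / 2 + a ∨ p.im = -(t / 2) - a) → ‖leadTerm t D σ N p‖ ≤ C * ρ ^ N := by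
  obtain ⟨ρ, h0, h1, hρ⟩ := exists_norm_gLower_le ht ha (by linarith)
  obtain ⟨C₁, hC₁, h2⟩ := exists_norm_modelF_le (D := D) (c := t / 2 + a) ht
    (by rw [abs_of_pos] <;> linarith) (by linarith)
  obtain ⟨C₂, hC₂, h3⟩ := exists_norm_modelF_le (D := D) (c := -(t / 2) - a) ht
    (by rw [abs_of_neg] <;> linarith) (by linarith)
  obtain ⟨C₃, hC₃, h4⟩ := hσ.exp_comp.exists_bound (a' := -(t / 2) - a) (b' := t / 2 + a)
    (by linarith) (by linarith)
  refine ⟨max C₁ C₂ * C₃, ρ, by positivity, h0, h1, fun N p hp => ?_⟩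
  rw [leadTerm, norm_mul, norm_mul, norm_pow]
  have e1 : ‖modelF (t * I) D (N + 1) p‖ ≤ max C₁ C₂ := by
    rcases hp with hp | hp
    · exact (h2 _ p hp).trans (le_max_left _ _)
    · exact (h3 _ p hp).trans (le_max_right _ _)
  have e2 : ‖exp (σ p)‖ ≤ C₃ := h4 p (by rcases hp with hp | hp <;> linarith)
    (by rcases hp with hp | hp <;> linarith)
  have e3 := hρ p hp
  gcongr

/-- On the part of the annulus away from `γ`, and on `γ` itself, the correction decays
geometrically. -/
theorem exists_norm_corrErr_le (ht : 0 < t) (hεt : ε < t / 2)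
    (hσ : PerHol (-(t / 2) - ε) (t / 2 + ε) σ) {a b : ℝ} (ha : 0 < a) (haε : a < ε) (hab : a < b) :
    ∃ C ρ : ℝ, 0 < C ∧ 0 < ρ ∧ ρ < 1 ∧ ∀ (N : ℕ) (p : ℂ), (|p.im| ≤ t / 2 - b ∨ p.im = t / 2) →
      ex (p - D) ≠ 1 → ‖corrErr t D a σ N p‖ * ‖1 - ex (p - D)‖ ≤ C * ρ ^ N := by
  have hκ := isCauchyKernel_zetaKernel ht
  obtain ⟨C, ρ, hC, hρ0, hρ1, hΦ⟩ := exists_norm_leadTerm_le (D := D) ht hεt hσ ha haε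
  obtain ⟨K, hK, hKeq⟩ := hκ.exists_pole_factor D
  set η := min (b - a) a with hη
  have hη0 : 0 < η := lt_min (by linarith) ha
  have hη1 : η ≤ b - a := min_le_left _ _
  have hη2 : η ≤ a := min_le_right _ _
  obtain ⟨C₁, hC₁, h1⟩ := hκ.perHol_left.exists_bound (a' := -t + η) (b' := -η) (by linarith)
    (by linarith)
  obtain ⟨C₂, hC₂, h2⟩ := hκ.perHol_right.exists_bound (a' := η) (b' := t - η) (by linarith)
    (by linarith)
  obtain ⟨C₃, hC₃, h3⟩ := hK.exists_bound (a' := -(t / 2)) (b' := t / 2) (by linarith) (by linarith)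
  obtain ⟨C₄, hC₄, h4⟩ := (perHol_one_sub_ex (a := -t) (b := t) (D : ℂ)).exists_bound
    (a' := -(t / 2)) (b' := t / 2) (by linarith) (by linarith)
  set M := max C₁ C₂ with hM
  have hM0 : 0 ≤ M := le_max_of_le_left hC₁
  refine ⟨M * C * C₄ + M * C * C₄ + C₃ * (C + C) + 1, ρ, by positivity, hρ0, hρ1,
    fun N p hp hpD => ?_⟩
  have hpi : ‖(2 * Real.pi * I : ℂ)⁻¹‖ ≤ 1 := by
    rw [norm_inv, norm_mul, norm_mul, norm_I, mul_one, norm_real, Real.norm_eq_abs,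
      abs_of_pos Real.pi_pos, Complex.norm_ofNat]
    exact inv_le_one_of_one_le₀ (by nlinarith [Real.pi_gt_three])
  have hp' : -(t / 2) ≤ p.im ∧ p.im ≤ t / 2 := by
    rcases hp with hp | hp
    · rw [abs_le] at hp; constructor <;> linarith
    · constructor <;> linarith
  have hker : ∀ (c s : ℝ), (c = t / 2 - a ∨ c = t / 2 + a) →
      ‖zetaKernel (t * I) (p - (s + c * I))‖ ≤ M := by
    intro c s hc
    have him : (p - (s + c * I)).im = p.im - c := by simp
    rcases hp with hp | hp
    · rw [abs_le] at hp
      refine (h1 _ ?_ ?_).trans (le_max_left _ _) <;> rw [him] <;> rcases hc with hc | hc <;> linarith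
    · rcases hc with hc | hc
      · refine (h2 _ ?_ ?_).trans (le_max_right _ _) <;> rw [him] <;> linarith
      · refine (h1 _ ?_ ?_).trans (le_max_left _ _) <;> rw [him] <;> linarith
  have hlow : ∀ s : ℝ, ‖leadTerm t D σ N (s + (t / 2 - a : ℝ) * I - t * I)‖ ≤ C * ρ ^ N := fun s =>
    hΦ N _ (Or.inr (by simp; ring))
  have hup : ∀ s : ℝ, ‖leadTerm t D σ N (s + (t / 2 + a : ℝ) * I)‖ ≤ C * ρ ^ N := fun s =>
    hΦ N _ (Or.inl (by simp))
  have e1 : ‖ctr (zetaKernel (t * I)) (fun q => leadTerm t D σ N (q - t * I)) (t / 2 - a) p‖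
      ≤ M * (C * ρ ^ N) := by
    rw [ctr, norm_mul]
    refine (mul_le_of_le_one_left (norm_nonneg _) hpi).trans (lineInt_norm_le fun s => ?_)
    rw [norm_mul]
    exact mul_le_mul (hker _ s (Or.inl rfl)) (hlow s) (norm_nonneg _) hM0
  have e2 : ‖ctr (zetaKernel (t * I)) (leadTerm t D σ N) (t / 2 + a) p‖ ≤ M * (C * ρ ^ N) := by
    rw [ctr, norm_mul]
    refine (mul_le_of_le_one_left (norm_nonneg _) hpi).trans (lineInt_norm_le fun s => ?_)
    rw [norm_mul]
    exact mul_le_mul (hker _ s (Or.inr rfl)) (hup s) (norm_nonneg _) hM0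
  have e3 : ‖lineInt (fun q => leadTerm t D σ N (q - t * I)) (t / 2 - a)
      - lineInt (leadTerm t D σ N) (t / 2 + a)‖ ≤ C * ρ ^ N + C * ρ ^ N :=
    (norm_sub_le _ _).trans (add_le_add (lineInt_norm_le hlow) (lineInt_norm_le hup))
  have h5 : 1 - ex (p - D) ≠ 0 := sub_ne_zero.2 hpD.symm
  have e4 : ‖zetaKernel (t * I) (p - D)‖ * ‖1 - ex (p - D)‖ ≤ C₃ := by
    rw [← norm_mul, hKeq p ⟨by linarith, by linarith⟩ hpD, div_mul_cancel₀ _ h5]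
    exact h3 p hp'.1 hp'.2
  have e5 := h4 p hp'.1 hp'.2
  have hρN : 0 ≤ ρ ^ N := (pow_pos hρ0 N).le
  have e6 : ‖corrErr t D a σ N p‖ ≤ M * (C * ρ ^ N) + M * (C * ρ ^ N)
      + ‖zetaKernel (t * I) (p - D)‖ * (C * ρ ^ N + C * ρ ^ N) := by
    rw [corrErr]
    refine (norm_sub_le _ _).trans (add_le_add ((norm_sub_le _ _).trans (add_le_add e1 e2)) ?_)
    rw [norm_mul, norm_mul]
    exact mul_le_mul (mul_le_of_le_one_left (norm_nonneg _) hpi) e3 (norm_nonneg _) (norm_nonneg _)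
  calc ‖corrErr t D a σ N p‖ * ‖1 - ex (p - D)‖
      ≤ (M * (C * ρ ^ N) + M * (C * ρ ^ N)
        + ‖zetaKernel (t * I) (p - D)‖ * (C * ρ ^ N + C * ρ ^ N)) * ‖1 - ex (p - D)‖ :=
        mul_le_mul_of_nonneg_right e6 (norm_nonneg _)
    _ = (M * (C * ρ ^ N) + M * (C * ρ ^ N)) * ‖1 - ex (p - D)‖
        + (‖zetaKernel (t * I) (p - D)‖ * ‖1 - ex (p - D)‖) * (C * ρ ^ N + C * ρ ^ N) := by ring
    _ ≤ (M * (C * ρ ^ N) + M * (C * ρ ^ N)) * C₄ + C₃ * (C * ρ ^ N + C * ρ ^ N) := by gcongr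
    _ ≤ (M * C * C₄ + M * C * C₄ + C₃ * (C + C) + 1) * ρ ^ N := by nlinarith

end

/-! ### The remainder -/

/-- The orthogonality data on the curve with periods `1` and `t i`, together with the analytic
extension `σ` of the Szegő function to the `ε`-neighbourhood of the period annulus. -/
structure SzegoData (t D ε : ℝ) (w σ : ℂ → ℂ) (P : ℕ → ℂ → ℂ) : Prop where
  ht : 0 < t
  hD : D ∈ Set.Ioo (0 : ℝ) 1
  hε : 0 < ε
  hεt : ε < t / 2
  hw : PerHol (t / 2 - ε) (t / 2 + ε) w
  hwr : ∀ p : ℂ, p.im = t / 2 → (w p).im = 0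
  hσ : PerHol (-(t / 2) - ε) (t / 2 + ε) σ
  hjump : ∀ p : ℂ, p.im = t / 2 → σ p + σ (p - t * I) = -w p
  hconj : ∀ p : ℂ, |p.im| ≤ t / 2 → σ ((starRingEnd ℂ) p) = (starRingEnd ℂ) (σ p)
  hP : IsMonicOrthogonal (t * I) D w P

/-- The difference between the suitably normalized orthogonal section of order `N + 1` and the
corrected leading term: a section of order `N`. -/
def remainder (t D ε : ℝ) (σ : ℂ → ℂ) (P : ℕ → ℂ → ℂ) (N : ℕ) (p : ℂ) : ℂ :=
  exp (σ 0) * (expEll (t * I) ^ N)⁻¹ * P (N + 1) p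
    - (leadTerm t D σ N p + corr t D ε σ N p)

theorem expEll_ne_zero {t : ℝ} (ht : 0 < t) : expEll (t * I) ≠ 0 := by
  intro h
  have := (expEll_pos ht).2
  rw [h] at this
  simp at this

theorem conj_eq_sub_tau {t : ℝ} {p : ℂ} (hp : p.im = t / 2) : (starRingEnd ℂ) p = p - t * I := by
  apply Complex.ext
  · simp
  · rw [conj_im, sub_im, tau_im, hp]; ring

/-- The weighted `L²` bound used in the least squares argument, in the form needed for `L¹`. -/
theorem integral_le_of_sq_le {r ω : ℝ → ℝ} (hr : Continuous r) (hω : Continuous ω)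
    (hr0 : ∀ s, 0 ≤ r s) {m M e : ℝ} (hm : 0 < m) (hmω : ∀ s, m ≤ ω s) (hωM : ∀ s, ω s ≤ M)
    (he : 0 < e)
    (h : ∫ s in (0 : ℝ)..1, r s ^ 2 * ω s ≤ e * ∫ s in (0 : ℝ)..1, r s * ω s) :
    ∫ s in (0 : ℝ)..1, r s ≤ M / m * e := by
  have hω0 : ∀ s, 0 ≤ ω s := fun s => hm.le.trans (hmω s)
  have i1 : IntervalIntegrable (fun s => r s ^ 2 * ω s) MeasureTheory.volume 0 1 :=
    ((hr.pow 2).mul hω).intervalIntegrable _ _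
  have i2 : IntervalIntegrable (fun s => 2 * e * (r s * ω s)) MeasureTheory.volume 0 1 :=
    (continuous_const.mul (hr.mul hω)).intervalIntegrable _ _
  have i3 : IntervalIntegrable (fun s => e ^ 2 * ω s) MeasureTheory.volume 0 1 :=
    (continuous_const.mul hω).intervalIntegrable _ _
  have h1 : 0 ≤ ∫ s in (0 : ℝ)..1, (r s - e) ^ 2 * ω s :=
    intervalIntegral.integral_nonneg zero_le_one fun s _ => mul_nonneg (sq_nonneg _) (hω0 s)
  have h2 : (∫ s in (0 : ℝ)..1, (r s - e) ^ 2 * ω s)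
      = (∫ s in (0 : ℝ)..1, r s ^ 2 * ω s) - 2 * e * (∫ s in (0 : ℝ)..1, r s * ω s)
        + e ^ 2 * ∫ s in (0 : ℝ)..1, ω s := by
    rw [← intervalIntegral.integral_const_mul, ← intervalIntegral.integral_const_mul,
      ← intervalIntegral.integral_sub i1 i2, ← intervalIntegral.integral_add (i1.sub i2) i3]
    refine intervalIntegral.integral_congr fun s _ => ?_
    ring
  have h3 : ∫ s in (0 : ℝ)..1, ω s ≤ M := by
    have := intervalIntegral.integral_mono_on (μ := MeasureTheory.volume) (g := fun _ => M)
      zero_le_one (hω.intervalIntegrable 0 1) (continuous_const.intervalIntegrable 0 1)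
      fun s _ => hωM s
    simpa using this
  have h4 : m * (∫ s in (0 : ℝ)..1, r s) ≤ ∫ s in (0 : ℝ)..1, r s * ω s := by
    rw [← intervalIntegral.integral_const_mul]
    refine intervalIntegral.integral_mono_on zero_le_one
      ((continuous_const.mul hr).intervalIntegrable _ _) ((hr.mul hω).intervalIntegrable _ _)
      fun s _ => ?_
    rw [mul_comm]
    exact mul_le_mul_of_nonneg_left (hmω s) (hr0 s)
  have h5 : ∫ s in (0 : ℝ)..1, r s * ω s ≤ e * M := by
    rw [h2] at h1
    have h6 : e * (∫ s in (0 : ℝ)..1, r s * ω s) ≤ e * (e * M) := by nlinarith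
    exact le_of_mul_le_mul_left h6 he
  rw [div_mul_eq_mul_div, le_div_iff₀ hm]
  linarith

theorem le_norm_one_sub_ex {p : ℂ} {y : ℝ} (hy : 0 < y) (hp : y ≤ |p.im|) :
    1 - Real.exp (-(2 * Real.pi * y)) ≤ ‖1 - ex p‖ := by
  have hpi := Real.pi_pos
  have h2 : Real.exp (-(2 * Real.pi * y)) ≤ 1 := Real.exp_le_one_iff.2 (by
    have := mul_pos hpi hy; linarith)
  rcases le_abs.1 hp with h | h
  · have h1 : ‖ex p‖ ≤ Real.exp (-(2 * Real.pi * y)) := by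
      rw [norm_ex]
      exact Real.exp_le_exp.2 (by nlinarith)
    have := norm_sub_norm_le 1 (ex p)
    rw [norm_one] at this
    linarith
  · have h1 : Real.exp (2 * Real.pi * y) ≤ ‖ex p‖ := by
      rw [norm_ex]
      exact Real.exp_le_exp.2 (by nlinarith)
    have h3 := norm_sub_norm_le (ex p) 1
    rw [norm_one, norm_sub_rev] at h3
    have h4 := Real.add_one_le_exp (2 * Real.pi * y)
    have h5 := Real.add_one_le_exp (-(2 * Real.pi * y))
    have h6 : Real.exp (-(2 * Real.pi * y)) * Real.exp (2 * Real.pi * y) = 1 := by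
      rw [← Real.exp_add]; simp
    nlinarith [Real.exp_pos (-(2 * Real.pi * y)), sq_nonneg (Real.exp (2 * Real.pi * y) - 1)]

theorem one_sub_exp_pos {y : ℝ} (hy : 0 < y) : 0 < 1 - Real.exp (-(2 * Real.pi * y)) := by
  have := mul_pos Real.pi_pos hy
  exact sub_pos.2 (Real.exp_lt_one_iff.2 (by linarith))

theorem norm_gUpper_eq_inv (τ p : ℂ) : ‖gUpper τ p‖ = ‖gLower τ p‖⁻¹ := by
  rw [gUpper_eq_inv, norm_inv]

namespace SzegoData

variable {t D ε : ℝ} {w σ : ℂ → ℂ} {P : ℕ → ℂ → ℂ}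

/-- The numerators of both terms have the same value at the origin, so the order of the difference
drops. -/
theorem exists_secNum_remainder (h : SzegoData t D ε w σ P) (N : ℕ) :
    ∃ g, SecNum t D (ε / 2) N (remainder t D ε σ P N) g := by
  have ht := h.ht
  have hε := h.hε
  have hεt := h.hεt
  obtain ⟨gP, hgP, -⟩ := (h.hP.isSection (N + 1)).exists_secNum ht h.hD (ε := ε / 2) (by linarith)
  obtain ⟨gQ, hgQ, hgQ0⟩ := exists_secNum_leadTerm_add_corr (D := D) ht hε hεt h.hσ N
  have h0 := hgP.num_zero ht (by linarith) (h.hP.monic (N + 1))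
  exact ((hgP.const_mul (exp (σ 0) * (expEll (t * I) ^ N)⁻¹)).sub hgQ).lower ht (by linarith)
    (by rw [h0, hgQ0, sub_self])

theorem continuous_w (h : SzegoData t D ε w σ P) :
    Continuous fun s : ℝ => w (s + (t / 2 : ℝ) * I) :=
  h.hw.continuous_line (by linarith [h.hε]) (by linarith [h.hε])

/-- The remainder is orthogonal to itself up to the boundary error of the corrected leading term,
hence small in `L¹(γ)`. -/
theorem exists_integral_remainder_le (h : SzegoData t D ε w σ P) :
    ∃ C ρ : ℝ, 0 < C ∧ 0 < ρ ∧ ρ < 1 ∧ (∀ N : ℕ,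
      ∫ s in (0 : ℝ)..1, ‖remainder t D ε σ P N (s + (t / 2 : ℝ) * I)‖ ≤ C * ρ ^ N) ∧
      ∀ (N : ℕ) (p : ℂ), p.im = t / 2 → ‖corrErr t D (ε / 2) σ N p‖ ≤ C * ρ ^ N := by
  have ht := h.ht
  have hε := h.hε
  have hεt := h.hεt
  have hε2 : 0 < ε / 2 := by linarith
  have hε2t : ε / 2 < t / 2 := by linarith
  obtain ⟨C, ρ, hC, hρ0, hρ1, hE⟩ := exists_norm_corrErr_le (D := D) (a := ε / 2) (b := ε) ht hεt
    h.hσ hε2 (by linarith) (by linarith)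
  have hc0 : 0 < 1 - Real.exp (-(2 * Real.pi * (t / 2))) := one_sub_exp_pos (by linarith)
  set c₀ := 1 - Real.exp (-(2 * Real.pi * (t / 2))) with hc₀
  have hE' : ∀ (N : ℕ) (p : ℂ), p.im = t / 2 → ‖corrErr t D (ε / 2) σ N p‖ ≤ C / c₀ * ρ ^ N := by
    intro N p hp
    have h1 := hE N p (Or.inr hp) (ex_sub_ofReal_ne_one D (by rw [hp]; positivity))
    have h2 : c₀ ≤ ‖1 - ex (p - D)‖ := le_norm_one_sub_ex (by linarith) (by
      rw [sub_im, ofReal_im, sub_zero, hp]; exact le_abs_self _)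
    rw [div_mul_eq_mul_div, le_div_iff₀ hc0]
    exact (mul_le_mul_of_nonneg_left h2 (norm_nonneg _)).trans h1
  obtain ⟨B, hB0, hB⟩ := h.hw.exists_bound (a' := t / 2) (b' := t / 2) (by linarith) (by linarith)
  have hBre : ∀ s : ℝ, |(w (s + (t / 2 : ℝ) * I)).re| ≤ B := fun s =>
    (abs_re_le_norm _).trans (hB _ (by simp) (by simp))
  refine ⟨max (Real.exp B / Real.exp (-B) * (C / c₀)) (C / c₀), ρ,
    lt_max_of_lt_right (div_pos hC hc0), hρ0, hρ1, fun N => ?_, fun N p hp => (hE' N p hp).trans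
    (mul_le_mul_of_nonneg_right (le_max_right _ _) (pow_pos hρ0 N).le)⟩
  obtain ⟨gR, hgR⟩ := h.exists_secNum_remainder N
  obtain ⟨gR', hgR'⟩ := hgR.conj
  obtain ⟨gP, hgP, -⟩ := (h.hP.isSection (N + 1)).exists_secNum ht h.hD (ε := ε / 2) (by linarith)
  set R := remainder t D ε σ P N with hR
  set k := exp (σ 0) * (expEll (t * I) ^ N)⁻¹ with hk
  have hcR := hgR.continuous_gamma ht hε2
  have hcR' := hgR'.continuous_gamma ht hε2
  have hcP := hgP.continuous_gamma ht hε2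
  have hcw := h.continuous_w
  have o1 := h.hP.lineInt_eq_zero ht h.hD hcw hε2 hε2t (Nat.lt_succ_self N) hgR'
  have o2 := lineInt_leadTerm (σ := σ) ht hε2 hε2t (h.hσ.mono (by linarith) (by linarith))
    h.hjump hgR'
  have hcΦ : Continuous fun s : ℝ => leadTerm t D σ N (s + (t / 2 : ℝ) * I)
      + leadTerm t D σ N (s + (t / 2 : ℝ) * I - t * I) :=
    ((perHol_leadTerm_upper ht hε hεt h.hσ N).continuous_line (by linarith) (by linarith)).add
      ((perHol_leadTerm_lower ht hε hεt h.hσ N).continuous_line (by linarith) (by linarith))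
  have him : ∀ s : ℝ, ((s : ℂ) + (t / 2 : ℝ) * I).im = t / 2 := fun s => by simp
  have hconj : ∀ s : ℝ, (starRingEnd ℂ) (R ((starRingEnd ℂ) (s + (t / 2 : ℝ) * I)))
      = (starRingEnd ℂ) (R (s + (t / 2 : ℝ) * I)) := fun s => by
    rw [conj_eq_sub_tau (him s), hgR.glue _ (by rw [him]; linarith) (by rw [him]; linarith)]
  -- On `γ` the remainder is the normalized orthogonal section, minus the two boundary values of
  -- the leading term, minus the error.
  have hdec : ∀ s : ℝ, R (s + (t / 2 : ℝ) * I) = k * P (N + 1) (s + (t / 2 : ℝ) * I)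
      - (leadTerm t D σ N (s + (t / 2 : ℝ) * I) + leadTerm t D σ N (s + (t / 2 : ℝ) * I - t * I))
      - corrErr t D (ε / 2) σ N (s + (t / 2 : ℝ) * I) := fun s => by
    rw [hR, remainder, corr_eq_on_gamma ht hε hεt h.hσ N hε2 (by linarith) (him s)]
    ring
  have hwreal : ∀ s : ℝ, exp (w (s + (t / 2 : ℝ) * I))
      = (Real.exp (w (s + (t / 2 : ℝ) * I)).re : ℂ) := fun s => by
    rw [ofReal_exp]
    congr 1
    exact Complex.ext (by simp) (by rw [h.hwr _ (him s), ofReal_im])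
  -- The conjugate of the remainder on `γ` is again the restriction of a section of order `N`. The
  -- orthogonal section and the sum of the boundary values are orthogonal to it, so only the error
  -- is left.
  have key : ((∫ s in (0 : ℝ)..1, ‖R (s + (t / 2 : ℝ) * I)‖ ^ 2 *
      Real.exp (w (s + (t / 2 : ℝ) * I)).re : ℝ) : ℂ)
      = - ∫ s in (0 : ℝ)..1, corrErr t D (ε / 2) σ N (s + (t / 2 : ℝ) * I) *
        (starRingEnd ℂ) (R (s + (t / 2 : ℝ) * I)) * exp (w (s + (t / 2 : ℝ) * I)) := by
    rw [← intervalIntegral.integral_ofReal, eq_neg_iff_add_eq_zero, ← intervalIntegral.integral_add]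
    · have o3 : lineInt (fun q => k * (P (N + 1) q * (starRingEnd ℂ) (R ((starRingEnd ℂ) q)) *
          exp (w q)) - (leadTerm t D σ N q + leadTerm t D σ N (q - t * I)) *
          (starRingEnd ℂ) (R ((starRingEnd ℂ) q)) * exp (w q)) (t / 2) = 0 := by
        rw [lineInt_sub (f := fun q => k * (P (N + 1) q * (starRingEnd ℂ) (R ((starRingEnd ℂ) q)) *
          exp (w q))) (g := fun q => (leadTerm t D σ N q + leadTerm t D σ N (q - t * I)) *
          (starRingEnd ℂ) (R ((starRingEnd ℂ) q)) * exp (w q))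
          (continuous_const.mul ((hcP.mul hcR').mul hcw.cexp))
          ((hcΦ.mul hcR').mul hcw.cexp), lineInt_const_mul, o1, o2, mul_zero, sub_zero]
      rw [← o3]
      refine intervalIntegral.integral_congr fun s _ => ?_
      simp only
      rw [hconj, ofReal_mul, ofReal_pow, ← hwreal, ← conj_mul', hdec s]
      ring
    · exact (continuous_ofReal.comp ((hcR.norm.pow 2).mul
        (Real.continuous_exp.comp (continuous_re.comp hcw)))).intervalIntegrable _ _
    · refine Continuous.intervalIntegrable ?_ _ _
      have : Continuous fun s : ℝ => corrErr t D (ε / 2) σ N (s + (t / 2 : ℝ) * I) := by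
        have h1 : ∀ s : ℝ, corrErr t D (ε / 2) σ N (s + (t / 2 : ℝ) * I)
            = k * P (N + 1) (s + (t / 2 : ℝ) * I) - (leadTerm t D σ N (s + (t / 2 : ℝ) * I) +
              leadTerm t D σ N (s + (t / 2 : ℝ) * I - t * I)) - R (s + (t / 2 : ℝ) * I) :=
          fun s => by rw [hdec s]; ring
        simp only [h1]
        exact ((continuous_const.mul hcP).sub hcΦ).sub hcR
      exact (this.mul (Complex.continuous_conj.comp hcR)).mul hcw.cexp
  have hs0 : 0 < C / c₀ * ρ ^ N := mul_pos (div_pos hC hc0) (pow_pos hρ0 N)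
  have hle := integral_le_of_sq_le (r := fun s => ‖R (s + (t / 2 : ℝ) * I)‖)
    (ω := fun s => Real.exp (w (s + (t / 2 : ℝ) * I)).re) (m := Real.exp (-B)) (M := Real.exp B)
    (e := C / c₀ * ρ ^ N) hcR.norm (Real.continuous_exp.comp (continuous_re.comp hcw))
    (fun s => norm_nonneg _) (Real.exp_pos _)
    (fun s => Real.exp_le_exp.2 (abs_le.1 (hBre s)).1)
    (fun s => Real.exp_le_exp.2 (abs_le.1 (hBre s)).2) hs0 (by
      have h1 : 0 ≤ ∫ s in (0 : ℝ)..1, ‖R (s + (t / 2 : ℝ) * I)‖ ^ 2 *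
          Real.exp (w (s + (t / 2 : ℝ) * I)).re :=
        intervalIntegral.integral_nonneg zero_le_one fun s _ => by positivity
      have h2 := congrArg norm key
      rw [norm_neg, norm_real, Real.norm_eq_abs, abs_of_nonneg h1] at h2
      rw [h2, ← intervalIntegral.integral_const_mul]
      refine intervalIntegral.norm_integral_le_of_norm_le zero_le_one (.of_forall fun s _ => ?_)
        (Continuous.intervalIntegrable (continuous_const.mul (hcR.norm.mul
          (Real.continuous_exp.comp (continuous_re.comp hcw)))) _ _)
      rw [norm_mul, norm_mul, norm_exp, RCLike.norm_conj, mul_assoc]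
      exact mul_le_mul_of_nonneg_right (hE' N _ (him s)) (by positivity))
  refine hle.trans ?_
  rw [← mul_assoc]
  exact mul_le_mul_of_nonneg_right (le_max_left _ _) (pow_pos hρ0 N).le

end SzegoData

/-! ### Pointwise bounds for the remainder -/

/-- Close to `γ` the function `e^{g - ℓ}` has modulus close to `1`. -/
theorem exists_norm_gLower_le_near {t μ η₁ : ℝ} (ht : 0 < t) (hμ : 1 < μ) (hη₁ : 0 < η₁) :
    ∃ η : ℝ, 0 < η ∧ η < η₁ ∧ η < t / 2 ∧ ∀ p : ℂ, |p.im| = t / 2 - η → ‖gLower (t * I) p‖ ≤ μ := by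
  obtain ⟨V, hV, hV0, hVeq⟩ := exists_gUpper_factor ht
  set f : ℂ → ℂ := fun z => (ex z * ((1 - ex z) * V z) ^ 2)⁻¹ with hf
  have hs : ∀ z ∈ strip 0 t, z ∈ strip (-t) t := fun z hz => ⟨by linarith [hz.1], hz.2⟩
  have h1 := perHol_one_sub_ex (a := 0) (b := t) 0
  simp only [sub_zero] at h1
  have hfp : PerHol 0 t f := by
    refine (perHol_ex.mul ((h1.mul (hV.mono (by linarith) le_rfl)).pow 2)).inv fun z hz =>
      mul_ne_zero (ex_ne_zero z) (pow_ne_zero 2 (mul_ne_zero ?_ (hV0 z (hs z hz))))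
    exact sub_ne_zero.2 (ex_ne_one_of_im_ne_zero hz.1.ne').symm
  have hfg : ∀ z ∈ strip 0 t, f z = gLower (t * I) z ^ 2 := fun z hz => by
    have h2 : gLower (t * I) z = (gUpper (t * I) z)⁻¹ := by rw [gUpper_eq_inv, inv_inv]
    have h3 : ex z = exp (Real.pi * I * z) ^ 2 := by
      rw [← exp_nat_mul, ex]; congr 1; push_cast; ring
    simp only [hf]
    rw [h2, hVeq z (hs z hz), h3, inv_pow, mul_pow (exp _)]
  obtain ⟨M, hM0, hM⟩ := hfp.deriv.exists_bound (a' := t / 4) (b' := 3 * t / 4) (by linarith)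
    (by linarith)
  set η := min (min (η₁ / 2) (t / 8)) ((μ ^ 2 - 1) / (M + 1)) with hη
  have hη0 : 0 < η := lt_min (lt_min (by linarith) (by linarith))
    (div_pos (by nlinarith) (by linarith))
  have hη1 : η ≤ η₁ / 2 := (min_le_left _ _).trans (min_le_left _ _)
  have hη2 : η ≤ t / 8 := (min_le_left _ _).trans (min_le_right _ _)
  have hη3 : M * η ≤ μ ^ 2 - 1 := by
    have h4 : η ≤ (μ ^ 2 - 1) / (M + 1) := min_le_right _ _
    rw [le_div_iff₀ (by linarith)] at h4
    nlinarith
  have key : ∀ p : ℂ, p.im = t / 2 - η → ‖gLower (t * I) p‖ ≤ μ := by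
    intro p hp
    have hq : (p + η * I).im = t / 2 := by simp [hp]
    have h5 := (convex_strip (t / 4) (3 * t / 4)).norm_image_sub_le_of_norm_deriv_le (𝕜 := ℂ)
      (f := f) (C := M) (x := p + η * I) (y := p)
      (fun z hz => hfp.differentiableAt ⟨by linarith [hz.1], by linarith [hz.2]⟩)
      (fun z hz => hM z hz.1.le hz.2.le) ⟨by rw [hq]; linarith, by rw [hq]; linarith⟩
      ⟨by rw [hp]; linarith, by rw [hp]; linarith⟩
    rw [hfg p ⟨by rw [hp]; linarith, by rw [hp]; linarith⟩,
      hfg (p + η * I) ⟨by rw [hq]; linarith, by rw [hq]; linarith⟩, sub_add_cancel_left, norm_neg,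
      norm_mul, norm_I, mul_one, norm_real, Real.norm_eq_abs, abs_of_pos hη0] at h5
    have h6 := norm_sub_norm_le (gLower (t * I) p ^ 2) (gLower (t * I) (p + η * I) ^ 2)
    rw [norm_pow, norm_pow, norm_gLower_of_im ht hq, one_pow] at h6
    refine abs_le_of_sq_le_sq' ?_ (by linarith) |>.2
    linarith
  refine ⟨η, hη0, by linarith, by linarith, fun p hp => ?_⟩
  rcases abs_choice p.im with h | h
  · exact key p (by rw [← hp, h])
  · rw [← RCLike.norm_conj, gLower_conj]
    exact key _ (by rw [conj_im, ← hp, h])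

theorem neg_one_pow_add_parity (N : ℕ) : (-1 : ℂ) ^ (N + parity (N + 1)) = 1 := by
  rw [add_comm, neg_one_pow_parity_add]

theorem norm_exp_pi_mul (m : ℕ) (p : ℂ) :
    ‖exp (Real.pi * I * m * p)‖ = Real.exp (-(Real.pi * m * p.im)) := by
  rw [norm_exp]
  congr 1
  simp

theorem parity_le_one (n : ℕ) : parity n ≤ 1 := by
  unfold parity; split_ifs <;> simp

theorem exp_parity_le {t : ℝ} (n : ℕ) {y : ℝ} (hy : |y| ≤ t / 2) :
    Real.exp (-(Real.pi * parity n * y)) ≤ Real.exp (Real.pi * t) := by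
  refine Real.exp_le_exp.2 ?_
  have h1 : (parity n : ℝ) ≤ 1 := by exact_mod_cast parity_le_one n
  have h2 : (0 : ℝ) ≤ parity n := Nat.cast_nonneg _
  have h3 := abs_le.1 hy
  have h4 : |(parity n : ℝ) * y| ≤ 1 * (t / 2) := by
    rw [abs_mul, abs_of_nonneg h2]
    exact mul_le_mul h1 hy (abs_nonneg _) zero_le_one
  have h5 := abs_le.1 h4
  nlinarith [Real.pi_pos]

theorem exp_neg_parity_le {t : ℝ} (n : ℕ) {y : ℝ} (hy : |y| ≤ t / 2) :
    Real.exp (Real.pi * parity n * y) ≤ Real.exp (Real.pi * t) := by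
  have := exp_parity_le (t := t) n (y := -y) (by rwa [abs_neg])
  rwa [mul_neg, neg_neg] at this

namespace SzegoData

variable {t D ε : ℝ} {w σ : ℂ → ℂ} {P : ℕ → ℂ → ℂ}

/-- The `L¹(γ)` bound of the remainder propagates into the annulus, against the growth of
`e^{N(g - ℓ)}`. -/
theorem exists_norm_remainder_le (h : SzegoData t D ε w σ P) :
    ∃ ρ : ℝ, 0 < ρ ∧ ρ < 1 ∧ (∃ C : ℝ, 0 < C ∧ ∀ (N : ℕ) (p : ℂ), p.im = t / 2 →
        ‖corrErr t D (ε / 2) σ N p‖ ≤ C * ρ ^ N) ∧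
      ∀ η : ℝ, 0 < η → ∃ C : ℝ, 0 < C ∧ ∀ (N : ℕ) (p : ℂ),
      |p.im| ≤ t / 2 - η → ex p ≠ 1 → ex (p - D) ≠ 1 →
      ‖remainder t D ε σ P N p‖ * ‖gUpper (t * I) p‖ ^ N * ‖1 - ex (p - D)‖ ≤ C * ρ ^ N := by
  have ht := h.ht
  have hε := h.hε
  have hεt := h.hεt
  have hε2 : 0 < ε / 2 := by linarith
  obtain ⟨C, ρ, hC, hρ0, hρ1, hR, hEr⟩ := h.exists_integral_remainder_le
  obtain ⟨V, hV, hV0, hVeq⟩ := exists_gUpper_factor ht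
  obtain ⟨B, hB0, hB⟩ := (perHol_one_sub_ex (a := -t) (b := t) (D : ℂ)).exists_bound
    (a' := -(t / 2)) (b' := t / 2) (by linarith) (by linarith)
  refine ⟨ρ, hρ0, hρ1, ⟨C, hC, hEr⟩, fun η hη => ?_⟩
  set A := Real.exp (Real.pi * t) with hA
  have hA0 : 0 < A := Real.exp_pos _
  have hK : 0 < 2 * (1 - Real.exp (-(2 * Real.pi * η)))⁻¹ :=
    mul_pos two_pos (inv_pos.2 (one_sub_exp_pos hη))
  set K := 2 * (1 - Real.exp (-(2 * Real.pi * η)))⁻¹ with hKdef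
  refine ⟨A * (K * (A * B * C)) + 1, by positivity, fun N p hp h1 h2 => ?_⟩
  obtain ⟨g, hg⟩ := h.exists_secNum_remainder N
  set R := remainder t D ε σ P N with hRdef
  set m := parity (N + 1) with hm
  -- Up to the bounded factor `e^{πimz}`, where `m ≤ 1`, the function `X` is the remainder times
  -- `e^{N(ℓ - g)} (1 - e^{2πi(z - D)})`. It is holomorphic, and the parity `m` makes it periodic.
  set X : ℂ → ℂ := fun z => exp (Real.pi * I * (N + m : ℕ) * z) * (V z ^ N * g z) with hX
  have hXp : PerHol (-(t / 2) - ε / 2) (t / 2 + ε / 2) X := by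
    refine PerHol.mul (.of_entire (by fun_prop) fun z => ?_)
      (((hV.mono (by linarith) (by linarith)).pow N).mul hg.num)
    rw [exp_pi_mul_nat_add_one, hm, neg_one_pow_add_parity, one_mul]
  have hXval : ∀ z ∈ strip (-(t / 2) - ε / 2) (t / 2 + ε / 2), ex z ≠ 1 → ex (z - D) ≠ 1 →
      X z = exp (Real.pi * I * m * z) * (R z * gUpper (t * I) z ^ N * (1 - ex (z - D))) := by
    intro z hz h3 h4
    have h5 : 1 - ex z ≠ 0 := sub_ne_zero.2 h3.symm
    have h6 : 1 - ex (z - D) ≠ 0 := sub_ne_zero.2 h4.symm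
    have h7 : exp (Real.pi * I * (N + m : ℕ) * z)
        = exp (Real.pi * I * m * z) * exp (Real.pi * I * z) ^ N := by
      rw [← exp_nat_mul, ← exp_add]; congr 1; push_cast; ring
    simp only [hX]
    rw [hg.eq_div z hz h3 h4, hVeq z ⟨by linarith [hz.1], by linarith [hz.2]⟩, h7, mul_pow, mul_pow]
    field_simp
  have hXnorm : ∀ z ∈ strip (-(t / 2) - ε / 2) (t / 2 + ε / 2), |z.im| ≤ t / 2 → z.im ≠ 0 →
      ‖gUpper (t * I) z‖ = 1 → ‖X z‖ ≤ A * B * ‖R z‖ := by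
    intro z hz h3 h4 h5
    rw [hXval z hz (ex_ne_one_of_im_ne_zero h4) (ex_sub_ofReal_ne_one D h4), norm_mul, norm_mul,
      norm_mul, norm_pow, h5, one_pow, mul_one, norm_exp_pi_mul]
    have h6 := exp_parity_le (t := t) (N + 1) h3
    have h7 := hB z (abs_le.1 h3).1 (abs_le.1 h3).2
    calc _ ≤ A * (‖R z‖ * B) := by gcongr
      _ = A * B * ‖R z‖ := by ring
  have hu : ∀ s : ℝ, ((s : ℂ) + (t / 2 : ℝ) * I).im = t / 2 := fun s => by simp
  have hl : ∀ s : ℝ, ((s : ℂ) + (-(t / 2) : ℝ) * I).im = -(t / 2) := fun s => by simp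
  have hRl : ∀ s : ℝ, R (s + (-(t / 2) : ℝ) * I) = R (s + (t / 2 : ℝ) * I) := fun s => by
    rw [← hg.glue (s + (t / 2 : ℝ) * I) (by rw [hu]; linarith) (by rw [hu]; linarith)]
    congr 1; push_cast; ring
  have hcR := hg.continuous_gamma ht hε2
  have iu : ∫ s in (0 : ℝ)..1, ‖X (s + (t / 2 : ℝ) * I)‖ ≤ A * B * (C * ρ ^ N) := by
    refine (intervalIntegral.integral_mono_on (g := fun s => A * B * ‖R (s + (t / 2 : ℝ) * I)‖)
      zero_le_one ((hXp.continuous_line (by linarith) (by linarith)).norm.intervalIntegrable _ _)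
      ((continuous_const.mul hcR.norm).intervalIntegrable _ _) fun s _ => hXnorm _ ?_ ?_ ?_ ?_).trans ?_
    · exact ⟨by rw [hu]; linarith, by rw [hu]; linarith⟩
    · rw [hu, abs_of_pos (by linarith)]
    · rw [hu]; linarith
    · rw [norm_gUpper_eq_inv, norm_gLower_of_im ht (hu s), inv_one]
    · rw [intervalIntegral.integral_const_mul]
      exact mul_le_mul_of_nonneg_left (hR N) (by positivity)
  have il : ∫ s in (0 : ℝ)..1, ‖X (s + (-(t / 2) : ℝ) * I)‖ ≤ A * B * (C * ρ ^ N) := by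
    refine (intervalIntegral.integral_mono_on (g := fun s => A * B * ‖R (s + (t / 2 : ℝ) * I)‖)
      zero_le_one ((hXp.continuous_line (by linarith) (by linarith)).norm.intervalIntegrable _ _)
      ((continuous_const.mul hcR.norm).intervalIntegrable _ _) fun s _ => ?_).trans ?_
    · rw [← hRl]
      refine hXnorm _ ?_ ?_ ?_ ?_
      · exact ⟨by rw [hl]; linarith, by rw [hl]; linarith⟩
      · rw [hl, abs_neg, abs_of_pos (by linarith)]
      · rw [hl]; linarith
      · rw [norm_gUpper_eq_inv, norm_gLower_of_im_neg ht (hl s), inv_one]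
    · rw [intervalIntegral.integral_const_mul]
      exact mul_le_mul_of_nonneg_left (hR N) (by positivity)
  have hp' := abs_le.1 hp
  have hXp' := hXp.norm_le_of_integral_le hη (p := p) (c := -(t / 2)) (d := t / 2) (by linarith)
    (by linarith) (by linarith) (by linarith) il iu
  rw [← hKdef, hXval p ⟨by linarith, by linarith⟩ h1 h2, norm_mul, norm_mul, norm_mul, norm_pow,
    norm_exp_pi_mul] at hXp'
  have h8 := exp_neg_parity_le (t := t) (N + 1) (y := p.im) (hp.trans (by linarith))
  have h9 : Real.exp (Real.pi * m * p.im) * Real.exp (-(Real.pi * m * p.im)) = 1 := by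
    rw [← Real.exp_add]; simp
  have hρN : 0 < ρ ^ N := pow_pos hρ0 N
  calc ‖R p‖ * ‖gUpper (t * I) p‖ ^ N * ‖1 - ex (p - D)‖
      = Real.exp (Real.pi * m * p.im) * (Real.exp (-(Real.pi * m * p.im)) *
        (‖R p‖ * ‖gUpper (t * I) p‖ ^ N * ‖1 - ex (p - D)‖)) := by rw [← mul_assoc, h9, one_mul]
    _ ≤ A * (K * (A * B * (C * ρ ^ N))) := by gcongr
    _ ≤ (A * (K * (A * B * C)) + 1) * ρ ^ N := by nlinarith

/-- The asymptotics of `P (N + 1)` inside the annulus. -/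
theorem exists_interior_asymptotics (h : SzegoData t D ε w σ P) {η : ℝ} (hη : 0 < η) :
    ∃ C ρ : ℝ, 0 < C ∧ 0 < ρ ∧ ρ < 1 ∧ ∀ (N : ℕ) (p : ℂ), |p.im| ≤ t / 2 - η → ex p ≠ 1 →
      ex (p - D) ≠ 1 → ∃ r : ℂ, ‖r‖ * ‖1 - ex (p - D)‖ ≤ C * ρ ^ N ∧
        P (N + 1) p = exp (-σ 0) * (modelF (t * I) D (N + 1) p + r) *
          ((expEll (t * I) * gLower (t * I) p) ^ N * exp (σ p)) := by
  have ht := h.ht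
  have hε := h.hε
  have hεt := h.hεt
  obtain ⟨ρ₁, hρ10, hρ11, -, hR⟩ := h.exists_norm_remainder_le
  obtain ⟨C₁, hC₁, hR⟩ := hR η hη
  set a := min (ε / 2) (η / 2) with ha
  have ha0 : 0 < a := lt_min (by linarith) (by linarith)
  have ha1 : a ≤ ε / 2 := min_le_left _ _
  have ha2 : a ≤ η / 2 := min_le_right _ _
  obtain ⟨C₂, ρ₂, hC₂, hρ20, hρ21, hE⟩ := exists_norm_corrErr_le (D := D) ht hεt h.hσ ha0
    (by linarith) (show a < η by linarith)
  obtain ⟨B, hB0, hB⟩ := h.hσ.neg.exp_comp.exists_bound (a' := -(t / 2)) (b' := t / 2)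
    (by linarith) (by linarith)
  refine ⟨(C₂ + C₁) * B + 1, max ρ₁ ρ₂, by positivity, lt_max_of_lt_left hρ10, max_lt hρ11 hρ21,
    fun N p hp h1 h2 => ?_⟩
  have hpt : |p.im| < t / 2 := by linarith
  have hU0 : gUpper (t * I) p ≠ 0 := gUpper_ne_zero ht (by linarith) h1
  have hUL : gLower (t * I) p = (gUpper (t * I) p)⁻¹ := by rw [gUpper_eq_inv, inv_inv]
  set W := corr t D ε σ N p with hW
  set R := remainder t D ε σ P N p with hRd
  refine ⟨(W + R) * exp (-σ p) * gUpper (t * I) p ^ N, ?_, ?_⟩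
  · have hUle : ‖gUpper (t * I) p‖ ^ N ≤ 1 :=
      pow_le_one₀ (norm_nonneg _) (norm_gUpper_lt_one ht hpt).le
    have e1 : ‖W‖ * ‖1 - ex (p - D)‖ ≤ C₂ * ρ₂ ^ N := by
      rw [hW, corr_eq_corrErr ht hε hεt h.hσ N ha0 (by linarith) (by linarith)]
      exact hE N p (Or.inl hp) h2
    have e2 : ‖R‖ * ‖gUpper (t * I) p‖ ^ N * ‖1 - ex (p - D)‖ ≤ C₁ * ρ₁ ^ N := hR N p hp h1 h2
    have e3 := hB p (by linarith [(abs_lt.1 hpt).1]) (abs_lt.1 hpt).2.le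
    have e4 : ρ₁ ^ N ≤ max ρ₁ ρ₂ ^ N := pow_le_pow_left₀ hρ10.le (le_max_left _ _) N
    have e5 : ρ₂ ^ N ≤ max ρ₁ ρ₂ ^ N := pow_le_pow_left₀ hρ20.le (le_max_right _ _) N
    have hM : 0 < max ρ₁ ρ₂ ^ N := pow_pos (lt_max_of_lt_left hρ10) N
    rw [norm_mul, norm_mul, norm_pow]
    have e6 : ‖W + R‖ * ‖gUpper (t * I) p‖ ^ N * ‖1 - ex (p - D)‖
        ≤ (C₂ + C₁) * max ρ₁ ρ₂ ^ N := by
      calc _ ≤ (‖W‖ + ‖R‖) * ‖gUpper (t * I) p‖ ^ N * ‖1 - ex (p - D)‖ := by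
            gcongr; exact norm_add_le _ _
        _ = ‖W‖ * ‖1 - ex (p - D)‖ * ‖gUpper (t * I) p‖ ^ N
            + ‖R‖ * ‖gUpper (t * I) p‖ ^ N * ‖1 - ex (p - D)‖ := by ring
        _ ≤ ‖W‖ * ‖1 - ex (p - D)‖ * 1 + C₁ * ρ₁ ^ N := by gcongr
        _ ≤ C₂ * max ρ₁ ρ₂ ^ N + C₁ * max ρ₁ ρ₂ ^ N := by
            rw [mul_one]
            exact add_le_add (e1.trans (by gcongr)) (by gcongr)
        _ = _ := by ring
    calc ‖W + R‖ * ‖exp (-σ p)‖ * ‖gUpper (t * I) p‖ ^ N * ‖1 - ex (p - D)‖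
        = (‖W + R‖ * ‖gUpper (t * I) p‖ ^ N * ‖1 - ex (p - D)‖) * ‖exp (-σ p)‖ := by ring
      _ ≤ ((C₂ + C₁) * max ρ₁ ρ₂ ^ N) * B := by gcongr
      _ ≤ ((C₂ + C₁) * B + 1) * max ρ₁ ρ₂ ^ N := by nlinarith
  · have e7 : exp (σ 0) * (expEll (t * I) ^ N)⁻¹ * P (N + 1) p = leadTerm t D σ N p + W + R := by
      rw [hRd, remainder]; ring
    have e8 : expEll (t * I) ^ N ≠ 0 := pow_ne_zero _ (expEll_ne_zero ht)
    have e9 : gUpper (t * I) p ^ N ≠ 0 := pow_ne_zero _ hU0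
    have e10 := exp_ne_zero (σ 0)
    have e11 := exp_ne_zero (σ p)
    rw [leadTerm, hUL, inv_pow] at e7
    rw [hUL, mul_pow, inv_pow, exp_neg, exp_neg]
    field_simp at e7 ⊢
    linear_combination e7

/-- The asymptotics of `P (N + 1)` on `γ`: both boundary values of the leading term contribute. -/
theorem exists_boundary_asymptotics (h : SzegoData t D ε w σ P) :
    ∃ C ρ : ℝ, 0 < C ∧ 0 < ρ ∧ ρ < 1 ∧ ∀ (N : ℕ) (p : ℂ), p.im = t / 2 →
      ∃ r : ℂ, ‖r‖ ≤ C * ρ ^ N ∧ P (N + 1) p = exp (-σ 0) * expEll (t * I) ^ N *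
        (leadTerm t D σ N p + leadTerm t D σ N (p - t * I) + r) := by
  have ht := h.ht
  have hε := h.hε
  have hεt := h.hεt
  obtain ⟨ρ, hρ0, hρ1, ⟨C, hC, hE⟩, hR⟩ := h.exists_norm_remainder_le
  -- `μ` is chosen with `ρ * μ < 1`.
  set μ := 2 / (1 + ρ) with hμ
  have hμ1 : 1 < μ := by rw [hμ, lt_div_iff₀ (by linarith)]; linarith
  have hμρ : ρ * μ < 1 := by rw [hμ, ← mul_div_assoc, div_lt_one (by linarith)]; linarith
  obtain ⟨η, hη0, hη1, hη2, hL⟩ := exists_norm_gLower_le_near ht hμ1 (show 0 < ε / 2 by linarith)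
  obtain ⟨C₁, hC₁, hR⟩ := hR η hη0
  set c := 1 - Real.exp (-(2 * Real.pi * (t / 2 - η))) with hc
  have hc0 : 0 < c := one_sub_exp_pos (by linarith)
  set K := 2 * (1 - Real.exp (-(2 * Real.pi * (η / 2))))⁻¹ with hK
  have hK0 : 0 < K := mul_pos two_pos (inv_pos.2 (one_sub_exp_pos (by linarith)))
  refine ⟨C + K * (C₁ / c), ρ * μ, by positivity, by positivity, hμρ, fun N p hp => ?_⟩
  obtain ⟨g, hg⟩ := h.exists_secNum_remainder N
  set R := remainder t D ε σ P N with hRd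
  -- Near `γ` the growth of `e^{N(g - ℓ)}` costs only the factor `μ ^ N`. The two lines on either
  -- side of `γ` then bound the remainder on `γ` by the Cauchy formula.
  have hline : ∀ q : ℂ, |q.im| = t / 2 - η → ‖R q‖ ≤ C₁ / c * (ρ * μ) ^ N := by
    intro q hq
    have hq0 : q.im ≠ 0 := fun h0 => by rw [h0, abs_zero] at hq; linarith
    have h1 := hR N q hq.le (ex_ne_one_of_im_ne_zero hq0) (ex_sub_ofReal_ne_one D hq0)
    have h2 : c ≤ ‖1 - ex (q - D)‖ := le_norm_one_sub_ex (by linarith) (by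
      rw [sub_im, ofReal_im, sub_zero, hq])
    have h3 := hL q hq
    have h4 : gUpper (t * I) q ≠ 0 :=
      gUpper_ne_zero ht (by rw [hq]; linarith) (ex_ne_one_of_im_ne_zero hq0)
    have h5 : ‖gUpper (t * I) q‖ ^ N * ‖gLower (t * I) q‖ ^ N = 1 := by
      rw [← mul_pow, norm_gUpper_eq_inv, inv_mul_cancel₀, one_pow]
      intro h6
      exact h4 (norm_eq_zero.1 (by rw [norm_gUpper_eq_inv, h6, inv_zero]))
    rw [div_mul_eq_mul_div, le_div_iff₀ hc0]
    calc ‖R q‖ * c ≤ ‖R q‖ * ‖1 - ex (q - D)‖ := by gcongr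
      _ = (‖R q‖ * ‖gUpper (t * I) q‖ ^ N * ‖1 - ex (q - D)‖) * ‖gLower (t * I) q‖ ^ N := by
          linear_combination (-(‖R q‖ * ‖1 - ex (q - D)‖)) * h5
      _ ≤ (C₁ * ρ ^ N) * μ ^ N := by gcongr
      _ = C₁ * (ρ * μ) ^ N := by rw [mul_pow]; ring
  have hRγ : ‖R p‖ ≤ K * (C₁ / c * (ρ * μ) ^ N) := by
    have hRp := hg.perHol (a := t / 2 - ε / 2) (b := t / 2 + ε / 2) (by linarith) le_rfl
      fun y h1 _ => by linarith
    have hb : ∀ d : ℝ, (d = t / 2 - η ∨ d = t / 2 + η) →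
        ∫ s in (0 : ℝ)..1, ‖R (s + d * I)‖ ≤ C₁ / c * (ρ * μ) ^ N := by
      intro d hd
      have hd' : t / 2 - ε / 2 < d ∧ d < t / 2 + ε / 2 := by
        rcases hd with rfl | rfl <;> constructor <;> linarith
      have := intervalIntegral.integral_mono_on (μ := MeasureTheory.volume)
        (f := fun s : ℝ => ‖R (s + d * I)‖)
        (g := fun _ => C₁ / c * (ρ * μ) ^ N) zero_le_one
        ((hRp.continuous_line hd'.1 hd'.2).norm.intervalIntegrable _ _)
        (continuous_const.intervalIntegrable 0 1) fun s _ => ?_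
      · simpa using this
      · have him : ((s : ℂ) + d * I).im = d := by simp
        rcases hd with hd | hd
        · exact hline _ (by rw [him, hd, abs_of_pos (by linarith)])
        · rw [← hg.glue _ (by rw [him]; linarith) (by rw [him]; linarith)]
          refine hline _ ?_
          rw [sub_im, tau_im, him, hd, abs_of_neg (by linarith)]
          ring
    exact hRp.norm_le_of_integral_le (η := η / 2) (c := t / 2 - η) (d := t / 2 + η) (by linarith)
      (by linarith) (by linarith) (by linarith) (by linarith) (hb _ (Or.inl rfl)) (hb _ (Or.inr rfl))
  refine ⟨corrErr t D (ε / 2) σ N p + R p, ?_, ?_⟩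
  · refine (norm_add_le _ _).trans ((add_le_add (hE N p hp) hRγ).trans ?_)
    have h7 : ρ ^ N ≤ (ρ * μ) ^ N := by
      refine pow_le_pow_left₀ hρ0.le ?_ N
      nlinarith
    nlinarith
  · have e8 : expEll (t * I) ^ N ≠ 0 := pow_ne_zero _ (expEll_ne_zero ht)
    have e10 := exp_ne_zero (σ 0)
    rw [hRd, remainder, corr_eq_on_gamma ht hε hεt h.hσ N (a := ε / 2) (by linarith) (by linarith) hp,
      exp_neg]
    field_simp
    ring

end SzegoData

/-! ### Asymptotics off the oval -/

namespace SzegoData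

variable {t D ε : ℝ} {w σ : ℂ → ℂ} {P : ℕ → ℂ → ℂ}

/-- The section `π_0` is the constant `1`. -/
theorem apply_zero (h : SzegoData t D ε w σ P) {p : ℂ}
    (hp : p ∈ strip (-(t / 2) - ε) (t / 2 + ε)) (h1 : ex p ≠ 1) (h2 : ex (p - D) ≠ 1) :
    P 0 p = 1 := by
  obtain ⟨g, hg, -⟩ := (h.hP.isSection 0).exists_secNum h.ht h.hD h.hεt.le
  have hg0 := hg.num_zero h.ht h.hε (h.hP.monic 0)
  have hc : SecNum t D ε 0 (fun _ => 1) (fun p => 1 - ex (p - D)) :=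
    ⟨perHol_one_sub_ex _, fun p _ _ h2 => by
      rw [pow_zero, one_mul, div_self (sub_ne_zero.2 h2.symm)], fun _ _ _ => rfl⟩
  exact sub_eq_zero.1 ((hg.sub hc).eq_zero h.ht h.hε h.hεt h.hD (by
    rw [hg0, pow_zero, one_mul, zero_sub, sub_self]) p hp h1 h2)

/-- The error of the leading term is bounded in the case `n = 0`, where `π_0 = 1`. -/
theorem exists_norm_zero_le (h : SzegoData t D ε w σ P) :
    ∃ C : ℝ, 0 ≤ C ∧ ∀ p : ℂ, |p.im| ≤ t / 2 → ex p ≠ 1 → ex (p - D) ≠ 1 →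
      ‖exp (σ 0 - σ p) * (expEll (t * I) * gLower (t * I) p) - modelF (t * I) D 0 p‖
        * ‖1 - ex (p - D)‖ ≤ C := by
  have ht := h.ht
  have hε := h.hε
  have hεt := h.hεt
  obtain ⟨V, hV, hV0, hVeq, hVe⟩ := exists_gUpper_factor_zero ht
  obtain ⟨A, hA, -, hA0, hAeq⟩ := exists_modelF_factor ht D
  have hs0 : (0 : ℂ) ∈ strip (-t) t := ⟨by simp; linarith, by simp; linarith⟩
  set Y : ℂ → ℂ := fun p => expEll (t * I) * (exp (σ 0 - σ p) * (1 - ex (p - D)) / V p) - A 0 p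
    with hY
  have hYp : PerHol (-(t / 2) - ε) (t / 2 + ε) Y :=
    (((((PerHol.const (σ 0)).sub h.hσ).exp_comp.mul (perHol_one_sub_ex (D : ℂ))).div
      (hV.mono (by linarith) (by linarith))
      fun z hz => hV0 z ⟨by linarith [hz.1], by linarith [hz.2]⟩).const_mul _).sub
        ((hA 0).mono (by linarith) (by linarith))
  obtain ⟨Y₁, hY₁, hYY⟩ := hYp.exists_div (p := 0) ⟨by simp; linarith, by simp; linarith⟩ (by
    have := hV0 0 hs0
    simp only [hY, hA0, sub_self, exp_zero, zero_sub, ← hVe]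
    field_simp
    ring)
  obtain ⟨B, hB0, hB⟩ := hY₁.exists_bound (a' := -(t / 2)) (b' := t / 2) (by linarith)
    (by linarith)
  refine ⟨Real.exp (Real.pi * t) * B, by positivity, fun p hp h1 h2 => ?_⟩
  have hp' := abs_le.1 hp
  have hps : p ∈ strip (-t) t := ⟨by linarith [hp'.1], by linarith [hp'.2]⟩
  have e1 := hYY p ⟨by linarith [hp'.1], by linarith [hp'.2]⟩
  have e2 := hVeq p hps
  have e3 := hAeq 0 p ⟨by linarith [hp'.1], by linarith [hp'.2]⟩
  have e4 : 1 - ex p ≠ 0 := sub_ne_zero.2 h1.symm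
  have e5 : 1 - ex (p - D) ≠ 0 := sub_ne_zero.2 h2.symm
  have e6 := hV0 p hps
  have e7 : gLower (t * I) p = (gUpper (t * I) p)⁻¹ := by rw [gUpper_eq_inv, inv_inv]
  have e8 : exp (Real.pi * I * p) ≠ 0 := exp_ne_zero _
  have hpar : parity 0 = 1 := by simp [parity]
  have e9 : (exp (σ 0 - σ p) * (expEll (t * I) * gLower (t * I) p) - modelF (t * I) D 0 p)
      * (1 - ex (p - D)) = (exp (Real.pi * I * p))⁻¹ * Y₁ p := by
    rw [sub_zero] at e1
    simp only [hY] at e1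
    rw [e7, e2, e3, hpar, Nat.cast_one, mul_one, exp_neg]
    field_simp at e1 ⊢
    linear_combination e1
  rw [← norm_mul, e9, norm_mul, norm_inv]
  have e10 : ‖exp (Real.pi * I * p)‖⁻¹ ≤ Real.exp (Real.pi * t) := by
    rw [norm_exp, ← Real.exp_neg, Real.exp_le_exp]
    have : (Real.pi * I * p).re = -(Real.pi * p.im) := by simp
    rw [this]
    nlinarith [Real.pi_pos]
  gcongr
  exact hB p hp'.1 hp'.2

/-- The asymptotics on the period annulus, for all `n`. -/
theorem exists_interior_asymptotics_zpow (h : SzegoData t D ε w σ P) {η : ℝ} (hη : 0 < η) :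
    ∃ C ρ : ℝ, 0 < C ∧ 0 < ρ ∧ ρ < 1 ∧ ∀ (n : ℕ) (p : ℂ), |p.im| ≤ t / 2 - η → ex p ≠ 1 →
      ex (p - D) ≠ 1 → ∃ r : ℂ, ‖r‖ * ‖1 - ex (p - D)‖ ≤ C * ρ ^ n ∧
        P n p = exp (-σ 0) * (modelF (t * I) D n p + r) *
          ((expEll (t * I) * gLower (t * I) p) ^ ((n : ℤ) - 1) * exp (σ p)) := by
  obtain ⟨C₁, ρ, hC₁, hρ0, hρ1, hN⟩ := h.exists_interior_asymptotics hη
  obtain ⟨C₀, hC₀, h0⟩ := h.exists_norm_zero_le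
  refine ⟨C₁ / ρ + C₀, ρ, by positivity, hρ0, hρ1, fun n p hp h1 h2 => ?_⟩
  have ht := h.ht
  have hp' := abs_le.1 hp
  rcases n with _ | N
  · refine ⟨_, (h0 p (by linarith) h1 h2).trans ?_, ?_⟩
    · rw [pow_zero, mul_one]
      linarith [div_pos hC₁ hρ0]
    · rw [h.apply_zero ⟨by linarith [hp'.1, h.hε], by linarith [hp'.2, h.hε]⟩ h1 h2]
      have e1 : gLower (t * I) p ≠ 0 := by
        have := gUpper_ne_zero ht (p := p) (by linarith) h1
        rw [gUpper_eq_inv] at this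
        exact fun h0 => this (by rw [h0, inv_zero])
      have e2 := expEll_ne_zero ht
      rw [add_sub_cancel, Nat.cast_zero, zero_sub, zpow_neg_one, exp_sub, exp_neg]
      have := exp_ne_zero (σ 0)
      have := exp_ne_zero (σ p)
      field_simp
  · obtain ⟨r, hr, hrP⟩ := hN N p hp h1 h2
    refine ⟨r, hr.trans ?_, ?_⟩
    · have : C₁ * ρ ^ N = C₁ / ρ * ρ ^ (N + 1) := by rw [pow_succ]; field_simp
      rw [this, add_mul]
      have : 0 ≤ C₀ * ρ ^ (N + 1) := by positivity
      linarith
    · rw [hrP, Nat.cast_succ, add_sub_cancel_right, zpow_natCast]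

end SzegoData

theorem pow_eq_exp_neg {ρ : ℝ} (hρ : 0 < ρ) (n : ℕ) :
    ρ ^ n = Real.exp (-(n * -Real.log ρ)) := by
  rw [mul_neg, neg_neg, Real.exp_nat_mul, Real.exp_log hρ]

theorem isClosed_lattice_translate {t : ℝ} (ht : 0 < t) (D : ℝ) :
    IsClosed {q : ℂ | InLattice (t * I) (q - D)} := by
  simp only [← theta1_eq_zero_iff ht]
  have := (differentiable_theta1 (τ := t * I) (by simpa using ht)).continuous
  exact isClosed_eq (this.comp (by fun_prop)) continuous_const

theorem torusDist_pos {t : ℝ} (ht : 0 < t) {D : ℝ} {p : ℂ} (hp : ¬ InLattice (t * I) (p - D)) :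
    0 < torusDist (t * I) D p :=
  ((isClosed_lattice_translate ht D).notMem_iff_infDist_pos ⟨D, 0, 0, by simp⟩).1 hp

/-- The flat distance to `D` is controlled by the factor `1 - e^{2πi(p - D)}`. -/
theorem exists_torusDist_le {t : ℝ} (ht : 0 < t) (D : ℝ) :
    ∃ C : ℝ, 0 < C ∧ ∀ p : ℂ, torusDist (t * I) D p ≤ C * ‖1 - ex (fold t p - D)‖ := by
  -- On a period rectangle the quotient `(1 - e^{2πiz}) / z` is bounded away from zero.
  set f : ℂ → ℂ := fun z => 1 - ex z with hf
  have hfd : HasDerivAt f (-(2 * Real.pi * I)) 0 := by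
    have := (hasDerivAt_ex 0).const_sub 1
    rwa [ex_zero, mul_one] at this
  have hfdiff : Differentiable ℂ f := differentiable_ex.const_sub 1
  set K : Set ℂ := Set.Icc (-(1 / 2) : ℝ) (1 / 2) ×ℂ Set.Icc (-(t / 2)) (t / 2) with hK
  have hKc : IsCompact K := isCompact_Icc.reProdIm isCompact_Icc
  have hne : ∀ z ∈ K, dslope f 0 z ≠ 0 := by
    intro z hz hz0
    by_cases h0 : z = 0
    · rw [h0, dslope_same, hfd.deriv] at hz0
      exact neg_ne_zero.2 two_pi_I_ne_zero hz0
    · rw [dslope_of_ne _ h0, slope_def_field, div_eq_zero_iff, sub_zero, or_iff_left h0] at hz0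
      simp only [hf, ex_zero, sub_self, sub_zero] at hz0
      obtain ⟨k, hk⟩ := ex_eq_one_iff.1 (sub_eq_zero.1 hz0).symm
      rw [hK, mem_reProdIm, hk, intCast_re] at hz
      have h1 : (-1 : ℝ) < k := by linarith [hz.1.1]
      have h2 : (k : ℝ) < 1 := by linarith [hz.1.2]
      have h3 : -1 < k := by exact_mod_cast h1
      have h4 : k < 1 := by exact_mod_cast h2
      exact h0 (by rw [hk, show k = 0 by lia, Int.cast_zero])
  have hcont : ContinuousOn (fun z => ‖dslope f 0 z‖) K := by
    refine ContinuousOn.norm (Continuous.continuousOn ?_)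
    rw [continuous_iff_continuousAt]
    intro z
    by_cases h0 : z = 0
    · rw [h0]
      exact continuousAt_dslope_same.2 (hfdiff 0)
    · exact (continuousAt_dslope_of_ne h0).2 (hfdiff z).continuousAt
  obtain ⟨z₀, hz₀, hmin⟩ := hKc.exists_isMinOn
    ⟨0, by rw [hK, mem_reProdIm]; simp; linarith⟩ hcont
  set c := ‖dslope f 0 z₀‖ with hc
  have hc0 : 0 < c := norm_pos_iff.2 (hne z₀ hz₀)
  refine ⟨c⁻¹, inv_pos.2 hc0, fun p => ?_⟩
  set m := round (p - D).re with hm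
  set k := round (p.im / t) with hk
  have hz : fold t p - D - m ∈ K := by
    rw [hK, mem_reProdIm]
    have h1 := abs_le.1 (abs_sub_round (p - D).re)
    have h2 := abs_le.1 (abs_fold_im_le ht p)
    have h3 : (fold t p - D - m).re = (p - D).re - m := by simp [fold]
    have h4 : (fold t p - D - m).im = (fold t p).im := by simp
    rw [h3, h4]
    exact ⟨⟨by linarith [h1.1], by linarith [h1.2]⟩, h2⟩
  have h1 : torusDist (t * I) D p ≤ ‖fold t p - D - m‖ := by
    have : (D + (m + k * (t * I)) : ℂ) ∈ {q : ℂ | InLattice (t * I) (q - D)} :=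
      ⟨m, k, by ring⟩
    refine (Metric.infDist_le_dist_of_mem this).trans (le_of_eq ?_)
    rw [dist_eq_norm, fold]
    congr 1
    ring
  have h2 : c * ‖fold t p - D - m‖ ≤ ‖1 - ex (fold t p - D)‖ := by
    have h3 : c ≤ ‖dslope f 0 (fold t p - D - m)‖ := hmin hz
    have h4 := sub_smul_dslope f 0 (fold t p - D - m)
    have h5 : ex (fold t p - D - m) = ex (fold t p - D) := by
      rw [ex_sub, ex_int, div_one]
    simp only [hf, ex_zero, sub_self, sub_zero, smul_eq_mul, h5] at h4
    rw [← h4, norm_mul, mul_comm]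
    gcongr
  rw [inv_mul_eq_div, le_div_iff₀ hc0, mul_comm]
  exact (mul_le_mul_of_nonneg_left h1 hc0.le).trans h2

/-- A compact set off the oval folds into a compact part of the open period annulus. -/
theorem exists_abs_fold_im_le {t : ℝ} (ht : 0 < t) {K : Set ℂ} (hK : IsCompact K)
    (hKγ : ∀ p ∈ K, ¬ OnGamma (t * I) p) :
    ∃ η : ℝ, 0 < η ∧ ∀ p ∈ K, |(fold t p).im| ≤ t / 2 - η := by
  rcases K.eq_empty_or_nonempty with rfl | hne
  · exact ⟨1, one_pos, by simp⟩
  have hc : ContinuousOn (fun p => |(fold t p).im|) K := fun p hp => by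
    have h1 : ContinuousAt (fun p' => p' - (round (p.im / t) : ℤ) * (t * I)) p := by fun_prop
    have h2 : ContinuousAt (fold t) p := h1.congr
      ((eventually_fold_eq ht (hKγ p hp)).mono fun _ h => h.symm)
    exact ((continuous_im.continuousAt.comp h2).abs).continuousWithinAt
  obtain ⟨p₀, hp₀, hmax⟩ := hK.exists_isMaxOn hne hc
  exact ⟨t / 2 - |(fold t p₀).im|, sub_pos.2 (abs_fold_im_lt ht (hKγ p₀ hp₀)), fun p hp => by
    have : |(fold t p).im| ≤ |(fold t p₀).im| := hmax hp
    linarith⟩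

theorem fold_sub_ofReal (t : ℝ) (p : ℂ) (D : ℝ) : fold t (p - D) = fold t p - D := by
  simp only [fold, sub_im, ofReal_im, sub_zero]
  ring

theorem SzegoData.exists_asymptotics_off_gamma {t D ε : ℝ} {w σ : ℂ → ℂ} {P : ℕ → ℂ → ℂ}
    (h : SzegoData t D ε w σ P)
    (hS : ∀ p : ℂ, ¬ OnGamma (t * I) p → szego (t * I) w p = σ (fold t p))
    {K : Set ℂ} (hK : IsCompact K) (hKγ : ∀ p ∈ K, ¬ OnGamma (t * I) p) :
    ∃ c₀ > (0 : ℝ), ∃ C : ℝ, ∀ (n : ℕ), ∀ p ∈ K,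
      ¬ InLattice (t * I) p → ¬ InLattice (t * I) (p - D) →
      ∃ r : ℂ, ‖r‖ ≤ C * Real.exp (-(n * c₀)) / torusDist (t * I) D p ∧
        P n p = exp (-szego (t * I) w 0) * (M11 (t * I) D n p + r) *
          (expG (t * I) p ^ ((n : ℤ) - 1) * exp (szego (t * I) w p)) := by
  have ht := h.ht
  obtain ⟨η, hη, hηK⟩ := exists_abs_fold_im_le ht hK hKγ
  obtain ⟨C, ρ, hC, hρ0, hρ1, hmain⟩ := h.exists_interior_asymptotics_zpow hη
  obtain ⟨C₁, hC₁, hdist⟩ := exists_torusDist_le ht D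
  have hz : szego (t * I) w 0 = σ 0 := by
    have h0 : |(0 : ℂ).im| < t / 2 := by simp [ht]
    rw [hS 0 (not_onGamma_of_abs_lt ht h0), fold_of_abs_lt ht h0]
  refine ⟨-Real.log ρ, neg_pos.2 (Real.log_neg hρ0 hρ1), C₁ * C, fun n p hp h1 h2 => ?_⟩
  have hpγ := hKγ p hp
  have him := hηK p hp
  have e1 : ex (fold t p) ≠ 1 := fun e => h1 (inLattice_fold.1
    ((inLattice_of_im ht (by linarith)).2 e))
  have e2 : ex (fold t p - D) ≠ 1 := fun e => h2 (inLattice_fold.1 (by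
    rw [fold_sub_ofReal]
    exact (inLattice_of_im ht (by simp; linarith)).2 e))
  obtain ⟨r, hr, hrP⟩ := hmain n (fold t p) him e1 e2
  refine ⟨r, ?_, ?_⟩
  · rw [le_div_iff₀ (torusDist_pos ht h2), ← pow_eq_exp_neg hρ0]
    calc ‖r‖ * torusDist (t * I) D p ≤ ‖r‖ * (C₁ * ‖1 - ex (fold t p - D)‖) := by
          gcongr; exact hdist p
      _ = C₁ * (‖r‖ * ‖1 - ex (fold t p - D)‖) := by ring
      _ ≤ C₁ * (C * ρ ^ n) := by gcongr
      _ = C₁ * C * ρ ^ n := by ring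
  · rw [hS p hpγ, hz, M11_eq ht D n hpγ, expG_eq ht hpγ, ← hrP,
      ← (h.hP.isSection n).add_lattice (fold t p) 0 (round (p.im / t)), fold]
    congr 1
    push_cast
    ring

/-! ### Asymptotics on the oval -/

theorem continuousAt_modelF {t : ℝ} (ht : 0 < t) (D : ℝ) (n : ℕ) {p : ℂ} (hp0 : p.im ≠ 0)
    (hp : |p.im| < 2 * t) : ContinuousAt (modelF (t * I) D n) p := by
  obtain ⟨A, hA, -, -, hAeq⟩ := exists_modelF_factor ht D
  have hps : p ∈ strip (-(2 * t)) (2 * t) := abs_lt.1 hp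
  have h1 : ContinuousAt (fun p => exp (-(Real.pi * I * parity n * p)) * A n p /
      ((1 - ex p) * (1 - ex (p - D)))) p := by
    refine ContinuousAt.div (ContinuousAt.mul (by fun_prop) ((hA n).continuousAt hps)) ?_ ?_
    · have := differentiable_ex.continuous
      fun_prop
    · exact mul_ne_zero (sub_ne_zero.2 (ex_ne_one_of_im_ne_zero hp0).symm)
        (sub_ne_zero.2 (ex_sub_ofReal_ne_one D hp0).symm)
  exact h1.congr (eventually_of_mem (strip_mem_nhds hps) fun q hq => (hAeq n q hq).symm)

/-- Near the oval, approached from above, folding is translation by one period. -/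
theorem tendsto_fold_above {t : ℝ} (ht : 0 < t) (s : ℝ) {f : ℂ → ℂ}
    (hf : ContinuousAt f (s - t * I / 2)) :
    Tendsto (fun ε : ℝ => f (fold t (s + t * I / 2 + ε * I))) (𝓝[>] 0) (𝓝 (f (s - t * I / 2))) := by
  have h1 : Tendsto (fun ε : ℝ => (s - t * I / 2 + ε * I : ℂ)) (𝓝[>] 0) (𝓝 (s - t * I / 2)) := by
    have : ContinuousAt (fun ε : ℝ => (s - t * I / 2 + ε * I : ℂ)) 0 := by fun_prop
    have h2 := this.tendsto
    rw [ofReal_zero, zero_mul, add_zero] at h2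
    exact h2.mono_left nhdsWithin_le_nhds
  refine (hf.tendsto.comp h1).congr' ?_
  filter_upwards [Ioo_mem_nhdsGT ht] with x hx
  have : fold t (s + t * I / 2 + x * I) = s + t * I / 2 + x * I - (1 : ℤ) * (t * I) := by
    refine fold_eq_of_abs_lt ht ?_
    have : (s + t * I / 2 + x * I : ℂ).im = t / 2 + x := by simp
    rw [this, abs_lt, Int.cast_one, one_mul]
    constructor <;> linarith [hx.1, hx.2]
  rw [this, Function.comp_apply]
  congr 1
  push_cast
  ring

theorem not_onGamma_above {t : ℝ} (ht : 0 < t) (s : ℝ) {x : ℝ} (hx : x ∈ Set.Ioo 0 t) :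
    ¬ OnGamma (t * I) (s + t * I / 2 + x * I) := by
  rintro ⟨k, hk⟩
  have h1 : (s + t * I / 2 + x * I : ℂ).im = t / 2 + x := by simp
  rw [h1, tau_im] at hk
  have h2 : x = k * t := by linarith
  have h3 : (0 : ℝ) < k := by
    by_contra! h
    nlinarith [hx.1]
  have h4 : (k : ℝ) < 1 := by
    by_contra! h
    nlinarith [hx.2]
  have h5 : 0 < k := by exact_mod_cast h3
  have h6 : k < 1 := by exact_mod_cast h4
  lia

namespace SzegoData

variable {t D ε : ℝ} {w σ : ℂ → ℂ} {P : ℕ → ℂ → ℂ}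

/-- The boundary value of the Szegő function has real part `- w / 2`. -/
theorem two_mul_re_boundary (h : SzegoData t D ε w σ P) (s : ℝ) :
    2 * (σ (s - t * I / 2)).re = -(w (s + t * I / 2)).re := by
  have him : (s + t * I / 2 : ℂ).im = t / 2 := by simp
  have h1 := h.hjump _ him
  have h2 := h.hconj _ (by rw [him, abs_of_pos (by linarith [h.ht])])
  rw [conj_eq_sub_tau him] at h2
  have h3 : (s + t * I / 2 - t * I : ℂ) = s - t * I / 2 := by ring
  rw [h3] at h1 h2
  have h4 := congrArg Complex.re h1
  have h5 := congrArg Complex.re h2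
  rw [add_re, neg_re] at h4
  rw [conj_re] at h5
  linarith

theorem exists_asymptotics_on_gamma (h : SzegoData t D ε w σ P) :
    ∃ c₀ > (0 : ℝ), ∃ C : ℝ, ∀ (n : ℕ) (s : ℝ), ∃ r : ℂ, ‖r‖ ≤ C * Real.exp (-(n * c₀)) ∧
      P n (s + t * I / 2) = 2 * (expEll (t * I) ^ ((n : ℤ) - 1) * exp (-σ 0)) *
        (((modelF (t * I) D n (s - t * I / 2) * exp (σ (s - t * I / 2)) *
          gLower (t * I) (s - t * I / 2) ^ ((n : ℤ) - 1)).re : ℂ) + r) := by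
  have ht := h.ht
  have hε := h.hε
  obtain ⟨C₁, ρ, hC₁, hρ0, hρ1, hN⟩ := h.exists_boundary_asymptotics
  obtain ⟨C₂, hC₂, hF⟩ := exists_norm_modelF_le (D := D) ht (c := -(t / 2))
    (by rw [abs_neg, abs_of_pos (by linarith)]; linarith) (by linarith)
  obtain ⟨B, hB0, hB⟩ := h.hσ.exp_comp.exists_bound (a' := -(t / 2)) (b' := t / 2)
    (by linarith) (by linarith)
  set C₃ := ‖expEll (t * I) * exp (σ 0) / 2‖ + C₂ * B with hC₃
  have hC₃0 : 0 ≤ C₃ := by positivity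
  refine ⟨-Real.log ρ, neg_pos.2 (Real.log_neg hρ0 hρ1), C₁ / ρ + C₃, fun n s => ?_⟩
  rw [← pow_eq_exp_neg hρ0]
  have him : (s + t * I / 2 : ℂ).im = t / 2 := by simp
  have him' : (s - t * I / 2 : ℂ).im = -(t / 2) := by simp
  have hE := expEll_ne_zero ht
  have hE0 := exp_ne_zero (σ 0)
  rcases n with _ | N
  · refine ⟨expEll (t * I) * exp (σ 0) / 2 - ((modelF (t * I) D 0 (s - t * I / 2) *
      exp (σ (s - t * I / 2)) * gLower (t * I) (s - t * I / 2) ^ (((0 : ℕ) : ℤ) - 1)).re : ℂ),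
      ?_, ?_⟩
    · rw [pow_zero, mul_one]
      refine (norm_sub_le _ _).trans ?_
      have e1 : ‖((modelF (t * I) D 0 (s - t * I / 2) * exp (σ (s - t * I / 2)) *
          gLower (t * I) (s - t * I / 2) ^ (((0 : ℕ) : ℤ) - 1)).re : ℂ)‖ ≤ C₂ * B := by
        rw [norm_real, Real.norm_eq_abs]
        refine (abs_re_le_norm _).trans ?_
        rw [norm_mul, norm_mul, norm_zpow, norm_gLower_of_im_neg ht him', one_zpow, mul_one]
        exact mul_le_mul (hF 0 _ him') (hB _ him'.ge (by rw [him']; linarith)) (norm_nonneg _) hC₂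
      linarith [div_pos hC₁ hρ0]
    · rw [h.apply_zero ⟨by rw [him]; linarith, by rw [him]; linarith⟩
        (ex_ne_one_of_im_ne_zero (by rw [him]; linarith))
        (ex_sub_ofReal_ne_one D (by rw [him]; linarith)), add_sub_cancel, Nat.cast_zero, zero_sub,
        zpow_neg_one, exp_neg]
      field_simp
  · obtain ⟨r, hr, hrP⟩ := hN N _ him
    refine ⟨r / 2, ?_, ?_⟩
    · have : C₁ / ρ * ρ ^ (N + 1) = C₁ * ρ ^ N := by rw [pow_succ]; field_simp
      rw [norm_div, norm_ofNat, add_mul, this]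
      have : 0 ≤ C₃ * ρ ^ (N + 1) := by positivity
      linarith [norm_nonneg r]
    · -- The two boundary values of the leading term are complex conjugates of each other.
      have e3 : (s + t * I / 2 - t * I : ℂ) = s - t * I / 2 := by ring
      have e1 : leadTerm t D σ N (s + t * I / 2)
          = (starRingEnd ℂ) (leadTerm t D σ N (s - t * I / 2)) := by
        have e2 : (starRingEnd ℂ) (s - t * I / 2 : ℂ) = s + t * I / 2 := by
          rw [← e3, ← conj_eq_sub_tau him, conj_conj]
        rw [leadTerm, leadTerm, map_mul, map_mul, map_pow, modelF_conj ht, gLower_conj, e2,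
          ← exp_conj, ← h.hconj _ (by rw [him', abs_neg, abs_of_pos (by linarith)]), e2]
      rw [hrP, e1, e3, Nat.cast_succ, add_sub_cancel_right, zpow_natCast, zpow_natCast,
        add_comm ((starRingEnd ℂ) _), add_conj, leadTerm]
      push_cast
      ring

end SzegoData

/-- Polar form of the leading term on the oval. -/
theorem re_mul_exp_mul_zpow {a S u : ℂ} {x : ℝ} (hu : ‖u‖ = 1) (hS : 2 * S.re = -x) (k : ℤ) :
    (a * exp S * u ^ k).re = ‖a‖ * Real.exp (-x / 2) * Real.cos (k * u.arg + a.arg + S.im) := by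
  have hS' : S.re = -x / 2 := by linarith
  have h1 : u = exp (u.arg * I) := by
    conv_lhs => rw [← norm_mul_exp_arg_mul_I u, hu, ofReal_one, one_mul]
  have h2 : a * exp S * u ^ k
      = (‖a‖ * Real.exp (-x / 2) : ℝ) * exp ((k * u.arg + a.arg + S.im : ℝ) * I) := by
    conv_lhs => rw [← norm_mul_exp_arg_mul_I a, h1, ← exp_int_mul, ← re_add_im S, hS', exp_add]
    push_cast
    rw [show ((k * u.arg + a.arg + S.im) * I : ℂ) = a.arg * I + S.im * I + k * (u.arg * I) by ring,
      exp_add, exp_add]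
    ring
  rw [h2, re_ofReal_mul, exp_ofReal_mul_I_re]

/-! ### Theta products with prescribed zeros on the oval -/

/-- The theta function `θ₁`, multiplied by an exponential that makes it `1`-periodic. -/
def thetaPer (t : ℝ) (y : ℂ) : ℂ := exp (Real.pi * I * y) * theta1 y (t * I)

theorem differentiable_thetaPer {t : ℝ} (ht : 0 < t) : Differentiable ℂ (thetaPer t) := by
  have := differentiable_theta1 (τ := t * I) (by simpa using ht)
  unfold thetaPer
  fun_prop

theorem thetaPer_add_one (t : ℝ) (y : ℂ) : thetaPer t (y + 1) = thetaPer t y := by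
  rw [thetaPer, theta1_add_one, mul_add, mul_one, exp_add, exp_pi_mul_I, thetaPer]
  ring

theorem thetaPer_sub_tau (t : ℝ) (y : ℂ) :
    thetaPer t (y - t * I) = -ex (y - t * I) * thetaPer t y := by
  have h := theta1_add_tau (y - t * I) (t * I)
  rw [sub_add_cancel] at h
  rw [thetaPer, thetaPer, h, ex]
  have e : exp (Real.pi * I * (y - t * I)) = exp (2 * Real.pi * I * (y - t * I)) *
      (exp (Real.pi * I * y) * exp (-(Real.pi * I * (t * I)) - 2 * Real.pi * I * (y - t * I))) := by
    rw [← exp_add, ← exp_add]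
    congr 1
    ring
  rw [e]
  ring

theorem thetaPer_conj (t : ℝ) (y : ℂ) :
    (starRingEnd ℂ) (thetaPer t y) = ex (-(starRingEnd ℂ) y) * thetaPer t ((starRingEnd ℂ) y) := by
  rw [thetaPer, thetaPer, map_mul, theta1_conj, ← exp_conj, ← mul_assoc, ex, ← exp_add]
  congr 2
  simp only [map_mul, conj_ofReal, conj_I]
  ring

theorem thetaPer_ne_zero {t : ℝ} (ht : 0 < t) {y : ℂ} (hy : |y.im| < t) (h1 : ex y ≠ 1) :
    thetaPer t y ≠ 0 :=
  mul_ne_zero (exp_ne_zero _) fun h => h1 ((inLattice_of_im ht hy).1 ((theta1_eq_zero_iff ht).1 h))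

theorem exists_thetaPer_factor {t : ℝ} (ht : 0 < t) :
    ∃ U : ℂ → ℂ, Differentiable ℂ U ∧ (∀ z, U (z + 1) = U z) ∧
      (∀ z : ℂ, |z.im| < t → U z ≠ 0) ∧ ∀ z, thetaPer t z = (1 - ex z) * U z := by
  obtain ⟨U, h1, h2, h3, h4⟩ := exists_theta1_factor ht
  refine ⟨U, h1, h2, h3, fun z => ?_⟩
  rw [thetaPer, h4, ← mul_assoc, ← exp_add, add_neg_cancel, exp_zero, one_mul]

theorem perHol_thetaPer {t a b : ℝ} (ht : 0 < t) (c : ℂ) :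
    PerHol a b (fun p => thetaPer t (p - c)) :=
  .of_entire ((differentiable_thetaPer ht).comp (by fun_prop)) fun p => by
    rw [show p + 1 - c = p - c + 1 by ring, thetaPer_add_one]

/-- A function that vanishes at the two boundary points `x ± t i / 2` of the period annulus is
divisible by the theta function with a zero there. -/
theorem PerHol.exists_div_thetaPer {t ε : ℝ} (ht : 0 < t) (hε : 0 < ε) (hεt : ε < t / 2) {g : ℂ → ℂ}
    (hg : PerHol (-(t / 2) - ε) (t / 2 + ε) g) (x : ℝ) (h1 : g (x + t * I / 2) = 0)
    (h2 : g (x - t * I / 2) = 0) :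
    ∃ h, PerHol (-(t / 2) - ε) (t / 2 + ε) h ∧
      ∀ p ∈ strip (-(t / 2) - ε) (t / 2 + ε), g p = thetaPer t (p - x - t * I / 2) * h p := by
  obtain ⟨U, hU, hU1, hU0, hUeq⟩ := exists_thetaPer_factor ht
  set a : ℂ := x + t * I / 2 with ha
  set b : ℂ := x - t * I / 2 with hb
  have ha_im : a.im = t / 2 := by simp [ha]
  have hb_im : b.im = -(t / 2) := by simp [hb]
  have has : a ∈ strip (-(t / 2) - ε) (t / 2 + ε) := ⟨by rw [ha_im]; linarith, by rw [ha_im]; linarith⟩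
  have hbs : b ∈ strip (-(t / 2) - ε) (t / 2 + ε) := ⟨by rw [hb_im]; linarith, by rw [hb_im]; linarith⟩
  have hab : a - t * I = b := by rw [ha, hb]; ring
  have hba : 1 - ex (b - a) ≠ 0 := sub_ne_zero.2 (ex_ne_one_of_im_ne_zero (by
    rw [sub_im, ha_im, hb_im]; linarith)).symm
  obtain ⟨g₁, hg₁, hgg₁⟩ := hg.exists_div has h1
  obtain ⟨g₂, hg₂, hgg₂⟩ := hg₁.exists_div hbs (by
    have := hgg₁ b hbs
    rw [h2] at this
    exact (mul_eq_zero.1 this.symm).resolve_left hba)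
  have hUp : PerHol (-(t / 2) - ε) (t / 2 + ε) (fun p => U (p - a)) :=
    .of_entire (hU.comp (by fun_prop)) fun p => by rw [show p + 1 - a = p - a + 1 by ring, hU1]
  obtain ⟨W, hW, hUW⟩ := hUp.exists_div hbs (by
    have e1 := hUeq (b - a)
    have e2 : thetaPer t (b - a) = 0 := by
      rw [show b - a = 0 - t * I by rw [← hab]; ring, thetaPer_sub_tau, hUeq 0, ex_zero]
      ring
    rw [e2] at e1
    exact (mul_eq_zero.1 e1.symm).resolve_left hba)
  -- The shift by one period exchanges the two simple zeros of the theta factor.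
  have hkey : ∀ p ∈ strip (-(t / 2) - ε) (t / 2 + ε),
      (1 - ex (p - a)) * W p = -ex (p - a) * U (p - b) := by
    intro p hp
    have hc1 : ContinuousAt (fun p => (1 - ex (p - a)) * W p) p :=
      ((perHol_one_sub_ex a).mul hW).continuousAt hp
    have hc2 : ContinuousAt (fun p => -ex (p - a) * U (p - b)) p := by
      have := differentiable_ex.continuous
      have := hU.continuous
      fun_prop
    refine tendsto_nhds_unique_of_eventuallyEq (hc1.tendsto.mono_left nhdsWithin_le_nhds)
      (hc2.tendsto.mono_left (nhdsWithin_le_nhds (s := {p}ᶜ))) ?_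
    filter_upwards [eventually_ex_sub_ne_one p b, nhdsWithin_le_nhds (strip_mem_nhds hp)] with q hq hqs
    have e1 := thetaPer_sub_tau t (q - b)
    have e2 : q - b - t * I = q - b + (b - a) := by rw [← hab]; ring
    rw [e2, sub_add_sub_cancel, hUeq, hUeq, hUW q hqs] at e1
    refine mul_left_cancel₀ (sub_ne_zero.2 hq.symm) ?_
    linear_combination e1
  have hW0 : ∀ p ∈ strip (-(t / 2) - ε) (t / 2 + ε), W p ≠ 0 := by
    intro p hp h0
    rcases lt_or_ge (-(t / 2)) p.im with hp1 | hp1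
    · refine hU0 (p - a) ?_ (by rw [hUW p hp, h0, mul_zero])
      rw [sub_im, ha_im, abs_lt]
      constructor <;> linarith [hp.2]
    · have e1 := hkey p hp
      rw [h0, mul_zero] at e1
      refine mul_ne_zero (neg_ne_zero.2 (ex_ne_zero _)) (hU0 (p - b) ?_) e1.symm
      rw [sub_im, hb_im, abs_lt]
      constructor <;> linarith [hp.1]
  refine ⟨_, hg₂.div hW hW0, fun p hp => ?_⟩
  have e1 : p - x - t * I / 2 = p - a := by rw [ha]; ring
  have e2 := hW0 p hp
  rw [e1, hUeq, hUW p hp, hgg₁ p hp, hgg₂ p hp]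
  field_simp

/-- The product of theta functions with zeros at the points `x + t i / 2` of the oval. -/
def ovalProd (t : ℝ) (xs : List ℝ) (p : ℂ) : ℂ :=
  (xs.map fun x : ℝ => thetaPer t (p - x - t * I / 2)).prod

theorem ovalProd_cons (t x : ℝ) (xs : List ℝ) (p : ℂ) :
    ovalProd t (x :: xs) p = thetaPer t (p - x - t * I / 2) * ovalProd t xs p := by
  simp [ovalProd]

theorem perHol_ovalProd {t a b : ℝ} (ht : 0 < t) (xs : List ℝ) : PerHol a b (ovalProd t xs) := by
  induction xs with
  | nil => exact (PerHol.const 1).congr fun p _ => by simp [ovalProd]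
  | cons x xs ih =>
    refine ((perHol_thetaPer ht (x + t * I / 2)).mul ih).congr fun p _ => ?_
    rw [ovalProd_cons, sub_sub]

theorem ovalProd_sub_tau (t : ℝ) (xs : List ℝ) (p : ℂ) :
    ovalProd t xs (p - t * I) =
      (-1) ^ xs.length * ex (xs.length * (p - 3 / 2 * (t * I)) - xs.sum) * ovalProd t xs p := by
  induction xs with
  | nil => simp [ovalProd, ex_zero]
  | cons x xs ih =>
    have e : ex ((x :: xs).length * (p - 3 / 2 * (t * I)) - ((x :: xs).sum : ℝ))
        = ex (p - x - t * I / 2 - t * I) * ex (xs.length * (p - 3 / 2 * (t * I)) - xs.sum) := by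
      rw [← ex_add]
      congr 1
      simp only [List.length_cons, List.sum_cons]
      push_cast
      ring
    rw [ovalProd_cons, ovalProd_cons, ih, e,
      show p - t * I - x - t * I / 2 = p - x - t * I / 2 - t * I by ring, thetaPer_sub_tau,
      List.length_cons, pow_succ]
    ring

theorem ovalProd_conj (t : ℝ) (xs : List ℝ) (p : ℂ) :
    (starRingEnd ℂ) (ovalProd t xs p) =
      (-1) ^ xs.length * ex (2 * (xs.sum - xs.length * (starRingEnd ℂ) p)) *
        ovalProd t xs ((starRingEnd ℂ) p) := by
  induction xs with
  | nil => simp [ovalProd, ex_zero]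
  | cons x xs ih =>
    set q := (starRingEnd ℂ) p with hq
    have e1 : (starRingEnd ℂ) (p - x - t * I / 2) = q - x + t * I / 2 := by
      simp only [map_sub, map_div₀, map_mul, conj_ofReal, conj_I, map_ofNat, ← hq]
      ring
    have e2 := thetaPer_sub_tau t (q - x + t * I / 2)
    have e3 : q - x + t * I / 2 - t * I = q - x - t * I / 2 := by ring
    rw [e3] at e2
    have e4 : ex (-(q - x + t * I / 2)) = ex (2 * (x - q)) * ex (q - x - t * I / 2) := by
      rw [← ex_add]
      congr 1
      ring
    have e : ex (2 * (((x :: xs).sum : ℝ) - (x :: xs).length * q))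
        = ex (2 * (x - q)) * ex (2 * (xs.sum - xs.length * q)) := by
      rw [← ex_add]
      congr 1
      simp only [List.length_cons, List.sum_cons]
      push_cast
      ring
    rw [ovalProd_cons, ovalProd_cons, map_mul, ih, e, thetaPer_conj, e1, e4, e2, List.length_cons,
      pow_succ]
    ring

theorem ovalProd_ne_zero {t : ℝ} (ht : 0 < t) (xs : List ℝ) {p : ℂ} (hp : |p.im| < t / 2) :
    ovalProd t xs p ≠ 0 := by
  have hp' := abs_lt.1 hp
  induction xs with
  | nil => simp [ovalProd]
  | cons x xs ih =>
    rw [ovalProd_cons]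
    have him : (p - x - t * I / 2).im = p.im - t / 2 := by simp
    refine mul_ne_zero (thetaPer_ne_zero ht ?_ (ex_ne_one_of_im_ne_zero ?_)) ih
    · rw [him, abs_lt]; constructor <;> linarith
    · rw [him]; linarith

theorem eventually_ovalProd_ne_zero {t : ℝ} (ht : 0 < t) (xs : List ℝ) {p : ℂ}
    (hp : -(t / 2) < p.im ∧ p.im < 3 * t / 2) : ∀ᶠ q in 𝓝[≠] p, ovalProd t xs q ≠ 0 := by
  induction xs with
  | nil => simp [ovalProd]
  | cons x xs ih =>
    filter_upwards [ih, eventually_ex_sub_ne_one p (x + t * I / 2),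
      nhdsWithin_le_nhds (strip_mem_nhds (mem_strip.2 hp))] with q h1 h2 h3
    rw [ovalProd_cons]
    refine mul_ne_zero (thetaPer_ne_zero ht ?_ (by rwa [sub_sub])) h1
    have him : (q - x - t * I / 2).im = q.im - t / 2 := by simp
    rw [him, abs_lt]
    constructor <;> linarith [h3.1, h3.2]

/-- Cancelling the theta product in a multiplicative relation across the oval. -/
theorem ovalProd_factor_sub_tau {t ε : ℝ} (ht : 0 < t) (hεt : ε < t / 2) {g h ν : ℂ → ℂ}
    (hh : PerHol (-(t / 2) - ε) (t / 2 + ε) h) {xs : List ℝ}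
    (hgh : ∀ p ∈ strip (-(t / 2) - ε) (t / 2 + ε), g p = ovalProd t xs p * h p)
    (hν : ∀ p ∈ strip (t / 2 - ε) (t / 2 + ε), ContinuousAt ν p)
    (hg : ∀ p ∈ strip (t / 2 - ε) (t / 2 + ε), g (p - t * I) = ν p * g p) :
    ∀ p ∈ strip (t / 2 - ε) (t / 2 + ε),
      (-1) ^ xs.length * ex (xs.length * (p - 3 / 2 * (t * I)) - xs.sum) * h (p - t * I)
        = ν p * h p := by
  intro p hp
  have hshift : ∀ q ∈ strip (t / 2 - ε) (t / 2 + ε),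
      q ∈ strip (-(t / 2) - ε) (t / 2 + ε) ∧ q - t * I ∈ strip (-(t / 2) - ε) (t / 2 + ε) :=
    fun q hq => by
      have := hq.1
      have := hq.2
      refine ⟨⟨by linarith, hq.2⟩, ?_, ?_⟩ <;> rw [sub_im, tau_im] <;> linarith
  have hc1 : ContinuousAt (fun q => (-1) ^ xs.length *
      ex (xs.length * (q - 3 / 2 * (t * I)) - xs.sum) * h (q - t * I)) p := by
    have := differentiable_ex.continuous
    have h1 : Continuous fun q : ℂ => ex (xs.length * (q - 3 / 2 * (t * I)) - xs.sum) :=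
      this.comp (by fun_prop)
    have h2 : ContinuousAt (fun q => h (q - t * I)) p :=
      ContinuousAt.comp (f := fun q => q - t * I) (hh.continuousAt (hshift p hp).2) (by fun_prop)
    exact (continuousAt_const.mul h1.continuousAt).mul h2
  have hc2 : ContinuousAt (fun q => ν q * h q) p := (hν p hp).mul (hh.continuousAt (hshift p hp).1)
  refine tendsto_nhds_unique_of_eventuallyEq (hc1.tendsto.mono_left nhdsWithin_le_nhds)
    (hc2.tendsto.mono_left (nhdsWithin_le_nhds (s := {p}ᶜ))) ?_
  filter_upwards [eventually_ovalProd_ne_zero ht xs (p := p) ⟨by linarith [hp.1], by linarith [hp.2]⟩,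
    nhdsWithin_le_nhds (strip_mem_nhds hp)] with q hq hqs
  have e1 := hg q hqs
  rw [hgh _ (hshift q hqs).1, hgh _ (hshift q hqs).2, ovalProd_sub_tau] at e1
  refine mul_left_cancel₀ hq ?_
  linear_combination e1

/-- Zeros on the oval are split off one at a time, until `m` of them are found or none is left. -/
theorem exists_ovalProd_factor {t ε : ℝ} (ht : 0 < t) (hε : 0 < ε) (hεt : ε < t / 2) {g ν : ℂ → ℂ}
    (hg : PerHol (-(t / 2) - ε) (t / 2 + ε) g)
    (hν : ∀ p ∈ strip (t / 2 - ε) (t / 2 + ε), ContinuousAt ν p)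
    (hgν : ∀ p ∈ strip (t / 2 - ε) (t / 2 + ε), g (p - t * I) = ν p * g p) (m : ℕ) :
    ∃ xs h, xs.length ≤ m ∧ PerHol (-(t / 2) - ε) (t / 2 + ε) h ∧
      (∀ p ∈ strip (-(t / 2) - ε) (t / 2 + ε), g p = ovalProd t xs p * h p) ∧
      (xs.length = m ∨ ∀ p : ℂ, p.im = t / 2 → h p ≠ 0) := by
  induction m with
  | zero => exact ⟨[], g, le_rfl, hg, fun p _ => by simp [ovalProd], Or.inl rfl⟩
  | succ m ih =>
    obtain ⟨xs, h, hlen, hh, hgh, hor⟩ := ih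
    by_cases hne : ∀ p : ℂ, p.im = t / 2 → h p ≠ 0
    · exact ⟨xs, h, by lia, hh, hgh, Or.inr hne⟩
    push Not at hne
    obtain ⟨p, hp, hp0⟩ := hne
    have hlen' : xs.length = m := hor.resolve_right fun hc => hc p hp hp0
    have hpx : p = p.re + t * I / 2 := by
      apply Complex.ext <;> simp [hp]
    have hps : p ∈ strip (t / 2 - ε) (t / 2 + ε) := ⟨by linarith, by linarith⟩
    have e1 := ovalProd_factor_sub_tau ht hεt hh hgh hν hgν p hps
    rw [hp0, mul_zero] at e1
    have e2 := (mul_eq_zero.1 e1).resolve_left (mul_ne_zero (pow_ne_zero _ (by norm_num))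
      (ex_ne_zero _))
    obtain ⟨h', hh', hhh⟩ := hh.exists_div_thetaPer ht hε hεt p.re (by rw [← hpx]; exact hp0) (by
      rw [show (p.re - t * I / 2 : ℂ) = p.re + t * I / 2 - t * I by ring, ← hpx]
      exact e2)
    refine ⟨p.re :: xs, h', by simp [hlen'], hh', fun q hq => ?_, Or.inl (by simp [hlen'])⟩
    rw [hgh q hq, hhh q hq, ovalProd_cons]
    ring

/-! ### Orthogonal sections are real on the oval -/

theorem isBigO_conj_monic {n : ℕ} {f : ℂ → ℂ}
    (hm : (fun p : ℂ => p ^ n * f p - 1) =O[𝓝[≠] 0] (fun p : ℂ => p)) :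
    (fun p : ℂ => p ^ n * (starRingEnd ℂ) (f ((starRingEnd ℂ) p)) - 1) =O[𝓝[≠] 0]
      (fun p : ℂ => p) := by
  have h1 : Tendsto (starRingEnd ℂ) (𝓝[≠] (0 : ℂ)) (𝓝[≠] 0) := by
    refine tendsto_nhdsWithin_iff.2 ⟨?_, ?_⟩
    · have := continuous_conj.tendsto (0 : ℂ)
      rw [map_zero] at this
      exact this.mono_left nhdsWithin_le_nhds
    · filter_upwards [self_mem_nhdsWithin] with p hp
      simpa using hp
  have h2 := hm.comp_tendsto h1
  rw [isBigO_iff] at h2 ⊢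
  obtain ⟨c, hc⟩ := h2
  refine ⟨c, hc.mono fun p hp => ?_⟩
  simp only [Function.comp_apply, RCLike.norm_conj] at hp
  rwa [← RCLike.norm_conj, map_sub, map_mul, map_pow, conj_conj, map_one]

/-- If `F` is orthogonal to its own imaginary part, with respect to a positive weight, then it is
real. -/
theorem im_eq_zero_of_integral_eq_zero {F : ℝ → ℂ} {e : ℝ → ℝ} (hF : Continuous F)
    (hper : Function.Periodic F 1) (he : Continuous e) (he0 : ∀ s, 0 < e s)
    (h : ∫ s in (0 : ℝ)..1, F s * (F s - (starRingEnd ℂ) (F s)) * e s = 0) (s : ℝ) :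
    (F s).im = 0 := by
  have hre : ∫ s in (0 : ℝ)..1, (F s).im ^ 2 * e s = 0 := by
    have h1 : ∀ s, F s * (F s - (starRingEnd ℂ) (F s)) * e s = 2 * (-((F s).im ^ 2 * e s : ℝ) +
          ((F s).re * (F s).im * e s : ℝ) * I) := by
      intro s
      have h2 := re_add_im (F s)
      rw [sub_conj]
      push_cast
      linear_combination (-(2 * (F s).im * I * e s)) * h2 + 2 * (F s).im ^ 2 * e s * I_sq
    have c1 : Continuous fun s => (-((F s).im ^ 2 * e s : ℝ) : ℂ) := by fun_prop
    have c2 : Continuous fun s => (((F s).re * (F s).im * e s : ℝ) : ℂ) * I := by fun_prop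
    simp only [h1] at h
    rw [intervalIntegral.integral_const_mul, intervalIntegral.integral_add
      (c1.intervalIntegrable _ _) (c2.intervalIntegrable _ _), intervalIntegral.integral_neg,
      intervalIntegral.integral_mul_const, intervalIntegral.integral_ofReal,
      intervalIntegral.integral_ofReal] at h
    have h3 := congrArg Complex.re h
    simpa using h3
  by_contra hne
  obtain ⟨y, hy, hys⟩ := hper.exists_mem_Ico₀ one_pos s
  rw [hys] at hne
  have := intervalIntegral.integral_pos (a := (0 : ℝ)) (b := 1)
    (f := fun s => (F s).im ^ 2 * e s) one_pos (Continuous.continuousOn (by fun_prop))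
    (fun s _ => mul_nonneg (sq_nonneg _) (he0 s).le)
    ⟨y, ⟨hy.1, hy.2.le⟩, mul_pos (by positivity) (he0 y)⟩
  rw [hre] at this
  exact this.false

namespace SzegoData

variable {t D ε : ℝ} {w σ : ℂ → ℂ} {P : ℕ → ℂ → ℂ}

theorem exp_w_eq (h : SzegoData t D ε w σ P) {p : ℂ} (hp : p.im = t / 2) :
    exp (w p) = (Real.exp (w p).re : ℂ) := by
  rw [ofReal_exp]
  congr 1
  apply Complex.ext
  · simp
  · simpa using h.hwr p hp

/-- The difference of `π_n` and its conjugate section has lower order, hence is orthogonal to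
`π_n`; this makes the imaginary part of `π_n` vanish in the mean square on `γ`. -/
theorem im_eq_zero (h : SzegoData t D ε w σ P) (n : ℕ) (s : ℝ) :
    (P n (s + (t / 2 : ℝ) * I)).im = 0 := by
  have ht := h.ht
  have hε := h.hε
  have hεt := h.hεt
  set γ : ℝ → ℂ := fun s => s + (t / 2 : ℝ) * I with hγ
  have hγim : ∀ s, (γ s).im = t / 2 := fun s => by simp [hγ]
  rcases n with _ | N
  · have him := hγim s
    change (P 0 (γ s)).im = 0
    rw [h.apply_zero ⟨by rw [him]; linarith, by rw [him]; linarith⟩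
      (ex_ne_one_of_im_ne_zero (by rw [him]; linarith))
      (ex_sub_ofReal_ne_one D (by rw [him]; linarith)), one_im]
  obtain ⟨g, hg, -⟩ := (h.hP.isSection (N + 1)).exists_secNum ht h.hD hεt.le
  obtain ⟨g', hg'⟩ := hg.conj
  have hg0 := hg.num_zero ht hε (h.hP.monic (N + 1))
  have hg0' := hg'.num_zero ht hε (isBigO_conj_monic (h.hP.monic (N + 1)))
  obtain ⟨d, hd⟩ := (hg.sub hg').lower ht hε (by rw [hg0, hg0', sub_self])
  have horth := h.hP.lineInt_eq_zero ht h.hD h.continuous_w hε hεt (Nat.lt_succ_self N) hd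
  have horth' : ∫ s in (0 : ℝ)..1, P (N + 1) (γ s) * (P (N + 1) (γ s) -
      (starRingEnd ℂ) (P (N + 1) (γ s))) * (Real.exp (w (γ s)).re : ℝ) = 0 := by
    rw [← horth]
    refine intervalIntegral.integral_congr fun s _ => ?_
    have e1 := hg.glue (γ s) (by rw [hγim]; linarith) (by rw [hγim]; linarith)
    change _ = P (N + 1) (γ s) * (P (N + 1) (γ s) -
      (starRingEnd ℂ) (P (N + 1) ((starRingEnd ℂ) (γ s)))) * exp (w (γ s))
    rw [conj_eq_sub_tau (hγim s), e1, h.exp_w_eq (hγim s)]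
  refine im_eq_zero_of_integral_eq_zero (F := fun s => P (N + 1) (γ s)) (hg.continuous_gamma ht hε)
    (fun s => ?_) (Real.continuous_exp.comp (continuous_re.comp h.continuous_w))
    (fun s => Real.exp_pos _) horth' s
  have e1 : γ (s + 1) = γ s + 1 := by simp only [hγ]; push_cast; ring
  simp only [e1, (h.hP.isSection (N + 1)).periodic_one]

end SzegoData

/-! ### Real functions on the oval with prescribed zeros -/

/-- The real trigonometric product with zeros at the points of `xs`. -/
def sinProd (xs : List ℝ) (s : ℝ) : ℝ := (xs.map fun x => Real.sin (Real.pi * (s - x))).prod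

theorem sinProd_cons (x : ℝ) (xs : List ℝ) (s : ℝ) :
    sinProd (x :: xs) s = Real.sin (Real.pi * (s - x)) * sinProd xs s := by
  simp [sinProd]

theorem continuous_sinProd (xs : List ℝ) : Continuous (sinProd xs) := by
  induction xs with
  | nil => exact (continuous_const (y := (1 : ℝ))).congr fun s => by simp [sinProd]
  | cons x xs ih =>
    have : Continuous fun s => Real.sin (Real.pi * (s - x)) * sinProd xs s := by fun_prop
    exact this.congr fun s => (sinProd_cons x xs s).symm

theorem sinProd_add_one (xs : List ℝ) (s : ℝ) :
    sinProd xs (s + 1) = (-1) ^ xs.length * sinProd xs s := by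
  induction xs with
  | nil => simp [sinProd]
  | cons x xs ih =>
    rw [sinProd_cons, sinProd_cons, ih, List.length_cons, pow_succ,
      show Real.pi * (s + 1 - x) = Real.pi * (s - x) + Real.pi by ring, Real.sin_add_pi]
    ring

theorem dense_sinProd_ne_zero (xs : List ℝ) : Dense {s | sinProd xs s ≠ 0} := by
  have hc : Set.Countable {s | sinProd xs s = 0} := by
    induction xs with
    | nil => simp [sinProd]
    | cons x xs ih =>
      refine (ih.union (Set.countable_range fun k : ℤ => x + k)).mono fun s hs => ?_
      rw [Set.mem_ofPred_eq, sinProd_cons, mul_eq_zero] at hs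
      rcases hs with hs | hs
      · obtain ⟨k, hk⟩ := Real.sin_eq_zero_iff.1 hs
        right
        refine ⟨k, ?_⟩
        have : (k : ℝ) = s - x := mul_right_cancel₀ Real.pi_ne_zero (by linarith)
        simp only [this]
        ring
      · exact Or.inl hs
  exact hc.dense_compl ℝ

/-- On the oval, the theta product is the trigonometric product up to a factor without zeros. -/
theorem exists_ovalProd_eq_sinProd {t : ℝ} (ht : 0 < t) (xs : List ℝ) :
    ∃ G : ℝ → ℂ, Continuous G ∧ (∀ s, G s ≠ 0) ∧
      ∀ s : ℝ, ovalProd t xs (s + (t / 2 : ℝ) * I) = sinProd xs s * G s := by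
  obtain ⟨U, hU, -, hU0, hUeq⟩ := exists_thetaPer_factor ht
  induction xs with
  | nil => exact ⟨fun _ => 1, continuous_const, fun _ => one_ne_zero, by simp [ovalProd, sinProd]⟩
  | cons x xs ih =>
    obtain ⟨G, hG, hG0, hGeq⟩ := ih
    have hUc := hU.continuous
    refine ⟨fun s => -(2 * I * exp (Real.pi * (s - x) * I)) * U (s - x) * G s, by fun_prop,
      fun s => mul_ne_zero (mul_ne_zero (neg_ne_zero.2 (mul_ne_zero (by simp) (exp_ne_zero _)))
        (hU0 _ (by simpa using ht))) (hG0 s), fun s => ?_⟩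
    have e1 : (s + (t / 2 : ℝ) * I - x - t * I / 2 : ℂ) = s - x := by push_cast; ring
    have e2 : 1 - ex (s - x) = Real.sin (Real.pi * (s - x)) *
        -(2 * I * exp (Real.pi * (s - x) * I)) := by
      rw [ofReal_sin, Complex.sin, ex]
      push_cast
      have h1 : exp (-(Real.pi * (s - x)) * I) * exp (Real.pi * (s - x) * I) = 1 := by
        rw [← exp_add, neg_mul, neg_add_cancel, exp_zero]
      have h2 : exp (2 * Real.pi * I * (s - x))
          = exp (Real.pi * (s - x) * I) * exp (Real.pi * (s - x) * I) := by
        rw [← exp_add]; congr 1; ring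
      rw [h2]
      linear_combination (-1 : ℂ) * h1 + (exp (-(Real.pi * (s - x)) * I) *
        exp (Real.pi * (s - x) * I) - exp (Real.pi * (s - x) * I) * exp (Real.pi * (s - x) * I)) * I_sq
    rw [ovalProd_cons, hGeq, e1, hUeq, e2, sinProd_cons]
    push_cast
    ring

/-- A real function that is the trigonometric product times a continuous factor without zeros:
the factor is real of constant sign. -/
theorem exists_real_factor {xs : List ℝ} {F : ℝ → ℝ} {G : ℝ → ℂ} (hG : Continuous G)
    (hG0 : ∀ s, G s ≠ 0) (hF : ∀ s, (F s : ℂ) = sinProd xs s * G s) :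
    ∃ Φ : ℝ → ℝ, Continuous Φ ∧ (∀ s, F s = sinProd xs s * Φ s) ∧
      ((∀ s, 0 < Φ s) ∨ ∀ s, Φ s < 0) := by
  have him : (fun s => (G s).im) = fun _ => 0 := by
    refine Continuous.ext_on (dense_sinProd_ne_zero xs) (by fun_prop) continuous_const fun s hs => ?_
    have := congrArg Complex.im (hF s)
    rw [ofReal_im, im_ofReal_mul] at this
    exact (mul_eq_zero.1 this.symm).resolve_left hs
  have hre : ∀ s, G s = (G s).re := fun s => by
    apply Complex.ext
    · simp
    · simpa using congrFun him s
  have hc : Continuous fun s => (G s).re := by fun_prop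
  have h0 : ∀ s, (G s).re ≠ 0 := fun s hs => hG0 s (by rw [hre, hs, ofReal_zero])
  refine ⟨fun s => (G s).re, hc, fun s => ?_, ?_⟩
  · have := hF s
    rw [hre s] at this
    exact_mod_cast this
  · by_contra! hcon
    obtain ⟨⟨a, ha⟩, b, hb⟩ := hcon
    obtain ⟨c, hc⟩ := mem_range_of_exists_le_of_exists_ge hc ⟨a, ha⟩ ⟨b, hb⟩
    exact h0 c hc

/-- If a periodic real function is the trigonometric product times a factor of constant sign, then
the number of its zeros is even. -/
theorem even_length_of_periodic {xs : List ℝ} {F Φ : ℝ → ℝ} (hF : ∀ s, F s = sinProd xs s * Φ s)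
    (hper : Function.Periodic F 1) (hΦ : (∀ s, 0 < Φ s) ∨ ∀ s, Φ s < 0) : Even xs.length := by
  by_contra hodd
  rw [Nat.not_even_iff_odd] at hodd
  obtain ⟨s, hs⟩ := (dense_sinProd_ne_zero xs).nonempty
  have h1 := hper s
  rw [hF, hF, sinProd_add_one, hodd.neg_one_pow] at h1
  have h2 : Φ (s + 1) + Φ s = 0 := mul_left_cancel₀ hs (by linear_combination -h1)
  rcases hΦ with h | h
  · linarith [h s, h (s + 1)]
  · linarith [h s, h (s + 1)]

/-! ### Sections with all but one zero on the oval -/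

theorem ex_nat_mul (n : ℕ) (z : ℂ) : ex (n * z) = ex z ^ n := by
  rw [ex, ex, ← exp_nat_mul]
  congr 1
  ring

theorem ex_add_int (z : ℂ) (m : ℤ) : ex (z + m) = ex z := by rw [ex_add, ex_int, mul_one]

theorem conj_ex (z : ℂ) : (starRingEnd ℂ) (ex z) = ex (-(starRingEnd ℂ) z) := by
  rw [ex, ex, ← exp_conj]
  congr 1
  simp only [map_mul, map_ofNat, conj_ofReal, conj_I]
  ring

theorem perHol_ex_nat_mul {a b : ℝ} (j : ℕ) : PerHol a b fun p => ex (j * p) :=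
  (perHol_ex.pow j).congr fun _ _ => ex_nat_mul _ _

/-- The section of `𝒪 (2j ∞ + D)` with zeros at the `2j` points of `γ` given by `xs` and at `z`;
Abel's condition reads `z + ∑ x = D` modulo `1`. -/
def ovalSec (t D z : ℝ) (j : ℕ) (xs : List ℝ) (p : ℂ) : ℂ :=
  thetaPer t (p - z) * ovalProd t xs p / (ex (j * p) * (thetaPer t (p - D) * thetaPer t p ^ (2 * j)))

theorem neg_one_pow_two_mul (j : ℕ) : (-1 : ℂ) ^ (2 * j) = 1 := by
  rw [pow_mul, neg_one_sq, one_pow]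

/-- The theta quotient is elliptic by the condition `z + ∑ x = D` modulo `1`. -/
theorem ovalSec_sub_tau (t D z : ℝ) (j : ℕ) {xs : List ℝ} (hxs : xs.length = 2 * j) {m : ℤ}
    (hz : z + xs.sum = D + m) (p : ℂ) : ovalSec t D z j xs (p - t * I) = ovalSec t D z j xs p := by
  have hz' : (z + (xs.sum : ℝ) : ℂ) = D + m := by exact_mod_cast hz
  have key : ex (p - z - t * I) * ex ((2 * j : ℕ) * (p - 3 / 2 * (t * I)) - xs.sum) * ex (j * p)
      = ex (j * (p - t * I)) * (ex (p - D - t * I) * ex ((2 * j : ℕ) * (p - t * I))) := by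
    rw [← ex_add, ← ex_add, ← ex_add, ← ex_add, ← ex_add_int _ m]
    congr 1
    push_cast
    linear_combination -hz'
  have e0 := ex_ne_zero (j * p)
  have e1 := ex_ne_zero (j * (p - t * I))
  have e2 := ex_ne_zero (p - D - t * I)
  have e3 := ex_ne_zero ((2 * j : ℕ) * (p - t * I))
  have e4 : thetaPer t (p - t * I) ^ (2 * j) = ex ((2 * j : ℕ) * (p - t * I)) *
      thetaPer t p ^ (2 * j) := by
    rw [thetaPer_sub_tau, mul_pow, neg_pow, neg_one_pow_two_mul, one_mul, ex_nat_mul]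
  have e5 : ex (p - z - t * I) * ex ((2 * j : ℕ) * (p - 3 / 2 * (t * I)) - xs.sum)
      = ex (j * (p - t * I)) * (ex (p - D - t * I) * ex ((2 * j : ℕ) * (p - t * I))) / ex (j * p) := by
    rw [eq_div_iff e0, key]
  rw [ovalSec, ovalSec, ovalProd_sub_tau, hxs, neg_one_pow_two_mul, one_mul, e4,
    show p - t * I - z = p - z - t * I by ring, show p - t * I - D = p - D - t * I by ring,
    thetaPer_sub_tau, thetaPer_sub_tau]
  set E := ex (j * (p - t * I)) * (ex (p - D - t * I) * ex ((2 * j : ℕ) * (p - t * I))) with hE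
  have hE0 : E ≠ 0 := mul_ne_zero e1 (mul_ne_zero e2 e3)
  calc _ = (-1 * E) * (thetaPer t (p - z) * ovalProd t xs p / ex (j * p)) /
        ((-1 * E) * (thetaPer t (p - D) * thetaPer t p ^ (2 * j))) := by
        congr 1
        · linear_combination (-(thetaPer t (p - z) * ovalProd t xs p)) * e5
        · rw [hE]; ring
    _ = _ := by
        rw [mul_div_mul_left _ _ (mul_ne_zero (by norm_num) hE0), div_div]

/-- On `γ` the theta quotient is real up to a constant phase. -/
theorem ovalSec_conj (t D z : ℝ) (j : ℕ) {xs : List ℝ} (hxs : xs.length = 2 * j) {m : ℤ}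
    (hz : z + xs.sum = D + m) {p : ℂ} (hp : p.im = t / 2) :
    (starRingEnd ℂ) (ovalSec t D z j xs p) = ex xs.sum * ovalSec t D z j xs p := by
  have hz' : (z + (xs.sum : ℝ) : ℂ) = D + m := by exact_mod_cast hz
  conv_rhs => rw [← ovalSec_sub_tau t D z j hxs hz p, ← conj_eq_sub_tau hp]
  have hconj : ∀ x : ℝ, (starRingEnd ℂ) (p - x) = (starRingEnd ℂ) p - x := by simp
  have hj : (starRingEnd ℂ) (j * p) = j * (starRingEnd ℂ) p := by simp
  rw [ovalSec, ovalSec, map_div₀, map_mul, map_mul, map_mul, map_pow, thetaPer_conj, thetaPer_conj,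
    thetaPer_conj, ovalProd_conj, conj_ex, hj, hconj, hconj, hxs, neg_one_pow_two_mul, one_mul, mul_pow,
    ← ex_nat_mul]
  set q := (starRingEnd ℂ) p with hq
  have key : ex (-(q - z)) * ex (2 * (xs.sum - (2 * j : ℕ) * q)) * ex (j * q)
      = ex xs.sum * (ex (-(j * q)) * (ex (-(q - D)) * ex ((2 * j : ℕ) * -q))) := by
    rw [← ex_add, ← ex_add, ← ex_add, ← ex_add, ← ex_add, ← ex_add_int (xs.sum + _) m]
    congr 1
    push_cast
    linear_combination hz'
  have e0 := ex_ne_zero (j * q)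
  set E := ex (-(j * q)) * (ex (-(q - D)) * ex ((2 * j : ℕ) * -q)) with hE
  have hE0 : E ≠ 0 := mul_ne_zero (ex_ne_zero _) (mul_ne_zero (ex_ne_zero _) (ex_ne_zero _))
  have e5 : ex (-(q - z)) * ex (2 * (xs.sum - (2 * j : ℕ) * q)) = ex xs.sum * E / ex (j * q) := by
    rw [eq_div_iff e0, key]
  calc _ = E * (ex xs.sum * (thetaPer t (q - z) * ovalProd t xs q / ex (j * q))) /
        (E * (thetaPer t (q - D) * thetaPer t q ^ (2 * j))) := by
        congr 1
        · linear_combination (thetaPer t (q - z) * ovalProd t xs q) * e5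
        · rw [hE]; ring
    _ = _ := by
        rw [mul_div_mul_left _ _ hE0, mul_div_assoc, div_div]

theorem secNum_ovalSec {t D z ε : ℝ} (ht : 0 < t) (hεt : ε < t / 2) (j : ℕ) {xs : List ℝ}
    (hxs : xs.length = 2 * j) {m : ℤ} (hz : z + xs.sum = D + m) :
    ∃ g, SecNum t D ε (2 * j) (ovalSec t D z j xs) g := by
  obtain ⟨U, hU, hU1, hU0, hUeq⟩ := exists_thetaPer_factor ht
  have him : ∀ p ∈ strip (-(t / 2) - ε) (t / 2 + ε), |p.im| < t := fun p hp =>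
    abs_lt.2 ⟨by linarith [hp.1], by linarith [hp.2]⟩
  have hUp : ∀ c : ℂ, PerHol (-(t / 2) - ε) (t / 2 + ε) (fun p => U (p - c)) := fun c =>
    .of_entire (hU.comp (by fun_prop)) fun p => by rw [show p + 1 - c = p - c + 1 by ring, hU1]
  have hUp0 : PerHol (-(t / 2) - ε) (t / 2 + ε) U := .of_entire hU hU1
  have hne : ∀ p ∈ strip (-(t / 2) - ε) (t / 2 + ε),
      ex (j * p) * (U (p - D) * U p ^ (2 * j)) ≠ 0 := fun p hp =>
    mul_ne_zero (ex_ne_zero _) (mul_ne_zero (hU0 _ (by simpa using him p hp))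
      (pow_ne_zero _ (hU0 _ (him p hp))))
  refine ⟨_, ((perHol_thetaPer ht z).mul (perHol_ovalProd ht xs)).div
    ((perHol_ex_nat_mul j).mul ((hUp D).mul (hUp0.pow (2 * j)))) hne, fun p hp h1 h2 => ?_,
    fun p _ _ => ovalSec_sub_tau t D z j hxs hz p⟩
  rw [ovalSec, hUeq (p - D), hUeq p, div_div, mul_pow]
  congr 1
  ring

namespace SzegoData

variable {t D ε : ℝ} {w σ : ℂ → ℂ} {P : ℕ → ℂ → ℂ}

/-- The section `π_n` has at least `n` zeros on `γ`. If it had fewer, the section of lower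
order with the same zeros on `γ` would make the orthogonality integral nonzero. -/
theorem exists_ovalProd_factor_length_eq (h : SzegoData t D ε w σ P) {n : ℕ} {g : ℂ → ℂ}
    (hg : SecNum t D ε n (P n) g) :
    ∃ xs k, xs.length = n ∧ PerHol (-(t / 2) - ε) (t / 2 + ε) k ∧
      ∀ p ∈ strip (-(t / 2) - ε) (t / 2 + ε), g p = ovalProd t xs p * k p := by
  have ht := h.ht
  have hε := h.hε
  have hεt := h.hεt
  set den : ℂ → ℂ := fun p => (1 - ex p) ^ n * (1 - ex (p - D)) with hden
  have hden0 : ∀ p : ℂ, p.im ≠ 0 → den p ≠ 0 := fun p hp => mul_ne_zero (pow_ne_zero _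
    (sub_ne_zero.2 (ex_ne_one_of_im_ne_zero hp).symm)) (sub_ne_zero.2 (ex_sub_ofReal_ne_one D hp).symm)
  have hdenc : Continuous den := by
    have := differentiable_ex.continuous
    fun_prop
  have hshift : ∀ p ∈ strip (t / 2 - ε) (t / 2 + ε), p.im ≠ 0 ∧ (p - t * I).im ≠ 0 ∧
      p ∈ strip (-(t / 2) - ε) (t / 2 + ε) ∧ p - t * I ∈ strip (-(t / 2) - ε) (t / 2 + ε) := by
    intro p hp
    have h1 := hp.1
    have h2 := hp.2
    have h3 : (p - t * I).im = p.im - t := by rw [sub_im, tau_im]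
    refine ⟨by linarith, by rw [h3]; linarith, ⟨by linarith, h2⟩, ?_, ?_⟩ <;> rw [h3] <;> linarith
  obtain ⟨xs, k, hlen, hk, hgk, hor⟩ := exists_ovalProd_factor ht hε hεt (g := g)
    (ν := fun p => den (p - t * I) / den p) hg.num
    (fun p hp => by
      have h1 := hden0 p (hshift p hp).1
      have h2 : Continuous fun p : ℂ => den (p - t * I) := hdenc.comp (by fun_prop)
      exact h2.continuousAt.div hdenc.continuousAt h1)
    (fun p hp => by
      obtain ⟨h1, h2, h3, h4⟩ := hshift p hp
      have e1 := hg.glue p hp.1 hp.2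
      rw [hg.eq_div _ h4 (ex_ne_one_of_im_ne_zero h2) (ex_sub_ofReal_ne_one D h2),
        hg.eq_div _ h3 (ex_ne_one_of_im_ne_zero h1) (ex_sub_ofReal_ne_one D h1),
        div_eq_iff (hden0 _ h2)] at e1
      rw [e1]
      ring) n
  refine ⟨xs, k, ?_, hk, hgk⟩
  by_contra hne
  have hk0 := hor.resolve_left hne
  set γ : ℝ → ℂ := fun s => s + (t / 2 : ℝ) * I with hγ
  have hγim : ∀ s, (γ s).im = t / 2 := fun s => by simp [hγ]
  have hγ0 : ∀ s, (γ s).im ≠ 0 := fun s => by rw [hγim]; linarith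
  have hγs : ∀ s, γ s ∈ strip (-(t / 2) - ε) (t / 2 + ε) := fun s =>
    ⟨by rw [hγim]; linarith, by rw [hγim]; linarith⟩
  have hγc : Continuous γ := by fun_prop
  obtain ⟨G, hG, hG0, hGeq⟩ := exists_ovalProd_eq_sinProd ht xs
  -- `π_n` on `γ`
  have hF : ∀ s, ((P n (γ s)).re : ℂ) = P n (γ s) := fun s =>
    conj_eq_iff_re.1 (conj_eq_iff_im.2 (h.im_eq_zero n s))
  obtain ⟨Φ, hΦ, hFΦ, hΦs⟩ := exists_real_factor (xs := xs) (F := fun s => (P n (γ s)).re)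
    (G := fun s => G s * (k (γ s) / den (γ s)))
    (hG.mul ((hk.continuous_line (by linarith) (by linarith)).div (hdenc.comp hγc)
      fun s => hden0 _ (hγ0 s)))
    (fun s => mul_ne_zero (hG0 s) (div_ne_zero (hk0 _ (hγim s)) (hden0 _ (hγ0 s))))
    (fun s => by
      rw [hF, hg.eq_div _ (hγs s) (ex_ne_one_of_im_ne_zero (hγ0 s)) (ex_sub_ofReal_ne_one D (hγ0 s)),
        hgk _ (hγs s), hGeq]
      ring)
  obtain ⟨j, hj⟩ := even_length_of_periodic hFΦ (fun s => by
    have e1 : γ (s + 1) = γ s + 1 := by simp only [hγ]; push_cast; ring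
    simp only [e1, (h.hP.isSection n).periodic_one]) hΦs
  rw [← two_mul] at hj
  -- the section of lower order, normalized to be real on `γ`
  have hz : (D - xs.sum) + xs.sum = D + ((0 : ℤ) : ℝ) := by simp
  set z := D - xs.sum with hzdef
  obtain ⟨v, hv⟩ := secNum_ovalSec ht hεt (z := z) j hj hz
  have horth := h.hP.lineInt_eq_zero ht h.hD h.continuous_w hε hεt (n := n) (by lia) hv
  set κ := exp (Real.pi * I * xs.sum) with hκ
  have hκ0 : κ ≠ 0 := exp_ne_zero _
  have hconj : ∀ s, (starRingEnd ℂ) (κ * ovalSec t D z j xs (γ s)) = κ * ovalSec t D z j xs (γ s) := by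
    intro s
    have e1 : (starRingEnd ℂ) κ * ex xs.sum = κ := by
      rw [hκ, ← exp_conj, ex, ← exp_add]
      congr 1
      simp only [map_mul, conj_ofReal, conj_I]
      ring
    rw [map_mul, ovalSec_conj t D z j hj hz (hγim s), ← mul_assoc, e1]
  have hV : ∀ s, ((κ * ovalSec t D z j xs (γ s)).re : ℂ) = κ * ovalSec t D z j xs (γ s) := fun s =>
    conj_eq_iff_re.1 (hconj s)
  have hθ : ∀ x s : ℝ, thetaPer t (γ s - x) ≠ 0 := fun x s => by
    have him : (γ s - x).im = t / 2 := by rw [sub_im, ofReal_im, sub_zero, hγim]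
    exact thetaPer_ne_zero ht (by rw [him, abs_of_pos] <;> linarith)
      (ex_ne_one_of_im_ne_zero (by rw [him]; linarith))
  have hθ0 : ∀ s : ℝ, thetaPer t (γ s) ≠ 0 := fun s => by simpa using hθ 0 s
  have hθc := (differentiable_thetaPer ht).continuous
  have hexc := differentiable_ex.continuous
  obtain ⟨Ψ, hΨ, hVΨ, hΨs⟩ := exists_real_factor (xs := xs)
    (F := fun s => (κ * ovalSec t D z j xs (γ s)).re)
    (G := fun s => G s * (κ * thetaPer t (γ s - z) /
      (ex (j * γ s) * (thetaPer t (γ s - D) * thetaPer t (γ s) ^ (2 * j)))))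
    (by
      refine hG.mul (Continuous.div ?_ ?_ fun s => mul_ne_zero (ex_ne_zero _) (mul_ne_zero (hθ D s)
        (pow_ne_zero _ (hθ0 s))))
      · exact continuous_const.mul (hθc.comp (by fun_prop))
      · exact (hexc.comp (by fun_prop)).mul ((hθc.comp (by fun_prop)).mul ((hθc.comp hγc).pow _)))
    (fun s => mul_ne_zero (hG0 s) (div_ne_zero (mul_ne_zero hκ0 (hθ z s)) (mul_ne_zero (ex_ne_zero _)
      (mul_ne_zero (hθ D s) (pow_ne_zero _ (hθ0 s))))))
    (fun s => by
      rw [hV, ovalSec, hGeq]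
      ring)
  -- the orthogonality integral has an integrand of constant sign
  set e : ℝ → ℝ := fun s => Real.exp (w (γ s)).re with he
  have hec : Continuous e := Real.continuous_exp.comp (continuous_re.comp h.continuous_w)
  have hint : ∫ s in (0 : ℝ)..1, sinProd xs s ^ 2 * (Φ s * Ψ s * e s) = 0 := by
    have h1 : ((∫ s in (0 : ℝ)..1, sinProd xs s ^ 2 * (Φ s * Ψ s * e s) : ℝ) : ℂ)
        = κ * lineInt (fun q => P n q * ovalSec t D z j xs q * exp (w q)) (t / 2) := by
      rw [← intervalIntegral.integral_ofReal, lineInt, ← intervalIntegral.integral_const_mul]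
      refine intervalIntegral.integral_congr fun s _ => ?_
      change _ = κ * (P n (γ s) * ovalSec t D z j xs (γ s) * exp (w (γ s)))
      rw [h.exp_w_eq (hγim s), ← hF]
      have h2 : ((sinProd xs s ^ 2 * (Φ s * Ψ s * e s) : ℝ) : ℂ)
          = ((P n (γ s)).re : ℝ) * ((κ * ovalSec t D z j xs (γ s)).re : ℝ) * (e s : ℝ) := by
        have e1 := hFΦ s
        have e2 := hVΨ s
        rw [e1, e2]
        push_cast
        ring
      rw [h2, hV]
      ring
    rw [horth, mul_zero] at h1
    exact_mod_cast h1
  obtain ⟨c, hc, hc0⟩ := (dense_sinProd_ne_zero xs).exists_mem_open isOpen_Ioo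
    (Set.nonempty_Ioo.2 (zero_lt_one' ℝ))
  have hsc := continuous_sinProd xs
  have hsign : (∀ s, 0 < Φ s * Ψ s) ∨ ∀ s, Φ s * Ψ s < 0 := by
    rcases hΦs with h1 | h1 <;> rcases hΨs with h2 | h2
    · exact Or.inl fun s => mul_pos (h1 s) (h2 s)
    · exact Or.inr fun s => mul_neg_of_pos_of_neg (h1 s) (h2 s)
    · exact Or.inr fun s => mul_neg_of_neg_of_pos (h1 s) (h2 s)
    · exact Or.inl fun s => mul_pos_of_neg_of_neg (h1 s) (h2 s)
  have hcs : 0 < sinProd xs c ^ 2 := by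
    have : sinProd xs c ≠ 0 := hc
    positivity
  rcases hsign with hs | hs
  · have := intervalIntegral.integral_pos (a := (0 : ℝ)) (b := 1)
      (f := fun s => sinProd xs s ^ 2 * (Φ s * Ψ s * e s)) one_pos
      (Continuous.continuousOn (by fun_prop))
      (fun s _ => mul_nonneg (sq_nonneg _) (mul_pos (hs s) (Real.exp_pos _)).le)
      ⟨c, ⟨hc0.1.le, hc0.2.le⟩, mul_pos hcs (mul_pos (hs c) (Real.exp_pos _))⟩
    rw [hint] at this
    exact this.false
  · have := intervalIntegral.integral_pos (a := (0 : ℝ)) (b := 1)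
      (f := fun s => -(sinProd xs s ^ 2 * (Φ s * Ψ s * e s))) one_pos
      (Continuous.continuousOn (by fun_prop))
      (fun s _ => neg_nonneg.2 (mul_nonpos_of_nonneg_of_nonpos (sq_nonneg _)
        (mul_neg_of_neg_of_pos (hs s) (Real.exp_pos _)).le))
      ⟨c, ⟨hc0.1.le, hc0.2.le⟩, neg_pos.2 (mul_neg_of_pos_of_neg hcs
        (mul_neg_of_neg_of_pos (hs c) (Real.exp_pos _)))⟩
    rw [intervalIntegral.integral_neg, hint, neg_zero] at this
    exact this.false

end SzegoData

/-! ### The zero off the oval -/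

namespace SzegoData

variable {t D ε : ℝ} {w σ : ℂ → ℂ} {P : ℕ → ℂ → ℂ}

/-- For even `n`, the section `π_n` is a constant multiple of a theta quotient with `n` zeros on
`γ`; its remaining zero is real. -/
theorem exists_zero_factor (h : SzegoData t D ε w σ P) {n : ℕ} (hn : Even n) {g : ℂ → ℂ}
    (hg : SecNum t D ε n (P n) g) :
    ∃ z ∈ Set.Ioo (0 : ℝ) 1, ∃ B : ℂ → ℂ,
      (∀ p ∈ strip (-(t / 2)) (t / 2), AnalyticAt ℂ B p ∧ B p ≠ 0) ∧
      ∀ p ∈ strip (-(t / 2)) (t / 2), g p = (1 - ex (p - z)) * B p := by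
  have ht := h.ht
  have hε := h.hε
  have hεt := h.hεt
  obtain ⟨xs, k, hlen, hk, hgk⟩ := h.exists_ovalProd_factor_length_eq hg
  obtain ⟨j, hj⟩ := hn
  rw [← two_mul] at hj
  subst hj
  -- Abel's condition determines the position of the remaining zero.
  set z := Int.fract (D - xs.sum) with hzdef
  have hz : z + xs.sum = D + ((-⌊D - xs.sum⌋ : ℤ) : ℝ) := by
    rw [hzdef, Int.fract]
    push_cast
    ring
  obtain ⟨U, hU, hU1, hU0, hUeq⟩ := exists_thetaPer_factor ht
  set S := strip (-(t / 2) - ε) (t / 2 + ε) with hS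
  have him : ∀ p ∈ S, |p.im| < t := fun p hp => abs_lt.2 ⟨by linarith [hp.1], by linarith [hp.2]⟩
  have hUp : ∀ c : ℂ, PerHol (-(t / 2) - ε) (t / 2 + ε) (fun p => U (p - c)) := fun c =>
    .of_entire (hU.comp (by fun_prop)) fun p => by rw [show p + 1 - c = p - c + 1 by ring, hU1]
  have hUp0 : PerHol (-(t / 2) - ε) (t / 2 + ε) U := .of_entire hU hU1
  have hUx : ∀ (x : ℝ), ∀ p ∈ S, U (p - x) ≠ 0 := fun x p hp => hU0 _ (by simpa using him p hp)
  -- the quotient of `π_n` and the theta quotient has at most a simple pole, at `z`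
  set q : ℂ → ℂ := fun p => k p * (U (p - D) * U p ^ (2 * j) * ex (j * p)) / U (p - z) with hq
  have hqp : PerHol (-(t / 2) - ε) (t / 2 + ε) q :=
    (hk.mul (((hUp D).mul (hUp0.pow _)).mul (perHol_ex_nat_mul j))).div (hUp z) (hUx z)
  have hquot : ∀ p ∈ S, p.im ≠ 0 → ovalProd t xs p ≠ 0 →
      q p / (1 - ex (p - z)) = P (2 * j) p / ovalSec t D z j xs p := by
    intro p hp hp0 hT
    have h1 : 1 - ex p ≠ 0 := sub_ne_zero.2 (ex_ne_one_of_im_ne_zero hp0).symm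
    have h2 : ∀ x : ℝ, 1 - ex (p - x) ≠ 0 := fun x => sub_ne_zero.2 (ex_sub_ofReal_ne_one x hp0).symm
    have h3 := h2 D
    have h4 := h2 z
    have h5 := hUx D p hp
    have h6 := hUx z p hp
    have h7 := hU0 p (him p hp)
    have h8 := ex_ne_zero (j * p)
    rw [hg.eq_div p hp (ex_ne_one_of_im_ne_zero hp0) (ex_sub_ofReal_ne_one D hp0), hgk p hp, ovalSec,
      hUeq (p - D), hUeq p, hUeq (p - z), hq, mul_pow]
    field_simp
  have hexc := differentiable_ex.continuous
  have hglue : ∀ p : ℂ, t / 2 - ε < p.im → p.im < t / 2 + ε →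
      q (p - t * I) / (1 - ex (p - t * I - z)) = q p / (1 - ex (p - z)) := by
    have hshift : ∀ p ∈ strip (t / 2 - ε) (t / 2 + ε), p.im ≠ 0 ∧ (p - t * I).im ≠ 0 ∧
        p ∈ S ∧ p - t * I ∈ S := by
      intro p hp
      have h1 := hp.1
      have h2 := hp.2
      have h3 : (p - t * I).im = p.im - t := by rw [sub_im, tau_im]
      refine ⟨by linarith, by rw [h3]; linarith, ⟨by linarith, h2⟩, ?_, ?_⟩ <;> rw [h3] <;> linarith
    intro p hp1 hp2
    have hps : p ∈ strip (t / 2 - ε) (t / 2 + ε) := ⟨hp1, hp2⟩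
    obtain ⟨h1, h2, h3, h4⟩ := hshift p hps
    have hc1 : ContinuousAt (fun p : ℂ => q (p - t * I) / (1 - ex (p - t * I - z))) p := by
      refine ContinuousAt.div (ContinuousAt.comp (f := fun p : ℂ => p - t * I) (hqp.continuousAt h4)
        (by fun_prop)) ?_ (sub_ne_zero.2 (ex_sub_ofReal_ne_one z h2).symm)
      exact continuousAt_const.sub (hexc.comp (by fun_prop)).continuousAt
    have hc2 : ContinuousAt (fun p : ℂ => q p / (1 - ex (p - z))) p := by
      refine ContinuousAt.div (hqp.continuousAt h3) ?_
        (sub_ne_zero.2 (ex_sub_ofReal_ne_one z h1).symm)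
      exact continuousAt_const.sub (hexc.comp (by fun_prop)).continuousAt
    refine tendsto_nhds_unique_of_eventuallyEq (hc1.tendsto.mono_left nhdsWithin_le_nhds)
      (hc2.tendsto.mono_left (nhdsWithin_le_nhds (s := {p}ᶜ))) ?_
    filter_upwards [eventually_ovalProd_ne_zero ht xs (p := p) ⟨by linarith, by linarith⟩,
      nhdsWithin_le_nhds (strip_mem_nhds hps)] with y hy hys
    obtain ⟨k1, k2, k3, k4⟩ := hshift y hys
    rw [hquot y k3 k1 hy, hquot _ k4 k2 (by
      rw [ovalProd_sub_tau]
      exact mul_ne_zero (mul_ne_zero (pow_ne_zero _ (by norm_num)) (ex_ne_zero _)) hy),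
      ovalSec_sub_tau t D z j hlen hz, hg.glue y hys.1 hys.2]
  obtain ⟨c, hc⟩ := const_of_simple_pole ht hε (x := z) hqp fun p h1 h2 _ _ => hglue p h1 h2
  set B : ℂ → ℂ := fun p => c * (ovalProd t xs p * U (p - z)) / (U (p - D) * U p ^ (2 * j) * ex (j * p))
    with hB
  have hden : ∀ p ∈ S, U (p - D) * U p ^ (2 * j) * ex (j * p) ≠ 0 := fun p hp =>
    mul_ne_zero (mul_ne_zero (hUx D p hp) (pow_ne_zero _ (hU0 p (him p hp)))) (ex_ne_zero _)
  have hgB : ∀ p ∈ S, g p = (1 - ex (p - z)) * B p := by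
    intro p hp
    have e1 := hc p hp
    have e2 := hden p hp
    rw [hq] at e1
    simp only at e1
    rw [div_eq_iff (hUx z p hp)] at e1
    rw [hgk p hp, hB, ← mul_div_assoc, eq_div_iff e2]
    linear_combination ovalProd t xs p * e1
  have hBp : PerHol (-(t / 2) - ε) (t / 2 + ε) B :=
    (((perHol_ovalProd ht xs).mul (hUp z)).const_mul c).div
      (((hUp D).mul (hUp0.pow _)).mul (perHol_ex_nat_mul j)) hden
  -- the normalization at `0` excludes `c = 0` and `z = 0`
  have hg0 : g 0 ≠ 0 := by
    rw [hg.num_zero ht hε (h.hP.monic (2 * j))]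
    exact mul_ne_zero (pow_ne_zero _ (neg_ne_zero.2 two_pi_I_ne_zero))
      (sub_ne_zero.2 (ex_neg_ofReal_ne_one h.hD).symm)
  have hs0 : (0 : ℂ) ∈ S := ⟨by rw [zero_im]; linarith, by rw [zero_im]; linarith⟩
  rw [hgB 0 hs0] at hg0
  have hc0 : c ≠ 0 := fun h0 => hg0 (by rw [hB, h0]; simp)
  have hz0 : z ≠ 0 := fun h0 => hg0 (by rw [h0, ofReal_zero, sub_zero, ex_zero, sub_self, zero_mul])
  have hsub : ∀ p ∈ strip (-(t / 2)) (t / 2), p ∈ S := fun p hp =>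
    ⟨by linarith [hp.1], by linarith [hp.2]⟩
  refine ⟨z, ⟨lt_of_le_of_ne (Int.fract_nonneg _) hz0.symm, Int.fract_lt_one _⟩, B, fun p hp =>
    ⟨hBp.analyticAt (hsub p hp), div_ne_zero (mul_ne_zero hc0 (mul_ne_zero
      (ovalProd_ne_zero ht xs (abs_lt.2 hp)) (hUx z p (hsub p hp)))) (hden p (hsub p hp))⟩,
    fun p hp => hgB p (hsub p hp)⟩

/-- The divisor of zeros of `π_n` off `γ`, in terms of the factorization of its numerator. -/
theorem sectionOrder_of_factor (h : SzegoData t D ε w σ P) {n : ℕ} {g B : ℂ → ℂ} {z : ℝ}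
    (hord : ∀ p ∈ strip (-(t / 2) - ε) (t / 2 + ε),
      meromorphicOrderAt g p = sectionOrder (t * I) D n (P n) p)
    (hB : ∀ p ∈ strip (-(t / 2)) (t / 2), AnalyticAt ℂ B p ∧ B p ≠ 0)
    (hgB : ∀ p ∈ strip (-(t / 2)) (t / 2), g p = (1 - ex (p - z)) * B p)
    {p : ℂ} (hp : ¬ OnGamma (t * I) p) :
    (InLattice (t * I) (p - z) → sectionOrder (t * I) D n (P n) p = 1) ∧
      (¬ InLattice (t * I) (p - z) → sectionOrder (t * I) D n (P n) p = 0) := by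
  classical
  have ht := h.ht
  have hε := h.hε
  set p' := fold t p with hp'
  have him := abs_fold_im_lt ht hp
  have hs : p' ∈ strip (-(t / 2)) (t / 2) := abs_lt.1 him
  have e1 : sectionOrder (t * I) D n (P n) p = if ex (p' - z) = 1 then 1 else 0 := by
    rw [(h.hP.isSection n).sectionOrder_fold p, ← hord _ ⟨by linarith [hs.1], by linarith [hs.2]⟩,
      meromorphicOrderAt_congr (f₂ := (fun y => 1 - ex (y - z)) * B)
        ((eventually_of_mem (strip_mem_nhds hs) hgB).filter_mono nhdsWithin_le_nhds),
      meromorphicOrderAt_mul (analyticAt_one_sub_ex _ _).meromorphicAt (hB _ hs).1.meromorphicAt,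
      meromorphicOrderAt_one_sub_ex, (hB _ hs).1.meromorphicOrderAt_eq,
      ((hB _ hs).1.analyticOrderAt_eq_zero).2 (hB _ hs).2]
    simp
  have e2 : InLattice (t * I) (p - z) ↔ ex (p' - z) = 1 := by
    rw [← inLattice_fold, fold_sub_ofReal]
    exact inLattice_of_im ht (by simp; linarith)
  rw [e1, e2]
  exact ⟨fun h1 => if_pos h1, fun h1 => if_neg h1⟩

end SzegoData

/-- For even `n`, the model function vanishes on the real axis only at `1/2`, to first order. -/
theorem exists_abs_sub_half_le {t : ℝ} (ht : 0 < t) {D : ℝ} (hD : D ∈ Set.Ioo (0 : ℝ) 1) :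
    ∃ c : ℝ, 0 < c ∧ ∀ x ∈ Set.Icc (0 : ℝ) 1, ex x ≠ 1 → ex (x - D) ≠ 1 →
      c * |x - 1 / 2| ≤ ‖modelF (t * I) D 0 x‖ * ‖1 - ex (x - D)‖ := by
  have ht2 : 0 < 2 * t := by linarith
  have hτ : (2 * (t * I) : ℂ) = (2 * t : ℝ) * I := by push_cast; ring
  obtain ⟨U, hU, hU1, hU0, hUeq⟩ := exists_theta1_factor ht2
  have hUc := hU.continuous
  have hre : ∀ x : ℝ, U x ≠ 0 := fun x => hU0 _ (by simpa using ht2)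
  set K : ℂ := theta1 D (2 * (t * I)) * theta1Deriv0 (2 * (t * I)) /
    (theta1 (D + t * I) (2 * (t * I)) * theta23 0 0 (2 * (t * I))) with hK
  set B : ℝ → ℝ := fun x => ‖K * (theta1 (x - D - t * I) (2 * (t * I)) * U ((x + 1 / 2 : ℝ) : ℂ)) /
    (U ((x - D : ℝ) : ℂ) * U x)‖ with hB
  have hθ1 : ∀ x : ℝ, theta1 (x + t * I) (2 * (t * I)) ≠ 0 := fun x =>
    theta1_two_ne_zero ht (by simp [ht.ne']) (by simp [abs_of_pos ht]; linarith)
  have hθ2 : ∀ x : ℝ, theta1 (x - t * I) (2 * (t * I)) ≠ 0 := fun x =>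
    theta1_two_ne_zero ht (by simp [ht.ne']) (by simp [abs_of_pos ht]; linarith)
  have hK0 : K ≠ 0 := by
    have h1 : theta1 D (2 * (t * I)) ≠ 0 := by
      rw [hτ]
      intro h0
      rw [theta1_eq_zero_iff ht2, inLattice_of_im ht2 (by simpa using ht2)] at h0
      have := ex_neg_ofReal_ne_one hD
      rw [ex_neg, h0, inv_one] at this
      exact this rfl
    have h2 : theta1Deriv0 (2 * (t * I)) ≠ 0 := by
      rw [hτ, theta1Deriv0_eq_of_factor hU hUeq]
      exact mul_ne_zero (neg_ne_zero.2 two_pi_I_ne_zero) (by simpa using hre 0)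
    have h3 : theta23 0 0 (2 * (t * I)) ≠ 0 := by
      rw [hτ]
      exact theta23_zero_ne_zero ht2 0
    exact div_ne_zero (mul_ne_zero h1 h2) (mul_ne_zero (hθ1 D) h3)
  have hBc : Continuous B := by
    have h1 : Continuous fun x : ℝ => theta1 (x - D - t * I) (2 * (t * I)) := by
      rw [hτ]
      exact (differentiable_theta1 (by simpa using ht)).continuous.comp (by fun_prop)
    refine Continuous.norm (Continuous.div ?_ ?_ fun x => mul_ne_zero (hre _) (hre _)) <;> fun_prop
  have hB0 : ∀ x, 0 < B x := fun x => norm_pos_iff.2 (div_ne_zero (mul_ne_zero hK0 (mul_ne_zero (by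
    have := hθ2 (x - D)
    push_cast at this
    exact this) (hre _))) (mul_ne_zero (hre _) (hre _)))
  obtain ⟨x₀, -, hmin⟩ := isCompact_Icc.exists_isMinOn (Set.nonempty_Icc.2 zero_le_one)
    hBc.continuousOn
  refine ⟨2 * B x₀, mul_pos two_pos (hB0 x₀), fun x hx h1 h2 => ?_⟩
  have hBx : B x₀ ≤ B x := hmin hx
  have hnex : ∀ y : ℝ, ‖exp (-(Real.pi * I * y))‖ = 1 := fun y => by
    rw [show (-(Real.pi * I * y) : ℂ) = ((-(Real.pi * y) : ℝ) : ℂ) * I by push_cast; ring,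
      norm_exp_ofReal_mul_I]
  have hθn : ∀ y : ℝ, ‖theta1 y (2 * (t * I))‖ = ‖1 - ex y‖ * ‖U y‖ := fun y => by
    rw [hτ, hUeq, norm_mul, norm_mul, hnex, one_mul]
  have h3 : 0 < ‖1 - ex x‖ := norm_pos_iff.2 (sub_ne_zero.2 h1.symm)
  have h4 : 0 < ‖1 - ex (x - D)‖ := norm_pos_iff.2 (sub_ne_zero.2 h2.symm)
  -- the zero at `1/2` comes from the factor `θ₂`
  have hF : ‖modelF (t * I) D 0 x‖ * ‖1 - ex (x - D)‖
      = ‖1 - ex (x + 1 / 2)‖ * B x / ‖1 - ex x‖ := by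
    have e1 : theta23 0 x (2 * (t * I)) = theta1 ((x + 1 / 2 : ℝ) : ℂ) (2 * (t * I)) := by
      rw [theta23, if_pos (by simp), theta2_eq]
      push_cast
      rfl
    have e2 := hθn (x - D)
    have e3 := hθn (x + 1 / 2)
    have e4 := hθn x
    push_cast at e2 e3
    have n1 := norm_pos_iff.2 (hre x)
    have n2 := norm_pos_iff.2 (hre (x - D))
    push_cast at n2
    rw [modelF, norm_div, norm_mul, norm_mul, norm_mul, norm_mul, norm_mul, norm_mul, norm_mul, hnex, e1]
    simp only [hB, hK, norm_div, norm_mul]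
    push_cast
    rw [e2, e3, e4]
    field_simp
  have h5 : 4 * |x - 1 / 2| ≤ ‖1 - ex (x + 1 / 2)‖ := by
    have e1 : ‖1 - ex (x + 1 / 2)‖ = 2 * |Real.sin (Real.pi * (x - 1 / 2))| := by
      have e2 : (x + 1 / 2 : ℂ) = ((x - 1 / 2 : ℝ) : ℂ) + 1 := by push_cast; ring
      rw [e2, ex_add_one, ex, norm_sub_rev,
        show (2 * Real.pi * I * ((x - 1 / 2 : ℝ) : ℂ)) = I * ((2 * (Real.pi * (x - 1 / 2)) : ℝ) : ℂ) by
          push_cast; ring, norm_exp_I_mul_ofReal_sub_one, mul_div_cancel_left₀ _ two_ne_zero,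
        Real.norm_eq_abs, abs_mul, abs_two]
    have e3 : |Real.sin (Real.pi * (x - 1 / 2))| = Real.sin (Real.pi * |x - 1 / 2|) := by
      have hab : |x - 1 / 2| ≤ 1 / 2 := abs_le.2 ⟨by linarith [hx.1], by linarith [hx.2]⟩
      rw [Real.abs_sin_eq_sin_abs_of_abs_le_pi, abs_mul, abs_of_pos Real.pi_pos]
      rw [abs_mul, abs_of_pos Real.pi_pos]
      nlinarith [Real.pi_pos]
    have e4 := Real.mul_le_sin (x := Real.pi * |x - 1 / 2|) (by positivity) (by
      have hab : |x - 1 / 2| ≤ 1 / 2 := abs_le.2 ⟨by linarith [hx.1], by linarith [hx.2]⟩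
      nlinarith [Real.pi_pos])
    rw [e1, e3]
    have : 2 / Real.pi * (Real.pi * |x - 1 / 2|) = 2 * |x - 1 / 2| := by
      field_simp
    linarith
  have h6 : ‖1 - ex x‖ ≤ 2 := by
    refine (norm_sub_le _ _).trans ?_
    rw [norm_one, norm_ex, ofReal_im, mul_zero, neg_zero, Real.exp_zero]
    norm_num
  rw [hF, le_div_iff₀ h3]
  calc 2 * B x₀ * |x - 1 / 2| * ‖1 - ex x‖ ≤ 2 * B x₀ * |x - 1 / 2| * 2 := by
        have := hB0 x₀
        gcongr
    _ = (4 * |x - 1 / 2|) * B x₀ := by ring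
    _ ≤ ‖1 - ex (x + 1 / 2)‖ * B x := by gcongr

namespace SzegoData

variable {t D ε : ℝ} {w σ : ℂ → ℂ} {P : ℕ → ℂ → ℂ}

/-- The zero of `π_n` off `γ` is exponentially close to the zero `1/2` of the model function: the
interior asymptotics are compared at real points that tend to the zero. -/
theorem exists_zero_bound (h : SzegoData t D ε w σ P) :
    ∃ c₀ > (0 : ℝ), ∃ C : ℝ, ∀ n : ℕ, Even n → ∃ z ∈ Set.Ioo (0 : ℝ) 1,
      (∀ p : ℂ, ¬ OnGamma (t * I) p →
        (InLattice (t * I) (p - z) → sectionOrder (t * I) D n (P n) p = 1) ∧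
        (¬ InLattice (t * I) (p - z) → sectionOrder (t * I) D n (P n) p = 0)) ∧
      |z - 1 / 2| ≤ C * Real.exp (-(n * c₀)) := by
  have ht := h.ht
  have hε := h.hε
  have hεt := h.hεt
  obtain ⟨C, ρ, hC, hρ0, hρ1, hmain⟩ := h.exists_interior_asymptotics_zpow (half_pos ht)
  obtain ⟨c, hc, hlow⟩ := exists_abs_sub_half_le ht h.hD
  refine ⟨-Real.log ρ, neg_pos.2 (Real.log_neg hρ0 hρ1), C / c, fun n hn => ?_⟩
  obtain ⟨g, hg, hord⟩ := (h.hP.isSection n).exists_secNum ht h.hD hεt.le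
  obtain ⟨z, hz, B, hB, hgB⟩ := h.exists_zero_factor hn hg
  refine ⟨z, hz, fun p hp => h.sectionOrder_of_factor hord hB hgB hp, ?_⟩
  rw [← pow_eq_exp_neg hρ0, div_mul_eq_mul_div, le_div_iff₀ hc, mul_comm]
  have hexz : ex z ≠ 1 := by
    have h1 := ex_neg_ofReal_ne_one hz
    rwa [ex_neg, ne_eq, inv_eq_one] at h1
  have hreal : ∀ x : ℝ, (x : ℂ) ∈ strip (-(t / 2)) (t / 2) := fun x =>
    ⟨by rw [ofReal_im]; linarith, by rw [ofReal_im]; linarith⟩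
  have hreal' : ∀ x : ℝ, (x : ℂ) ∈ strip (-(t / 2) - ε) (t / 2 + ε) := fun x =>
    ⟨by rw [ofReal_im]; linarith, by rw [ofReal_im]; linarith⟩
  -- `M` is the factor between the numerator of `π_n` and the model function with its error.
  set M : ℝ → ℝ := fun x => ‖exp (σ 0) * (gUpper (t * I) x / expEll (t * I)) ^ ((n : ℤ) - 1) *
    exp (-σ x) / (1 - ex x) ^ n‖ with hM
  have hUz : gUpper (t * I) z ≠ 0 := gUpper_ne_zero ht (by simpa using ht) hexz
  have hMc : ContinuousAt M z := by
    have c0 : ContinuousAt (fun x : ℝ => (x : ℂ)) z := continuous_ofReal.continuousAt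
    have c1 : ContinuousAt (fun x : ℝ => gUpper (t * I) x) z :=
      (differentiableAt_gUpper ht (p := z) (by simpa using ht)).continuousAt.comp c0
    have c2 : ContinuousAt (fun x : ℝ => σ x) z :=
      (h.hσ.continuousAt (hreal' z)).comp (f := fun x : ℝ => (x : ℂ)) c0
    have c3 : ContinuousAt (fun x : ℝ => ex x) z :=
      (differentiable_ex.continuous.comp continuous_ofReal).continuousAt
    refine ContinuousAt.norm (ContinuousAt.div ((continuousAt_const.mul ((c1.div_const _).zpow₀ _
      (Or.inl (div_ne_zero hUz (expEll_ne_zero ht))))).mul c2.neg.cexp)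
      ((continuousAt_const.sub c3).pow n) (pow_ne_zero _ (sub_ne_zero.2 hexz.symm)))
  have hgc : ContinuousAt (fun x : ℝ => ‖g x‖) z :=
    ((hg.num.continuousAt (hreal' z)).comp (f := fun x : ℝ => (x : ℂ))
      continuous_ofReal.continuousAt).norm
  have hgz : g z = 0 := by
    rw [hgB _ (hreal z), sub_self, ex_zero, sub_self, zero_mul]
  have hlim1 : Tendsto (fun x : ℝ => c * |x - 1 / 2|) (𝓝[≠] z) (𝓝 (c * |z - 1 / 2|)) := by
    have : Continuous fun x : ℝ => c * |x - 1 / 2| := by fun_prop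
    exact this.continuousAt.tendsto.mono_left nhdsWithin_le_nhds
  have hlim2 : Tendsto (fun x : ℝ => M x * ‖g x‖ + C * ρ ^ n) (𝓝[≠] z) (𝓝 (C * ρ ^ n)) := by
    have h1 : ContinuousAt (fun x : ℝ => M x * ‖g x‖ + C * ρ ^ n) z :=
      (hMc.mul hgc).add continuousAt_const
    have h2 := h1.tendsto
    rw [hgz, norm_zero, mul_zero, zero_add] at h2
    exact h2.mono_left nhdsWithin_le_nhds
  refine le_of_tendsto_of_tendsto hlim1 hlim2 ?_
  have hofReal : Tendsto (fun x : ℝ => (x : ℂ)) (𝓝[≠] z) (𝓝[≠] (z : ℂ)) := by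
    refine tendsto_nhdsWithin_iff.2 ⟨(continuous_ofReal.tendsto z).mono_left nhdsWithin_le_nhds, ?_⟩
    filter_upwards [self_mem_nhdsWithin] with x hx
    exact fun h0 => hx (ofReal_injective h0)
  filter_upwards [hofReal.eventually (eventually_ex_sub_ne_one z 0),
    hofReal.eventually (eventually_ex_sub_ne_one z D),
    nhdsWithin_le_nhds (Ioo_mem_nhds hz.1 hz.2)] with x hx1 hx2 hx3
  rw [sub_zero] at hx1
  obtain ⟨r, hr, hrP⟩ := hmain n x (by rw [ofReal_im, abs_zero, sub_self]) hx1 hx2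
  have hlowx := hlow x ⟨hx3.1.le, hx3.2.le⟩ hx1 hx2
  rw [← modelF_congr (n := n) (m := 0) (by simp [hn])] at hlowx
  have hU : gUpper (t * I) x ≠ 0 := gUpper_ne_zero ht (by simpa using ht) hx1
  have hE := expEll_ne_zero ht
  have e1 : ‖modelF (t * I) D n x + r‖ * ‖1 - ex (x - D)‖ = M x * ‖g x‖ := by
    rw [hM, ← norm_mul, ← norm_mul]
    congr 1
    have h1 : 1 - ex x ≠ 0 := sub_ne_zero.2 hx1.symm
    have h2 : 1 - ex (x - D) ≠ 0 := sub_ne_zero.2 hx2.symm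
    have h3 : g x = P n x * ((1 - ex x) ^ n * (1 - ex (x - D))) := by
      rw [hg.eq_div x (hreal' x) hx1 hx2, div_mul_cancel₀ _ (mul_ne_zero (pow_ne_zero _ h1) h2)]
    have h4 : (expEll (t * I) * gLower (t * I) x) = (gUpper (t * I) x / expEll (t * I))⁻¹ := by
      rw [gUpper_eq_inv]
      field_simp
    have h5 : (gUpper (t * I) x / expEll (t * I)) ^ ((n : ℤ) - 1) ≠ 0 :=
      zpow_ne_zero _ (div_ne_zero hU hE)
    rw [h3, hrP, h4, inv_zpow, exp_neg, exp_neg]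
    have := exp_ne_zero (σ 0)
    have := exp_ne_zero (σ x)
    field_simp
  calc c * |x - 1 / 2| ≤ ‖modelF (t * I) D n x‖ * ‖1 - ex (x - D)‖ := hlowx
    _ ≤ (‖modelF (t * I) D n x + r‖ + ‖r‖) * ‖1 - ex (x - D)‖ := by
        gcongr
        have := norm_sub_le (modelF (t * I) D n x + r) r
        rwa [add_sub_cancel_right] at this
    _ ≤ M x * ‖g x‖ + C * ρ ^ n := by
        rw [add_mul, e1]
        linarith

end SzegoData

/-! ### The analytic extension of the Szegő function -/

/-- The strip on which `w` is analytic is shrunk, so that `w` and the extension of the Szegő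
function share one width `ε < t/2`. -/
theorem exists_szegoData {t D δ : ℝ} (ht : 0 < t) (hD : D ∈ Set.Ioo (0 : ℝ) 1) (hδ : 0 < δ)
    {w : ℂ → ℂ} (hw : DifferentiableOn ℂ w {p : ℂ | |p.im - t / 2| < δ})
    (hwper : ∀ p : ℂ, |p.im - t / 2| < δ → w (p + 1) = w p)
    (hwr : ∀ p : ℂ, p.im = t / 2 → (w p).im = 0) {P : ℕ → ℂ → ℂ}
    (hP : IsMonicOrthogonal (t * I) D w P) :
    ∃ ε σ, SzegoData t D ε w σ P ∧
      ∀ p : ℂ, ¬ OnGamma (t * I) p → szego (t * I) w p = σ (fold t p) := by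
  set δ₀ := min δ (t / 2) with hδ₀
  have hδ₀0 : 0 < δ₀ := lt_min hδ (by linarith)
  have hδ₀1 : δ₀ ≤ δ := min_le_left _ _
  have hδ₀2 : δ₀ ≤ t / 2 := min_le_right _ _
  have hsub : ∀ p ∈ strip (t / 2 - δ₀) (t / 2 + δ₀), |p.im - t / 2| < δ := fun p hp =>
    abs_lt.2 ⟨by linarith [hp.1], by linarith [hp.2]⟩
  have hw' : PerHol (t / 2 - δ₀) (t / 2 + δ₀) w := ⟨hw.mono hsub, fun p hp => hwper p (hsub p hp)⟩
  obtain ⟨σ, h1, h2, h3, h4⟩ := exists_szego ht hδ₀0 (by linarith) hw' hwr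
  exact ⟨δ₀ / 2, σ, ⟨ht, hD, by linarith, by linarith, hw'.mono (by linarith) (by linarith), hwr, h1,
    fun p hp => h2 p ⟨by linarith, by linarith⟩, h4, hP⟩, h3⟩

/-- The Szegő function is analytic off the oval. -/
theorem SzegoData.analyticAt_szego {t D ε : ℝ} {w σ : ℂ → ℂ} {P : ℕ → ℂ → ℂ}
    (h : SzegoData t D ε w σ P)
    (hS : ∀ p : ℂ, ¬ OnGamma (t * I) p → szego (t * I) w p = σ (fold t p)) {p : ℂ}
    (hp : ¬ OnGamma (t * I) p) : AnalyticAt ℂ (szego (t * I) w) p := by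
  have ht := h.ht
  have hε := h.hε
  have him := abs_lt.1 (abs_fold_im_lt ht hp)
  have h1 : AnalyticAt ℂ σ (p - (round (p.im / t) : ℤ) * (t * I)) :=
    h.hσ.analyticAt (z := fold t p) ⟨by linarith, by linarith⟩
  have h2 : AnalyticAt ℂ (fun q => σ (q - (round (p.im / t) : ℤ) * (t * I))) p :=
    AnalyticAt.fun_comp (g := σ) h1 (by fun_prop)
  refine h2.congr ?_
  filter_upwards [eventually_fold_eq ht hp, eventually_not_onGamma ht hp] with q hq hq2
  rw [hS q hq2, hq]

end

end EllipticSections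

theorem mainTheorem1
    (τ : ℂ) (hre : τ.re = 0) (him : 0 < τ.im)
    (D : ℝ) (hD : D ∈ Set.Ioo (0 : ℝ) 1)
    (w : ℂ → ℂ) (δ : ℝ) (hδ : 0 < δ)
    (hw : DifferentiableOn ℂ w {p : ℂ | |p.im - τ.im / 2| < δ})
    (hwper : ∀ p : ℂ, |p.im - τ.im / 2| < δ → w (p + 1) = w p)
    (hwreal : ∀ p : ℂ, p.im = τ.im / 2 → (w p).im = 0)
    (P : ℕ → ℂ → ℂ) (hP : IsMonicOrthogonal τ D w P) :
    -- `e^ℓ` is positive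
    ((expEll τ).im = 0 ∧ 0 < (expEll τ).re) ∧
    -- `e^g` is the exponential of the `g`-function: `g' = H`, `H² = ℘ - ℘(1/2)`, `e^g ~ 1/p` at `0`
    (∀ p : ℂ, ¬ OnGamma τ p → ¬ InLattice τ p →
      HasDerivAt (expG τ) (H τ p * expG τ p) p ∧
      H τ p ^ 2 = (periods τ him).weierstrassP p - (periods τ him).weierstrassP (1 / 2)) ∧
    Tendsto (fun p : ℂ => p * expG τ p) (𝓝[≠] 0) (𝓝 1) ∧
    -- the Szegő function is analytic off `γ`
    (∀ p : ℂ, ¬ OnGamma τ p → AnalyticAt ℂ (szego τ w) p) ∧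
    -- asymptotics on compact subsets of the complement of `γ`
    (∀ K : Set ℂ, IsCompact K → (∀ p ∈ K, ¬ OnGamma τ p) →
      ∃ c₀ > (0 : ℝ), ∃ C : ℝ, ∀ (n : ℕ), ∀ p ∈ K,
        ¬ InLattice τ p → ¬ InLattice τ (p - D) →
        ∃ r : ℂ, ‖r‖ ≤ C * Real.exp (-(n * c₀)) / torusDist τ D p ∧
          P n p = exp (-szego τ w 0) * (M11 τ D n p + r) *
            (expG τ p ^ ((n : ℤ) - 1) * exp (szego τ w p))) ∧
    -- asymptotics on `γ`; `Mp` and `Sp` are the boundary values of `M₁₁` and `S` from above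
    (∃ (Mp : ℕ → ℝ → ℂ) (Sp : ℝ → ℂ) (u : ℝ → ℂ),
      (∀ (n : ℕ) (s : ℝ), Tendsto (fun ε : ℝ => M11 τ D n (s + τ / 2 + ε * I))
        (𝓝[>] 0) (𝓝 (Mp n s))) ∧
      (∀ s : ℝ, Tendsto (fun ε : ℝ => szego τ w (s + τ / 2 + ε * I)) (𝓝[>] 0) (𝓝 (Sp s))) ∧
      (∀ s : ℝ, u s = exp (Real.pi * I * s - Real.pi * I / 2) *
        (theta1 (s + τ / 2) (2 * τ) / theta1 (s - τ / 2) (2 * τ))) ∧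
      (∃ c₀ > (0 : ℝ), ∃ C : ℝ, ∀ (n : ℕ) (s : ℝ), ∃ r : ℂ,
        ‖r‖ ≤ C * Real.exp (-(n * c₀)) ∧
        P n (s + τ / 2) = 2 * (expEll τ ^ ((n : ℤ) - 1) * exp (-szego τ w 0)) *
          (((Mp n s * exp (Sp s) * u s ^ ((n : ℤ) - 1)).re : ℂ) + r)) ∧
      -- the leading term is a modulated cosine
      (∀ (n : ℕ) (s : ℝ), (Mp n s * exp (Sp s) * u s ^ ((n : ℤ) - 1)).re =
        ‖Mp n s‖ * Real.exp (-(w (s + τ / 2)).re / 2) *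
          Real.cos (((n : ℝ) - 1) * (u s).arg + (Mp n s).arg + (Sp s).im))) ∧
    -- for even `n`, the unique zero of the section off `γ` tends exponentially fast to `1/2`
    (∃ c₀ > (0 : ℝ), ∃ C : ℝ, ∀ n : ℕ, Even n → ∃ z ∈ Set.Ioo (0 : ℝ) 1,
      (∀ p : ℂ, ¬ OnGamma τ p →
        (InLattice τ (p - z) → sectionOrder τ D n (P n) p = 1) ∧
        (¬ InLattice τ (p - z) → sectionOrder τ D n (P n) p = 0)) ∧
      |z - 1 / 2| ≤ C * Real.exp (-(n * c₀))) := by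
  have hτ : τ = (τ.im : ℂ) * I := by
    apply Complex.ext <;> simp [hre]
  obtain ⟨t, ht⟩ : ∃ t : ℝ, t = τ.im := ⟨_, rfl⟩
  rw [← ht] at hτ
  subst hτ
  rw [tau_im] at hw hwper hwreal
  have ht0 : 0 < t := by rwa [tau_im] at him
  obtain ⟨ε, σ, h, hS⟩ := exists_szegoData ht0 hD hδ hw hwper hwreal hP
  have h0 : szego (t * I) w 0 = σ 0 := by
    have h1 : |(0 : ℂ).im| < t / 2 := by simpa using half_pos ht0
    rw [hS 0 (not_onGamma_of_abs_lt ht0 h1), fold_of_abs_lt ht0 h1]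
  refine ⟨expEll_pos ht0, fun p hp hL => ⟨hasDerivAt_expG ht0 hp hL, H_sq ht0 him hp hL⟩,
    tendsto_mul_expG ht0, fun p hp => h.analyticAt_szego hS hp,
    fun K hK hKγ => h.exists_asymptotics_off_gamma hS hK hKγ,
    ⟨fun n s => modelF (t * I) D n (s - t * I / 2), fun s => σ (s - t * I / 2),
      fun s => gLower (t * I) (s - t * I / 2), fun n s => ?_, fun s => ?_, fun s => ?_, ?_,
      fun n s => ?_⟩, h.exists_zero_bound⟩
  · refine (tendsto_fold_above ht0 s (continuousAt_modelF ht0 D n (by simpa using ht0.ne')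
      ?_)).congr' ?_
    · have him' : (s - t * I / 2 : ℂ).im = -(t / 2) := by simp
      rw [him', abs_neg, abs_of_pos (half_pos ht0)]
      linarith
    · filter_upwards [Ioo_mem_nhdsGT ht0] with x hx
      rw [M11_eq ht0 D n (not_onGamma_above ht0 s hx)]
  · have him' : (s - t * I / 2 : ℂ).im = -(t / 2) := by simp
    refine (tendsto_fold_above ht0 s (h.hσ.continuousAt
      ⟨by rw [him']; linarith [h.hε], by rw [him']; linarith [h.hε]⟩)).congr' ?_
    filter_upwards [Ioo_mem_nhdsGT ht0] with x hx
    rw [hS _ (not_onGamma_above ht0 s hx)]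
  · beta_reduce
    rw [← gUpper_add_tau, gUpper, show (s - t * I / 2 + t * I : ℂ) = s + t * I / 2 by ring,
      show (s + t * I / 2 - t * I / 2 : ℂ) = s by ring,
      show (s + t * I / 2 - t * I : ℂ) = s - t * I / 2 by ring]
  · obtain ⟨c₀, hc₀, C, hC⟩ := h.exists_asymptotics_on_gamma
    refine ⟨c₀, hc₀, C, fun n s => ?_⟩
    rw [h0]
    exact hC n s
  · have him' : (s - t * I / 2 : ℂ).im = -(t / 2) := by simp
    have := re_mul_exp_mul_zpow (a := modelF (t * I) D n (s - t * I / 2))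
      (norm_gLower_of_im_neg ht0 him') (h.two_mul_re_boundary s) ((n : ℤ) - 1)
    push_cast at this
    exact this
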